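/- Let $\Bbbk$ be a field of characteristic $p>2$, let $n\ge 0$, and let $R=\Bbbk[x_1,\dots,x_n]$ be graded with $\deg x_i=2$. Let $H_q=\Bbbk[\partial_q]/(\partial_q^p)$, $\deg\partial_q=2$, act on $R$ by the derivation with $\partial_q(x_i)=x_i^2$. A graded $(R,R)\#H_q$-module is a graded $(R,R)$-bimodule (with $\Bbbk$ acting centrally) with a $\Bbbk$-linear operator $\partial_q$ of degree $2$ such that $\partial_q^p=0$ and the Leibniz rule holds for both actions of $R$; on a tensor product over $R$, $\partial_q$ acts by the Leibniz rule. Let $\mathcal{C}((R,R)\#H_q,d_0)$ and $\mathcal{C}((R,R),d_0)$ be the homotopy categories of chain complexes of graded $(R,R)\#H_q$-modules and of graded $(R,R)$-bimodules (with degree-preserving homomorphisms), and let $\mathcal{F}_d$ be the functor from the first to the second that forgets $\partial_q$. The relative homotopy category $\mathcal{C}_{\partial_q}(R,R,d_0)$ is the localization of $\mathcal{C}((R,R)\#H_q,d_0)$ at the morphisms $f$ such that $\mathcal{F}_d(f)$ is an isomorphism (equivalently, its Verdier quotient by $\mathrm{Ker}(\mathcal{F}_d)$). For $1\le i\le n-1$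 let $R^i\subset R$ be the subalgebra of polynomials symmetric in $x_i,x_{i+1}$, let $B_i=R\otimes_{R^i}R$ with $\partial_q(a\otimes b)=\partial_q(a)\otimes b+a\otimes\partial_q(b)$, and let $B_i^{-(x_i+x_{i+1})}$ be the same bimodule with the action of $\partial_q$ twisted so that $\partial_q(1\otimes 1)=-(1\otimes 1)(x_i+x_{i+1})$. Write $q^s$ for the shift that raises all internal degrees by $s$. Consider the chain complexes of graded $(R,R)\#H_q$-modules $$T_i=\left(B_i\xrightarrow{\ br_i\ }R\right),\qquad T_i'=\left(R\xrightarrow{\ rb_i\ }q^{-2}B_i^{-(x_i+x_{i+1})}\right),$$ where $br_i(1\otimes 1)=1$, $rb_i(1)=x_{i+1}\otimes 1-1\otimes x_i$, and the term $R$ is in homological degree $0$ in both (so $B_i$ is in degree $1$ in $T_i$ and in degree $-1$ in $T_i'$; differentials lower the degree by one). For a word $w=\sigma_{i_1}^{\epsilon_1}\cdots\sigma_{i_r}^{\epsilon_r}$ in the generators $\sigma_i$ of the braid group $\mathrm{Br}_n$ and their inverses $\sigma_i'=\sigma_i^{-1}$ let $$T_w=T_{i_1}^{\epsilon_1}\otimes_R\cdots\otimes_R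 T_{i_r}^{\epsilon_r}$$ (with $T_w=R$ for the empty word). Then for every braid $\beta\in\mathrm{Br}_n$ the complex $T_\beta:=T_w$, where $w$ is any word that represents $\beta$, is well defined up to isomorphism in $\mathcal{C}_{\partial_q}(R,R,d_0)$: every $\beta$ is represented by a word, and if two words $w,w'$ represent the same braid, then $T_w\cong T_{w'}$ in $\mathcal{C}_{\partial_q}(R,R,d_0)$. In particular the Reidemeister II and III relations hold there. -/

import Mathlib

open scoped TensorProduct DirectSum
open CategoryTheory

set_option linter.unusedSectionVars false

universe u

namespace SoergelBraid

noncomputable section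

section Gradings

variable {k : Type*} [Field k] {ι : Type} [AddCommGroup ι] [DecidableEq ι]

section Components

variable {M : Type*} [AddCommGroup M] [Module k M] {A : ι → Submodule k M}

/-- The map sending an element of a graded module to the family of its homogeneous components. -/
def components (hA : DirectSum.IsInternal A) : M →ₗ[k] (ι →₀ M) :=
  (DirectSum.toModule k ι (ι →₀ M) fun i => (Finsupp.lsingle i).comp (A i).subtype).comp
    (LinearEquiv.ofBijective (DirectSum.coeLinearMap A) hA).symm.toLinearMap

theorem components_of_mem (hA : DirectSum.IsInternal A) {i : ι} {m : M} (hm : m ∈ A i) :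
    components hA m = Finsupp.single i m := by
  have h : (LinearEquiv.ofBijective (DirectSum.coeLinearMap A) hA).symm m
      = DirectSum.lof k ι (fun i => A i) i ⟨m, hm⟩ := by
    rw [LinearEquiv.symm_apply_eq]
    exact (DirectSum.coeLinearMap_lof A i ⟨m, hm⟩).symm
  simp [components, h]

theorem graded_induction (hA : DirectSum.IsInternal A) {P : M → Prop}
    (hom : ∀ i m, m ∈ A i → P m) (zero : P 0) (add : ∀ x y, P x → P y → P (x + y)) (m : M) :
    P m := by
  have hm : m ∈ iSup A := by rw [hA.submodule_iSup_eq_top]; trivial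
  exact Submodule.iSup_induction A (motive := P) hm hom zero add

theorem isInternal_of_components (δ : M →+ (ι →₀ M)) (mem : ∀ m i, δ m i ∈ A i)
    (sum : ∀ m, ((δ m).sum fun _ x => x) = m)
    (single : ∀ i m, m ∈ A i → δ m = Finsupp.single i m) : DirectSum.IsInternal A := by
  refine DirectSum.isInternal_submodule_of_iSupIndep_of_iSup_eq_top ?_ ?_
  · rw [iSupIndep_iff_finsetSum_eq_zero_imp_eq_zero]
    intro s v hv hs i hi
    have h := congrArg (fun m => δ m i) hs
    simp only [map_sum, map_zero, Finsupp.coe_zero, Pi.zero_apply] at h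
    rw [Finset.sum_congr rfl fun j hj => single j (v j) (hv j hj)] at h
    simpa [Finsupp.finsetSum_apply, Finsupp.single_apply, hi] using h
  · rw [eq_top_iff]
    intro m _
    rw [← sum m]
    exact Submodule.sum_mem _ fun i _ => Submodule.mem_iSup_of_mem i (mem m i)

/-- The operator that multiplies the homogeneous component of degree `i` by `c i`. -/
def rescale (hA : DirectSum.IsInternal A) (c : ι → ℤ) : M →ₗ[k] M :=
  (Finsupp.lsum k fun i => c i • (LinearMap.id : M →ₗ[k] M)).comp (components hA)

theorem rescale_of_mem (hA : DirectSum.IsInternal A) (c : ι → ℤ) {i : ι} {m : M} (hm : m ∈ A i) :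
    rescale hA c m = c i • m := by
  simp [rescale, components_of_mem hA hm]

end Components

section Tensor

variable {S : Type*} [CommRing S] [Algebra k S]
  {M N : Type*} [AddCommGroup M] [Module k M] [Module S M] [IsScalarTower k S M]
  [AddCommGroup N] [Module k N] [Module S N] [IsScalarTower k S N]

/-- The tensor product grading on `M ⊗[S] N`. -/
def tensorDeg (S : Type*) [CommRing S] [Algebra k S] [Module S M] [IsScalarTower k S M]
    [Module S N] [IsScalarTower k S N]
    (A : ι → Submodule k M) (B : ι → Submodule k N) (j : ι) : Submodule k (M ⊗[S] N) :=
  Submodule.span k {x | ∃ a b : ι, a + b = j ∧ ∃ m ∈ A a, ∃ n ∈ B b, x = m ⊗ₜ[S] n}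

theorem tmul_mem_tensorDeg {A : ι → Submodule k M} {B : ι → Submodule k N} {a b : ι} {m : M}
    {n : N} (hm : m ∈ A a) (hn : n ∈ B b) : m ⊗ₜ[S] n ∈ tensorDeg S A B (a + b) :=
  Submodule.subset_span ⟨a, b, rfl, m, hm, n, hn, rfl⟩

/-- `s` acts homogeneously, of the same degree, on both factors. -/
def ActsHomogeneously (A : ι → Submodule k M) (B : ι → Submodule k N) (s : S) : Prop :=
  ∃ e : ι, (∀ a, ∀ m ∈ A a, s • m ∈ A (e + a)) ∧ (∀ b, ∀ n ∈ B b, s • n ∈ B (e + b))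

variable {A : ι → Submodule k M} {B : ι → Submodule k N}

theorem tensor_isInternal (hA : DirectSum.IsInternal A) (hB : DirectSum.IsInternal B)
    (hS : ∀ s : S, s ∈ AddSubmonoid.closure {s : S | ActsHomogeneously A B s}) :
    DirectSum.IsInternal (tensorDeg S A B) := by
  let g : M →+ N →+ (ι →₀ M ⊗[S] N) := AddMonoidHom.mk'
    (fun m => AddMonoidHom.mk' (fun n => (components hA m).sum fun a x =>
      (components hB n).sum fun b y => Finsupp.single (a + b) (x ⊗ₜ[S] y)) (by
        intro n n'
        rw [← Finsupp.sum_add]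
        refine Finsupp.sum_congr fun a _ => ?_
        rw [map_add, Finsupp.sum_add_index'] <;> simp [TensorProduct.tmul_add])) (by
        intro m m'
        ext1 n
        simp only [AddMonoidHom.mk'_apply, AddMonoidHom.add_apply, map_add]
        rw [Finsupp.sum_add_index'] <;> simp [TensorProduct.add_tmul, Finsupp.sum_add])
  have gh : ∀ a b m n, m ∈ A a → n ∈ B b → g m n = Finsupp.single (a + b) (m ⊗ₜ[S] n) := by
    intro a b m n hm hn
    simp [g, components_of_mem hA hm, components_of_mem hB hn]
  have bal : ∀ (s : S) (m : M) (n : N), g (s • m) n = g m (s • n) := by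
    intro s
    refine AddSubmonoid.closure_induction (motive := fun s _ => ∀ m n, g (s • m) n = g m (s • n))
      ?_ ?_ ?_ (hS s)
    · rintro s ⟨e, h1, h2⟩ m n
      refine graded_induction hA (P := fun m => g (s • m) n = g m (s • n)) ?_ (by simp)
        (fun x y hx hy => by simp [hx, hy]) m
      intro a m hm
      refine graded_induction hB (P := fun n => g (s • m) n = g m (s • n)) ?_ (by simp)
        (fun x y hx hy => by simp [hx, hy]) n
      intro b n hn
      rw [gh _ _ _ _ (h1 a m hm) hn, gh _ _ _ _ hm (h2 b n hn), TensorProduct.smul_tmul,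
        show e + a + b = a + (e + b) by abel]
    · simp
    · intro s t _ _ hs ht m n
      simp [add_smul, hs, ht]
  let δ := TensorProduct.liftAddHom g bal
  have ind : ∀ P : M ⊗[S] N → Prop, (∀ a b m n, m ∈ A a → n ∈ B b → P (m ⊗ₜ n)) → P 0 →
      (∀ x y, P x → P y → P (x + y)) → ∀ x, P x := by
    intro P h h0 hadd x
    refine TensorProduct.induction_on x h0 (fun m n => ?_) hadd
    refine graded_induction hA (P := fun m => P (m ⊗ₜ n)) ?_ (by simpa)
      (fun x y hx hy => by rw [TensorProduct.add_tmul]; exact hadd _ _ hx hy) m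
    intro a m hm
    exact graded_induction hB (P := fun n => P (m ⊗ₜ n)) (fun b n hn => h a b m n hm hn) (by simpa)
      (fun x y hx hy => by rw [TensorProduct.tmul_add]; exact hadd _ _ hx hy) n
  have δh : ∀ a b m n, m ∈ A a → n ∈ B b →
      δ (m ⊗ₜ n) = Finsupp.single (a + b) (m ⊗ₜ[S] n) := by
    intro a b m n hm hn
    exact gh a b m n hm hn
  have δsmul : ∀ (c : k) (x), δ (c • x) = c • δ x := by
    intro c
    refine ind _ ?_ (by simp) fun x y hx hy => by simp [hx, hy]
    intro a b m n hm hn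
    rw [TensorProduct.smul_tmul', δh a b _ n ((A a).smul_mem c hm) hn, δh a b m n hm hn,
      Finsupp.smul_single, TensorProduct.smul_tmul']
  refine isInternal_of_components δ ?_ ?_ ?_
  · refine ind _ ?_ (by simp) ?_
    · intro a b m n hm hn i
      rw [δh a b m n hm hn, Finsupp.single_apply]
      split_ifs with h
      · exact h ▸ tmul_mem_tensorDeg hm hn
      · exact zero_mem _
    · intro x y hx hy i
      rw [map_add]
      exact add_mem (hx i) (hy i)
  · refine ind _ ?_ (by simp) ?_
    · intro a b m n hm hn
      rw [δh a b m n hm hn]; simp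
    · intro x y hx hy
      rw [map_add, Finsupp.sum_add_index', hx, hy] <;> simp
  · intro i x hx
    refine Submodule.span_induction (p := fun x _ => δ x = Finsupp.single i x) ?_ (by simp)
      ?_ ?_ hx
    · rintro x ⟨a, b, rfl, m, hm, n, hn, rfl⟩
      exact δh a b m n hm hn
    · intro x y _ _ hx hy
      simp [hx, hy]
    · intro c x _ hx
      rw [δsmul, hx, Finsupp.smul_single]

/-- The operator `m ⊗ n ↦ f m ⊗ n + m ⊗ g n` on `M ⊗[S] N`, for operators `f`, `g` that satisfy the
Leibniz rule over `δ : S → S`. -/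
def leibniz (δ : S → S) (f : M →ₗ[k] M) (g : N →ₗ[k] N) (hf : ∀ s m, f (s • m) = δ s • m + s • f m)
    (hg : ∀ s n, g (s • n) = δ s • n + s • g n) : M ⊗[S] N →ₗ[k] M ⊗[S] N :=
  let φ : M ⊗[S] N →+ M ⊗[S] N := TensorProduct.liftAddHom
    (AddMonoidHom.mk' (fun m => AddMonoidHom.mk' (fun n => f m ⊗ₜ[S] n + m ⊗ₜ[S] g n) (by
      intro n n'; simp only [map_add, TensorProduct.tmul_add]; abel)) (by
      intro m m'; ext1 n
      simp only [map_add, TensorProduct.add_tmul, AddMonoidHom.mk'_apply, AddMonoidHom.add_apply]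
      abel)) (by
      intro s m n
      simp only [AddMonoidHom.mk'_apply, hf, hg, TensorProduct.add_tmul, TensorProduct.tmul_add,
        TensorProduct.smul_tmul]
      abel)
  { φ with
    map_smul' := by
      intro c x
      refine TensorProduct.induction_on x (by simp) (fun m n => ?_) (fun x y hx hy => ?_)
      · simp only [TensorProduct.smul_tmul']
        change f (c • m) ⊗ₜ[S] n + (c • m) ⊗ₜ[S] g n = c • (f m ⊗ₜ[S] n + m ⊗ₜ[S] g n)
        simp [TensorProduct.smul_tmul', smul_add]
      · change φ (c • x) = c • φ x at hx
        change φ (c • y) = c • φ y at hy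
        change φ (c • (x + y)) = c • φ (x + y)
        rw [smul_add, map_add, map_add, smul_add, hx, hy] }

theorem leibniz_tmul (δ : S → S) (f : M →ₗ[k] M) (g : N →ₗ[k] N)
    (hf : ∀ s m, f (s • m) = δ s • m + s • f m) (hg : ∀ s n, g (s • n) = δ s • n + s • g n)
    (m : M) (n : N) :
    leibniz δ f g hf hg (m ⊗ₜ[S] n) = f m ⊗ₜ[S] n + m ⊗ₜ[S] g n := rfl

theorem leibniz_pow_eq_zero (p : ℕ) [Fact p.Prime] [CharP k p] (δ : S → S) (f : M →ₗ[k] M)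
    (g : N →ₗ[k] N) (hf : ∀ s m, f (s • m) = δ s • m + s • f m)
    (hg : ∀ s n, g (s • n) = δ s • n + s • g n) (hfp : f ^ p = 0) (hgp : g ^ p = 0) :
    leibniz δ f g hf hg ^ p = 0 := by
  have key : ∀ (r : ℕ) (m : M) (n : N), (leibniz δ f g hf hg ^ r) (m ⊗ₜ[S] n) =
      ∑ ij ∈ Finset.HasAntidiagonal.antidiagonal r, (r.choose ij.1) • ((f ^ ij.1) m ⊗ₜ[S] (g ^ ij.2) n) := by
    intro r
    induction r with
    | zero => intro m n; simp
    | succ r ih =>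
      intro m n
      rw [Finset.sum_antidiagonal_choose_succ_nsmul
        (fun i j => (f ^ i) m ⊗ₜ[S] (g ^ j) n), pow_succ, Module.End.mul_apply, leibniz_tmul,
        map_add, ih, ih, add_comm]
      simp only [pow_succ, Module.End.mul_apply]
      congr 1
      refine Finset.sum_congr rfl fun ij hij => ?_
      rw [Nat.choose_symm_of_eq_add (Finset.HasAntidiagonal.mem_antidiagonal.1 hij).symm]
  refine LinearMap.ext fun x => TensorProduct.induction_on x (by simp) (fun m n => ?_)
    fun x y hx hy => by rw [map_add, hx, hy]; simp
  rw [key, Finset.sum_eq_zero]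
  · simp
  · rintro ⟨i, j⟩ hij
    rw [Finset.HasAntidiagonal.mem_antidiagonal] at hij
    simp only at hij ⊢
    have hp : p.Prime := Fact.out
    by_cases hi : i = 0
    · subst hi
      rw [show j = p by omega, hgp]; simp
    · by_cases hj : j = 0
      · rw [show i = p by omega, hfp]; simp
      · have : ((p.choose i : ℕ) : k) = 0 :=
          (CharP.cast_eq_zero_iff k p _).2 (hp.dvd_choose_self hi (by omega))
        rw [← Nat.cast_smul_eq_nsmul k, this, zero_smul]

theorem leibniz_mem (v : ι) (δ : S → S) (f : M →ₗ[k] M)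
    (g : N →ₗ[k] N) (hf : ∀ s m, f (s • m) = δ s • m + s • f m)
    (hg : ∀ s n, g (s • n) = δ s • n + s • g n)
    (hfv : ∀ j, ∀ m ∈ A j, f m ∈ A (v + j)) (hgv : ∀ j, ∀ m ∈ B j, g m ∈ B (v + j))
    (j : ι) (x : M ⊗[S] N) (hx : x ∈ tensorDeg S A B j) :
    leibniz δ f g hf hg x ∈ tensorDeg S A B (v + j) := by
  refine Submodule.span_induction
    (p := fun x _ => leibniz δ f g hf hg x ∈ tensorDeg S A B (v + j)) ?_ (by simp)
    (fun x y _ _ hx hy => by rw [map_add]; exact add_mem hx hy)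
    (fun c x _ hx => by rw [map_smul]; exact Submodule.smul_mem _ _ hx) hx
  rintro x ⟨a, b, rfl, m, hm, n, hn, rfl⟩
  rw [leibniz_tmul]
  refine add_mem ?_ ?_
  · rw [← add_assoc]; exact tmul_mem_tensorDeg (hfv _ _ hm) hn
  · rw [← add_assoc, add_comm v, add_assoc]; exact tmul_mem_tensorDeg hm (hgv _ _ hn)

end Tensor

end Gradings

section Bimodules

variable (k : Type u) [Field k]

/-- The polynomial algebra `R = k[x_1, …, x_n]`. -/
abbrev Poly (n : ℕ) : Type u := MvPolynomial (Fin n) k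

/-- The derivation `∂_q` of `R` with `∂_q x_i = x_i ^ 2`. -/
def dq (n : ℕ) : Derivation k (Poly k n) (Poly k n) :=
  MvPolynomial.mkDerivation k fun i => MvPolynomial.X i ^ 2

variable (p n : ℕ) {ι : Type} [AddCommGroup ι] [DecidableEq ι] (v : ι)

/-- A graded `(R, R)`-bimodule (with `k` acting centrally), graded by `ι`, where the variables `x_i`
have degree `v`. -/
structure GrBimod where
  carrier : Type u
  [addCommGroup : AddCommGroup carrier]
  [module : Module k carrier]
  left : Poly k n →ₐ[k] Module.End k carrier
  right : Poly k n →ₐ[k] Module.End k carrier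
  left_right : ∀ a b m, left a (right b m) = right b (left a m)
  deg : ι → Submodule k carrier
  isInternal : DirectSum.IsInternal deg
  left_mem : ∀ {a e j m}, MvPolynomial.IsWeightedHomogeneous (fun _ => v) a e → m ∈ deg j →
    left a m ∈ deg (e + j)
  right_mem : ∀ {a e j m}, MvPolynomial.IsWeightedHomogeneous (fun _ => v) a e → m ∈ deg j →
    right a m ∈ deg (e + j)

attribute [instance] GrBimod.addCommGroup GrBimod.module

/-- A graded module over the smash product `(R ⊗ R) # H_q` with `H_q = k[∂_q] / (∂_q ^ p)`, where
`∂_q` has the same degree `v` as the variables: a graded `(R, R)`-bimodule with an operator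
`D = ∂_q` such that `D ^ p = 0` and such that the Leibniz rule holds. -/
structure EqBimod extends GrBimod k n v where
  D : carrier →ₗ[k] carrier
  D_pow : D ^ p = 0
  D_left : ∀ a m, D (left a m) = left (dq k n a) m + left a (D m)
  D_right : ∀ a m, D (right a m) = right (dq k n a) m + right a (D m)
  D_mem : ∀ j, ∀ m ∈ deg j, D m ∈ deg (v + j)

variable {k p n v}

/-- The bimodule homomorphisms of degree zero. -/
def GrBimod.homs (M N : GrBimod k n v) : AddSubgroup (M.carrier →ₗ[k] N.carrier) where
  carrier := {f | (∀ a m, f (M.left a m) = N.left a (f m)) ∧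
    (∀ a m, f (M.right a m) = N.right a (f m)) ∧ ∀ j, ∀ m ∈ M.deg j, f m ∈ N.deg j}
  zero_mem' := by simp
  add_mem' := by
    rintro f g ⟨hf1, hf2, hf3⟩ ⟨hg1, hg2, hg3⟩
    exact ⟨by simp [hf1, hg1], by simp [hf2, hg2],
      fun j m hm => add_mem (hf3 j m hm) (hg3 j m hm)⟩
  neg_mem' := by
    rintro f ⟨hf1, hf2, hf3⟩
    exact ⟨by simp [hf1], by simp [hf2], fun j m hm => neg_mem (hf3 j m hm)⟩

/-- The bimodule homomorphisms of degree zero that commute with `∂_q`. -/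
def EqBimod.homs (M N : EqBimod k p n v) : AddSubgroup (M.carrier →ₗ[k] N.carrier) where
  carrier := {f | f ∈ GrBimod.homs M.toGrBimod N.toGrBimod ∧ ∀ m, f (M.D m) = N.D (f m)}
  zero_mem' := ⟨zero_mem _, by simp⟩
  add_mem' := by
    rintro f g ⟨hf1, hf2⟩ ⟨hg1, hg2⟩
    exact ⟨add_mem hf1 hg1, by simp [hf2, hg2]⟩
  neg_mem' := by
    rintro f ⟨hf1, hf2⟩
    exact ⟨neg_mem hf1, by simp [hf2]⟩

instance : Category (GrBimod k n v) where
  Hom M N := GrBimod.homs M N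
  id M := ⟨LinearMap.id, fun _ _ => rfl, fun _ _ => rfl, fun _ _ h => h⟩
  comp f g := ⟨g.1.comp f.1,
    fun a m => (congrArg g.1 (f.2.1 a m)).trans (g.2.1 a _),
    fun a m => (congrArg g.1 (f.2.2.1 a m)).trans (g.2.2.1 a _),
    fun j m hm => g.2.2.2 j _ (f.2.2.2 j m hm)⟩

instance : Category (EqBimod k p n v) where
  Hom M N := EqBimod.homs M N
  id M := ⟨LinearMap.id, ⟨fun _ _ => rfl, fun _ _ => rfl, fun _ _ h => h⟩, fun _ => rfl⟩
  comp f g := ⟨g.1.comp f.1,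
    ⟨fun a m => (congrArg g.1 (f.2.1.1 a m)).trans (g.2.1.1 a _),
    fun a m => (congrArg g.1 (f.2.1.2.1 a m)).trans (g.2.1.2.1 a _),
    fun j m hm => g.2.1.2.2 j _ (f.2.1.2.2 j m hm)⟩,
    fun m => (congrArg g.1 (f.2.2 m)).trans (g.2.2 _)⟩

instance : Preadditive (GrBimod k n v) where
  homGroup M N := inferInstanceAs (AddCommGroup (GrBimod.homs M N))
  add_comp _ _ _ f f' g := Subtype.ext (LinearMap.comp_add f.1 f'.1 g.1)
  comp_add _ _ _ f g g' := Subtype.ext (LinearMap.add_comp f.1 g'.1 g.1)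

instance : Preadditive (EqBimod k p n v) where
  homGroup M N := inferInstanceAs (AddCommGroup (EqBimod.homs M N))
  add_comp _ _ _ f f' g := Subtype.ext (LinearMap.comp_add f.1 f'.1 g.1)
  comp_add _ _ _ f g g' := Subtype.ext (LinearMap.add_comp f.1 g'.1 g.1)

variable (k p n v) in
/-- The functor that forgets the action of `H_q`. -/
def forgetHq : EqBimod k p n v ⥤ GrBimod k n v where
  obj M := M.toGrBimod
  map f := ⟨f.1, f.2.1⟩

instance : (forgetHq k p n v).Additive where
  map_add := rfl

end Bimodules

section RelativeHomotopyCategory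

variable (k : Type u) [Field k] (p n : ℕ)

/-- The homotopy category `𝒞((R, R) # H_q, d_0)` of chain complexes of graded
`(R, R) # H_q`-modules, where the variables and `∂_q` have `q`-degree two. -/
abbrev EqHomotopyCat := HomotopyCategory (EqBimod k p n (2 : ℤ)) (ComplexShape.down ℤ)

/-- The homotopy category `𝒞((R, R), d_0)` of chain complexes of graded `(R, R)`-bimodules. -/
abbrev BimodHomotopyCat := HomotopyCategory (GrBimod k n (2 : ℤ)) (ComplexShape.down ℤ)

/-- The functor `ℱ_d : 𝒞((R, R) # H_q, d_0) ⥤ 𝒞((R, R), d_0)` forgetting the action of `H_q`. -/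
def forgetHomotopy : EqHomotopyCat k p n ⥤ BimodHomotopyCat k n :=
  (forgetHq k p n (2 : ℤ)).mapHomotopyCategory (ComplexShape.down ℤ)

/-- The relative isomorphisms: the morphisms of `𝒞((R, R) # H_q, d_0)` that become isomorphisms
when the action of `H_q` is forgotten. -/
def relIso : MorphismProperty (EqHomotopyCat k p n) :=
  (MorphismProperty.isomorphisms (BimodHomotopyCat k n)).inverseImage (forgetHomotopy k p n)

/-- The relative homotopy category `𝒞_{∂_q}(R, R, d_0)`: the localization of
`𝒞((R, R) # H_q, d_0)` at all relative isomorphisms, i.e. its Verdier quotient by the kernel of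
`ℱ_d`. -/
abbrev RelHomotopyCat := (relIso k p n).Localization

/-- A chain complex of graded `(R, R) # H_q`-modules as an object of `𝒞_{∂_q}(R, R, d_0)`. -/
def toRel (K : ChainComplex (EqBimod k p n (2 : ℤ)) ℤ) : RelHomotopyCat k p n :=
  (relIso k p n).Q.obj ((HomotopyCategory.quotient _ _).obj K)

end RelativeHomotopyCategory

section Polynomials

variable {k : Type u} [Field k] {n : ℕ} {ι : Type} [AddCommGroup ι] [DecidableEq ι]

theorem isWeightedHomogeneous_of_isHomogeneous (v : ι) {a : Poly k n} {r : ℕ}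
    (h : a.IsHomogeneous r) : MvPolynomial.IsWeightedHomogeneous (fun _ => v) a (r • v) := by
  intro α hα
  have h' := h hα
  rw [← h', Finsupp.weight_apply, Finsupp.weight_apply, Finsupp.sum, Finsupp.sum, Finset.sum_smul]
  simp

theorem dq_X (i : Fin n) : dq k n (MvPolynomial.X i) = MvPolynomial.X i ^ 2 :=
  MvPolynomial.mkDerivation_X _ _ _

theorem dq_mem (v : ι) {a : Poly k n} {e : ι}
    (h : MvPolynomial.IsWeightedHomogeneous (fun _ => v) a e) :
    MvPolynomial.IsWeightedHomogeneous (fun _ => v) (dq k n a) (v + e) := by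
  rw [← MvPolynomial.support_sum_monomial_coeff a, map_sum]
  refine MvPolynomial.IsWeightedHomogeneous.sum _ _ _ fun α hα => ?_
  have hα' := h (MvPolynomial.mem_support_iff.1 hα)
  rw [dq, MvPolynomial.mkDerivation_monomial, Finsupp.sum, ← MvPolynomial.mem_weightedHomogeneousSubmodule]
  refine Submodule.smul_mem _ _ (Submodule.sum_mem _ fun i hi => ?_)
  rw [MvPolynomial.mem_weightedHomogeneousSubmodule, smul_eq_mul]
  have hX := (MvPolynomial.isWeightedHomogeneous_X k (fun _ : Fin n => v) i).pow 2
  have hm := MvPolynomial.isWeightedHomogeneous_monomial (fun _ : Fin n => v)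
    (α - Finsupp.single i 1) ((α i : ℕ) : k) rfl
  have := hm.mul hX
  convert this using 1
  have h1 : α = (α - Finsupp.single i 1) + Finsupp.single i 1 := by
    refine (tsub_add_cancel_of_le ?_).symm
    rw [Finsupp.single_le_iff]
    exact Nat.one_le_iff_ne_zero.2 (Finsupp.mem_support_iff.1 hi)
  rw [← hα']
  conv_lhs => rw [h1, map_add]
  rw [Finsupp.weight_single]
  simp only [one_smul, two_smul]
  abel

/-- The operator `∂_q + f` on `R`: the action of `∂_q` on the free rank one module `R ^ f`. -/
def dqTwist (f : Poly k n) : Poly k n →ₗ[k] Poly k n :=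
  (dq k n : Poly k n →ₗ[k] Poly k n) + LinearMap.mulLeft k f

theorem dqTwist_apply (f a : Poly k n) : dqTwist f a = dq k n a + f * a := rfl

theorem dqTwist_zero (a : Poly k n) : dqTwist 0 a = dq k n a := by simp [dqTwist_apply]

theorem dqTwist_mul (f a b : Poly k n) : dqTwist f (a * b) = dq k n a * b + a * dqTwist f b := by
  simp only [dqTwist_apply, Derivation.leibniz, smul_eq_mul]
  ring

variable (p : ℕ) [Fact p.Prime] [CharP k p]

theorem dqTwist_pow_mul (f a b : Poly k n) : (dqTwist f ^ p) (a * b) =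
    (dqTwist 0 ^ p) a * b + a * (dqTwist f ^ p) b := by
  have key : ∀ (r : ℕ) (a b : Poly k n), (dqTwist f ^ r) (a * b) =
      ∑ ij ∈ Finset.HasAntidiagonal.antidiagonal r,
        (r.choose ij.1) • ((dqTwist 0 ^ ij.1) a * (dqTwist f ^ ij.2) b) := by
    intro r
    induction r with
    | zero => intro a b; simp
    | succ r ih =>
      intro a b
      rw [Finset.sum_antidiagonal_choose_succ_nsmul
        (fun i j => (dqTwist 0 ^ i) a * (dqTwist f ^ j) b), pow_succ, Module.End.mul_apply,
        dqTwist_mul, map_add, ih, ih, add_comm]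
      simp only [pow_succ, Module.End.mul_apply, dqTwist_zero]
      congr 1
      refine Finset.sum_congr rfl fun ij hij => ?_
      rw [Nat.choose_symm_of_eq_add (Finset.HasAntidiagonal.mem_antidiagonal.1 hij).symm]
  have hp : p.Prime := Fact.out
  rw [key, Finset.sum_eq_add (p, 0) (0, p)]
  · simp
  · simp [hp.ne_zero]
  · rintro ⟨i, j⟩ hij ⟨h1, h2⟩
    rw [Finset.HasAntidiagonal.mem_antidiagonal] at hij
    simp only at hij
    have hi : i ≠ 0 := by rintro rfl; exact h2 (by simp [← hij])
    have hj : j ≠ 0 := by rintro rfl; exact h1 (by simp [← hij])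
    have : ((p.choose i : ℕ) : k) = 0 :=
      (CharP.cast_eq_zero_iff k p _).2 (hp.dvd_choose_self hi (by omega))
    rw [← Nat.cast_smul_eq_nsmul k, this, zero_smul]
  · intro h; simp [Finset.HasAntidiagonal.mem_antidiagonal] at h
  · intro h; simp [Finset.HasAntidiagonal.mem_antidiagonal] at h

theorem dqTwist_zero_pow : (dqTwist (0 : Poly k n)) ^ p = 0 := by
  have hp : p.Prime := Fact.out
  have hX : ∀ (r : ℕ) (i : Fin n), (dqTwist (0 : Poly k n) ^ r) (MvPolynomial.X i) =
      (r.factorial : Poly k n) * MvPolynomial.X i ^ (r + 1) := by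
    intro r i
    induction r with
    | zero => simp
    | succ r ih =>
      rw [pow_succ', Module.End.mul_apply, ih, dqTwist_zero, Derivation.leibniz,
        Derivation.leibniz_pow, dq_X, Derivation.map_natCast]
      simp only [Nat.factorial_succ, smul_eq_mul, nsmul_eq_mul, Nat.add_sub_cancel]
      push_cast
      ring
  have hC : ∀ c : k, (dqTwist (0 : Poly k n) ^ p) (MvPolynomial.C c) = 0 := by
    intro c
    obtain ⟨r, hr⟩ := Nat.exists_eq_succ_of_ne_zero hp.ne_zero
    have h0 : dqTwist (0 : Poly k n) (MvPolynomial.C c) = 0 := by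
      rw [dqTwist_zero]; exact MvPolynomial.derivation_C _ _
    rw [hr, pow_succ, Module.End.mul_apply, h0, map_zero]
  refine LinearMap.ext fun a => ?_
  rw [LinearMap.zero_apply]
  induction a using MvPolynomial.induction_on with
  | C c => exact hC c
  | add a b ha hb => rw [map_add, ha, hb, add_zero]
  | mul_X a i ha =>
    have h0 : ((p.factorial : ℕ) : Poly k n) = 0 := by
      have : ((p.factorial : ℕ) : k) = 0 :=
        (CharP.cast_eq_zero_iff k p _).2 (Nat.dvd_factorial hp.pos le_rfl)
      rw [← map_natCast (MvPolynomial.C (σ := Fin n) (R := k)), this, map_zero]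
    rw [dqTwist_pow_mul, ha, hX, h0]
    simp

theorem dqTwist_pow (f : Poly k n) (h : (dqTwist f ^ p) 1 = 0) : dqTwist f ^ p = 0 := by
  refine LinearMap.ext fun a => ?_
  have := dqTwist_pow_mul p f a 1
  rw [mul_one, h, dqTwist_zero_pow] at this
  simpa using this

theorem dqTwist_neg_pow (hp : 2 < p) (i j : Fin n) :
    dqTwist (-(MvPolynomial.X i + MvPolynomial.X j) : Poly k n) ^ p = 0 := by
  apply dqTwist_pow
  obtain ⟨r, rfl⟩ : ∃ r, p = r + 3 := ⟨p - 3, by omega⟩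
  rw [pow_add, Module.End.mul_apply]
  have : (dqTwist (-(MvPolynomial.X i + MvPolynomial.X j) : Poly k n) ^ 3) 1 = 0 := by
    simp only [pow_succ, pow_zero, Module.End.mul_apply, dqTwist_apply, one_mul,
      map_add, map_neg, Derivation.leibniz, dq_X, smul_eq_mul, mul_one,
      Derivation.map_one_eq_zero, zero_add]
    ring
  rw [this, map_zero]

end Polynomials

section BalancedTensor

variable {k : Type u} [Field k] {ι : Type} [AddCommGroup ι] [DecidableEq ι] {S : Type u}
  {M N : Type u} [AddCommGroup M] [Module k M] [AddCommGroup N] [Module k N]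

/-- The subspace of `M ⊗[k] N` spanned by the elements `m s ⊗ n - m ⊗ s n`, where `s` acts on `M`
(from the right) by `ρ s` and on `N` (from the left) by `σ s`. -/
def balancedRel (ρ : S → Module.End k M) (σ : S → Module.End k N) : Submodule k (M ⊗[k] N) :=
  Submodule.span k {x | ∃ s m n, x = ρ s m ⊗ₜ[k] n - m ⊗ₜ[k] σ s n}

/-- The tensor product `M ⊗_S N` of a right module and a left module over a `k`-algebra `S`. -/
abbrev BalTensor (ρ : S → Module.End k M) (σ : S → Module.End k N) : Type u :=
  (M ⊗[k] N) ⧸ balancedRel ρ σ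

namespace BalTensor

variable (ρ : S → Module.End k M) (σ : S → Module.End k N)

/-- The pure tensor `m ⊗ n` in `M ⊗_S N`. -/
def tmul : M →ₗ[k] N →ₗ[k] BalTensor ρ σ :=
  (TensorProduct.mk k M N).compr₂ (balancedRel ρ σ).mkQ

theorem tmul_balanced (s : S) (m : M) (n : N) : tmul ρ σ (ρ s m) n = tmul ρ σ m (σ s n) :=
  (Submodule.Quotient.eq _).2 (Submodule.subset_span ⟨s, m, n, rfl⟩)

variable {ρ σ}

theorem induction {P : BalTensor ρ σ → Prop} (zero : P 0) (pure : ∀ m n, P (tmul ρ σ m n))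
    (add : ∀ x y, P x → P y → P (x + y)) (x : BalTensor ρ σ) : P x := by
  obtain ⟨x, rfl⟩ := Submodule.mkQ_surjective _ x
  induction x using TensorProduct.induction_on with
  | zero => rw [map_zero]; exact zero
  | tmul m n => exact pure m n
  | add x y hx hy => rw [map_add]; exact add _ _ hx hy

theorem balancedRel_le_ker {Q : Type*} [AddCommGroup Q] [Module k Q] (f : M →ₗ[k] N →ₗ[k] Q)
    (hf : ∀ s m n, f (ρ s m) n = f m (σ s n)) :
    balancedRel ρ σ ≤ LinearMap.ker (TensorProduct.lift f) :=
  Submodule.span_le.2 (by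
    rintro x ⟨s, m, n, rfl⟩
    rw [SetLike.mem_coe, LinearMap.mem_ker, map_sub, TensorProduct.lift.tmul,
      TensorProduct.lift.tmul, hf, sub_self])

/-- The linear map out of `M ⊗_S N` given by a balanced bilinear map. -/
def lift {Q : Type*} [AddCommGroup Q] [Module k Q] (f : M →ₗ[k] N →ₗ[k] Q)
    (hf : ∀ s m n, f (ρ s m) n = f m (σ s n)) : BalTensor ρ σ →ₗ[k] Q :=
  (balancedRel ρ σ).liftQ (TensorProduct.lift f) (balancedRel_le_ker f hf)

@[simp]
theorem lift_tmul {Q : Type*} [AddCommGroup Q] [Module k Q] (f : M →ₗ[k] N →ₗ[k] Q)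
    (hf : ∀ s m n, f (ρ s m) n = f m (σ s n)) (m : M) (n : N) :
    lift f hf (tmul ρ σ m n) = f m n := by
  change (balancedRel ρ σ).liftQ _ _ ((balancedRel ρ σ).mkQ (m ⊗ₜ[k] n)) = _
  rw [Submodule.mkQ_apply, Submodule.liftQ_apply, TensorProduct.lift.tmul]

theorem ext {Q : Type*} [AddCommGroup Q] [Module k Q] {f g : BalTensor ρ σ →ₗ[k] Q}
    (h : ∀ m n, f (tmul ρ σ m n) = g (tmul ρ σ m n)) : f = g :=
  LinearMap.ext fun x => induction (P := fun x => f x = g x) (by simp) h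
    (fun x y hx hy => by rw [map_add, map_add, hx, hy]) x

/-- The operator `m ⊗ n ↦ f m ⊗ g n` on `M ⊗_S N`. -/
def map (f : M →ₗ[k] M) (g : N →ₗ[k] N) (hf : ∀ s m, f (ρ s m) = ρ s (f m))
    (hg : ∀ s n, g (σ s n) = σ s (g n)) : BalTensor ρ σ →ₗ[k] BalTensor ρ σ :=
  lift ((tmul ρ σ).compl₁₂ f g) fun s m n => by
    simp only [LinearMap.compl₁₂_apply, hf, hg, tmul_balanced]

@[simp]
theorem map_tmul (f : M →ₗ[k] M) (g : N →ₗ[k] N) (hf : ∀ s m, f (ρ s m) = ρ s (f m))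
    (hg : ∀ s n, g (σ s n) = σ s (g n)) (m : M) (n : N) :
    map f g hf hg (tmul ρ σ m n) = tmul ρ σ (f m) (g n) := by
  simp [map]

/-- The operator `m ⊗ n ↦ f m ⊗ n + m ⊗ g n` on `M ⊗_S N`, for operators `f` and `g` that satisfy
the Leibniz rule over `δ : S → S`. -/
def leibniz (δ : S → S) (f : M →ₗ[k] M) (g : N →ₗ[k] N)
    (hf : ∀ s m, f (ρ s m) = ρ (δ s) m + ρ s (f m))
    (hg : ∀ s n, g (σ s n) = σ (δ s) n + σ s (g n)) : BalTensor ρ σ →ₗ[k] BalTensor ρ σ :=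
  lift ((tmul ρ σ).comp f + (tmul ρ σ).compl₂ g) fun s m n => by
    simp only [LinearMap.add_apply, LinearMap.comp_apply, LinearMap.compl₂_apply, hf, hg, map_add,
      tmul_balanced]
    abel

@[simp]
theorem leibniz_tmul (δ : S → S) (f : M →ₗ[k] M) (g : N →ₗ[k] N)
    (hf : ∀ s m, f (ρ s m) = ρ (δ s) m + ρ s (f m))
    (hg : ∀ s n, g (σ s n) = σ (δ s) n + σ s (g n)) (m : M) (n : N) :
    leibniz δ f g hf hg (tmul ρ σ m n) = tmul ρ σ (f m) n + tmul ρ σ m (g n) := by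
  simp [leibniz]

/-- The operator `m ⊗ n ↦ f m ⊗ n` on `M ⊗_S N`. -/
def mapLeft (f : M →ₗ[k] M) (hf : ∀ s m, f (ρ s m) = ρ s (f m)) :
    BalTensor ρ σ →ₗ[k] BalTensor ρ σ :=
  map f LinearMap.id hf fun _ _ => rfl

/-- The operator `m ⊗ n ↦ m ⊗ g n` on `M ⊗_S N`. -/
def mapRight (g : N →ₗ[k] N) (hg : ∀ s n, g (σ s n) = σ s (g n)) :
    BalTensor ρ σ →ₗ[k] BalTensor ρ σ :=
  map LinearMap.id g (fun _ _ => rfl) hg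

@[simp]
theorem mapLeft_tmul (f : M →ₗ[k] M) (hf : ∀ s m, f (ρ s m) = ρ s (f m)) (m : M) (n : N) :
    mapLeft f hf (tmul ρ σ m n) = tmul ρ σ (f m) n :=
  map_tmul _ _ _ _ _ _

@[simp]
theorem mapRight_tmul (g : N →ₗ[k] N) (hg : ∀ s n, g (σ s n) = σ s (g n)) (m : M) (n : N) :
    mapRight g hg (tmul ρ σ m n) = tmul ρ σ m (g n) :=
  map_tmul _ _ _ _ _ _

variable (ρ σ) in
/-- The action on `M ⊗_S N` of an algebra that acts on `M`. -/
def leftAction {A : Type u} [CommRing A] [Algebra k A] (l : A →ₐ[k] Module.End k M)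
    (hl : ∀ a s m, l a (ρ s m) = ρ s (l a m)) : A →ₐ[k] Module.End k (BalTensor ρ σ) :=
  AlgHom.ofLinearMap
    { toFun := fun a => mapLeft (l a) (hl a)
      map_add' := fun a b => ext fun x y => by simp
      map_smul' := fun c a => ext fun x y => by simp }
    (ext fun x y => by simp) (fun a b => ext fun x y => by simp)

variable (ρ σ) in
/-- The action on `M ⊗_S N` of an algebra that acts on `N`. -/
def rightAction {A : Type u} [CommRing A] [Algebra k A] (r : A →ₐ[k] Module.End k N)
    (hr : ∀ a s n, r a (σ s n) = σ s (r a n)) : A →ₐ[k] Module.End k (BalTensor ρ σ) :=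
  AlgHom.ofLinearMap
    { toFun := fun a => mapRight (r a) (hr a)
      map_add' := fun a b => ext fun x y => by simp
      map_smul' := fun c a => ext fun x y => by simp }
    (ext fun x y => by simp) (fun a b => ext fun x y => by simp)

section Actions

variable {A : Type u} [CommRing A] [Algebra k A] (l : A →ₐ[k] Module.End k M)
  (hl : ∀ a s m, l a (ρ s m) = ρ s (l a m)) (r : A →ₐ[k] Module.End k N)
  (hr : ∀ a s n, r a (σ s n) = σ s (r a n))

@[simp]
theorem leftAction_tmul (a : A) (m : M) (n : N) :
    leftAction ρ σ l hl a (tmul ρ σ m n) = tmul ρ σ (l a m) n :=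
  mapLeft_tmul _ (hl a) _ _

@[simp]
theorem rightAction_tmul (a : A) (m : M) (n : N) :
    rightAction ρ σ r hr a (tmul ρ σ m n) = tmul ρ σ m (r a n) :=
  mapRight_tmul _ (hr a) _ _

theorem leftAction_rightAction (a b : A) (x : BalTensor ρ σ) :
    leftAction ρ σ l hl a (rightAction ρ σ r hr b x) =
      rightAction ρ σ r hr b (leftAction ρ σ l hl a x) := by
  induction x using induction with
  | zero => simp only [map_zero]
  | pure m n => simp only [leftAction_tmul, rightAction_tmul]
  | add x y hx hy => simp only [map_add, hx, hy]

variable (δ : S → S) (f : M →ₗ[k] M) (g : N →ₗ[k] N)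
  (hf : ∀ s m, f (ρ s m) = ρ (δ s) m + ρ s (f m))
  (hg : ∀ s n, g (σ s n) = σ (δ s) n + σ s (g n))

theorem leibniz_leftAction (a a' : A) (h : ∀ m, f (l a m) = l a' m + l a (f m))
    (x : BalTensor ρ σ) : leibniz δ f g hf hg (leftAction ρ σ l hl a x) =
      leftAction ρ σ l hl a' x + leftAction ρ σ l hl a (leibniz δ f g hf hg x) := by
  induction x using induction with
  | zero => simp only [map_zero, add_zero]
  | pure m n => simp only [leftAction_tmul, leibniz_tmul, h, map_add, LinearMap.add_apply, add_assoc]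
  | add x y hx hy => simp only [map_add, hx, hy]; abel

theorem leibniz_rightAction (a a' : A) (h : ∀ n, g (r a n) = r a' n + r a (g n))
    (x : BalTensor ρ σ) : leibniz δ f g hf hg (rightAction ρ σ r hr a x) =
      rightAction ρ σ r hr a' x + rightAction ρ σ r hr a (leibniz δ f g hf hg x) := by
  induction x using induction with
  | zero => simp only [map_zero, add_zero]
  | pure m n => simp only [rightAction_tmul, leibniz_tmul, h, map_add, add_left_comm]
  | add x y hx hy => simp only [map_add, hx, hy]; abel

end Actions

theorem leibniz_pow_eq_zero (p : ℕ) [Fact p.Prime] [CharP k p] (δ : S → S) (f : M →ₗ[k] M)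
    (g : N →ₗ[k] N) (hf : ∀ s m, f (ρ s m) = ρ (δ s) m + ρ s (f m))
    (hg : ∀ s n, g (σ s n) = σ (δ s) n + σ s (g n)) (hfp : f ^ p = 0) (hgp : g ^ p = 0) :
    leibniz δ f g hf hg ^ p = 0 := by
  have key : ∀ (r : ℕ) (m : M) (n : N), (leibniz δ f g hf hg ^ r) (tmul ρ σ m n) =
      (balancedRel ρ σ).mkQ
        ((SoergelBraid.leibniz (S := k) (fun _ => 0) f g (by simp) (by simp) ^ r) (m ⊗ₜ n)) := by
    intro r m n
    have : ∀ x : M ⊗[k] N, leibniz δ f g hf hg ((balancedRel ρ σ).mkQ x) = (balancedRel ρ σ).mkQ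
        (SoergelBraid.leibniz (S := k) (fun _ => 0) f g (by simp) (by simp) x) := by
      intro x
      induction x using TensorProduct.induction_on with
      | zero => simp only [map_zero]
      | tmul m n =>
        rw [SoergelBraid.leibniz_tmul, map_add]
        exact leibniz_tmul δ f g hf hg m n
      | add x y hx hy => simp only [map_add, hx, hy]
    have h : ∀ x : M ⊗[k] N, (leibniz δ f g hf hg ^ r) ((balancedRel ρ σ).mkQ x) =
        (balancedRel ρ σ).mkQ
          ((SoergelBraid.leibniz (S := k) (fun _ => 0) f g (by simp) (by simp) ^ r) x) := by
      induction r with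
      | zero => intro x; rfl
      | succ r ih =>
        intro x
        rw [pow_succ, pow_succ, Module.End.mul_apply, Module.End.mul_apply, this, ih]
    exact h _
  refine ext fun m n => ?_
  rw [key, SoergelBraid.leibniz_pow_eq_zero p _ _ _ _ _ hfp hgp]
  simp

/-- The tensor product grading on `M ⊗_S N`. -/
def deg (ρ : S → Module.End k M) (σ : S → Module.End k N) (A : ι → Submodule k M)
    (B : ι → Submodule k N) (j : ι) : Submodule k (BalTensor ρ σ) :=
  Submodule.span k {x | ∃ a b : ι, a + b = j ∧ ∃ m ∈ A a, ∃ n ∈ B b, x = tmul ρ σ m n}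

variable {A : ι → Submodule k M} {B : ι → Submodule k N}

theorem tmul_mem_deg {a b : ι} {m : M} {n : N} (hm : m ∈ A a) (hn : n ∈ B b) :
    tmul ρ σ m n ∈ deg ρ σ A B (a + b) :=
  Submodule.subset_span ⟨a, b, rfl, m, hm, n, hn, rfl⟩

theorem map_mem_deg {Q : Type*} [AddCommGroup Q] [Module k Q] (f : BalTensor ρ σ →ₗ[k] Q)
    (P : Submodule k Q) (j : ι)
    (h : ∀ a b, a + b = j → ∀ m ∈ A a, ∀ n ∈ B b, f (tmul ρ σ m n) ∈ P)
    (x : BalTensor ρ σ) (hx : x ∈ deg ρ σ A B j) : f x ∈ P := by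
  have : deg ρ σ A B j ≤ P.comap f := Submodule.span_le.2 (by
    rintro x ⟨a, b, hab, m, hm, n, hn, rfl⟩
    exact h a b hab m hm n hn)
  exact this hx

theorem isInternal (hA : DirectSum.IsInternal A) (hB : DirectSum.IsInternal B)
    (hS : ∀ s, ∃ (T : Finset ℕ) (c : ℕ → S), (ρ s = ∑ t ∈ T, ρ (c t)) ∧
      (σ s = ∑ t ∈ T, σ (c t)) ∧ ∀ t ∈ T, ∃ e : ι, (∀ a, ∀ m ∈ A a, ρ (c t) m ∈ A (e + a)) ∧
        ∀ b, ∀ n ∈ B b, σ (c t) n ∈ B (e + b)) :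
    DirectSum.IsInternal (deg ρ σ A B) := by
  let g : M →ₗ[k] N →ₗ[k] (ι →₀ BalTensor ρ σ) :=
    (Finsupp.lsum k fun a => LinearMap.flip ((Finsupp.lsum k fun b => LinearMap.flip
      ((tmul ρ σ).compr₂ (Finsupp.lsingle (a + b)))).comp (components hB))).comp (components hA)
  have gh : ∀ a b m n, m ∈ A a → n ∈ B b → g m n = Finsupp.single (a + b) (tmul ρ σ m n) := by
    intro a b m n hm hn
    simp [g, components_of_mem hA hm, components_of_mem hB hn]
  have bal : ∀ (s : S) (m : M) (n : N), g (ρ s m) n = g m (σ s n) := by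
    intro s m n
    obtain ⟨T, c, h1, h2, hT⟩ := hS s
    simp only [h1, h2, LinearMap.sum_apply, map_sum]
    refine Finset.sum_congr rfl fun t ht => ?_
    obtain ⟨e, h1, h2⟩ := hT t ht
    refine graded_induction hA (P := fun m => g (ρ (c t) m) n = g m (σ (c t) n)) ?_ (by simp)
      (fun x y hx hy => by simp [hx, hy]) m
    intro a m hm
    refine graded_induction hB (P := fun n => g (ρ (c t) m) n = g m (σ (c t) n)) ?_ (by simp)
      (fun x y hx hy => by simp [hx, hy]) n
    intro b n hn
    rw [gh _ _ _ _ (h1 a m hm) hn, gh _ _ _ _ hm (h2 b n hn), tmul_balanced,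
      show e + a + b = a + (e + b) by abel]
  have δh : ∀ a b m n, m ∈ A a → n ∈ B b →
      lift g bal (tmul ρ σ m n) = Finsupp.single (a + b) (tmul ρ σ m n) := by
    intro a b m n hm hn
    rw [lift_tmul, gh a b m n hm hn]
  have ind : ∀ P : BalTensor ρ σ → Prop, (∀ a b m n, m ∈ A a → n ∈ B b → P (tmul ρ σ m n)) →
      P 0 → (∀ x y, P x → P y → P (x + y)) → ∀ x, P x := by
    intro P h h0 hadd x
    refine induction h0 (fun m n => ?_) hadd x
    refine graded_induction hA (P := fun m => P (tmul ρ σ m n)) ?_ (by simpa using h0)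
      (fun x y hx hy => by rw [map_add]; exact hadd _ _ hx hy) m
    intro a m hm
    exact graded_induction hB (P := fun n => P (tmul ρ σ m n)) (fun b n hn => h a b m n hm hn)
      (by simpa using h0) (fun x y hx hy => by rw [map_add]; exact hadd _ _ hx hy) n
  refine isInternal_of_components (lift g bal).toAddMonoidHom ?_ ?_ ?_
  · refine ind _ ?_ (by simp) ?_
    · intro a b m n hm hn i
      rw [LinearMap.toAddMonoidHom_coe, δh a b m n hm hn, Finsupp.single_apply]
      split_ifs with h
      · exact h ▸ tmul_mem_deg hm hn
      · exact zero_mem _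
    · intro x y hx hy i
      rw [map_add]
      exact add_mem (hx i) (hy i)
  · refine ind _ ?_ (by simp) ?_
    · intro a b m n hm hn
      rw [LinearMap.toAddMonoidHom_coe, δh a b m n hm hn]; simp
    · intro x y hx hy
      rw [map_add, Finsupp.sum_add_index', hx, hy] <;> simp
  · intro i x hx
    have := map_mem_deg (lift g bal - Finsupp.lsingle i) ⊥ i (by
      rintro a b rfl m hm n hn
      simp [gh a b m n hm hn]) x hx
    simpa [sub_eq_zero] using this

end BalTensor

end BalancedTensor

section UnitAndTensor

variable {k : Type u} [Field k] {p n : ℕ} {ι : Type} [AddCommGroup ι] [DecidableEq ι] {v : ι}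

variable (k p n v) in
/-- The bimodule `R`, with its action of `H_q`. -/
def unitBimod [Fact p.Prime] [CharP k p] : EqBimod k p n v where
  carrier := Poly k n
  left := Algebra.lmul k (Poly k n)
  right := Algebra.lmul k (Poly k n)
  left_right a b m := mul_left_comm a b m
  deg := MvPolynomial.weightedHomogeneousSubmodule k fun _ => v
  isInternal := (MvPolynomial.weightedDecomposition k fun _ : Fin n => v).isInternal
  left_mem h hm := h.mul hm
  right_mem h hm := h.mul hm
  D := dq k n
  D_pow := by
    have h : ((dq k n : Derivation k _ _) : Poly k n →ₗ[k] Poly k n) = dqTwist 0 :=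
      LinearMap.ext fun a => (dqTwist_zero a).symm
    rw [h, dqTwist_zero_pow]
  D_left a m := by
    change dq k n (a * m) = dq k n a * m + a * dq k n m
    rw [Derivation.leibniz, smul_eq_mul, smul_eq_mul]; ring
  D_right a m := by
    change dq k n (a * m) = dq k n a * m + a * dq k n m
    rw [Derivation.leibniz, smul_eq_mul, smul_eq_mul]; ring
  D_mem _ _ hm := dq_mem v hm


/-- The tensor product `M ⊗_R N` of graded bimodules. -/
@[reducible]
def GrBimod.tensor (M N : GrBimod k n v) : GrBimod k n v where
  carrier := BalTensor M.right N.left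
  left := BalTensor.leftAction M.right N.left M.left M.left_right
  right := BalTensor.rightAction M.right N.left N.right fun a b n => (N.left_right b a n).symm
  left_right := BalTensor.leftAction_rightAction _ _ _ _
  deg := BalTensor.deg M.right N.left M.deg N.deg
  isInternal := by
    refine BalTensor.isInternal M.isInternal N.isInternal fun a =>
      ⟨Finset.range (a.totalDegree + 1), fun r => MvPolynomial.homogeneousComponent r a, ?_, ?_, ?_⟩
    · rw [← map_sum, MvPolynomial.sum_homogeneousComponent]
    · rw [← map_sum, MvPolynomial.sum_homogeneousComponent]
    · intro r _
      have h := isWeightedHomogeneous_of_isHomogeneous v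
        (MvPolynomial.homogeneousComponent_isHomogeneous r a)
      exact ⟨r • v, fun _ _ hm => M.right_mem h hm, fun _ _ hm => N.left_mem h hm⟩
  left_mem {a e j x} ha hx := BalTensor.map_mem_deg _ _ j (by
    rintro b c rfl m hm n hn
    rw [BalTensor.leftAction_tmul, ← add_assoc]
    exact BalTensor.tmul_mem_deg (M.left_mem ha hm) hn) x hx
  right_mem {a e j x} ha hx := BalTensor.map_mem_deg _ _ j (by
    rintro b c rfl m hm n hn
    rw [BalTensor.rightAction_tmul, add_left_comm]
    exact BalTensor.tmul_mem_deg hm (N.right_mem ha hn)) x hx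

/-- The tensor product `M ⊗_R N` with `∂_q` acting by the Leibniz rule. -/
@[reducible]
def EqBimod.tensor [Fact p.Prime] [CharP k p] (M N : EqBimod k p n v) : EqBimod k p n v where
  toGrBimod := M.toGrBimod.tensor N.toGrBimod
  D := BalTensor.leibniz (dq k n) M.D N.D M.D_right N.D_left
  D_pow := BalTensor.leibniz_pow_eq_zero p _ _ _ _ _ M.D_pow N.D_pow
  D_left a x := BalTensor.leibniz_leftAction _ _ _ _ _ _ _ a _ (M.D_left a) x
  D_right a x := BalTensor.leibniz_rightAction _ _ _ _ _ _ _ a _ (N.D_right a) x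
  D_mem j x hx := BalTensor.map_mem_deg _ _ j (by
    rintro b c rfl m hm n hn
    rw [BalTensor.leibniz_tmul]
    refine add_mem ?_ ?_
    · rw [← add_assoc]; exact BalTensor.tmul_mem_deg (M.D_mem _ _ hm) hn
    · rw [add_left_comm]; exact BalTensor.tmul_mem_deg hm (N.D_mem _ _ hn)) x hx

end UnitAndTensor

section Soergel

variable (k : Type u) [Field k] {p n : ℕ}

/-- The position `i` of the first strand on which the `i`-th braid generator acts. -/
def pos (i : Fin (n - 1)) : Fin n := ⟨i, by omega⟩

/-- The position `i + 1` of the second strand on which the `i`-th braid generator acts. -/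
def posSucc (i : Fin (n - 1)) : Fin n := ⟨i + 1, by omega⟩

/-- The variable `x_i`. -/
abbrev xa (i : Fin (n - 1)) : Poly k n := MvPolynomial.X (pos i)

/-- The variable `x_{i + 1}`. -/
abbrev xb (i : Fin (n - 1)) : Poly k n := MvPolynomial.X (posSucc i)

/-- The subalgebra `R^i` of the polynomials that are symmetric in `x_i` and `x_{i + 1}`. -/
def symSubalgebra (i : Fin (n - 1)) : Subalgebra k (Poly k n) :=
  AlgHom.equalizer (MvPolynomial.rename (Equiv.swap (pos i) (posSucc i))) (AlgHom.id k (Poly k n))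

variable {k}

theorem dq_rename (e : Equiv.Perm (Fin n)) (a : Poly k n) :
    dq k n (MvPolynomial.rename e a) = MvPolynomial.rename e (dq k n a) := by
  induction a using MvPolynomial.induction_on with
  | C c => rw [MvPolynomial.rename_C, MvPolynomial.derivation_C, map_zero]
  | add a b ha hb => simp only [map_add, ha, hb]
  | mul_X a i ha =>
    simp only [map_mul, Derivation.leibniz, MvPolynomial.rename_X, dq_X, ha, smul_eq_mul, map_add,
      map_pow]

theorem mem_symSubalgebra {i : Fin (n - 1)} {a : Poly k n} : a ∈ symSubalgebra k i ↔
    MvPolynomial.rename (Equiv.swap (pos i) (posSucc i)) a = a := Iff.rfl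

/-- The restriction of `∂_q` to `R^i`. -/
def dqSym (i : Fin (n - 1)) (s : symSubalgebra k i) : symSubalgebra k i :=
  ⟨dq k n s, mem_symSubalgebra.2 (by rw [← dq_rename, mem_symSubalgebra.1 s.2])⟩

/-- The underlying space of the bimodule `B_i = R ⊗_{R^i} R`. -/
abbrev BCarrier (i : Fin (n - 1)) : Type u := Poly k n ⊗[symSubalgebra k i] Poly k n

theorem polyDeg_isInternal (v : ℤ) : DirectSum.IsInternal
    (MvPolynomial.weightedHomogeneousSubmodule k fun _ : Fin n => v) :=
  (MvPolynomial.weightedDecomposition k fun _ : Fin n => v).isInternal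

/-- The grading of `B_i`. -/
abbrev bDeg (i : Fin (n - 1)) : ℤ → Submodule k (BCarrier (k := k) i) :=
  tensorDeg (symSubalgebra k i)
    (MvPolynomial.weightedHomogeneousSubmodule k fun _ : Fin n => (2 : ℤ))
    (MvPolynomial.weightedHomogeneousSubmodule k fun _ : Fin n => (2 : ℤ))

theorem bDeg_isInternal (i : Fin (n - 1)) : DirectSum.IsInternal (bDeg (k := k) i) := by
  refine tensor_isInternal (polyDeg_isInternal 2) (polyDeg_isInternal 2) fun s => ?_
  have hs : ∀ r, MvPolynomial.homogeneousComponent r (s : Poly k n) ∈ symSubalgebra k i := by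
    intro r
    rw [mem_symSubalgebra, MvPolynomial.rename_homogeneousComponent, mem_symSubalgebra.1 s.2]
  have h : s = ∑ r ∈ Finset.range ((s : Poly k n).totalDegree + 1),
      (⟨MvPolynomial.homogeneousComponent r (s : Poly k n), hs r⟩ : symSubalgebra k i) := by
    apply Subtype.ext
    rw [AddSubmonoidClass.coe_finsetSum, MvPolynomial.sum_homogeneousComponent]
  rw [h]
  refine AddSubmonoid.sum_mem _ fun r _ => AddSubmonoid.subset_closure ?_
  have h := isWeightedHomogeneous_of_isHomogeneous (2 : ℤ)
    (MvPolynomial.homogeneousComponent_isHomogeneous r (s : Poly k n))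
  exact ⟨r • 2, fun _ _ hm => h.mul hm, fun _ _ hm => h.mul hm⟩

theorem dq_smul (i : Fin (n - 1)) (s : symSubalgebra k i) (a : Poly k n) :
    (dq k n : Poly k n →ₗ[k] Poly k n) (s • a) = dqSym i s • a + s • dq k n a := by
  change dq k n ((s : Poly k n) * a) = dq k n s * a + s * dq k n a
  rw [Derivation.leibniz, smul_eq_mul, smul_eq_mul]; ring

theorem dqTwist_smul (i : Fin (n - 1)) (f : Poly k n) (s : symSubalgebra k i) (a : Poly k n) :
    dqTwist f (s • a) = dqSym i s • a + s • dqTwist f a :=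
  dqTwist_mul f s a

/-- The operator `∂_q (a ⊗ b) = ∂_q a ⊗ b + a ⊗ (∂_q b + f b)` on `B_i ^ f`; in particular
`∂_q (1 ⊗ 1) = (1 ⊗ 1) f`. -/
def bTwistD (i : Fin (n - 1)) (f : Poly k n) : BCarrier (k := k) i →ₗ[k] BCarrier (k := k) i :=
  leibniz (dqSym i) (dq k n : Poly k n →ₗ[k] Poly k n) (dqTwist f) (dq_smul i) (dqTwist_smul i f)

theorem bTwistD_tmul (i : Fin (n - 1)) (f a b : Poly k n) :
    bTwistD i f (a ⊗ₜ b) = dq k n a ⊗ₜ b + a ⊗ₜ dqTwist f b := rfl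

theorem bTwistD_left (i : Fin (n - 1)) (f a : Poly k n) (x : BCarrier (k := k) i) :
    bTwistD i f ((a ⊗ₜ 1) * x) = (dq k n a ⊗ₜ 1) * x + (a ⊗ₜ 1) * bTwistD i f x := by
  induction x using TensorProduct.induction_on with
  | zero => simp
  | tmul b c =>
    simp only [Algebra.TensorProduct.tmul_mul_tmul, one_mul, bTwistD_tmul, mul_add,
      Derivation.leibniz, smul_eq_mul, TensorProduct.add_tmul]
    rw [mul_comm b]; abel
  | add x y hx hy => simp only [mul_add, map_add, hx, hy]; abel

theorem bTwistD_right (i : Fin (n - 1)) (f a : Poly k n) (x : BCarrier (k := k) i) :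
    bTwistD i f ((1 ⊗ₜ a) * x) = (1 ⊗ₜ dq k n a) * x + (1 ⊗ₜ a) * bTwistD i f x := by
  induction x using TensorProduct.induction_on with
  | zero => simp
  | tmul b c =>
    simp only [Algebra.TensorProduct.tmul_mul_tmul, one_mul, bTwistD_tmul, mul_add,
      dqTwist_mul, TensorProduct.tmul_add]
    abel
  | add x y hx hy => simp only [mul_add, map_add, hx, hy]; abel

theorem mul_mem_bDeg (i : Fin (n - 1)) {a b : Poly k n} {e e' j : ℤ} {x : BCarrier (k := k) i}
    (ha : MvPolynomial.IsWeightedHomogeneous (fun _ => (2 : ℤ)) a e)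
    (hb : MvPolynomial.IsWeightedHomogeneous (fun _ => (2 : ℤ)) b e')
    (hx : x ∈ bDeg i j) : (a ⊗ₜ b) * x ∈ bDeg i (e + e' + j) := by
  have : bDeg i j ≤ (bDeg i (e + e' + j)).comap (LinearMap.mulLeft k (a ⊗ₜ b)) :=
    Submodule.span_le.2 (by
      rintro x ⟨c, d, rfl, m, hm, l, hl, rfl⟩
      rw [SetLike.mem_coe, Submodule.mem_comap, LinearMap.mulLeft_apply,
        Algebra.TensorProduct.tmul_mul_tmul, show e + e' + (c + d) = (e + c) + (e' + d) by ring]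
      exact tmul_mem_tensorDeg (ha.mul hm) (hb.mul hl))
  exact this hx

theorem left_mul_mem_bDeg (i : Fin (n - 1)) {a : Poly k n} {e j : ℤ} {x : BCarrier (k := k) i}
    (ha : MvPolynomial.IsWeightedHomogeneous (fun _ => (2 : ℤ)) a e) (hx : x ∈ bDeg i j) :
    (a ⊗ₜ 1) * x ∈ bDeg i (e + j) := by
  have := mul_mem_bDeg i ha (MvPolynomial.isWeightedHomogeneous_one k _) hx
  rwa [add_zero] at this

theorem right_mul_mem_bDeg (i : Fin (n - 1)) {a : Poly k n} {e j : ℤ} {x : BCarrier (k := k) i}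
    (ha : MvPolynomial.IsWeightedHomogeneous (fun _ => (2 : ℤ)) a e) (hx : x ∈ bDeg i j) :
    (1 ⊗ₜ a) * x ∈ bDeg i (e + j) := by
  have := mul_mem_bDeg i (MvPolynomial.isWeightedHomogeneous_one k _) ha hx
  rwa [zero_add] at this

/-- The graded `(R, R) # H_q`-module `B_i ^ f`, for a linear form `f` such that `∂_q ^ p = 0` on
the twisted module `R ^ f`. -/
@[reducible]
def bTwist [Fact p.Prime] [CharP k p] (i : Fin (n - 1)) (f : Poly k n)
    (hf : MvPolynomial.IsWeightedHomogeneous (fun _ => (2 : ℤ)) f 2) (hfp : dqTwist f ^ p = 0) :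
    EqBimod k p n (2 : ℤ) where
  carrier := BCarrier (k := k) i
  left := (Algebra.lmul k (BCarrier (k := k) i)).comp Algebra.TensorProduct.includeLeft
  right := (Algebra.lmul k (BCarrier (k := k) i)).comp
    (Algebra.TensorProduct.includeRight.restrictScalars k)
  left_right a b m := mul_left_comm _ _ _
  deg := bDeg i
  isInternal := bDeg_isInternal i
  left_mem ha hx := left_mul_mem_bDeg i ha hx
  right_mem ha hx := right_mul_mem_bDeg i ha hx
  D := bTwistD i f
  D_pow := by
    have h : (dq k n : Poly k n →ₗ[k] Poly k n) = dqTwist 0 :=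
      LinearMap.ext fun a => (dqTwist_zero a).symm
    exact leibniz_pow_eq_zero p _ _ _ _ _ (by rw [h, dqTwist_zero_pow]) hfp
  D_left a x := bTwistD_left i f a x
  D_right a x := bTwistD_right i f a x
  D_mem := leibniz_mem 2 _ _ _ _ _ (fun _ _ hm => dq_mem 2 hm) fun _ _ hm =>
    add_mem (dq_mem 2 hm) (hf.mul hm)

/-- The grading shift `q ^ s M`, which raises all degrees by `s`. -/
@[reducible]
def qShift (s : ℤ) (M : EqBimod k p n (2 : ℤ)) : EqBimod k p n (2 : ℤ) where
  carrier := M.carrier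
  left := M.left
  right := M.right
  left_right := M.left_right
  deg j := M.deg (j - s)
  isInternal := by
    have h := M.isInternal
    rw [DirectSum.isInternal_submodule_iff_iSupIndep_and_iSup_eq_top] at h ⊢
    refine ⟨h.1.comp (sub_left_injective), ?_⟩
    rw [← h.2]
    exact (Equiv.subRight s).iSup_comp (g := M.deg)
  left_mem ha hx := by rw [add_sub_assoc]; exact M.left_mem ha hx
  right_mem ha hx := by rw [add_sub_assoc]; exact M.right_mem ha hx
  D := M.D
  D_pow := M.D_pow
  D_left := M.D_left
  D_right := M.D_right
  D_mem j m hm := by rw [add_sub_assoc]; exact M.D_mem _ m hm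

variable (k) in
/-- The linear form `-(x_i + x_{i + 1})`. -/
def negForm (i : Fin (n - 1)) : Poly k n := -(xa k i + xb k i)

theorem negForm_isWeightedHomogeneous (i : Fin (n - 1)) :
    MvPolynomial.IsWeightedHomogeneous (fun _ => (2 : ℤ)) (negForm k i) 2 := by
  unfold negForm
  have h := fun l => MvPolynomial.isWeightedHomogeneous_X k (fun _ : Fin n => (2 : ℤ)) l
  exact ((h (pos i)).add (h (posSucc i))).neg

variable [Fact p.Prime] [CharP k p]

variable (k p) in
/-- The graded `(R, R) # H_q`-module `B_i = R ⊗_{R^i} R`. -/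
abbrev bBimod (i : Fin (n - 1)) : EqBimod k p n (2 : ℤ) :=
  bTwist i 0 (MvPolynomial.isWeightedHomogeneous_zero k _ _) (dqTwist_zero_pow p)

variable (k) in
/-- The graded `(R, R) # H_q`-module `q^{-2} B_i^{-(x_i + x_{i + 1})}`. -/
abbrev bNegBimod (hp : 2 < p) (i : Fin (n - 1)) : EqBimod k p n (2 : ℤ) :=
  qShift (-2) (bTwist i (negForm k i) (negForm_isWeightedHomogeneous i) (dqTwist_neg_pow p hp _ _))

/-- The multiplication map `B_i → R`, `a ⊗ b ↦ a b`, on underlying spaces. -/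
def brLin (i : Fin (n - 1)) : BCarrier (k := k) i →ₗ[k] Poly k n :=
  ((Algebra.TensorProduct.lmul' (symSubalgebra k i) (S := Poly k n)).restrictScalars k).toLinearMap

theorem brLin_tmul (i : Fin (n - 1)) (a b : Poly k n) :
    brLin i (a ⊗ₜ[symSubalgebra k i] b) = a * b :=
  Algebra.TensorProduct.lmul'_apply_tmul a b

theorem brLin_mul (i : Fin (n - 1)) (x y : BCarrier (k := k) i) :
    brLin i (x * y) = brLin i x * brLin i y :=
  map_mul (Algebra.TensorProduct.lmul' (symSubalgebra k i) (S := Poly k n)) x y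

theorem brLin_D (i : Fin (n - 1)) (x : BCarrier (k := k) i) :
    brLin i (bTwistD i 0 x) = dq k n (brLin i x) := by
  induction x using TensorProduct.induction_on with
  | zero => simp
  | tmul b c =>
    rw [bTwistD_tmul, map_add, brLin_tmul, brLin_tmul, brLin_tmul, dqTwist_zero,
      Derivation.leibniz, smul_eq_mul, smul_eq_mul]
    ring
  | add x y hx hy => simp only [map_add, hx, hy]

theorem brLin_mem (i : Fin (n - 1)) (j : ℤ) (x : BCarrier (k := k) i) (hx : x ∈ bDeg i j) :
    brLin i x ∈ MvPolynomial.weightedHomogeneousSubmodule k (fun _ : Fin n => (2 : ℤ)) j := by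
  have : bDeg i j ≤ (MvPolynomial.weightedHomogeneousSubmodule k
      (fun _ : Fin n => (2 : ℤ)) j).comap (brLin i) :=
    Submodule.span_le.2 (by
      rintro x ⟨c, d, rfl, m, hm, l, hl, rfl⟩
      rw [SetLike.mem_coe, Submodule.mem_comap, brLin_tmul]
      exact MvPolynomial.IsWeightedHomogeneous.mul hm hl)
  exact this hx

variable (k p) in
/-- The morphism `br_i : B_i → R`, `1 ⊗ 1 ↦ 1`. -/
def br (i : Fin (n - 1)) : bBimod k p i ⟶ unitBimod k p n (2 : ℤ) :=
  ⟨brLin i, ⟨fun a x => (brLin_mul i (a ⊗ₜ 1) x).trans (by rw [brLin_tmul, mul_one]; rfl),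
    fun a x => (brLin_mul i (1 ⊗ₜ a) x).trans (by rw [brLin_tmul, one_mul]; rfl),
    brLin_mem i⟩, brLin_D i⟩

/-- The element `x_{i + 1} ⊗ 1 - 1 ⊗ x_i` of `R ⊗_{R^i} R`. -/
def rbElt (i : Fin (n - 1)) : BCarrier (k := k) i := xb k i ⊗ₜ 1 - 1 ⊗ₜ xa k i

theorem sym_tmul (i : Fin (n - 1)) (s : Poly k n) (hs : s ∈ symSubalgebra k i) :
    (s ⊗ₜ 1 : BCarrier (k := k) i) = 1 ⊗ₜ s := by
  have := TensorProduct.smul_tmul (R := symSubalgebra k i) (⟨s, hs⟩ : symSubalgebra k i)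
    (1 : Poly k n) (1 : Poly k n)
  have h : (⟨s, hs⟩ : symSubalgebra k i) • (1 : Poly k n) = s := mul_one s
  rwa [h] at this

theorem left_rbElt (i : Fin (n - 1)) (a : Poly k n) :
    (a ⊗ₜ 1) * rbElt i = (1 ⊗ₜ a) * (rbElt i : BCarrier (k := k) i) := by
  have hadd : (xa k i ⊗ₜ 1 : BCarrier (k := k) i) + xb k i ⊗ₜ 1 = 1 ⊗ₜ xa k i + 1 ⊗ₜ xb k i := by
    rw [← TensorProduct.add_tmul, ← TensorProduct.tmul_add]
    refine sym_tmul i _ (mem_symSubalgebra.2 ?_)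
    simp [add_comm]
  have hmul : (xa k i ⊗ₜ 1 : BCarrier (k := k) i) * xb k i ⊗ₜ 1 = 1 ⊗ₜ xa k i * 1 ⊗ₜ xb k i := by
    rw [Algebra.TensorProduct.tmul_mul_tmul, Algebra.TensorProduct.tmul_mul_tmul, one_mul]
    refine sym_tmul i _ (mem_symSubalgebra.2 ?_)
    simp [mul_comm]
  have h1 : (xa k i ⊗ₜ 1) * rbElt i = (1 ⊗ₜ xa k i) * (rbElt i : BCarrier (k := k) i) := by
    rw [rbElt]
    linear_combination hmul - (1 ⊗ₜ xa k i : BCarrier (k := k) i) * hadd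
  have h2 : (xb k i ⊗ₜ 1) * rbElt i = (1 ⊗ₜ xb k i) * (rbElt i : BCarrier (k := k) i) := by
    linear_combination (rbElt i) * hadd - h1
  induction a using MvPolynomial.induction_on with
  | C c =>
    rw [sym_tmul i _ (mem_symSubalgebra.2 (by simp))]
  | add a b ha hb =>
    rw [TensorProduct.add_tmul, TensorProduct.tmul_add, add_mul, add_mul, ha, hb]
  | mul_X a l ha =>
    have hX : (MvPolynomial.X l ⊗ₜ 1) * rbElt i
        = (1 ⊗ₜ MvPolynomial.X l) * (rbElt i : BCarrier (k := k) i) := by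
      by_cases hl : l = pos i
      · rw [hl]; exact h1
      · by_cases hl' : l = posSucc i
        · rw [hl']; exact h2
        · rw [sym_tmul i _ (mem_symSubalgebra.2 ?_)]
          rw [MvPolynomial.rename_X, Equiv.swap_apply_of_ne_of_ne hl hl']
    have e1 : (a * MvPolynomial.X l) ⊗ₜ[symSubalgebra k i] (1 : Poly k n)
        = (a ⊗ₜ 1) * (MvPolynomial.X l ⊗ₜ 1) := by
      rw [Algebra.TensorProduct.tmul_mul_tmul, one_mul]
    have e2 : (1 : Poly k n) ⊗ₜ[symSubalgebra k i] (a * MvPolynomial.X l)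
        = (1 ⊗ₜ a) * (1 ⊗ₜ MvPolynomial.X l) := by
      rw [Algebra.TensorProduct.tmul_mul_tmul, one_mul]
    rw [e1, e2]
    linear_combination (a ⊗ₜ 1 : BCarrier (k := k) i) * hX
      + (1 ⊗ₜ MvPolynomial.X l : BCarrier (k := k) i) * ha

theorem rbElt_D (i : Fin (n - 1)) : bTwistD i (negForm k i) (rbElt i) = 0 := by
  have h' : bTwistD i (negForm k i) (rbElt i) = (xb k i ^ 2) ⊗ₜ 1 - 1 ⊗ₜ (xa k i ^ 2)
      - (1 ⊗ₜ (xa k i + xb k i)) * rbElt i := by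
    have e1 : bTwistD i (negForm k i) (xb k i ⊗ₜ 1) =
        (xb k i ^ 2) ⊗ₜ 1 - (1 ⊗ₜ (xa k i + xb k i)) * (xb k i ⊗ₜ 1) := by
      rw [bTwistD_tmul, dqTwist_apply, Derivation.map_one_eq_zero, mul_one, zero_add, dq_X, negForm,
        TensorProduct.tmul_neg, Algebra.TensorProduct.tmul_mul_tmul, one_mul, mul_one,
        sub_eq_add_neg]
    have e2 : bTwistD i (negForm k i) (1 ⊗ₜ xa k i) =
        1 ⊗ₜ (xa k i ^ 2) - (1 ⊗ₜ (xa k i + xb k i)) * (1 ⊗ₜ xa k i) := by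
      rw [bTwistD_tmul, dqTwist_apply, Derivation.map_one_eq_zero, TensorProduct.zero_tmul,
        zero_add, dq_X, negForm, neg_mul, TensorProduct.tmul_add, TensorProduct.tmul_neg,
        Algebra.TensorProduct.tmul_mul_tmul, one_mul, sub_eq_add_neg]
    rw [rbElt, map_sub, e1, e2, mul_sub]
    abel
  rw [h', rbElt, TensorProduct.tmul_add]
  have hadd : (xa k i ⊗ₜ 1 : BCarrier (k := k) i) + xb k i ⊗ₜ 1 = 1 ⊗ₜ xa k i + 1 ⊗ₜ xb k i := by
    rw [← TensorProduct.add_tmul, ← TensorProduct.tmul_add]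
    refine sym_tmul i _ (mem_symSubalgebra.2 ?_)
    simp [add_comm]
  have hmul : (xa k i ⊗ₜ 1 : BCarrier (k := k) i) * xb k i ⊗ₜ 1 = 1 ⊗ₜ xa k i * 1 ⊗ₜ xb k i := by
    rw [Algebra.TensorProduct.tmul_mul_tmul, Algebra.TensorProduct.tmul_mul_tmul, one_mul]
    refine sym_tmul i _ (mem_symSubalgebra.2 ?_)
    simp [mul_comm]
  have s1 : ((xb k i ^ 2) ⊗ₜ 1 : BCarrier (k := k) i) = (xb k i ⊗ₜ 1) ^ 2 := by
    rw [Algebra.TensorProduct.tmul_pow, one_pow]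
  have s2 : (1 ⊗ₜ (xa k i ^ 2) : BCarrier (k := k) i) = (1 ⊗ₜ xa k i) ^ 2 := by
    rw [Algebra.TensorProduct.tmul_pow, one_pow]
  rw [s1, s2]
  linear_combination (xb k i ⊗ₜ 1 : BCarrier (k := k) i) * hadd - hmul

/-- The map `R → R ⊗_{R^i} R`, `a ↦ (a ⊗ 1) (x_{i + 1} ⊗ 1 - 1 ⊗ x_i)`. -/
def rbLin (i : Fin (n - 1)) : Poly k n →ₗ[k] BCarrier (k := k) i where
  toFun a := (a ⊗ₜ[symSubalgebra k i] (1 : Poly k n)) * rbElt i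
  map_add' a b := by rw [TensorProduct.add_tmul, add_mul]
  map_smul' c a := by
    rw [← TensorProduct.smul_tmul', RingHom.id_apply]
    exact smul_mul_assoc c (a ⊗ₜ[symSubalgebra k i] (1 : Poly k n)) (rbElt i)

theorem rbLin_apply (i : Fin (n - 1)) (a : Poly k n) : rbLin i a = (a ⊗ₜ 1) * rbElt i := rfl

theorem rbLin_left (i : Fin (n - 1)) (a b : Poly k n) :
    rbLin i (a * b) = (a ⊗ₜ 1) * rbLin i b := by
  rw [rbLin_apply, rbLin_apply, ← mul_assoc, Algebra.TensorProduct.tmul_mul_tmul, one_mul]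

theorem rbLin_right (i : Fin (n - 1)) (a b : Poly k n) :
    rbLin i (a * b) = (1 ⊗ₜ a) * rbLin i b := by
  rw [mul_comm, rbLin_left, rbLin_apply, rbLin_apply, left_rbElt, mul_left_comm]

theorem rbLin_D (i : Fin (n - 1)) (a : Poly k n) :
    rbLin i (dq k n a) = bTwistD i (negForm k i) (rbLin i a) := by
  rw [rbLin_apply, rbLin_apply, bTwistD_left, rbElt_D, mul_zero, add_zero]

theorem rbElt_mem (i : Fin (n - 1)) : (rbElt i : BCarrier (k := k) i) ∈ bDeg i 2 := by
  have h1 := MvPolynomial.isWeightedHomogeneous_one k (fun _ : Fin n => (2 : ℤ))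
  have hX := fun l => MvPolynomial.isWeightedHomogeneous_X k (fun _ : Fin n => (2 : ℤ)) l
  have h : ∀ {a b : Poly k n} {e e' : ℤ},
      a ∈ MvPolynomial.weightedHomogeneousSubmodule k (fun _ : Fin n => (2 : ℤ)) e →
      b ∈ MvPolynomial.weightedHomogeneousSubmodule k (fun _ : Fin n => (2 : ℤ)) e' →
      (a ⊗ₜ b : BCarrier (k := k) i) ∈ bDeg i (e + e') := tmul_mem_tensorDeg
  have e1 := h (hX (posSucc i)) h1
  have e2 := h h1 (hX (pos i))
  rw [add_zero] at e1
  rw [zero_add] at e2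
  rw [rbElt]
  exact Submodule.sub_mem _ e1 e2

theorem rbLin_mem (i : Fin (n - 1)) (j : ℤ) (a : Poly k n)
    (ha : a ∈ MvPolynomial.weightedHomogeneousSubmodule k (fun _ : Fin n => (2 : ℤ)) j) :
    rbLin i a ∈ bDeg i (j - -2) := by
  rw [sub_neg_eq_add]
  exact left_mul_mem_bDeg i ha (rbElt_mem i)

variable (k) in
/-- The morphism `rb_i : R → q^{-2} B_i^{-(x_i + x_{i + 1})}`, `1 ↦ x_{i + 1} ⊗ 1 - 1 ⊗ x_i`. -/
def rb (hp : 2 < p) (i : Fin (n - 1)) : unitBimod k p n (2 : ℤ) ⟶ bNegBimod k hp i :=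
  ⟨rbLin i, ⟨rbLin_left i, rbLin_right i, rbLin_mem i⟩, rbLin_D i⟩

end Soergel
section DgBimodules

variable (k : Type u) [Field k] (p n : ℕ)

/-- A chain complex of graded `(R, R) # H_q`-modules, written as one bigraded module: `deg (j, t)`
is the part of `q`-degree `j` in homological degree `t`, and `d` has bidegree `(0, -1)`. -/
structure DgBimod extends EqBimod k p n ((2, 0) : ℤ × ℤ) where
  d : carrier →ₗ[k] carrier
  d_d : ∀ m, d (d m) = 0
  d_left : ∀ a m, d (left a m) = left a (d m)
  d_right : ∀ a m, d (right a m) = right a (d m)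
  d_D : ∀ m, d (D m) = D (d m)
  d_mem : ∀ j t, ∀ m ∈ deg (j, t), d m ∈ deg (j, t - 1)

variable {k p n}

theorem isWeightedHomogeneous_pair {a : Poly k n} {e : ℤ}
    (h : MvPolynomial.IsWeightedHomogeneous (fun _ => (2 : ℤ)) a e) :
    MvPolynomial.IsWeightedHomogeneous (fun _ => ((2, 0) : ℤ × ℤ)) a (e, 0) := by
  intro α hα
  rw [← h hα, Finsupp.weight_apply, Finsupp.weight_apply, Finsupp.sum, Finsupp.sum]
  ext
  · simp [Prod.fst_sum]
  · simp [Prod.snd_sum]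

theorem exists_isWeightedHomogeneous_of_pair {a : Poly k n} {e : ℤ × ℤ}
    (h : MvPolynomial.IsWeightedHomogeneous (fun _ => ((2, 0) : ℤ × ℤ)) a e) (ha : a ≠ 0) :
    e.2 = 0 ∧ MvPolynomial.IsWeightedHomogeneous (fun _ => (2 : ℤ)) a e.1 := by
  have key : ∀ α : Fin n →₀ ℕ, Finsupp.weight (fun _ : Fin n => ((2, 0) : ℤ × ℤ)) α =
      (Finsupp.weight (fun _ : Fin n => (2 : ℤ)) α, 0) := by
    intro α
    rw [Finsupp.weight_apply, Finsupp.weight_apply, Finsupp.sum, Finsupp.sum]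
    ext
    · simp [Prod.fst_sum]
    · simp [Prod.snd_sum]
  refine ⟨?_, fun α hα => ?_⟩
  · obtain ⟨α, hα⟩ := MvPolynomial.ne_zero_iff.1 ha
    rw [← h hα, key]
  · rw [← h hα, key]

namespace DgBimod

variable (M : DgBimod k p n)

/-- The part of homological degree `t`. -/
def partSubmodule (t : ℤ) : Submodule k M.carrier := ⨆ j, M.deg (j, t)

theorem le_partSubmodule (j t : ℤ) : M.deg (j, t) ≤ M.partSubmodule t :=
  le_iSup (fun j => M.deg (j, t)) j

theorem map_partSubmodule (f : M.carrier →ₗ[k] M.carrier) (t t' : ℤ)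
    (h : ∀ j, ∀ m ∈ M.deg (j, t), f m ∈ M.partSubmodule t') :
    ∀ m ∈ M.partSubmodule t, f m ∈ M.partSubmodule t' := by
  have : M.partSubmodule t ≤ (M.partSubmodule t').comap f := iSup_le fun j m hm => h j m hm
  exact this

theorem left_mem_part (t : ℤ) (a : Poly k n) :
    ∀ m ∈ M.partSubmodule t, M.left a m ∈ M.partSubmodule t := by
  refine M.map_partSubmodule _ t t fun j m hm => ?_
  rw [← MvPolynomial.sum_homogeneousComponent a, map_sum, LinearMap.sum_apply]
  refine Submodule.sum_mem _ fun r _ => ?_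
  have h := M.left_mem (isWeightedHomogeneous_of_isHomogeneous ((2, 0) : ℤ × ℤ)
    (MvPolynomial.homogeneousComponent_isHomogeneous r a)) hm
  have e : r • ((2, 0) : ℤ × ℤ) + (j, t) = (r • 2 + j, t) := by ext <;> simp
  rw [e] at h
  exact M.le_partSubmodule _ _ h

theorem right_mem_part (t : ℤ) (a : Poly k n) :
    ∀ m ∈ M.partSubmodule t, M.right a m ∈ M.partSubmodule t := by
  refine M.map_partSubmodule _ t t fun j m hm => ?_
  rw [← MvPolynomial.sum_homogeneousComponent a, map_sum, LinearMap.sum_apply]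
  refine Submodule.sum_mem _ fun r _ => ?_
  have h := M.right_mem (isWeightedHomogeneous_of_isHomogeneous ((2, 0) : ℤ × ℤ)
    (MvPolynomial.homogeneousComponent_isHomogeneous r a)) hm
  have e : r • ((2, 0) : ℤ × ℤ) + (j, t) = (r • 2 + j, t) := by ext <;> simp
  rw [e] at h
  exact M.le_partSubmodule _ _ h

theorem D_mem' (j t : ℤ) {m : M.carrier} (hm : m ∈ M.deg (j, t)) : M.D m ∈ M.deg (2 + j, t) := by
  have h := M.D_mem _ m hm
  have e : ((2, 0) : ℤ × ℤ) + (j, t) = (2 + j, t) := by ext <;> simp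
  rwa [e] at h

theorem D_mem_part (t : ℤ) : ∀ m ∈ M.partSubmodule t, M.D m ∈ M.partSubmodule t :=
  M.map_partSubmodule _ t t fun j _ hm => M.le_partSubmodule _ _ (M.D_mem' j t hm)

theorem d_mem_part (t t' : ℤ) (h : t = t' + 1) :
    ∀ m ∈ M.partSubmodule t, M.d m ∈ M.partSubmodule t' := by
  subst h
  refine M.map_partSubmodule _ _ _ fun j m hm => ?_
  have := M.d_mem j (t' + 1) m hm
  rw [add_sub_cancel_right] at this
  exact M.le_partSubmodule _ _ this

theorem part_isInternal (t : ℤ) : DirectSum.IsInternal fun j : ℤ =>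
    (M.deg (j, t)).comap (M.partSubmodule t).subtype := by
  have h := M.isInternal.submodule_iSupIndep
  refine DirectSum.isInternal_submodule_of_iSupIndep_of_iSup_eq_top ?_ ?_
  · have hi : Function.Injective fun j : ℤ => (j, t) := fun a b h => congrArg Prod.fst h
    have h' : iSupIndep fun j : ℤ => M.deg (j, t) := h.comp hi
    rw [iSupIndep_iff_finsetSum_eq_zero_imp_eq_zero] at h' ⊢
    intro s w hw hs j hj
    apply Subtype.ext
    refine h' s (fun j => (w j : M.carrier)) (fun j hj => hw j hj) ?_ j hj
    rw [← AddSubmonoidClass.coe_finsetSum, hs]; rfl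
  · rw [← Submodule.map_injective_of_injective (M.partSubmodule t).injective_subtype |>.eq_iff,
      Submodule.map_iSup, Submodule.map_top, Submodule.range_subtype]
    exact iSup_congr fun j => Submodule.map_comap_eq_of_le
      (by rw [Submodule.range_subtype]; exact M.le_partSubmodule j t)

/-- The restriction of an action to an invariant subspace. -/
def restrictAction {V : Type u} [AddCommGroup V] [Module k V] (l : Poly k n →ₐ[k] Module.End k V)
    (P : Submodule k V) (hP : ∀ a, ∀ m ∈ P, l a m ∈ P) : Poly k n →ₐ[k] Module.End k P :=
  AlgHom.ofLinearMap
    { toFun := fun a => (l a).restrict (hP a)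
      map_add' := fun a b => LinearMap.ext fun x => Subtype.ext (by simp)
      map_smul' := fun c a => LinearMap.ext fun x => Subtype.ext (by simp) }
    (LinearMap.ext fun x => Subtype.ext (by simp))
    (fun a b => LinearMap.ext fun x => Subtype.ext (by simp))

theorem restrict_pow {V : Type u} [AddCommGroup V] [Module k V] (f : V →ₗ[k] V)
    (P : Submodule k V) (hP : ∀ m ∈ P, f m ∈ P) (r : ℕ) (x : P) :
    (((f.restrict hP) ^ r) x : V) = (f ^ r) (x : V) := by
  induction r generalizing x with
  | zero => rfl
  | succ r ih => rw [pow_succ, pow_succ, Module.End.mul_apply, Module.End.mul_apply, ih]; rfl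

/-- The term of homological degree `t`. -/
@[reducible]
def part (t : ℤ) : EqBimod k p n (2 : ℤ) where
  carrier := M.partSubmodule t
  left := restrictAction M.left _ (M.left_mem_part t)
  right := restrictAction M.right _ (M.right_mem_part t)
  left_right a b m := Subtype.ext (M.left_right a b m)
  deg j := (M.deg (j, t)).comap (M.partSubmodule t).subtype
  isInternal := M.part_isInternal t
  left_mem {a e j m} ha hm := by
    have h := M.left_mem (isWeightedHomogeneous_pair ha) hm
    rwa [Prod.mk_add_mk, zero_add] at h
  right_mem {a e j m} ha hm := by
    have h := M.right_mem (isWeightedHomogeneous_pair ha) hm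
    rwa [Prod.mk_add_mk, zero_add] at h
  D := M.D.restrict (M.D_mem_part t)
  D_pow := LinearMap.ext fun x => Subtype.ext (by
    rw [restrict_pow, M.D_pow]; rfl)
  D_left a m := Subtype.ext (M.D_left a m)
  D_right a m := Subtype.ext (M.D_right a m)
  D_mem j _ hm := M.D_mem' j t hm

/-- The differential from homological degree `t + 1` to homological degree `t`. -/
def partD (t : ℤ) : M.part (t + 1) ⟶ M.part t :=
  ⟨M.d.restrict (M.d_mem_part (t + 1) t rfl),
    ⟨fun a m => Subtype.ext (M.d_left a m), fun a m => Subtype.ext (M.d_right a m),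
      fun j m hm => by
        have := M.d_mem j (t + 1) m hm
        rwa [add_sub_cancel_right] at this⟩,
    fun m => Subtype.ext (M.d_D m)⟩

/-- The chain complex of graded `(R, R) # H_q`-modules given by `M`. -/
def toComplex : ChainComplex (EqBimod k p n (2 : ℤ)) ℤ :=
  ChainComplex.of M.part M.partD fun _ => Subtype.ext (LinearMap.ext fun m =>
    Subtype.ext (M.d_d m))

/-- The sign `(-1) ^ t` in homological degree `t`. -/
def signOp : M.carrier →ₗ[k] M.carrier :=
  rescale M.isInternal fun jt => ((Int.negOnePow jt.2 : ℤˣ) : ℤ)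

variable {M}

theorem signOp_of_mem {j t : ℤ} {m : M.carrier} (hm : m ∈ M.deg (j, t)) :
    M.signOp m = ((Int.negOnePow t : ℤˣ) : ℤ) • m :=
  rescale_of_mem _ _ hm

theorem signOp_comm (f : M.carrier →ₗ[k] M.carrier) (c : ℤ)
    (h : ∀ j t, ∀ m ∈ M.deg (j, t), M.signOp (f m) = (c * (Int.negOnePow t : ℤˣ) : ℤ) • f m)
    (m : M.carrier) : M.signOp (f m) = c • f (M.signOp m) := by
  refine graded_induction M.isInternal (P := fun m => M.signOp (f m) = c • f (M.signOp m))
    (fun jt m hm => ?_) (by simp) (fun x y hx hy => by simp only [map_add, hx, hy, smul_add]) m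
  rw [h jt.1 jt.2 m hm, signOp_of_mem (j := jt.1) (t := jt.2) hm, map_zsmul, mul_smul]

theorem signOp_right (a : Poly k n) (m : M.carrier) :
    M.signOp (M.right a m) = M.right a (M.signOp m) := by
  rw [signOp_comm (M.right a) 1 _ m, one_smul]
  intro j t m hm
  rw [one_mul, ← MvPolynomial.sum_homogeneousComponent a, map_sum, LinearMap.sum_apply, map_sum,
    Finset.smul_sum]
  refine Finset.sum_congr rfl fun r _ => ?_
  have h := M.right_mem (isWeightedHomogeneous_of_isHomogeneous ((2, 0) : ℤ × ℤ)
    (MvPolynomial.homogeneousComponent_isHomogeneous r a)) hm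
  have e : r • ((2, 0) : ℤ × ℤ) + (j, t) = (r • 2 + j, t) := by ext <;> simp
  rw [e] at h
  exact signOp_of_mem h

theorem signOp_left (a : Poly k n) (m : M.carrier) :
    M.signOp (M.left a m) = M.left a (M.signOp m) := by
  rw [signOp_comm (M.left a) 1 _ m, one_smul]
  intro j t m hm
  rw [one_mul, ← MvPolynomial.sum_homogeneousComponent a, map_sum, LinearMap.sum_apply, map_sum,
    Finset.smul_sum]
  refine Finset.sum_congr rfl fun r _ => ?_
  have h := M.left_mem (isWeightedHomogeneous_of_isHomogeneous ((2, 0) : ℤ × ℤ)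
    (MvPolynomial.homogeneousComponent_isHomogeneous r a)) hm
  have e : r • ((2, 0) : ℤ × ℤ) + (j, t) = (r • 2 + j, t) := by ext <;> simp
  rw [e] at h
  exact signOp_of_mem h

theorem signOp_D (m : M.carrier) : M.signOp (M.D m) = M.D (M.signOp m) := by
  rw [signOp_comm M.D 1 _ m, one_smul]
  intro j t m hm
  rw [one_mul]
  exact signOp_of_mem (M.D_mem' j t hm)

theorem signOp_d (m : M.carrier) : M.signOp (M.d m) = -M.d (M.signOp m) := by
  rw [signOp_comm M.d (-1) _ m, neg_one_zsmul]
  intro j t m hm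
  rw [signOp_of_mem (M.d_mem j t m hm), Int.negOnePow_sub, Int.negOnePow_one]
  simp

theorem signOp_mem (jt : ℤ × ℤ) {m : M.carrier} (hm : m ∈ M.deg jt) : M.signOp m ∈ M.deg jt := by
  rw [signOp_of_mem (j := jt.1) (t := jt.2) hm]
  exact zsmul_mem hm _

end DgBimod

end DgBimodules

section DgTensor

variable {k : Type u} [Field k] {p n : ℕ} [Fact p.Prime] [CharP k p]

namespace DgBimod

/-- The differential `d (m ⊗ n) = d m ⊗ n + (-1) ^ |m| m ⊗ d n`. -/
def tensorD (M N : DgBimod k p n) :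
    BalTensor M.right N.left →ₗ[k] BalTensor M.right N.left :=
  BalTensor.mapLeft M.d (fun a m => M.d_right a m) +
    BalTensor.map M.signOp N.d (fun a m => signOp_right a m) (fun a m => N.d_left a m)

theorem tensorD_tmul (M N : DgBimod k p n) (m : M.carrier) (l : N.carrier) :
    tensorD M N (BalTensor.tmul M.right N.left m l) =
      BalTensor.tmul M.right N.left (M.d m) l +
        BalTensor.tmul M.right N.left (M.signOp m) (N.d l) := by
  simp [tensorD]

theorem tensorD_tensorD (M N : DgBimod k p n) (x : BalTensor M.right N.left) :
    tensorD M N (tensorD M N x) = 0 := by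
  induction x using BalTensor.induction with
  | zero => simp only [map_zero]
  | pure m l =>
    simp only [tensorD_tmul, map_add, M.d_d, N.d_d, signOp_d, map_neg, map_zero,
      LinearMap.zero_apply, LinearMap.neg_apply]
    abel
  | add x y hx hy => rw [map_add, map_add, hx, hy, add_zero]

theorem tensorD_left (M N : DgBimod k p n) (a : Poly k n) (x : BalTensor M.right N.left) :
    tensorD M N ((M.toGrBimod.tensor N.toGrBimod).left a x) =
      (M.toGrBimod.tensor N.toGrBimod).left a (tensorD M N x) := by
  induction x using BalTensor.induction with
  | zero => simp only [map_zero]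
  | pure m l =>
    simp only [tensorD_tmul, BalTensor.leftAction_tmul, map_add, M.d_left, signOp_left]
  | add x y hx hy => simp only [map_add, hx, hy]

theorem tensorD_right (M N : DgBimod k p n) (a : Poly k n) (x : BalTensor M.right N.left) :
    tensorD M N ((M.toGrBimod.tensor N.toGrBimod).right a x) =
      (M.toGrBimod.tensor N.toGrBimod).right a (tensorD M N x) := by
  induction x using BalTensor.induction with
  | zero => simp only [map_zero]
  | pure m l =>
    simp only [tensorD_tmul, BalTensor.rightAction_tmul, map_add, N.d_right]
  | add x y hx hy => simp only [map_add, hx, hy]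

theorem tensorD_D (M N : DgBimod k p n) (x : BalTensor M.right N.left) :
    tensorD M N ((M.toEqBimod.tensor N.toEqBimod).D x) =
      (M.toEqBimod.tensor N.toEqBimod).D (tensorD M N x) := by
  induction x using BalTensor.induction with
  | zero => simp only [map_zero]
  | pure m l =>
    simp only [tensorD_tmul, BalTensor.leibniz_tmul, map_add, M.d_D, N.d_D, signOp_D]
    abel
  | add x y hx hy => simp only [map_add, hx, hy]

theorem tensorD_mem (M N : DgBimod k p n) (j t : ℤ) (x : BalTensor M.right N.left)
    (hx : x ∈ BalTensor.deg M.right N.left M.deg N.deg (j, t)) :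
    tensorD M N x ∈ BalTensor.deg M.right N.left M.deg N.deg (j, t - 1) := by
  refine BalTensor.map_mem_deg _ _ (j, t) ?_ x hx
  rintro ⟨a, s⟩ ⟨b, r⟩ hab m hm l hl
  rw [Prod.mk_add_mk, Prod.mk.injEq] at hab
  obtain ⟨rfl, rfl⟩ := hab
  rw [tensorD_tmul]
  have h1 := BalTensor.tmul_mem_deg (ρ := M.right) (σ := N.left) (M.d_mem a s m hm) hl
  have h2 := BalTensor.tmul_mem_deg (ρ := M.right) (σ := N.left) (signOp_mem (a, s) hm)
    (N.d_mem b r l hl)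
  rw [Prod.mk_add_mk] at h1 h2
  rw [show s - 1 + r = s + r - 1 by ring] at h1
  rw [show s + (r - 1) = s + r - 1 by ring] at h2
  exact add_mem h1 h2

/-- The tensor product over `R` of two complexes of graded `(R, R) # H_q`-modules. -/
@[reducible]
def tensor (M N : DgBimod k p n) : DgBimod k p n where
  toEqBimod := M.toEqBimod.tensor N.toEqBimod
  d := tensorD M N
  d_d := tensorD_tensorD M N
  d_left := tensorD_left M N
  d_right := tensorD_right M N
  d_D := tensorD_D M N
  d_mem := tensorD_mem M N

variable (k p n) in
/-- The bimodule `R` as a complex concentrated in homological degree zero. -/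
@[reducible]
def unit : DgBimod k p n where
  toEqBimod := unitBimod k p n ((2, 0) : ℤ × ℤ)
  d := 0
  d_d _ := rfl
  d_left _ _ := (map_zero _).symm
  d_right _ _ := (map_zero _).symm
  d_D _ := (map_zero _).symm
  d_mem _ _ _ _ := zero_mem _

end DgBimod

end DgTensor

section TwoTerm

variable {k : Type u} [Field k] {p n : ℕ}

/-- The grading of the complex `X → Y` with `X` in homological degree `t₀ + 1` and `Y` in
homological degree `t₀`. -/
def twoTermDeg (X Y : EqBimod k p n (2 : ℤ)) (t₀ : ℤ) (jt : ℤ × ℤ) :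
    Submodule k (X.carrier × Y.carrier) :=
  (if jt.2 = t₀ + 1 then X.deg jt.1 else ⊥).prod (if jt.2 = t₀ then Y.deg jt.1 else ⊥)

theorem twoTermDeg_isInternal (X Y : EqBimod k p n (2 : ℤ)) (t₀ : ℤ) :
    DirectSum.IsInternal (twoTermDeg X Y t₀) := by
  refine isInternal_of_components
    (((Finsupp.mapRange.linearMap (LinearMap.inl k X.carrier Y.carrier)).comp
      ((Finsupp.lmapDomain X.carrier k fun j : ℤ => (j, t₀ + 1)).comp
        ((components X.isInternal).comp (LinearMap.fst k _ _)))) +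
    ((Finsupp.mapRange.linearMap (LinearMap.inr k X.carrier Y.carrier)).comp
      ((Finsupp.lmapDomain Y.carrier k fun j : ℤ => (j, t₀)).comp
        ((components Y.isInternal).comp (LinearMap.snd k _ _))))).toAddMonoidHom ?_ ?_ ?_
  · rintro ⟨x, y⟩ jt
    simp only [LinearMap.toAddMonoidHom_coe, LinearMap.add_apply, LinearMap.comp_apply,
      LinearMap.fst_apply, LinearMap.snd_apply, Finsupp.add_apply]
    refine add_mem ?_ ?_
    · refine graded_induction X.isInternal (P := fun x => ((Finsupp.mapRange.linearMap
        (LinearMap.inl k X.carrier Y.carrier)) ((Finsupp.lmapDomain X.carrier k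
          fun j : ℤ => (j, t₀ + 1)) (components X.isInternal x))) jt ∈ twoTermDeg X Y t₀ jt)
          ?_ (by simp) (fun x y hx hy => by
            simp only [map_add, Finsupp.add_apply]; exact add_mem hx hy) x
      intro j x hx
      rw [components_of_mem X.isInternal hx, Finsupp.lmapDomain_apply, Finsupp.mapDomain_single,
        Finsupp.mapRange.linearMap_apply, Finsupp.mapRange_single, Finsupp.single_apply]
      split_ifs with h
      · subst h
        simp [twoTermDeg, hx]
      · exact zero_mem _
    · refine graded_induction Y.isInternal (P := fun y => ((Finsupp.mapRange.linearMap
        (LinearMap.inr k X.carrier Y.carrier)) ((Finsupp.lmapDomain Y.carrier k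
          fun j : ℤ => (j, t₀)) (components Y.isInternal y))) jt ∈ twoTermDeg X Y t₀ jt)
          ?_ (by simp) (fun x y hx hy => by
            simp only [map_add, Finsupp.add_apply]; exact add_mem hx hy) y
      intro j y hy
      rw [components_of_mem Y.isInternal hy, Finsupp.lmapDomain_apply, Finsupp.mapDomain_single,
        Finsupp.mapRange.linearMap_apply, Finsupp.mapRange_single, Finsupp.single_apply]
      split_ifs with h
      · subst h
        simp [twoTermDeg, hy]
      · exact zero_mem _
  · rintro ⟨x, y⟩
    have hx : ∀ x : X.carrier, ((Finsupp.mapRange.linearMap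
        (LinearMap.inl k X.carrier Y.carrier)) ((Finsupp.lmapDomain X.carrier k
          fun j : ℤ => (j, t₀ + 1)) (components X.isInternal x))).sum (fun _ z => z) = (x, 0) := by
      intro x
      refine graded_induction X.isInternal (P := fun x => ((Finsupp.mapRange.linearMap
        (LinearMap.inl k X.carrier Y.carrier)) ((Finsupp.lmapDomain X.carrier k
          fun j : ℤ => (j, t₀ + 1)) (components X.isInternal x))).sum (fun _ z => z) = (x, 0))
          ?_ (by simp; rfl) (fun x y hx hy => by
            rw [map_add, map_add, map_add, Finsupp.sum_add_index', hx, hy] <;> simp) x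
      intro j x hx
      simp [components_of_mem X.isInternal hx]
    have hy : ∀ y : Y.carrier, ((Finsupp.mapRange.linearMap
        (LinearMap.inr k X.carrier Y.carrier)) ((Finsupp.lmapDomain Y.carrier k
          fun j : ℤ => (j, t₀)) (components Y.isInternal y))).sum (fun _ z => z) = (0, y) := by
      intro y
      refine graded_induction Y.isInternal (P := fun y => ((Finsupp.mapRange.linearMap
        (LinearMap.inr k X.carrier Y.carrier)) ((Finsupp.lmapDomain Y.carrier k
          fun j : ℤ => (j, t₀)) (components Y.isInternal y))).sum (fun _ z => z) = (0, y))
          ?_ (by simp; rfl) (fun x y hx hy => by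
            rw [map_add, map_add, map_add, Finsupp.sum_add_index', hx, hy] <;> simp) y
      intro j y hy
      simp [components_of_mem Y.isInternal hy]
    simp only [LinearMap.toAddMonoidHom_coe, LinearMap.add_apply, LinearMap.comp_apply,
      LinearMap.fst_apply, LinearMap.snd_apply]
    rw [Finsupp.sum_add_index', hx, hy] <;> simp
  · rintro ⟨j, t⟩ ⟨x, y⟩ ⟨hx, hy⟩
    simp only [LinearMap.toAddMonoidHom_coe, LinearMap.add_apply, LinearMap.comp_apply,
      LinearMap.fst_apply, LinearMap.snd_apply]
    simp only at hx hy
    by_cases h1 : t = t₀ + 1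
    · have h2 : t ≠ t₀ := by omega
      rw [if_pos h1] at hx
      rw [if_neg h2, SetLike.mem_coe, Submodule.mem_bot] at hy
      subst hy h1
      simp [components_of_mem X.isInternal hx]
    · rw [if_neg h1, SetLike.mem_coe, Submodule.mem_bot] at hx
      subst hx
      by_cases h2 : t = t₀
      · rw [if_pos h2] at hy
        subst h2
        simp [components_of_mem Y.isInternal hy]
      · rw [if_neg h2, SetLike.mem_coe, Submodule.mem_bot] at hy
        subst hy
        rw [← Prod.zero_eq_mk]
        simp

theorem twoTermDeg_action (X Y : EqBimod k p n (2 : ℤ)) (t₀ : ℤ)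
    (lX : Poly k n →ₐ[k] Module.End k X.carrier) (lY : Poly k n →ₐ[k] Module.End k Y.carrier)
    (hX : ∀ {a e j m}, MvPolynomial.IsWeightedHomogeneous (fun _ => (2 : ℤ)) a e → m ∈ X.deg j →
      lX a m ∈ X.deg (e + j))
    (hY : ∀ {a e j m}, MvPolynomial.IsWeightedHomogeneous (fun _ => (2 : ℤ)) a e → m ∈ Y.deg j →
      lY a m ∈ Y.deg (e + j)) {a : Poly k n} {e jt : ℤ × ℤ} {z : X.carrier × Y.carrier}
    (ha : MvPolynomial.IsWeightedHomogeneous (fun _ => ((2, 0) : ℤ × ℤ)) a e)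
    (hz : z ∈ twoTermDeg X Y t₀ jt) : (lX a z.1, lY a z.2) ∈ twoTermDeg X Y t₀ (e + jt) := by
  by_cases h0 : a = 0
  · subst h0
    simp [← Prod.zero_eq_mk]
  obtain ⟨h1, h2⟩ := exists_isWeightedHomogeneous_of_pair ha h0
  obtain ⟨e, e'⟩ := e
  obtain ⟨j, t⟩ := jt
  simp only at h1 h2
  subst h1
  obtain ⟨hx, hy⟩ := hz
  simp only at hx hy
  refine ⟨?_, ?_⟩
  · simp only [Prod.mk_add_mk, zero_add]
    split_ifs with h
    · rw [if_pos h] at hx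
      exact hX h2 hx
    · rw [if_neg h, SetLike.mem_coe, Submodule.mem_bot] at hx
      rw [hx, map_zero]; exact zero_mem _
  · simp only [Prod.mk_add_mk, zero_add]
    split_ifs with h
    · rw [if_pos h] at hy
      exact hY h2 hy
    · rw [if_neg h, SetLike.mem_coe, Submodule.mem_bot] at hy
      rw [hy, map_zero]; exact zero_mem _

/-- The two-term complex `X → Y` given by a morphism `f`, with `X` in homological degree `t₀ + 1`
and `Y` in homological degree `t₀`. -/
@[reducible]
def twoTerm {X Y : EqBimod k p n (2 : ℤ)} (f : X ⟶ Y) (t₀ : ℤ) : DgBimod k p n where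
  carrier := X.carrier × Y.carrier
  left := (LinearMap.prodMapAlgHom k X.carrier Y.carrier).comp (X.left.prod Y.left)
  right := (LinearMap.prodMapAlgHom k X.carrier Y.carrier).comp (X.right.prod Y.right)
  left_right a b m := Prod.ext (X.left_right a b m.1) (Y.left_right a b m.2)
  deg := twoTermDeg X Y t₀
  isInternal := twoTermDeg_isInternal X Y t₀
  left_mem ha hm := twoTermDeg_action X Y t₀ X.left Y.left X.left_mem Y.left_mem ha hm
  right_mem ha hm := twoTermDeg_action X Y t₀ X.right Y.right X.right_mem Y.right_mem ha hm
  D := X.D.prodMap Y.D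
  D_pow := by
    have h : ∀ r : ℕ, (X.D.prodMap Y.D) ^ r = (X.D ^ r).prodMap (Y.D ^ r) := by
      intro r
      exact (map_pow (LinearMap.prodMapAlgHom k X.carrier Y.carrier) (X.D, Y.D) r).symm
    rw [h, X.D_pow, Y.D_pow]
    rfl
  D_left a m := Prod.ext (X.D_left a m.1) (Y.D_left a m.2)
  D_right a m := Prod.ext (X.D_right a m.1) (Y.D_right a m.2)
  D_mem := by
    rintro ⟨j, t⟩ ⟨x, y⟩ ⟨hx, hy⟩
    simp only at hx hy
    refine ⟨?_, ?_⟩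
    · simp only [Prod.mk_add_mk, zero_add]
      split_ifs with h
      · rw [if_pos h] at hx
        exact X.D_mem _ _ hx
      · rw [if_neg h, SetLike.mem_coe, Submodule.mem_bot] at hx
        subst hx
        exact map_zero X.D
    · simp only [Prod.mk_add_mk, zero_add]
      split_ifs with h
      · rw [if_pos h] at hy
        exact Y.D_mem _ _ hy
      · rw [if_neg h, SetLike.mem_coe, Submodule.mem_bot] at hy
        subst hy
        exact map_zero Y.D
  d := (LinearMap.inr k X.carrier Y.carrier).comp (f.1.comp (LinearMap.fst k X.carrier Y.carrier))
  d_d m := Prod.ext rfl (map_zero f.1)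
  d_left a m := Prod.ext (map_zero (X.left a)).symm (f.2.1.1 a m.1)
  d_right a m := Prod.ext (map_zero (X.right a)).symm (f.2.1.2.1 a m.1)
  d_D m := Prod.ext (map_zero X.D).symm (f.2.2 m.1)
  d_mem := by
    rintro j t ⟨x, y⟩ ⟨hx, hy⟩
    simp only at hx hy
    refine ⟨zero_mem _, ?_⟩
    simp only [sub_eq_iff_eq_add]
    split_ifs with h
    · rw [if_pos h] at hx
      exact f.2.1.2.2 j x hx
    · rw [if_neg h, SetLike.mem_coe, Submodule.mem_bot] at hx
      subst hx
      exact map_zero f.1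

end TwoTerm

section Braids

/-- The defining relations of the braid group on `n` strands. -/
def braidRels (n : ℕ) : Set (FreeGroup (Fin (n - 1))) :=
  {r | ∃ i j : Fin (n - 1), (i : ℕ) + 1 < j ∧
    r = FreeGroup.of i * FreeGroup.of j * (FreeGroup.of j * FreeGroup.of i)⁻¹} ∪
  {r | ∃ i j : Fin (n - 1), (i : ℕ) + 1 = j ∧
    r = FreeGroup.of i * FreeGroup.of j * FreeGroup.of i *
      (FreeGroup.of j * FreeGroup.of i * FreeGroup.of j)⁻¹}

/-- The braid group `Br_n` on `n` strands, in Artin's presentation. -/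
abbrev BraidGroup (n : ℕ) : Type := PresentedGroup (braidRels n)

/-- A braid word: a list of letters `(i, true)`, for `σ_i`, and `(i, false)`, for `σ_i'`. -/
abbrev BraidWord (n : ℕ) : Type := List (Fin (n - 1) × Bool)

/-- The braid given by a letter: `σ_i`, or `σ_i' = σ_i⁻¹`. -/
def letterBraid {n : ℕ} (s : Fin (n - 1) × Bool) : BraidGroup n :=
  if s.2 then PresentedGroup.of s.1 else (PresentedGroup.of s.1)⁻¹

/-- The braid given by a word. -/
def wordBraid {n : ℕ} (w : BraidWord n) : BraidGroup n := (w.map letterBraid).prod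

variable (k : Type u) [Field k] {p n : ℕ} [Fact p.Prime] [CharP k p]

/-- The complex `T_i = (t B_i → R)`, with `R` in homological degree zero. -/
def rouquierPos (p : ℕ) [Fact p.Prime] [CharP k p] (i : Fin (n - 1)) : DgBimod k p n :=
  twoTerm (br k p i) 0

/-- The complex `T_i' = (R → q^{-2} t^{-1} B_i^{-(x_i + x_{i + 1})})`, with `R` in homological
degree zero. -/
def rouquierNeg (hp : 2 < p) (i : Fin (n - 1)) : DgBimod k p n :=
  twoTerm (rb k hp i) (-1)

/-- The elementary complex of a letter. -/
def letterComplex (hp : 2 < p) (s : Fin (n - 1) × Bool) : DgBimod k p n :=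
  if s.2 then rouquierPos k p s.1 else rouquierNeg k hp s.1

/-- The tensor product over `R` of the elementary complexes of the letters of a braid word. -/
def wordComplex (hp : 2 < p) : BraidWord n → DgBimod k p n
  | [] => DgBimod.unit k p n
  | s :: w => (letterComplex k hp s).tensor (wordComplex hp w)

/-- The complex `T_β` built from a braid word for `β`, as an object of the relative homotopy
category `𝒞_{∂_q}(R, R, d_0)`. -/
def braidObject (hp : 2 < p) (w : BraidWord n) : RelHomotopyCat k p n :=
  toRel k p n (wordComplex k hp w).toComplex

end Braids

end

end SoergelBraid

/-!
In the relative homotopy category two complexes `M`, `N` become isomorphic as soon as there is a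
`∂_q`-equivariant chain map `M → N` that is a homotopy equivalence of complexes of bimodules; its
homotopy inverse and the homotopies need not commute with `∂_q`. The proof produces such maps in the
form of deformation retractions (`DefRetract`): an equivariant inclusion, with a retraction and a
homotopy that are only bimodule maps and satisfy `htpy ∘ incl = 0`
(`DefRetract.nonempty_toRel_iso`). They are compatible with tensor products over `R`
(`DefRetract.tensLeft`, `DefRetract.tensRight`) and, thanks to `htpy ∘ incl = 0`, with mapping cones
(`cone.retract`). Hence the classes of complexes under the equivalence relation they generate
(`RetractClass`) form a monoid under `⊗_R`, and it remains to see that the classes of the `T_i` are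
invertible and satisfy the braid relations. Then `σ_i ↦ T_i` extends to a homomorphism on the braid
group (`braidHom`), whose value at the braid of a word is the class of the complex of the word
(`braidHom_wordBraid`).

All the maps in question are maps of bimodules, and so are their commutators with `∂_q` and with
`d`, so every identity may be checked on bimodule generators (`Gen.ext`, `Gen.map_D`). Maps out of
tensor products with `B_i` are constructed from the facts that `B_i` is `R ⊗ R` over `R^i` and that
`R` has the basis `1, x_i` over `R^i` (`Ind`, `QuadBasis`).

* `PosNeg.retract`, `NegPos.retract`: both `T_i ⊗ T_i'` and `T_i' ⊗ T_i` retract onto a copy of `R`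
  that is spanned by a central element. The twist `-(x_i + x_{i + 1})` is what makes this element
  invariant under `∂_q`.
* `Far.retract`: if `i` and `j` are far apart, exchanging the generators is an isomorphism of
  `T_i ⊗ T_j` with `T_j ⊗ T_i`.
* `Adj.exists_retract`: let `i` and `j` be adjacent. Writing one of the outer factors as a cone
  identifies `T_i ⊗ T_j ⊗ T_i` with the cone of a map `T_i ⊗ T_j ⊗ B_i → T_i ⊗ T_j`, and
  `T_j ⊗ T_i ⊗ T_j` with the cone of a map `B_j ⊗ T_i ⊗ T_j → T_i ⊗ T_j`, with the same target
  (`TensCone.rightRetract`, `TensCone.leftRetract`). Both sources retract onto the complex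
  `X = (R ⊗ R → B_j ⊗ B_i)`, where the tensor product in the first term is over the polynomials
  symmetric for both `i` and `j` (`LeftTriple.retract`, `RightTriple.retract`). The two composites
  `X → T_i ⊗ T_j` agree, so both complexes retract onto the cone of that map.

The retraction onto `X` uses the bimodule map from `B_i ⊗ B_j ⊗ B_i` to `R ⊗ R` that underlies the
six-valent vertex of the Soergel calculus (`Adj.six`). It is well defined because a variable `c`
moved by `j` but not by `i` satisfies a quadratic equation over `R^j` and a cubic equation over the
polynomials symmetric for both (`Adj.kappa_quad`, `Adj.left_cubic`).
-/

namespace SoergelBraid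

noncomputable section

/-! ### Bimodule maps and generation -/

section Generation

variable {k : Type u} [Field k] {p n : ℕ}

/-- The `k`-linear maps `M → N` that are linear over the subalgebra `S` of `R` on the left and over
all of `R` on the right. They need not respect gradings, differentials or `∂_q`. -/
def sHomSubmodule (S : Subalgebra k (Poly k n)) (M N : DgBimod k p n) :
    Submodule k (M.carrier →ₗ[k] N.carrier) where
  carrier := {f | (∀ a ∈ S, ∀ m, f (M.left a m) = N.left a (f m)) ∧
    ∀ a m, f (M.right a m) = N.right a (f m)}
  zero_mem' := by simp
  add_mem' := by
    rintro f g ⟨hf1, hf2⟩ ⟨hg1, hg2⟩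
    exact ⟨fun a ha m => by simp [hf1 a ha, hg1 a ha], fun a m => by simp [hf2, hg2]⟩
  smul_mem' := by
    rintro c f ⟨hf1, hf2⟩
    exact ⟨fun a ha m => by simp [hf1 a ha], fun a m => by simp [hf2]⟩

/-- The type of the maps in `sHomSubmodule`. -/
def SHom (S : Subalgebra k (Poly k n)) (M N : DgBimod k p n) : Type u := sHomSubmodule S M N

/-- The bimodule maps `M → N`, with no condition on gradings, differentials or `∂_q`. -/
abbrev BHom (M N : DgBimod k p n) := SHom (⊤ : Subalgebra k (Poly k n)) M N

instance (S : Subalgebra k (Poly k n)) (M N : DgBimod k p n) : AddCommGroup (SHom S M N) :=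
  inferInstanceAs (AddCommGroup (sHomSubmodule S M N))

namespace SHom

variable {S : Subalgebra k (Poly k n)} {M N Q : DgBimod k p n}

/-- The underlying linear map. -/
def lin (f : SHom S M N) : M.carrier →ₗ[k] N.carrier := Subtype.val f

instance : CoeFun (SHom S M N) fun _ => M.carrier → N.carrier := ⟨fun f => f.lin⟩

theorem lin_injective {f g : SHom S M N} (h : ∀ m, f m = g m) : f = g :=
  Subtype.ext (LinearMap.ext h)

/-- A linear map that commutes with the left action of `S` and the right action of `R`. -/
def mk (f : M.carrier →ₗ[k] N.carrier) (h1 : ∀ a ∈ S, ∀ m, f (M.left a m) = N.left a (f m))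
    (h2 : ∀ a m, f (M.right a m) = N.right a (f m)) : SHom S M N := ⟨f, h1, h2⟩

theorem map_left (f : SHom S M N) {a : Poly k n} (ha : a ∈ S) (m : M.carrier) :
    f (M.left a m) = N.left a (f m) := f.2.1 a ha m

@[simp] theorem map_right (f : SHom S M N) (a : Poly k n) (m : M.carrier) :
    f (M.right a m) = N.right a (f m) := f.2.2 a m

/-- Composition of maps that are `S`-linear on the left and `R`-linear on the right. -/
def comp (g : SHom S N Q) (f : SHom S M N) : SHom S M Q :=
  mk (g.lin.comp f.lin) (fun a ha m => by simp [f.map_left ha, g.map_left ha])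
    (fun a m => by simp)

@[simp] theorem comp_apply (g : SHom S N Q) (f : SHom S M N) (m : M.carrier) :
    (g.comp f) m = g (f m) := rfl

/-- The identity map. -/
def id (M : DgBimod k p n) : SHom S M M := mk LinearMap.id (fun _ _ _ => rfl) (fun _ _ => rfl)

@[simp] theorem id_apply (m : M.carrier) : (id (S := S) M) m = m := rfl

@[simp] theorem add_apply (f g : SHom S M N) (m : M.carrier) : (f + g) m = f m + g m := rfl

@[simp] theorem sub_apply (f g : SHom S M N) (m : M.carrier) : (f - g) m = f m - g m := rfl

@[simp] theorem neg_apply (f : SHom S M N) (m : M.carrier) : (-f) m = -f m := rfl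

@[simp] theorem zero_apply (m : M.carrier) : (0 : SHom S M N) m = 0 := rfl

end SHom

namespace BHom

variable {S : Subalgebra k (Poly k n)} {M N : DgBimod k p n}

@[simp] theorem map_left (f : BHom M N) (a : Poly k n) (m : M.carrier) :
    f (M.left a m) = N.left a (f m) := f.2.1 a Algebra.mem_top m

/-- A bimodule map, seen as a map that is `S`-linear on the left. -/
def restr (S : Subalgebra k (Poly k n)) (f : BHom M N) : SHom S M N :=
  SHom.mk f.lin (fun a _ m => f.map_left a m) (fun a m => f.map_right a m)

@[simp] theorem restr_apply (f : BHom M N) (m : M.carrier) : (f.restr S) m = f m := rfl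

/-- A `k`-linear map that commutes with both actions of `R`. -/
def mk (f : M.carrier →ₗ[k] N.carrier) (h1 : ∀ a m, f (M.left a m) = N.left a (f m))
    (h2 : ∀ a m, f (M.right a m) = N.right a (f m)) : BHom M N :=
  SHom.mk f (fun a _ m => h1 a m) h2

@[simp] theorem mk_apply (f : M.carrier →ₗ[k] N.carrier) (h1 h2) (m : M.carrier) :
    (mk (M := M) (N := N) f h1 h2) m = f m := rfl

/-- The differential is a map of bimodules. -/
def d (M : DgBimod k p n) : BHom M M := mk M.d M.d_left M.d_right

@[simp] theorem d_apply (m : M.carrier) : (d M) m = M.d m := rfl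

end BHom

/-- The map `f` raises bidegrees by `e`. -/
def HasDeg {M N : DgBimod k p n} (e : ℤ × ℤ) (f : M.carrier →ₗ[k] N.carrier) : Prop :=
  ∀ jt, ∀ m ∈ M.deg jt, f m ∈ N.deg (e + jt)

/-- The set `S` generates `M` as an `(R, R)`-bimodule. -/
def Gen (M : DgBimod k p n) (S : Set M.carrier) : Prop :=
  ∀ P : Submodule k M.carrier, (∀ a, ∀ m ∈ P, M.left a m ∈ P) → (∀ a, ∀ m ∈ P, M.right a m ∈ P) →
    S ⊆ P → ∀ m, m ∈ P

theorem components_apply_mem {V : Type*} [AddCommGroup V] [Module k V] {ι : Type} [AddCommGroup ι]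
    [DecidableEq ι] {A : ι → Submodule k V} (hA : DirectSum.IsInternal A) (m : V) (i : ι) :
    components hA m i ∈ A i := by
  refine graded_induction hA (P := fun m => components hA m i ∈ A i) ?_ (by simp)
    (fun x y hx hy => by rw [map_add]; exact add_mem hx hy) m
  intro j m hm
  rw [components_of_mem hA hm, Finsupp.single_apply]
  split_ifs with h
  · exact h ▸ hm
  · exact zero_mem _

theorem components_sum {V : Type*} [AddCommGroup V] [Module k V] {ι : Type} [AddCommGroup ι]
    [DecidableEq ι] {A : ι → Submodule k V} (hA : DirectSum.IsInternal A) (m : V) :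
    ((components hA m).sum fun _ x => x) = m := by
  refine graded_induction hA (P := fun m => ((components hA m).sum fun _ x => x) = m) ?_ (by simp)
    (fun x y hx hy => by rw [map_add, Finsupp.sum_add_index', hx, hy] <;> simp) m
  intro j m hm
  simp [components_of_mem hA hm]

theorem mem_of_components_eq_zero {V : Type*} [AddCommGroup V] [Module k V] {ι : Type}
    [AddCommGroup ι] [DecidableEq ι] {A : ι → Submodule k V} (hA : DirectSum.IsInternal A) {m : V}
    {i : ι} (h : ∀ j, j ≠ i → components hA m j = 0) : m ∈ A i := by
  have h1 : components hA m = Finsupp.single i (components hA m i) := by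
    ext j
    rw [Finsupp.single_apply]
    split_ifs with hj
    · rw [hj]
    · exact h j (Ne.symm hj)
  have h2 := components_sum hA m
  rw [h1, Finsupp.sum_single_index rfl] at h2
  rw [← h2]
  exact components_apply_mem hA m i

theorem components_of_shift {V W : Type*} [AddCommGroup V] [Module k V] [AddCommGroup W]
    [Module k W] {ι : Type} [AddCommGroup ι] [DecidableEq ι] {A : ι → Submodule k V}
    {B : ι → Submodule k W} (hA : DirectSum.IsInternal A) (hB : DirectSum.IsInternal B) (e : ι)
    (f : V →ₗ[k] W) (hf : ∀ i, ∀ m ∈ A i, f m ∈ B (e + i)) (m : V) (i : ι) :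
    components hB (f m) (e + i) = f (components hA m i) := by
  refine graded_induction hA
    (P := fun m => components hB (f m) (e + i) = f (components hA m i)) ?_ (by simp)
    (fun x y hx hy => by simp only [map_add, Finsupp.add_apply, hx, hy]) m
  intro j m hm
  rw [components_of_mem hA hm, components_of_mem hB (hf j m hm), Finsupp.single_apply,
    Finsupp.single_apply]
  by_cases h : j = i
  · simp [h]
  · simp [h]

variable (k n) in
/-- An additive statement about polynomials may be checked on weighted homogeneous ones. -/
theorem poly_induction {P : Poly k n → Prop} (add : ∀ a b, P a → P b → P (a + b)) (zero : P 0)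
    (hom : ∀ e a, MvPolynomial.IsWeightedHomogeneous (fun _ => ((2, 0) : ℤ × ℤ)) a e → P a)
    (a : Poly k n) : P a := by
  rw [← MvPolynomial.sum_homogeneousComponent a]
  exact Finset.sum_induction _ _ add zero fun r _ => hom _ _ (isWeightedHomogeneous_of_isHomogeneous
    _ (MvPolynomial.homogeneousComponent_isHomogeneous r a))

namespace Gen

variable {M N : DgBimod k p n} {S : Set M.carrier}

theorem ext (hS : Gen M S) {f g : BHom M N} (h : ∀ s ∈ S, f s = g s) : f = g := by
  refine SHom.lin_injective fun m => ?_
  refine hS (LinearMap.eqLocus f.lin g.lin) (fun a m hm => ?_) (fun a m hm => ?_) h m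
  · rw [LinearMap.mem_eqLocus] at hm ⊢
    rw [f.map_left, g.map_left, hm]
  · rw [LinearMap.mem_eqLocus] at hm ⊢
    rw [f.map_right, g.map_right, hm]

/-- The commutator of a bimodule map with `∂_q` is again a bimodule map, so that it vanishes as
soon as it does on generators. -/
theorem map_D (hS : Gen M S) (f : BHom M N) (h : ∀ s ∈ S, f (M.D s) = N.D (f s))
    (m : M.carrier) : f (M.D m) = N.D (f m) := by
  refine hS (LinearMap.eqLocus (f.lin.comp M.D) (N.D.comp f.lin)) (fun a m hm => ?_)
    (fun a m hm => ?_) h m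
  · rw [LinearMap.mem_eqLocus, LinearMap.comp_apply, LinearMap.comp_apply] at hm ⊢
    rw [M.D_left, map_add, f.map_left, f.map_left, f.map_left, N.D_left, hm]
  · rw [LinearMap.mem_eqLocus, LinearMap.comp_apply, LinearMap.comp_apply] at hm ⊢
    rw [M.D_right, map_add, f.map_right, f.map_right, f.map_right, N.D_right, hm]

/-- A bimodule map is homogeneous as soon as it is so on homogeneous generators. -/
theorem hasDeg (hS : Gen M S) (f : BHom M N) (e : ℤ × ℤ)
    (h : ∀ s ∈ S, ∃ jt, s ∈ M.deg jt ∧ f s ∈ N.deg (e + jt)) : HasDeg e f.lin := by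
  have key : ∀ m jt, components N.isInternal (f m) (e + jt) =
      f (components M.isInternal m jt) := by
    let P : Submodule k M.carrier :=
      { carrier := {m | ∀ jt, components N.isInternal (f m) (e + jt) =
          f (components M.isInternal m jt)}
        zero_mem' := by simp
        add_mem' := fun {x y} hx hy jt => by
          rw [f.lin.map_add, (components N.isInternal).map_add, Finsupp.add_apply, hx, hy,
            (components M.isInternal).map_add, Finsupp.add_apply, f.lin.map_add]
        smul_mem' := fun c x hx jt => by
          simp only [map_smul, Finsupp.smul_apply]; rw [hx] }
    refine hS P (fun a m hm => ?_) (fun a m hm => ?_) fun s hs jt => ?_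
    · refine poly_induction k n (P := fun a => M.left a m ∈ P) (fun a b ha hb => ?_) ?_
        (fun c a ha jt => ?_) a
      · rw [map_add]; exact add_mem ha hb
      · rw [map_zero]; exact zero_mem _
      · have h1 := components_of_shift N.isInternal N.isInternal c (N.left a)
          (fun i m hm => N.left_mem ha hm) (f m) (e + (jt - c))
        have h2 := components_of_shift M.isInternal M.isInternal c (M.left a)
          (fun i m hm => M.left_mem ha hm) m (jt - c)
        rw [show c + (e + (jt - c)) = e + jt by abel] at h1
        rw [show c + (jt - c) = jt by abel] at h2
        rw [f.map_left, h1, h2, f.map_left, hm]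
    · refine poly_induction k n (P := fun a => M.right a m ∈ P) (fun a b ha hb => ?_) ?_
        (fun c a ha jt => ?_) a
      · rw [map_add]; exact add_mem ha hb
      · rw [map_zero]; exact zero_mem _
      · have h1 := components_of_shift N.isInternal N.isInternal c (N.right a)
          (fun i m hm => N.right_mem ha hm) (f m) (e + (jt - c))
        have h2 := components_of_shift M.isInternal M.isInternal c (M.right a)
          (fun i m hm => M.right_mem ha hm) m (jt - c)
        rw [show c + (e + (jt - c)) = e + jt by abel] at h1
        rw [show c + (jt - c) = jt by abel] at h2
        rw [f.map_right, h1, h2, f.map_right, hm]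
    · obtain ⟨it, h1, h2⟩ := h s hs
      rw [components_of_mem _ h1, components_of_mem _ h2, Finsupp.single_apply,
        Finsupp.single_apply]
      by_cases hi : it = jt
      · simp [hi]
      · simp [hi]
  intro jt m hm
  have := key m jt
  rw [components_of_mem _ hm, Finsupp.single_eq_same] at this
  rw [← this]
  exact components_apply_mem _ _ _

end Gen

end Generation

/-! ### Deformation retractions of complexes -/

section Retractions

variable {k : Type u} [Field k] {p n : ℕ}

/-- A morphism of complexes of graded `(R, R) # H_q`-modules. -/
structure DgHom (M N : DgBimod k p n) where
  hom : BHom M N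
  map_D : ∀ m, hom (M.D m) = N.D (hom m)
  map_d : ∀ m, hom (M.d m) = N.d (hom m)
  map_deg : ∀ jt, ∀ m ∈ M.deg jt, hom m ∈ N.deg jt

namespace DgHom

variable {M N Q : DgBimod k p n}

/-- Composition of morphisms of complexes. -/
def comp (g : DgHom N Q) (f : DgHom M N) : DgHom M Q where
  hom := g.hom.comp f.hom
  map_D m := by simp [f.map_D, g.map_D]
  map_d m := by simp [f.map_d, g.map_d]
  map_deg jt m hm := g.map_deg jt _ (f.map_deg jt m hm)

@[simp] theorem comp_apply (g : DgHom N Q) (f : DgHom M N) (m : M.carrier) :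
    (g.comp f).hom m = g.hom (f.hom m) := rfl

/-- A bimodule map that commutes with `∂_q` and `d` and preserves degrees on homogeneous generators
is a morphism of complexes. -/
def ofGen {S : Set M.carrier} (hS : Gen M S) (f : BHom M N)
    (hD : ∀ s ∈ S, f (M.D s) = N.D (f s)) (hd : ∀ s ∈ S, f (M.d s) = N.d (f s))
    (hdeg : ∀ s ∈ S, ∃ jt, s ∈ M.deg jt ∧ f s ∈ N.deg jt) : DgHom M N where
  hom := f
  map_D := hS.map_D f hD
  map_d m := congrArg (fun g => g.lin m)
    (hS.ext (f := f.comp (BHom.d M)) (g := (BHom.d N).comp f) hd)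
  map_deg jt m hm := by
    have := hS.hasDeg f 0 (by simpa using hdeg) jt m hm
    rwa [zero_add] at this

@[simp] theorem ofGen_hom {S : Set M.carrier} (hS : Gen M S) (f : BHom M N) (hD hd hdeg) :
    (ofGen hS f hD hd hdeg).hom = f := rfl

end DgHom

/-- A deformation retraction of `N` onto `M`: an inclusion `M → N` of complexes of graded
`(R, R) # H_q`-modules, with a retraction and a homotopy that are bimodule maps but need not
commute with `∂_q`. The condition `htpy ∘ incl = 0` makes such data pass to mapping cones. -/
structure DefRetract (M N : DgBimod k p n) where
  incl : DgHom M N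
  retr : BHom N M
  htpy : BHom N N
  htpy_deg : HasDeg (0, 1) htpy.lin
  retr_incl : ∀ m, retr (incl.hom m) = m
  htpy_incl : ∀ m, htpy (incl.hom m) = 0
  htpy_d : ∀ m, N.d (htpy m) + htpy (N.d m) = incl.hom (retr m) - m

namespace DefRetract

variable {M N Q : DgBimod k p n}

theorem incl_injective (R : DefRetract M N) : Function.Injective R.incl.hom.lin :=
  Function.LeftInverse.injective R.retr_incl

/-- The retraction of a deformation retraction commutes with `d`: the composite `incl ∘ retr`
differs from the identity by the commutator of `d` with the homotopy, and `incl` is injective. -/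
theorem retr_d (R : DefRetract M N) (m : N.carrier) :
    R.retr (N.d m) = M.d (R.retr m) := by
  apply R.incl_injective
  have h1 := R.htpy_d (N.d m)
  have h2 := congrArg N.d (R.htpy_d m)
  rw [N.d_d, map_zero, add_zero] at h1
  rw [map_add, N.d_d, zero_add, map_sub] at h2
  rw [R.incl.map_d]
  exact sub_left_injective (h1.symm.trans h2)

/-- The retraction of a deformation retraction preserves degrees, because `incl ∘ retr` does and
`incl` is injective. -/
theorem retr_deg (R : DefRetract M N) (jt : ℤ × ℤ) (m : N.carrier) (hm : m ∈ N.deg jt) :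
    R.retr m ∈ M.deg jt := by
  have h : R.incl.hom (R.retr m) ∈ N.deg jt := by
    rw [← sub_add_cancel (R.incl.hom (R.retr m)) m, ← R.htpy_d]
    refine add_mem (add_mem ?_ ?_) hm
    · have := N.d_mem _ _ _ (R.htpy_deg jt m hm)
      rwa [zero_add, show (1 : ℤ) + jt.2 - 1 = jt.2 by ring] at this
    · have := R.htpy_deg _ _ (N.d_mem jt.1 jt.2 m hm)
      rwa [Prod.mk_add_mk, zero_add, show (1 : ℤ) + (jt.2 - 1) = jt.2 by ring] at this
  refine mem_of_components_eq_zero M.isInternal fun i hi => R.incl_injective ?_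
  have h2 := components_of_shift M.isInternal N.isInternal 0 R.incl.hom.lin
    (fun i m hm => by rw [zero_add]; exact R.incl.map_deg i m hm) (R.retr m) i
  rw [zero_add] at h2
  rw [map_zero, ← h2, components_of_mem _ h, Finsupp.single_eq_of_ne hi]

/-- A deformation retraction given by its effect on bimodule generators. -/
def ofGen {S : Set M.carrier} {T : Set N.carrier} (hS : Gen M S) (hT : Gen N T)
    (incl : DgHom M N) (retr : BHom N M) (htpy : BHom N N)
    (hdeg : ∀ t ∈ T, ∃ jt, t ∈ N.deg jt ∧ htpy t ∈ N.deg ((0, 1) + jt))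
    (h1 : ∀ s ∈ S, retr (incl.hom s) = s) (h2 : ∀ s ∈ S, htpy (incl.hom s) = 0)
    (h3 : ∀ t ∈ T, N.d (htpy t) + htpy (N.d t) = incl.hom (retr t) - t) :
    DefRetract M N where
  incl := incl
  retr := retr
  htpy := htpy
  htpy_deg := hT.hasDeg htpy _ hdeg
  retr_incl m := congrArg (fun g => g.lin m) (hS.ext (f := retr.comp incl.hom) (g := SHom.id M) h1)
  htpy_incl m := congrArg (fun g => g.lin m) (hS.ext (f := htpy.comp incl.hom) (g := 0) h2)
  htpy_d m := congrArg (fun g => g.lin m) (hT.ext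
    (f := (BHom.d N).comp htpy + htpy.comp (BHom.d N)) (g := incl.hom.comp retr - SHom.id N)
    fun t ht => by simpa using h3 t ht)

/-- An isomorphism of complexes is a deformation retraction. -/
def ofIso (f : DgHom M N) (g : BHom N M) (h1 : ∀ m, g (f.hom m) = m) (h2 : ∀ m, f.hom (g m) = m) :
    DefRetract M N where
  incl := f
  retr := g
  htpy := 0
  htpy_deg _ _ _ := zero_mem _
  retr_incl := h1
  htpy_incl _ := rfl
  htpy_d m := by simp [h2]

/-- Composition of deformation retractions. -/
def trans (R : DefRetract M N) (R' : DefRetract N Q) : DefRetract M Q where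
  incl := R'.incl.comp R.incl
  retr := R.retr.comp R'.retr
  htpy := R'.htpy + R'.incl.hom.comp (R.htpy.comp R'.retr)
  htpy_deg jt m hm := add_mem (R'.htpy_deg jt m hm)
    (R'.incl.map_deg _ _ (R.htpy_deg jt _ (R'.retr_deg jt m hm)))
  retr_incl m := by simp [R.retr_incl, R'.retr_incl]
  htpy_incl m := by simp [R.htpy_incl, R'.htpy_incl, R'.retr_incl]
  htpy_d m := by
    have h1 := R'.htpy_d m
    have h2 := congrArg R'.incl.hom.lin (R.htpy_d (R'.retr m))
    simp only [map_add, map_sub, R'.incl.map_d, ← R'.retr_d] at h2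
    simp only [SHom.add_apply, SHom.comp_apply, map_add, DgHom.comp_apply]
    linear_combination (norm := abel) h1 + h2

end DefRetract

end Retractions

/-! ### Tensor products of complexes -/

section Tensor

variable {k : Type u} [Field k] {p n : ℕ}

namespace DgBimod

theorem signOp_of_hasDeg {M N : DgBimod k p n} (f : M.carrier →ₗ[k] N.carrier) {e : ℤ × ℤ}
    (hf : HasDeg e f) (m : M.carrier) :
    N.signOp (f m) = ((Int.negOnePow e.2 : ℤˣ) : ℤ) • f (M.signOp m) := by
  refine graded_induction M.isInternal
    (P := fun m => N.signOp (f m) = ((Int.negOnePow e.2 : ℤˣ) : ℤ) • f (M.signOp m))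
    (fun jt m hm => ?_) (by simp) (fun x y hx hy => by simp only [map_add, hx, hy, smul_add]) m
  have h := hf jt m hm
  rw [signOp_of_mem (j := (e + jt).1) (t := (e + jt).2) h,
    signOp_of_mem (j := jt.1) (t := jt.2) hm, map_zsmul, smul_smul, Prod.snd_add,
    Int.negOnePow_add, Units.val_mul]

theorem signOp_hom {M N : DgBimod k p n} (f : DgHom M N) (m : M.carrier) :
    N.signOp (f.hom m) = f.hom (M.signOp m) := by
  rw [signOp_of_hasDeg (e := 0) f.hom.lin fun jt m hm => by rw [zero_add]; exact f.map_deg jt m hm]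
  simp

theorem signOp_htpy {M N : DgBimod k p n} (f : BHom M N) (hf : HasDeg (0, 1) f.lin)
    (m : M.carrier) : N.signOp (f m) = -f (M.signOp m) := by
  rw [signOp_of_hasDeg f.lin hf]
  simp

theorem signOp_signOp {M : DgBimod k p n} (m : M.carrier) : M.signOp (M.signOp m) = m := by
  refine graded_induction M.isInternal (P := fun m => M.signOp (M.signOp m) = m)
    (fun jt m hm => ?_) (by simp) (fun x y hx hy => by simp only [map_add, hx, hy]) m
  rw [signOp_of_mem (j := jt.1) (t := jt.2) hm, map_zsmul,
    signOp_of_mem (j := jt.1) (t := jt.2) hm, smul_smul, ← Units.val_mul, Int.units_mul_self,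
    Units.val_one, one_smul]

/-- The sign `(-1) ^ t` in homological degree `t`, as a bimodule map. -/
def sgn (M : DgBimod k p n) : BHom M M := BHom.mk M.signOp signOp_left signOp_right

@[simp] theorem sgn_apply (M : DgBimod k p n) (m : M.carrier) : M.sgn m = M.signOp m := rfl

variable [Fact p.Prime] [CharP k p]

/-- The tensor product of complexes, kept folded: it is used through `tmul` and its universal
property `tensorLift`. -/
def tens (M N : DgBimod k p n) : DgBimod k p n := M.tensor N

end DgBimod

/-- The tensor product over `R` of complexes. -/
infixr:70 " ⊠ " => DgBimod.tens

namespace DgBimod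

variable [Fact p.Prime] [CharP k p] {M N L M' N' : DgBimod k p n}

/-- The pure tensor `m ⊗ l`. -/
def tmul : M.carrier →ₗ[k] N.carrier →ₗ[k] (M ⊠ N).carrier := BalTensor.tmul M.right N.left

/-- The map `m ↦ m ⊗ l`. -/
def tmulRight (l : N.carrier) : M.carrier →ₗ[k] (M ⊠ N).carrier where
  toFun m := tmul m l
  map_add' _ _ := by simp
  map_smul' _ _ := by simp

@[simp] theorem tmulRight_apply (m : M.carrier) (l : N.carrier) :
    tmulRight (M := M) l m = tmul m l := rfl

theorem tmul_balanced (a : Poly k n) (m : M.carrier) (l : N.carrier) :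
    tmul (M.right a m) l = tmul m (N.left a l) := BalTensor.tmul_balanced _ _ a m l

@[simp] theorem tens_left (a : Poly k n) (m : M.carrier) (l : N.carrier) :
    (M ⊠ N).left a (tmul m l) = tmul (M.left a m) l := BalTensor.leftAction_tmul _ _ a m l

@[simp] theorem tens_right (a : Poly k n) (m : M.carrier) (l : N.carrier) :
    (M ⊠ N).right a (tmul m l) = tmul m (N.right a l) := BalTensor.rightAction_tmul _ _ a m l

@[simp] theorem tens_D (m : M.carrier) (l : N.carrier) :
    (M ⊠ N).D (tmul m l) = tmul (M.D m) l + tmul m (N.D l) :=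
  BalTensor.leibniz_tmul (dq k n) M.D N.D M.D_right N.D_left m l

@[simp] theorem tens_d (m : M.carrier) (l : N.carrier) :
    (M ⊠ N).d (tmul m l) = tmul (M.d m) l + tmul (M.signOp m) (N.d l) := tensorD_tmul M N m l

theorem tmul_mem {a b : ℤ × ℤ} {m : M.carrier} {l : N.carrier} (hm : m ∈ M.deg a)
    (hl : l ∈ N.deg b) : tmul m l ∈ (M ⊠ N).deg (a + b) := BalTensor.tmul_mem_deg hm hl

theorem tens_induction {P : (M ⊠ N).carrier → Prop} (zero : P 0) (pure : ∀ m l, P (tmul m l))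
    (add : ∀ x y, P x → P y → P (x + y)) (x : (M ⊠ N).carrier) : P x :=
  BalTensor.induction zero pure add x

theorem map_mem_of_mem_tens {V : Type*} [AddCommGroup V] [Module k V]
    (f : (M ⊠ N).carrier →ₗ[k] V) (P : Submodule k V) (jt : ℤ × ℤ)
    (h : ∀ a b, a + b = jt → ∀ m ∈ M.deg a, ∀ l ∈ N.deg b, f (tmul m l) ∈ P)
    (x : (M ⊠ N).carrier) (hx : x ∈ (M ⊠ N).deg jt) : f x ∈ P := BalTensor.map_mem_deg f P jt h x hx

/-- The linear map out of `M ⊗_R N` given by a balanced bilinear map. -/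
def tensorLift {V : Type*} [AddCommGroup V] [Module k V] (f : M.carrier →ₗ[k] N.carrier →ₗ[k] V)
    (hf : ∀ a m l, f (M.right a m) l = f m (N.left a l)) : (M ⊠ N).carrier →ₗ[k] V :=
  BalTensor.lift f hf

@[simp] theorem tensorLift_tmul {V : Type*} [AddCommGroup V] [Module k V]
    (f : M.carrier →ₗ[k] N.carrier →ₗ[k] V) (hf) (m : M.carrier) (l : N.carrier) :
    tensorLift f hf (tmul m l) = f m l := BalTensor.lift_tmul f hf m l

theorem signOp_tmul (m : M.carrier) (l : N.carrier) :
    (M ⊠ N).signOp (tmul m l) = tmul (M.signOp m) (N.signOp l) := by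
  refine graded_induction M.isInternal (P := fun m => (M ⊠ N).signOp (tmul m l) =
    tmul (M.signOp m) (N.signOp l)) (fun a m hm => ?_) (by simp)
    (fun x y hx hy => by simp only [map_add, LinearMap.add_apply, hx, hy]) m
  refine graded_induction N.isInternal (P := fun l => (M ⊠ N).signOp (tmul m l) =
    tmul (M.signOp m) (N.signOp l)) (fun b l hl => ?_) (by simp)
    (fun x y hx hy => by simp only [map_add, hx, hy]) l
  rw [signOp_of_mem (j := (a + b).1) (t := (a + b).2) (tmul_mem hm hl),
    signOp_of_mem (j := a.1) (t := a.2) hm, signOp_of_mem (j := b.1) (t := b.2) hl,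
    Prod.snd_add, Int.negOnePow_add, Units.val_mul, map_zsmul, map_zsmul, LinearMap.smul_apply,
    smul_smul, mul_comm]

end DgBimod

open DgBimod

variable [Fact p.Prime] [CharP k p] {M N L M' N' : DgBimod k p n}

/-- The linear map out of `M ⊗_R N` given by a balanced bilinear map that respects the outer
actions. -/
def SHom.tensorLift {S : Subalgebra k (Poly k n)} (f : M.carrier →ₗ[k] N.carrier →ₗ[k] L.carrier)
    (hf : ∀ a m l, f (M.right a m) l = f m (N.left a l))
    (h1 : ∀ a ∈ S, ∀ m l, f (M.left a m) l = L.left a (f m l))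
    (h2 : ∀ a m l, f m (N.right a l) = L.right a (f m l)) : SHom S (M ⊠ N) L :=
  SHom.mk (DgBimod.tensorLift f hf)
    (fun a ha x => tens_induction (P := fun x => DgBimod.tensorLift f hf ((M ⊠ N).left a x) =
      L.left a (DgBimod.tensorLift f hf x)) (by simp) (fun m l => by simp [h1 a ha])
      (fun x y hx hy => by simp only [map_add, hx, hy]) x)
    (fun a x => tens_induction (P := fun x => DgBimod.tensorLift f hf ((M ⊠ N).right a x) =
      L.right a (DgBimod.tensorLift f hf x)) (by simp) (fun m l => by simp [h2])
      (fun x y hx hy => by simp only [map_add, hx, hy]) x)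

@[simp] theorem SHom.tensorLift_tmul {S : Subalgebra k (Poly k n)}
    (f : M.carrier →ₗ[k] N.carrier →ₗ[k] L.carrier) (hf h1 h2) (m : M.carrier) (l : N.carrier) :
    (SHom.tensorLift (S := S) f hf h1 h2) (tmul m l) = f m l := DgBimod.tensorLift_tmul f hf m l

/-- The tensor product of two maps. -/
def SHom.tmap {S : Subalgebra k (Poly k n)} (f : SHom S M M') (g : BHom N N') :
    SHom S (M ⊠ N) (M' ⊠ N') :=
  SHom.tensorLift (tmul.compl₁₂ f.lin g.lin)
    (fun a m l => by simp [tmul_balanced])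
    (fun a ha m l => by simp [f.map_left ha])
    (fun a m l => by simp)

@[simp] theorem SHom.tmap_tmul {S : Subalgebra k (Poly k n)} (f : SHom S M M') (g : BHom N N')
    (m : M.carrier) (l : N.carrier) : (SHom.tmap f g) (tmul m l) = tmul (f m) (g l) := by
  simp [SHom.tmap]

theorem SHom.tens_ext {S : Subalgebra k (Poly k n)} {f g : SHom S (M ⊠ N) L}
    (h : ∀ m l, f (tmul m l) = g (tmul m l)) : f = g :=
  SHom.lin_injective fun x => tens_induction (P := fun x => f x = g x) (by simp) h
    (fun x y hx hy => by simp only [map_add, hx, hy]) x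

theorem SHom.tens_congr {S : Subalgebra k (Poly k n)} {f g : SHom S (M ⊠ N) L}
    (h : ∀ m l, f (tmul m l) = g (tmul m l)) (x : (M ⊠ N).carrier) : f x = g x := by
  rw [SHom.tens_ext h]

/-- A bimodule map out of a tensor product is a morphism of complexes as soon as it behaves like
one on pure tensors. -/
def DgHom.ofTens (f : BHom (M ⊠ N) L)
    (hD : ∀ m l, f (tmul (M.D m) l) + f (tmul m (N.D l)) = L.D (f (tmul m l)))
    (hd : ∀ m l, f (tmul (M.d m) l) + f (tmul (M.signOp m) (N.d l)) = L.d (f (tmul m l)))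
    (hdeg : ∀ a b, ∀ m ∈ M.deg a, ∀ l ∈ N.deg b, f (tmul m l) ∈ L.deg (a + b)) :
    DgHom (M ⊠ N) L where
  hom := f
  map_D x := tens_induction (P := fun x => f ((M ⊠ N).D x) = L.D (f x)) (by simp)
    (fun m l => by simp [hD]) (fun x y hx hy => by simp only [map_add, hx, hy]) x
  map_d x := tens_induction (P := fun x => f ((M ⊠ N).d x) = L.d (f x)) (by simp)
    (fun m l => by simp [hd]) (fun x y hx hy => by simp only [map_add, hx, hy]) x
  map_deg jt x hx := map_mem_of_mem_tens f.lin _ jt (by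
    rintro a b rfl m hm l hl
    exact hdeg a b m hm l hl) x hx

@[simp] theorem DgHom.ofTens_hom (f : BHom (M ⊠ N) L) (hD hd hdeg) :
    (DgHom.ofTens f hD hd hdeg).hom = f := rfl

theorem tmap_hasDeg {e e' : ℤ × ℤ} (f : BHom M M') (g : BHom N N') (hf : HasDeg e f.lin)
    (hg : HasDeg e' g.lin) : HasDeg (e + e') (SHom.tmap f g).lin := by
  intro jt x hx
  refine map_mem_of_mem_tens (SHom.tmap f g).lin _ jt ?_ x hx
  rintro a b rfl m hm l hl
  rw [SHom.tmap_tmul, add_add_add_comm]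
  exact tmul_mem (hf a m hm) (hg b l hl)

namespace DefRetract

variable (L)

/-- Tensoring a deformation retraction on the right. -/
def tensRight (R : DefRetract M N) : DefRetract (M ⊠ L) (N ⊠ L) where
  incl := DgHom.ofTens (SHom.tmap R.incl.hom (SHom.id L))
    (fun m l => by simp [R.incl.map_D])
    (fun m l => by simp [R.incl.map_d, signOp_hom])
    (fun a b m hm l hl => by simpa using tmul_mem (R.incl.map_deg _ _ hm) hl)
  retr := SHom.tmap R.retr (SHom.id L)
  htpy := SHom.tmap R.htpy (SHom.id L)
  htpy_deg := by
    have := tmap_hasDeg (e' := 0) R.htpy (SHom.id L) R.htpy_deg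
      (fun jt m hm => by rw [zero_add]; exact hm)
    rwa [add_zero] at this
  retr_incl := SHom.tens_congr (f := (SHom.tmap R.retr (SHom.id L)).comp
    (SHom.tmap R.incl.hom (SHom.id L))) (g := SHom.id _) fun m l => by simp [R.retr_incl]
  htpy_incl := SHom.tens_congr (f := (SHom.tmap R.htpy (SHom.id L)).comp
    (SHom.tmap R.incl.hom (SHom.id L))) (g := 0) fun m l => by simp [R.htpy_incl]
  htpy_d x := by
    have h := SHom.tens_congr
      (f := (BHom.d _).comp (SHom.tmap R.htpy (SHom.id L)) +
        (SHom.tmap R.htpy (SHom.id L)).comp (BHom.d _))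
      (g := (SHom.tmap R.incl.hom (SHom.id L)).comp (SHom.tmap R.retr (SHom.id L)) - SHom.id _)
      (fun m l => by
        have h := congrArg (fun y => tmul (N := L) y l) (R.htpy_d m)
        simp only [map_add, map_sub, LinearMap.add_apply, LinearMap.sub_apply] at h
        simp only [SHom.add_apply, SHom.comp_apply, SHom.tmap_tmul, BHom.d_apply, tens_d,
          SHom.id_apply, map_add, SHom.sub_apply, signOp_htpy _ R.htpy_deg, map_neg,
          LinearMap.neg_apply, ← h]
        abel) x
    simpa using h

/-- Tensoring a deformation retraction on the left. The homotopy anticommutes with signs. -/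
def tensLeft (R : DefRetract M N) : DefRetract (L ⊠ M) (L ⊠ N) where
  incl := DgHom.ofTens (SHom.tmap (SHom.id L) R.incl.hom)
    (fun m l => by simp [R.incl.map_D])
    (fun m l => by simp [R.incl.map_d])
    (fun a b m hm l hl => by simpa using tmul_mem hm (R.incl.map_deg _ _ hl))
  retr := SHom.tmap (SHom.id L) R.retr
  htpy := SHom.tmap L.sgn R.htpy
  htpy_deg := by
    have := tmap_hasDeg (e := 0) L.sgn R.htpy
      (fun jt m hm => by rw [zero_add]; exact signOp_mem jt hm) R.htpy_deg
    rwa [zero_add] at this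
  retr_incl := SHom.tens_congr (f := (SHom.tmap (SHom.id L) R.retr).comp
    (SHom.tmap (SHom.id L) R.incl.hom)) (g := SHom.id _) fun m l => by simp [R.retr_incl]
  htpy_incl := SHom.tens_congr (f := (SHom.tmap L.sgn R.htpy).comp
    (SHom.tmap (SHom.id L) R.incl.hom)) (g := 0) fun m l => by simp [R.htpy_incl]
  htpy_d x := by
    have h := SHom.tens_congr
      (f := (BHom.d _).comp (SHom.tmap L.sgn R.htpy) + (SHom.tmap L.sgn R.htpy).comp (BHom.d _))
      (g := (SHom.tmap (SHom.id L) R.incl.hom).comp (SHom.tmap (SHom.id L) R.retr) - SHom.id _)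
      (fun l m => by
        have h := congrArg (fun y => tmul l y) (R.htpy_d m)
        simp only [map_add, map_sub] at h
        simp only [SHom.add_apply, SHom.comp_apply, SHom.tmap_tmul, BHom.d_apply, tens_d,
          SHom.id_apply, map_add, SHom.sub_apply, signOp_d, map_neg, sgn_apply, signOp_signOp,
          LinearMap.neg_apply, ← h]
        abel) x
    simpa using h

end DefRetract

section Associativity

variable (M N L)

/-- The bilinear map underlying the associator. -/
def assocAux : (M ⊠ N).carrier →ₗ[k] L.carrier →ₗ[k] (M ⊠ N ⊠ L).carrier :=
  DgBimod.tensorLift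
    (LinearMap.mk₂ k (fun m l => (tmul m).comp (tmul l))
      (fun m m' l => LinearMap.ext fun x => by simp)
      (fun c m l => LinearMap.ext fun x => by simp)
      (fun m l l' => LinearMap.ext fun x => by simp)
      (fun c m l => LinearMap.ext fun x => by simp))
    (fun a m l => LinearMap.ext fun x => by simp [tmul_balanced])

@[simp] theorem assocAux_tmul (m : M.carrier) (l : N.carrier) (x : L.carrier) :
    assocAux M N L (tmul m l) x = tmul m (tmul l x) := by simp [assocAux]

/-- The bilinear map underlying the inverse of the associator. -/
def assocInvAux : (N ⊠ L).carrier →ₗ[k] M.carrier →ₗ[k] ((M ⊠ N) ⊠ L).carrier :=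
  DgBimod.tensorLift
    (LinearMap.mk₂ k (fun l x => (tmul.flip x).comp (tmul.flip l))
      (fun m m' l => LinearMap.ext fun x => by simp)
      (fun c m l => LinearMap.ext fun x => by simp)
      (fun m l l' => LinearMap.ext fun x => by simp)
      (fun c m l => LinearMap.ext fun x => by simp))
    (fun a m l => LinearMap.ext fun x => by simp [← tmul_balanced])

@[simp] theorem assocInvAux_tmul (m : M.carrier) (l : N.carrier) (x : L.carrier) :
    assocInvAux M N L (tmul l x) m = tmul (tmul m l) x := by simp [assocInvAux]

/-- The associator `(M ⊗ N) ⊗ L → M ⊗ (N ⊗ L)` as a map of bimodules. -/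
def assocMap : BHom ((M ⊠ N) ⊠ L) (M ⊠ N ⊠ L) :=
  SHom.tensorLift (assocAux M N L)
    (fun a y x => tens_induction (P := fun y => assocAux M N L ((M ⊠ N).right a y) x =
      assocAux M N L y (L.left a x)) (by simp) (fun m l => by simp [tmul_balanced])
      (fun y z hy hz => by simp only [map_add, LinearMap.add_apply, hy, hz]) y)
    (fun a _ y x => tens_induction (P := fun y => assocAux M N L ((M ⊠ N).left a y) x =
      (M ⊠ N ⊠ L).left a (assocAux M N L y x)) (by simp) (fun m l => by simp)
      (fun y z hy hz => by simp only [map_add, LinearMap.add_apply, hy, hz]) y)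
    (fun a y x => tens_induction (P := fun y => assocAux M N L y (L.right a x) =
      (M ⊠ N ⊠ L).right a (assocAux M N L y x)) (by simp) (fun m l => by simp)
      (fun y z hy hz => by simp only [map_add, LinearMap.add_apply, hy, hz]) y)

@[simp] theorem assocMap_tmul (m : M.carrier) (l : N.carrier) (x : L.carrier) :
    assocMap M N L (tmul (tmul m l) x) = tmul m (tmul l x) := by simp [assocMap]

/-- The inverse of the associator as a map of bimodules. -/
def assocInv : BHom (M ⊠ N ⊠ L) ((M ⊠ N) ⊠ L) :=
  SHom.tensorLift (assocInvAux M N L).flip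
    (fun a m y => tens_induction (P := fun y => (assocInvAux M N L).flip (M.right a m) y =
      (assocInvAux M N L).flip m ((N ⊠ L).left a y)) (by simp) (fun l x => by simp [tmul_balanced])
      (fun y z hy hz => by simp only [map_add, hy, hz]) y)
    (fun a _ m y => tens_induction (P := fun y => (assocInvAux M N L).flip (M.left a m) y =
      ((M ⊠ N) ⊠ L).left a ((assocInvAux M N L).flip m y)) (by simp) (fun l x => by simp)
      (fun y z hy hz => by simp only [map_add, hy, hz]) y)
    (fun a m y => tens_induction (P := fun y => (assocInvAux M N L).flip m ((N ⊠ L).right a y) =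
      ((M ⊠ N) ⊠ L).right a ((assocInvAux M N L).flip m y)) (by simp) (fun l x => by simp)
      (fun y z hy hz => by simp only [map_add, hy, hz]) y)

@[simp] theorem assocInv_tmul (m : M.carrier) (l : N.carrier) (x : L.carrier) :
    assocInv M N L (tmul m (tmul l x)) = tmul (tmul m l) x := by simp [assocInv]

theorem assocMap_assocInv (x : (M ⊠ N ⊠ L).carrier) :
    assocMap M N L (assocInv M N L x) = x :=
  SHom.tens_congr (f := (assocMap M N L).comp (assocInv M N L)) (g := SHom.id _)
    (fun m y => tens_induction (P := fun y => ((assocMap M N L).comp (assocInv M N L)) (tmul m y) =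
      tmul m y) (by simp) (fun l x => by simp) (fun y z hy hz => by simp only [map_add, hy, hz]) y) x

theorem assocInv_assocMap (x : ((M ⊠ N) ⊠ L).carrier) :
    assocInv M N L (assocMap M N L x) = x :=
  SHom.tens_congr (f := (assocInv M N L).comp (assocMap M N L)) (g := SHom.id _)
    (fun y x => tens_induction (P := fun y => ((assocInv M N L).comp (assocMap M N L)) (tmul y x) =
      tmul y x) (by simp) (fun l x => by simp)
      (fun y z hy hz => by simp only [map_add, LinearMap.add_apply, hy, hz]) y) x

/-- The associator `(M ⊗ N) ⊗ L → M ⊗ (N ⊗ L)`. -/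
def assocHom : DgHom ((M ⊠ N) ⊠ L) (M ⊠ N ⊠ L) where
  hom := assocMap M N L
  map_D x := tens_induction (P := fun x => assocMap M N L (((M ⊠ N) ⊠ L).D x) =
    (M ⊠ N ⊠ L).D (assocMap M N L x)) (by simp)
    (fun y x => tens_induction (P := fun y => assocMap M N L (((M ⊠ N) ⊠ L).D (tmul y x)) =
      (M ⊠ N ⊠ L).D (assocMap M N L (tmul y x))) (by simp)
      (fun m l => by simp only [tens_D, assocMap_tmul, map_add, LinearMap.add_apply]; abel)
      (fun y z hy hz => by simp only [map_add, LinearMap.add_apply] at hy hz ⊢; rw [hy, hz]) y)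
    (fun y z hy hz => by simp only [map_add, hy, hz]) x
  map_d x := tens_induction (P := fun x => assocMap M N L (((M ⊠ N) ⊠ L).d x) =
    (M ⊠ N ⊠ L).d (assocMap M N L x)) (by simp)
    (fun y x => tens_induction (P := fun y => assocMap M N L (((M ⊠ N) ⊠ L).d (tmul y x)) =
      (M ⊠ N ⊠ L).d (assocMap M N L (tmul y x))) (by simp)
      (fun m l => by
        simp only [tens_d, assocMap_tmul, map_add, LinearMap.add_apply, signOp_tmul]; abel)
      (fun y z hy hz => by simp only [map_add, LinearMap.add_apply] at hy hz ⊢; rw [hy, hz]) y)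
    (fun y z hy hz => by simp only [map_add, hy, hz]) x
  map_deg jt x hx := map_mem_of_mem_tens (assocMap M N L).lin _ jt (by
    rintro a b rfl y hy z hz
    refine map_mem_of_mem_tens ((assocMap M N L).lin.comp (tmul.flip z)) _ a ?_ y hy
    rintro c e rfl m hm l hl
    simp only [LinearMap.comp_apply, LinearMap.flip_apply, assocMap_tmul, add_assoc]
    exact tmul_mem hm (tmul_mem hl hz)) x hx

/-- The associator as a deformation retraction. -/
def assocRetract : DefRetract ((M ⊠ N) ⊠ L) (M ⊠ N ⊠ L) :=
  .ofIso (assocHom M N L) (assocInv M N L) (assocInv_assocMap M N L) (assocMap_assocInv M N L)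

/-- The inverse associator `M ⊗ (N ⊗ L) → (M ⊗ N) ⊗ L`. -/
def assocInvHom : DgHom (M ⊠ N ⊠ L) ((M ⊠ N) ⊠ L) where
  hom := assocInv M N L
  map_D x := by
    have h := (assocHom M N L).map_D (assocInv M N L x)
    change assocMap M N L _ = (M ⊠ N ⊠ L).D (assocMap M N L _) at h
    rw [assocMap_assocInv] at h
    rw [← h, assocInv_assocMap]
  map_d x := by
    have h := (assocHom M N L).map_d (assocInv M N L x)
    change assocMap M N L _ = (M ⊠ N ⊠ L).d (assocMap M N L _) at h
    rw [assocMap_assocInv] at h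
    rw [← h, assocInv_assocMap]
  map_deg jt x hx := (assocRetract M N L).retr_deg jt x hx

/-- The inverse associator as a deformation retraction. -/
def assocInvRetract : DefRetract (M ⊠ N ⊠ L) ((M ⊠ N) ⊠ L) :=
  .ofIso (assocInvHom M N L) (assocMap M N L) (assocMap_assocInv M N L) (assocInv_assocMap M N L)

end Associativity

section Unit

variable (k p n) in
/-- The bimodule `R` in homological degree zero, kept folded. -/
def unitC : DgBimod k p n := DgBimod.unit k p n

variable (k p n) in
/-- The generator of `R`. -/
def unitOne : (unitC k p n).carrier := (1 : Poly k n)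

theorem unitC_eq (x : (unitC k p n).carrier) :
    ∃ a : Poly k n, x = (unitC k p n).left a (unitOne k p n) :=
  ⟨x, (mul_one (M := Poly k n) x).symm⟩

@[simp] theorem unit_left_one (a : Poly k n) :
    (unitC k p n).left a (unitOne k p n) = (unitC k p n).right a (unitOne k p n) := rfl

@[simp] theorem unit_D_one : (unitC k p n).D (unitOne k p n) = 0 := by
  have h : dq k n (1 : Poly k n) = 0 := Derivation.map_one_eq_zero _
  exact h

@[simp] theorem unit_d (x : (unitC k p n).carrier) : (unitC k p n).d x = 0 := rfl

theorem unitOne_mem : unitOne k p n ∈ (unitC k p n).deg 0 :=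
  MvPolynomial.isWeightedHomogeneous_one k (fun _ : Fin n => ((2, 0) : ℤ × ℤ))

@[simp] theorem unit_signOp (x : (unitC k p n).carrier) : (unitC k p n).signOp x = x := by
  have h1 : (unitC k p n).signOp (unitOne k p n) = unitOne k p n := by
    rw [signOp_of_mem (j := 0) (t := 0) unitOne_mem]; simp
  obtain ⟨a, rfl⟩ := unitC_eq x
  rw [signOp_left, h1]

theorem unit_gen : Gen (unitC k p n) {unitOne k p n} := by
  intro P h1 _ h3 x
  obtain ⟨a, rfl⟩ := unitC_eq x
  exact h1 a _ (h3 rfl)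

variable (k p n) in
/-- The elements of the complex `R`, seen as polynomials. -/
def unitVal : (unitC k p n).carrier →ₗ[k] Poly k n := by
  exact (LinearMap.id : Poly k n →ₗ[k] Poly k n)

@[simp] theorem unitVal_one : unitVal k p n (unitOne k p n) = 1 := rfl

@[simp] theorem unitVal_left (a : Poly k n) (x : (unitC k p n).carrier) :
    unitVal k p n ((unitC k p n).left a x) = a * unitVal k p n x := rfl

@[simp] theorem unitVal_right (a : Poly k n) (x : (unitC k p n).carrier) :
    unitVal k p n ((unitC k p n).right a x) = a * unitVal k p n x := rfl

/-- The bimodule map out of `R` that sends `1` to a central element. -/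
def ofCentral (z : M.carrier) (hz : ∀ a, M.left a z = M.right a z) : BHom (unitC k p n) M :=
  BHom.mk
    { toFun := fun b => M.left (unitVal k p n b) z
      map_add' := fun b c => by simp
      map_smul' := fun b c => by simp }
    (fun a b => by simp) (fun a b => by
      change M.left _ z = M.right a (M.left _ z)
      rw [← M.left_right, ← hz, unitVal_right, mul_comm, map_mul]; rfl)

@[simp] theorem ofCentral_one (z : M.carrier) (hz) :
    ofCentral (p := p) z hz (unitOne k p n) = z := by simp [ofCentral]

variable (M)

/-- The isomorphism `R ⊗ M → M` as a map of bimodules. -/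
def leftUnitMap : BHom (unitC k p n ⊠ M) M :=
  SHom.tensorLift (LinearMap.mk₂ k (fun b m => M.left (unitVal k p n b) m)
      (fun _ _ _ => by simp) (fun _ _ _ => by simp) (fun _ _ _ => by simp) (fun _ _ _ => by simp))
    (fun a b m => by simp [mul_comm a]) (fun a _ b m => by simp) (fun a b m => by
      simp [M.left_right])

@[simp] theorem leftUnitMap_tmul (m : M.carrier) :
    leftUnitMap M (tmul (unitOne k p n) m) = m :=
  (SHom.tensorLift_tmul _ _ _ _ _ _).trans (by simp)

/-- The isomorphism `M ⊗ R → M` as a map of bimodules. -/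
def rightUnitMap : BHom (M ⊠ unitC k p n) M :=
  SHom.tensorLift (LinearMap.mk₂ k (fun m b => M.right (unitVal k p n b) m)
      (fun _ _ _ => by simp) (fun _ _ _ => by simp) (fun _ _ _ => by simp) (fun _ _ _ => by simp))
    (fun a m b => by simp [mul_comm a]) (fun a _ m b => by simp [M.left_right])
    (fun a m b => by simp)

@[simp] theorem rightUnitMap_tmul (m : M.carrier) :
    rightUnitMap M (tmul m (unitOne k p n)) = m :=
  (SHom.tensorLift_tmul _ _ _ _ _ _).trans (by simp)

theorem leftUnit_exists (x : (unitC k p n ⊠ M).carrier) : ∃ m, x = tmul (unitOne k p n) m := by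
  refine tens_induction (P := fun x => ∃ m, x = tmul (unitOne k p n) m) ⟨0, by simp⟩ ?_ ?_ x
  · intro r m
    obtain ⟨a, rfl⟩ := unitC_eq r
    exact ⟨M.left a m, by rw [unit_left_one, tmul_balanced]⟩
  · rintro _ _ ⟨m, rfl⟩ ⟨m', rfl⟩
    exact ⟨m + m', by rw [map_add]⟩

theorem rightUnit_exists (x : (M ⊠ unitC k p n).carrier) : ∃ m, x = tmul m (unitOne k p n) := by
  refine tens_induction (P := fun x => ∃ m, x = tmul m (unitOne k p n)) ⟨0, by simp⟩ ?_ ?_ x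
  · intro m r
    obtain ⟨a, rfl⟩ := unitC_eq r
    exact ⟨M.right a m, by rw [tmul_balanced]⟩
  · rintro _ _ ⟨m, rfl⟩ ⟨m', rfl⟩
    exact ⟨m + m', by rw [map_add, LinearMap.add_apply]⟩

/-- The unit isomorphism `M → R ⊗ M`. -/
def leftUnitRetract : DefRetract M (unitC k p n ⊠ M) :=
  .ofIso
    { hom := BHom.mk (tmul (unitOne k p n)) (fun a m => by
          rw [tens_left, unit_left_one, tmul_balanced]) (fun a m => by rw [tens_right])
      map_D := fun m => by simp
      map_d := fun m => by simp
      map_deg := fun jt m hm => by simpa using tmul_mem unitOne_mem hm }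
    (leftUnitMap M) (fun m => by simp) (fun x => by
      obtain ⟨m, rfl⟩ := leftUnit_exists M x
      simp)

/-- The map `m ↦ m ⊗ 1`. -/
def tmulOne : BHom M (M ⊠ unitC k p n) :=
  BHom.mk (tmulRight (unitOne k p n)) (fun a m => (tens_left a m _).symm)
    (fun a m => (tmul_balanced a m _).trans (tens_right a m (unitOne k p n)).symm)

@[simp] theorem tmulOne_apply (m : M.carrier) : tmulOne M m = tmul m (unitOne k p n) := rfl

/-- The unit isomorphism `M → M ⊗ R`. -/
def rightUnitRetract : DefRetract M (M ⊠ unitC k p n) :=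
  .ofIso
    { hom := tmulOne M
      map_D := fun m => by simp
      map_d := fun m => by simp
      map_deg := fun jt m hm => by simpa using tmul_mem hm unitOne_mem }
    (rightUnitMap M) (fun m => by simp) (fun x => by
      obtain ⟨m, rfl⟩ := rightUnit_exists M x
      simp)

end Unit

end Tensor

/-! ### Mapping cones and complexes concentrated in one degree -/

section Cones

variable {k : Type u} [Field k] {p n : ℕ}

theorem sum_mapRange_components {U V : Type*} [AddCommGroup U] [Module k U] [AddCommGroup V]
    [Module k V] {ι : Type} [AddCommGroup ι] [DecidableEq ι] {A : ι → Submodule k U}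
    (hA : DirectSum.IsInternal A) (f : U →ₗ[k] V) (u : U) :
    (Finsupp.mapRange.linearMap f (components hA u)).sum (fun _ x => x) = f u := by
  conv_rhs => rw [← components_sum hA u]
  rw [Finsupp.mapRange.linearMap_apply, Finsupp.sum_mapRange_index (fun _ => rfl), map_finsuppSum]

theorem isInternal_prod {V W : Type*} [AddCommGroup V] [Module k V] [AddCommGroup W] [Module k W]
    {ι : Type} [AddCommGroup ι] [DecidableEq ι] {A : ι → Submodule k V} {B : ι → Submodule k W}
    (hA : DirectSum.IsInternal A) (hB : DirectSum.IsInternal B) :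
    DirectSum.IsInternal fun i => (A i).prod (B i) := by
  refine isInternal_of_components
    ((Finsupp.mapRange.linearMap (LinearMap.inl k V W)).comp
      ((components hA).comp (LinearMap.fst k V W)) +
    (Finsupp.mapRange.linearMap (LinearMap.inr k V W)).comp
      ((components hB).comp (LinearMap.snd k V W))).toAddMonoidHom ?_ ?_ ?_
  · rintro ⟨x, y⟩ i
    have hx := components_apply_mem hA x i
    have hy := components_apply_mem hB y i
    simpa using ⟨hx, hy⟩
  · rintro ⟨x, y⟩
    simp only [LinearMap.toAddMonoidHom_coe, LinearMap.add_apply, LinearMap.comp_apply,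
      LinearMap.fst_apply, LinearMap.snd_apply]
    rw [Finsupp.sum_add_index' (fun _ => rfl) (fun _ _ _ => rfl), sum_mapRange_components,
      sum_mapRange_components]
    simp
  · rintro i ⟨x, y⟩ ⟨hx, hy⟩
    simp only [LinearMap.toAddMonoidHom_coe, LinearMap.add_apply, LinearMap.comp_apply,
      LinearMap.fst_apply, LinearMap.snd_apply]
    rw [components_of_mem hA hx, components_of_mem hB hy, Finsupp.mapRange.linearMap_apply,
      Finsupp.mapRange.linearMap_apply, Finsupp.mapRange_single, Finsupp.mapRange_single,
      ← Finsupp.single_add]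
    simp

theorem isInternal_shift {V : Type*} [AddCommGroup V] [Module k V] {ι : Type} [AddCommGroup ι]
    [DecidableEq ι] {A : ι → Submodule k V} (h : DirectSum.IsInternal A) (s : ι) :
    DirectSum.IsInternal fun i => A (i - s) := by
  rw [DirectSum.isInternal_submodule_iff_iSupIndep_and_iSup_eq_top] at h ⊢
  refine ⟨h.1.comp sub_left_injective, ?_⟩
  rw [← h.2]
  exact (Equiv.subRight s).iSup_comp (g := A)

/-- The mapping cone of a morphism `f : X → Y`, with `X` shifted up by one homological degree. -/
def cone {X Y : DgBimod k p n} (f : DgHom X Y) : DgBimod k p n where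
  carrier := X.carrier × Y.carrier
  left := (LinearMap.prodMapAlgHom k X.carrier Y.carrier).comp (X.left.prod Y.left)
  right := (LinearMap.prodMapAlgHom k X.carrier Y.carrier).comp (X.right.prod Y.right)
  left_right a b m := Prod.ext (X.left_right a b m.1) (Y.left_right a b m.2)
  deg jt := (X.deg (jt - (0, 1))).prod (Y.deg jt)
  isInternal := isInternal_prod (isInternal_shift X.isInternal _) Y.isInternal
  left_mem ha hm := ⟨by rw [add_sub_assoc]; exact X.left_mem ha hm.1, Y.left_mem ha hm.2⟩
  right_mem ha hm := ⟨by rw [add_sub_assoc]; exact X.right_mem ha hm.1, Y.right_mem ha hm.2⟩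
  D := X.D.prodMap Y.D
  D_pow := by
    have h : ∀ r : ℕ, (X.D.prodMap Y.D) ^ r = (X.D ^ r).prodMap (Y.D ^ r) := fun r =>
      (map_pow (LinearMap.prodMapAlgHom k X.carrier Y.carrier) (X.D, Y.D) r).symm
    rw [h, X.D_pow, Y.D_pow]
    rfl
  D_left a m := Prod.ext (X.D_left a m.1) (Y.D_left a m.2)
  D_right a m := Prod.ext (X.D_right a m.1) (Y.D_right a m.2)
  D_mem jt m hm := ⟨by rw [add_sub_assoc]; exact X.D_mem _ _ hm.1, Y.D_mem _ _ hm.2⟩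
  d := (-X.d.comp (LinearMap.fst k X.carrier Y.carrier)).prod (f.hom.lin.coprod Y.d)
  d_d m := Prod.ext (by simp [X.d_d]) (by simp [Y.d_d, f.map_d])
  d_left a m := Prod.ext (by simp [X.d_left]) (by simp [Y.d_left])
  d_right a m := Prod.ext (by simp [X.d_right]) (by simp [Y.d_right])
  d_D m := Prod.ext (by simp [X.d_D]) (by simp [Y.d_D, f.map_D])
  d_mem j t m hm := by
    obtain ⟨h1, h2⟩ := hm
    simp only [Prod.mk_sub_mk, sub_zero] at h1
    refine ⟨?_, ?_⟩
    · simp only [Prod.mk_sub_mk, sub_zero]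
      exact neg_mem (X.d_mem _ _ _ h1)
    · exact add_mem (f.map_deg _ _ h1) (Y.d_mem _ _ _ h2)

namespace cone

variable {X Y Z Q : DgBimod k p n} (f : DgHom X Y)

/-- The inclusion of the source of `f`. -/
def inl : BHom X (cone f) :=
  BHom.mk (by exact LinearMap.inl k X.carrier Y.carrier)
    (fun a _ => Prod.ext rfl (map_zero (Y.left a)).symm)
    (fun a _ => Prod.ext rfl (map_zero (Y.right a)).symm)

/-- The inclusion of the target of `f`. -/
def inr : BHom Y (cone f) :=
  BHom.mk (by exact LinearMap.inr k X.carrier Y.carrier)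
    (fun a _ => Prod.ext (map_zero (X.left a)).symm rfl)
    (fun a _ => Prod.ext (map_zero (X.right a)).symm rfl)

theorem eq_inl_add_inr (z : (cone f).carrier) : ∃ x y, z = inl f x + inr f y :=
  ⟨z.1, z.2, Prod.ext (add_zero _).symm (zero_add _).symm⟩

@[simp] theorem D_inl (x : X.carrier) : (cone f).D (inl f x) = inl f (X.D x) :=
  Prod.ext rfl (map_zero Y.D)

@[simp] theorem D_inr (y : Y.carrier) : (cone f).D (inr f y) = inr f (Y.D y) :=
  Prod.ext (map_zero X.D) rfl

@[simp] theorem d_inl (x : X.carrier) :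
    (cone f).d (inl f x) = inr f (f.hom x) - inl f (X.d x) :=
  Prod.ext (zero_sub _).symm
    ((congrArg (f.hom x + ·) (map_zero Y.d)).trans ((add_zero _).trans (sub_zero _).symm))

@[simp] theorem d_inr (y : Y.carrier) : (cone f).d (inr f y) = inr f (Y.d y) :=
  Prod.ext ((congrArg Neg.neg (map_zero X.d)).trans neg_zero)
    ((congrArg (· + Y.d y) (map_zero f.hom.lin)).trans (zero_add _))

variable {f}

theorem inl_mem {jt : ℤ × ℤ} {x : X.carrier} (hx : x ∈ X.deg jt) :
    inl f x ∈ (cone f).deg ((0, 1) + jt) :=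
  ⟨by rw [add_sub_cancel_left]; exact hx, zero_mem _⟩

theorem inr_mem {jt : ℤ × ℤ} {y : Y.carrier} (hy : y ∈ Y.deg jt) : inr f y ∈ (cone f).deg jt :=
  ⟨zero_mem _, hy⟩

/-- The map out of a cone with prescribed restrictions. -/
def desc (a : BHom X Q) (b : BHom Y Q) : BHom (cone f) Q :=
  BHom.mk (by exact a.lin.coprod b.lin)
    (fun r z => (congrArg₂ (· + ·) (a.map_left r z.1) (b.map_left r z.2)).trans
      (map_add (Q.left r) _ _).symm)
    (fun r z => (congrArg₂ (· + ·) (a.map_right r z.1) (b.map_right r z.2)).trans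
      (map_add (Q.right r) _ _).symm)

@[simp] theorem desc_inl (a : BHom X Q) (b : BHom Y Q) (x : X.carrier) :
    (desc (f := f) a b) (inl f x) = a x :=
  (congrArg (a x + ·) (map_zero b.lin)).trans (add_zero _)

@[simp] theorem desc_inr (a : BHom X Q) (b : BHom Y Q) (y : Y.carrier) :
    (desc (f := f) a b) (inr f y) = b y :=
  (congrArg (· + b y) (map_zero a.lin)).trans (zero_add _)

theorem gen {S : Set X.carrier} {T : Set Y.carrier} (hS : Gen X S) (hT : Gen Y T) :
    Gen (cone f) ((fun x => inl f x) '' S ∪ (fun y => inr f y) '' T) := by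
  intro P h1 h2 h3 z
  obtain ⟨x, y, rfl⟩ := eq_inl_add_inr f z
  refine add_mem ?_ ?_
  · refine hS (P.comap (inl f).lin) (fun a m hm => ?_) (fun a m hm => ?_) (fun s hs => ?_) x
    · rw [Submodule.mem_comap, BHom.map_left]; exact h1 a _ hm
    · rw [Submodule.mem_comap, SHom.map_right]; exact h2 a _ hm
    · exact h3 (Or.inl ⟨s, hs, rfl⟩)
  · refine hT (P.comap (inr f).lin) (fun a m hm => ?_) (fun a m hm => ?_) (fun s hs => ?_) y
    · rw [Submodule.mem_comap, BHom.map_left]; exact h1 a _ hm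
    · rw [Submodule.mem_comap, SHom.map_right]; exact h2 a _ hm
    · exact h3 (Or.inr ⟨s, hs, rfl⟩)

/-- A morphism of complexes out of a cone, from its behaviour on both parts. -/
def descHom (a : BHom X Q) (b : DgHom Y Q) (hD : ∀ x, a (X.D x) = Q.D (a x))
    (hd : ∀ x, b.hom (f.hom x) - a (X.d x) = Q.d (a x)) (hdeg : HasDeg (0, 1) a.lin) :
    DgHom (cone f) Q where
  hom := desc a b.hom
  map_D z := by
    obtain ⟨x, y, rfl⟩ := eq_inl_add_inr f z
    simp [hD, b.map_D]
  map_d z := by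
    obtain ⟨x, y, rfl⟩ := eq_inl_add_inr f z
    simp [← hd, b.map_d]
  map_deg jt z hz := by
    refine add_mem ?_ (b.map_deg _ _ hz.2)
    have := hdeg _ _ hz.1
    rwa [add_sub_cancel] at this

variable (f) in
/-- The inclusion of the target of `f`, as a morphism of complexes. -/
def inrHom : DgHom Y (cone f) where
  hom := inr f
  map_D m := (D_inr f m).symm
  map_d m := (d_inr f m).symm
  map_deg _ _ hm := inr_mem hm

@[simp] theorem inrHom_hom : (inrHom f).hom = inr f := rfl

/-- The morphism from the cone of `X → Y → Z` to the cone of `Y → Z`. -/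
def mapSource (r : DgHom X Y) (g : DgHom Y Z) (f : DgHom X Z)
    (h : ∀ x, f.hom x = g.hom (r.hom x)) : DgHom (cone f) (cone g) :=
  descHom ((inl g).comp r.hom) (inrHom g)
    (fun x => by simp [r.map_D]) (fun x => by simp [r.map_d, h])
    (fun jt x hx => inl_mem (r.map_deg jt x hx))

@[simp] theorem mapSource_hom (r : DgHom X Y) (g : DgHom Y Z) (f : DgHom X Z) (h) :
    (mapSource r g f h).hom = desc ((inl g).comp r.hom) (inr g) := rfl

/-- A deformation retraction `X → Y` induces one of the cone of `X → Y → Z` into the cone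
of `Y → Z`. The inclusion fixes `Z`, so the retraction needs the correction `-g ∘ htpy` to be a
chain map; it vanishes on the image of the inclusion because `htpy ∘ incl = 0`. -/
def retract (R : DefRetract X Y) (g : DgHom Y Z) (f : DgHom X Z)
    (h : ∀ x, f.hom x = g.hom (R.incl.hom x)) : DefRetract (cone f) (cone g) where
  incl := mapSource R.incl g f h
  retr := desc ((inl f).comp R.retr - (inr f).comp (g.hom.comp R.htpy)) (inr f)
  htpy := desc (-(inl g).comp R.htpy) 0
  htpy_deg jt z hz := by
    refine add_mem (neg_mem ?_) (zero_mem _)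
    have := inl_mem (f := g) (R.htpy_deg _ _ hz.1)
    rwa [add_sub_cancel] at this
  retr_incl z := by
    obtain ⟨x, y, rfl⟩ := eq_inl_add_inr f z
    simp [R.retr_incl, R.htpy_incl]
  htpy_incl z := by
    obtain ⟨x, y, rfl⟩ := eq_inl_add_inr f z
    simp [R.htpy_incl]
  htpy_d z := by
    obtain ⟨x, y, rfl⟩ := eq_inl_add_inr g z
    have h1 := congrArg (inl g).lin (R.htpy_d x)
    simp only [map_add, map_sub] at h1
    simp only [map_add, desc_inl, desc_inr, SHom.neg_apply, SHom.comp_apply, map_neg, d_inl, d_inr,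
      map_sub, SHom.zero_apply, map_zero, mapSource_hom, SHom.sub_apply]
    have h2 : ∀ a b c e s y : (cone g).carrier, a + b = c - e →
        -(s - a) + 0 + (0 - -b + 0) = c - s + y - (e + y) := by
      intro a b c e s y h
      rw [sub_eq_iff_eq_add.1 h.symm]; abel
    exact h2 _ _ _ _ _ _ h1

end cone

/-- The complex with the single term `X`, in homological degree `t₀`. -/
def conc (X : EqBimod k p n (2 : ℤ)) (t₀ : ℤ) : DgBimod k p n where
  carrier := X.carrier
  left := X.left
  right := X.right
  left_right := X.left_right
  deg jt := if jt.2 = t₀ then X.deg jt.1 else ⊥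
  isInternal := by
    refine isInternal_of_components ((Finsupp.lmapDomain X.carrier k fun j : ℤ => (j, t₀)).comp
      (components X.isInternal)).toAddMonoidHom (fun x jt => ?_) (fun x => ?_) (fun jt x hx => ?_)
    · obtain ⟨j, t⟩ := jt
      rw [LinearMap.toAddMonoidHom_coe, LinearMap.comp_apply, Finsupp.lmapDomain_apply]
      split_ifs with h
      · simp only at h
        subst h
        rw [Finsupp.mapDomain_apply (fun a b hab => congrArg Prod.fst hab) _ j]
        exact components_apply_mem _ _ _
      · rw [Finsupp.mapDomain_of_notMem_range _ _ fun ⟨i, hi⟩ => h (congrArg Prod.snd hi).symm]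
        exact zero_mem _
    · rw [LinearMap.toAddMonoidHom_coe, LinearMap.comp_apply, Finsupp.lmapDomain_apply,
        Finsupp.sum_mapDomain_index (fun _ => rfl) (fun _ _ _ => rfl)]
      exact components_sum _ _
    · obtain ⟨j, t⟩ := jt
      rw [LinearMap.toAddMonoidHom_coe, LinearMap.comp_apply, Finsupp.lmapDomain_apply]
      split_ifs at hx with h
      · simp only at h
        subst h
        rw [components_of_mem _ hx, Finsupp.mapDomain_single]
      · rw [Submodule.mem_bot] at hx
        simp [hx]
  left_mem {a e jt x} ha hx := by
    by_cases h0 : a = 0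
    · rw [h0, map_zero]; exact zero_mem _
    obtain ⟨h1, h2⟩ := exists_isWeightedHomogeneous_of_pair ha h0
    rw [Prod.snd_add, h1, zero_add]
    split_ifs at hx ⊢ with h
    · exact X.left_mem h2 hx
    · rw [(Submodule.mem_bot k).1 hx, map_zero]; exact zero_mem _
  right_mem {a e jt x} ha hx := by
    by_cases h0 : a = 0
    · rw [h0, map_zero]; exact zero_mem _
    obtain ⟨h1, h2⟩ := exists_isWeightedHomogeneous_of_pair ha h0
    rw [Prod.snd_add, h1, zero_add]
    split_ifs at hx ⊢ with h
    · exact X.right_mem h2 hx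
    · rw [(Submodule.mem_bot k).1 hx, map_zero]; exact zero_mem _
  D := X.D
  D_pow := X.D_pow
  D_left := X.D_left
  D_right := X.D_right
  D_mem jt x hx := by
    rw [Prod.snd_add, zero_add]
    split_ifs at hx ⊢ with h
    · exact X.D_mem _ _ hx
    · rw [(Submodule.mem_bot k).1 hx, map_zero]; exact zero_mem _
  d := 0
  d_d _ := rfl
  d_left _ _ := (map_zero _).symm
  d_right _ _ := (map_zero _).symm
  d_D _ := (map_zero _).symm
  d_mem _ _ _ _ := zero_mem _

theorem conc_mem {X : EqBimod k p n (2 : ℤ)} {j : ℤ} {x : X.carrier} (t₀ : ℤ) (hx : x ∈ X.deg j) :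
    (x : (conc X t₀).carrier) ∈ (conc X t₀).deg (j, t₀) := by
  change x ∈ if t₀ = t₀ then X.deg j else ⊥
  rwa [if_pos rfl]

end Cones

/-! ### Polynomials over the symmetric subalgebras -/

section Polynomials

variable {k : Type u} [Field k] {p n : ℕ}

/-- The ring `R` is free over the subalgebra `S` with basis `1, v`; the coordinates of `f` are
`c0 f` and `c1 f`. -/
structure QuadBasis (S : Subalgebra k (Poly k n)) (v : Poly k n) where
  c0 : Poly k n →ₗ[S] Poly k n
  c1 : Poly k n →ₗ[S] Poly k n
  c0_mem : ∀ f, c0 f ∈ S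
  c1_mem : ∀ f, c1 f ∈ S
  eq : ∀ f, f = c0 f + v * c1 f
  c0_eq : ∀ a ∈ S, ∀ b ∈ S, c0 (a + v * b) = a
  c1_eq : ∀ a ∈ S, ∀ b ∈ S, c1 (a + v * b) = b

/-- Every polynomial can be written as `a + x b` with coefficients in a subalgebra that contains the
elementary symmetric polynomials in `x`, `y` and the other variables: `x` is a root of
`t ^ 2 - (x + y) t + x y`, and `y = (x + y) - x`. -/
theorem exists_add_mul_X {x y : Fin n} (A : Subalgebra k (Poly k n))
    (h1 : MvPolynomial.X x + MvPolynomial.X y ∈ A) (h2 : MvPolynomial.X x * MvPolynomial.X y ∈ A)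
    (h3 : ∀ l, l ≠ x → l ≠ y → MvPolynomial.X l ∈ A) (f : Poly k n) :
    ∃ a ∈ A, ∃ b ∈ A, f = a + MvPolynomial.X x * b := by
  induction f using MvPolynomial.induction_on with
  | C c => exact ⟨_, A.algebraMap_mem c, 0, A.zero_mem, by simp [MvPolynomial.algebraMap_eq]⟩
  | add f g hf hg =>
    obtain ⟨a, ha, b, hb, rfl⟩ := hf
    obtain ⟨a', ha', b', hb', rfl⟩ := hg
    exact ⟨a + a', A.add_mem ha ha', b + b', A.add_mem hb hb', by ring⟩
  | mul_X f l hf =>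
    obtain ⟨a, ha, b, hb, rfl⟩ := hf
    by_cases hx : l = x
    · subst hx
      exact ⟨_, A.neg_mem (A.mul_mem h2 hb), _, A.add_mem ha (A.mul_mem h1 hb), by ring⟩
    by_cases hy : l = y
    · subst hy
      exact ⟨_, A.add_mem (A.mul_mem h1 ha) (A.mul_mem h2 hb), _, A.neg_mem ha, by ring⟩
    · exact ⟨_, A.mul_mem ha (h3 l hx hy), _, A.mul_mem hb (h3 l hx hy), by ring⟩

theorem X_mem_sym {i : Fin (n - 1)} {l : Fin n} (h1 : l ≠ pos i) (h2 : l ≠ posSucc i) :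
    MvPolynomial.X l ∈ symSubalgebra k i := by
  rw [mem_symSubalgebra, MvPolynomial.rename_X, Equiv.swap_apply_of_ne_of_ne h1 h2]

theorem pos_ne_posSucc (i : Fin (n - 1)) : pos i ≠ posSucc i := by
  simp [pos, posSucc]

/-- `x` and `y` are the two strands exchanged by the `i`-th generator, in some order. -/
def IsPair (i : Fin (n - 1)) (x y : Fin n) : Prop :=
  x = pos i ∧ y = posSucc i ∨ x = posSucc i ∧ y = pos i

theorem isPair (i : Fin (n - 1)) : IsPair i (pos i) (posSucc i) := Or.inl ⟨rfl, rfl⟩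

namespace IsPair

variable {i : Fin (n - 1)} {x y : Fin n}

theorem symm (h : IsPair i x y) : IsPair i y x := h.elim (fun h => Or.inr ⟨h.2, h.1⟩)
  fun h => Or.inl ⟨h.2, h.1⟩

theorem ne (h : IsPair i x y) : x ≠ y := by
  obtain ⟨rfl, rfl⟩ | ⟨rfl, rfl⟩ := h
  · exact pos_ne_posSucc i
  · exact (pos_ne_posSucc i).symm

theorem swap (h : IsPair i x y) : Equiv.swap (pos i) (posSucc i) = Equiv.swap x y := by
  obtain ⟨rfl, rfl⟩ | ⟨rfl, rfl⟩ := h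
  · rfl
  · exact Equiv.swap_comm _ _

theorem mem_iff (h : IsPair i x y) {a : Poly k n} :
    a ∈ symSubalgebra k i ↔ MvPolynomial.rename (Equiv.swap x y) a = a := by
  rw [mem_symSubalgebra, h.swap]

theorem sum_mem (h : IsPair i x y) :
    MvPolynomial.X x + MvPolynomial.X y ∈ symSubalgebra k i := by
  rw [h.mem_iff]; simp [add_comm]

theorem prod_mem (h : IsPair i x y) :
    MvPolynomial.X x * MvPolynomial.X y ∈ symSubalgebra k i := by
  rw [h.mem_iff]; simp [mul_comm]

theorem X_mem (h : IsPair i x y) {l : Fin n} (h1 : l ≠ x) (h2 : l ≠ y) :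
    MvPolynomial.X l ∈ symSubalgebra k i := by
  rw [h.mem_iff, MvPolynomial.rename_X, Equiv.swap_apply_of_ne_of_ne h1 h2]

/-- Uniqueness of the coordinates with respect to `1, x`: subtracting the relation with `x` and `y`
exchanged gives `(x - y) b = 0`. -/
theorem eq_zero (h : IsPair i x y) {a b : Poly k n} (ha : a ∈ symSubalgebra k i)
    (hb : b ∈ symSubalgebra k i) (hab : a + MvPolynomial.X x * b = 0) : a = 0 ∧ b = 0 := by
  have h1 := congrArg (MvPolynomial.rename (Equiv.swap x y)) hab
  rw [map_add, map_mul, map_zero, h.mem_iff.1 ha, h.mem_iff.1 hb, MvPolynomial.rename_X,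
    Equiv.swap_apply_left] at h1
  have h2 : (MvPolynomial.X x - MvPolynomial.X y) * b = 0 := by linear_combination hab - h1
  have h3 : (MvPolynomial.X x - MvPolynomial.X y : Poly k n) ≠ 0 :=
    sub_ne_zero.2 fun h4 => h.ne (MvPolynomial.X_injective h4)
  have hb0 : b = 0 := (mul_eq_zero.1 h2).resolve_left h3
  subst hb0
  exact ⟨by simpa using hab, rfl⟩

/-- The subalgebra of polynomials symmetric in `x` and `y` is contained in every subalgebra that
contains the elementary symmetric polynomials in `x`, `y` and the other variables. -/
theorem le_of_mem (h : IsPair i x y) (A : Subalgebra k (Poly k n))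
    (h1 : MvPolynomial.X x + MvPolynomial.X y ∈ A) (h2 : MvPolynomial.X x * MvPolynomial.X y ∈ A)
    (h3 : ∀ l, l ≠ x → l ≠ y → MvPolynomial.X l ∈ A) : symSubalgebra k i ≤ A := by
  intro f hf
  obtain ⟨a, ha, b, hb, hab⟩ := exists_add_mul_X (A ⊓ symSubalgebra k i) ⟨h1, h.sum_mem⟩
    ⟨h2, h.prod_mem⟩ (fun l hx hy => ⟨h3 l hx hy, h.X_mem hx hy⟩) f
  have := h.eq_zero (Subalgebra.sub_mem _ hf ha.2) (Subalgebra.neg_mem _ hb.2)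
    (by rw [hab]; ring)
  rw [sub_eq_zero.1 this.1]
  exact ha.1

/-- The map `(a, b) ↦ a + x b`, which is bijective. -/
def pairMap (_ : IsPair i x y) :
    (symSubalgebra k i × symSubalgebra k i) →ₗ[symSubalgebra k i] Poly k n where
  toFun c := (c.1 : Poly k n) + MvPolynomial.X x * (c.2 : Poly k n)
  map_add' c c' := by simp only [Prod.fst_add, Prod.snd_add, Subalgebra.coe_add]; ring
  map_smul' s c := by
    simp only [Prod.smul_fst, Prod.smul_snd, smul_eq_mul, Subalgebra.coe_mul, RingHom.id_apply,
      Subalgebra.smul_def]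
    ring

theorem pairMap_bijective (h : IsPair i x y) : Function.Bijective (h.pairMap (k := k)) := by
  refine ⟨(injective_iff_map_eq_zero _).2 fun c hc => ?_, fun f => ?_⟩
  · obtain ⟨h1, h2⟩ := h.eq_zero c.1.2 c.2.2 hc
    exact Prod.ext (Subtype.ext h1) (Subtype.ext h2)
  · obtain ⟨a, ha, b, hb, rfl⟩ := exists_add_mul_X (symSubalgebra k i) h.sum_mem h.prod_mem
      (fun l hx hy => h.X_mem hx hy) f
    exact ⟨(⟨a, ha⟩, ⟨b, hb⟩), rfl⟩

/-- The isomorphism of `R` with two copies of the subalgebra of symmetric polynomials. -/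
def pairEquiv (h : IsPair i x y) :
    (symSubalgebra k i × symSubalgebra k i) ≃ₗ[symSubalgebra k i] Poly k n :=
  LinearEquiv.ofBijective h.pairMap h.pairMap_bijective

theorem pairEquiv_symm (h : IsPair i x y) {a b : Poly k n} (ha : a ∈ symSubalgebra k i)
    (hb : b ∈ symSubalgebra k i) :
    h.pairEquiv.symm (a + MvPolynomial.X x * b) = (⟨a, ha⟩, ⟨b, hb⟩) :=
  h.pairEquiv.symm_apply_eq.2 rfl

variable (k) in
/-- The basis `1, x` of `R` over the polynomials symmetric in `x` and `y`. -/
def quadBasis (h : IsPair i x y) : QuadBasis (symSubalgebra k i) (MvPolynomial.X x) where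
  c0 := (Algebra.linearMap _ _).comp
    ((LinearMap.fst _ _ _).comp (h.pairEquiv (k := k)).symm.toLinearMap)
  c1 := (Algebra.linearMap _ _).comp
    ((LinearMap.snd _ _ _).comp (h.pairEquiv (k := k)).symm.toLinearMap)
  c0_mem f := ((h.pairEquiv (k := k)).symm f).1.2
  c1_mem f := ((h.pairEquiv (k := k)).symm f).2.2
  eq f := ((h.pairEquiv (k := k)).apply_symm_apply f).symm
  c0_eq _ ha _ hb := congrArg (fun c => (c.1 : Poly k n)) (h.pairEquiv_symm ha hb)
  c1_eq _ ha _ hb := congrArg (fun c => (c.2 : Poly k n)) (h.pairEquiv_symm ha hb)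

end IsPair

namespace QuadBasis

variable {S : Subalgebra k (Poly k n)} {v : Poly k n} (B : QuadBasis S v)

theorem c0_of_mem {a : Poly k n} (ha : a ∈ S) : B.c0 a = a := by
  simpa using B.c0_eq a ha 0 S.zero_mem

theorem c1_of_mem {a : Poly k n} (ha : a ∈ S) : B.c1 a = 0 := by
  simpa using B.c1_eq a ha 0 S.zero_mem

theorem c0_self : B.c0 v = 0 := by simpa using B.c0_eq 0 S.zero_mem 1 S.one_mem

theorem c1_self : B.c1 v = 1 := by simpa using B.c1_eq 0 S.zero_mem 1 S.one_mem

end QuadBasis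

end Polynomials

/-! ### Bimodules induced from a subalgebra -/

section Induced

variable {k : Type u} [Field k] {p n : ℕ}

namespace SHom

variable {S S' : Subalgebra k (Poly k n)} {M N Q : DgBimod k p n}

variable (S M) in
/-- Multiplication by `r` on the left. -/
def lmul (r : Poly k n) : SHom S M M :=
  mk (M.left r) (fun a _ m => by
    rw [← Module.End.mul_apply, ← map_mul, mul_comm, map_mul, Module.End.mul_apply])
    (fun a m => M.left_right r a m)

@[simp] theorem lmul_apply (r : Poly k n) (m : M.carrier) : (lmul S M r) m = M.left r m := rfl

/-- A map that is linear over a subalgebra `S'` and commutes with a further polynomial `r` is linear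
over every subalgebra that is contained in the one generated by `S'` and `r`. -/
def upgrade (r : Poly k n) (h : S ≤ Algebra.adjoin k (insert r (S' : Set (Poly k n))))
    (f : SHom S' M N) (hr : ∀ m, f (M.left r m) = N.left r (f m)) : SHom S M N :=
  mk f.lin (fun a ha => by
    refine Algebra.adjoin_induction (p := fun a _ => ∀ m, f (M.left a m) = N.left a (f m))
      ?_ ?_ ?_ ?_ (h ha)
    · rintro a (rfl | ha) m
      · exact hr m
      · exact f.map_left ha m
    · intro c m
      exact f.map_left (S'.algebraMap_mem c) m
    · intro a b _ _ ha hb m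
      simp only [map_add, LinearMap.add_apply, ha, hb]
    · intro a b _ _ ha hb m
      simp only [map_mul, Module.End.mul_apply, ha, hb]) (fun a m => f.map_right a m)

@[simp] theorem upgrade_apply (r : Poly k n) (h) (f : SHom S' M N) (hr) (m : M.carrier) :
    (upgrade (S := S) r h f hr) m = f m := rfl

end SHom

/-- The set `T` generates `M` under the left action of `S` and the right action of `R`. -/
def GenOver (S : Subalgebra k (Poly k n)) (M : DgBimod k p n) (T : Set M.carrier) : Prop :=
  ∀ P : Submodule k M.carrier, (∀ a ∈ S, ∀ m ∈ P, M.left a m ∈ P) →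
    (∀ a, ∀ m ∈ P, M.right a m ∈ P) → T ⊆ P → ∀ m, m ∈ P

/-- Generators of a bimodule, together with their multiples by `v`, generate it under the left
action of the smaller ring `S`. -/
theorem Gen.genOver_quad {S : Subalgebra k (Poly k n)} {v : Poly k n} (B : QuadBasis S v)
    {M : DgBimod k p n} {T : Set M.carrier} (hT : Gen M T) :
    GenOver S M (T ∪ (fun t => M.left v t) '' T) := by
  intro P h1 h2 h3 m
  have key : ∀ m, m ∈ P ∧ M.left v m ∈ P := by
    refine hT (P ⊓ P.comap (M.left v)) (fun a m hm => ?_) (fun a m hm => ?_) (fun t ht => ?_)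
    · have h4 : ∀ a, M.left a m ∈ P := by
        intro a
        rw [B.eq a, map_add, mul_comm, map_mul]
        exact add_mem (h1 _ (B.c0_mem a) _ hm.1) (h1 _ (B.c1_mem a) _ hm.2)
      refine ⟨h4 a, ?_⟩
      have := h4 (v * a)
      rwa [map_mul] at this
    · refine ⟨h2 a m hm.1, ?_⟩
      rw [SetLike.mem_coe, Submodule.mem_comap, M.left_right]
      exact h2 a _ hm.2
    · exact ⟨h3 (Or.inl ht), h3 (Or.inr ⟨t, ht, rfl⟩)⟩
  exact (key m).1

theorem Gen.of_gen {M : DgBimod k p n} {T T' : Set M.carrier} (hT : Gen M T)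
    (h : ∀ P : Submodule k M.carrier, (∀ a, ∀ m ∈ P, M.left a m ∈ P) →
      (∀ a, ∀ m ∈ P, M.right a m ∈ P) → T' ⊆ P → T ⊆ P) : Gen M T' :=
  fun P h1 h2 h3 => hT P h1 h2 (h P h1 h2 h3)

variable [Fact p.Prime] [CharP k p]

open DgBimod

variable {S S' : Subalgebra k (Poly k n)} {M N Q : DgBimod k p n}

/-- The map `R → Q` that sends `1` to an element on which both actions of `S` agree. -/
def unitLift (S : Subalgebra k (Poly k n)) (z : Q.carrier)
    (hz : ∀ s ∈ S, Q.left s z = Q.right s z) :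
    SHom S (unitC k p n) Q :=
  SHom.mk
    { toFun := fun b => Q.right (unitVal k p n b) z
      map_add' := fun b c => by simp
      map_smul' := fun b c => by simp }
    (fun a ha b => by
      change Q.right _ z = Q.left a (Q.right _ z)
      rw [unitVal_left, Q.left_right, hz a ha, mul_comm, map_mul]; rfl)
    (fun a b => by
      change Q.right _ z = Q.right a (Q.right _ z)
      rw [unitVal_right, map_mul]; rfl)

theorem unitLift_apply (z : Q.carrier) (hz) (x : (unitC k p n).carrier) :
    (unitLift S z hz) x = Q.right (unitVal k p n x) z := rfl

@[simp] theorem unitLift_one (z : Q.carrier) (hz) :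
    (unitLift (p := p) S z hz) (unitOne k p n) = z := by simp [unitLift_apply]

/-- The bimodule `M` is `R ⊗_S R`, up to shifts of the grading and twists of the action of `∂_q`:
it is generated by an element `one` on which both actions of `S` agree, and a map out of `M ⊗ N` is
the same as an `S`-linear map out of `N`. -/
structure Ind (S : Subalgebra k (Poly k n)) (M : DgBimod k p n) where
  one : M.carrier
  central : ∀ s ∈ S, M.left s one = M.right s one
  gen : Gen M {one}
  tlift : ∀ {N Q : DgBimod k p n}, SHom S N Q → BHom (M ⊠ N) Q
  tlift_one : ∀ {N Q : DgBimod k p n} (α : SHom S N Q) (l : N.carrier),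
    tlift α (tmul one l) = α l

attribute [simp] Ind.tlift_one

namespace Ind

variable (I : Ind S M)

/-- The bimodule map that sends the generator to `z`. -/
def lift (z : Q.carrier) (hz : ∀ s ∈ S, Q.left s z = Q.right s z) : BHom M Q :=
  (I.tlift (unitLift S z hz)).comp (tmulOne M)

@[simp] theorem lift_one (z : Q.carrier) (hz) : (I.lift z hz) I.one = z := by simp [lift]

theorem gen_tens {T : Set N.carrier} (hT : GenOver S N T) :
    Gen (M ⊠ N) ((fun t => tmul I.one t) '' T) := by
  intro P h1 h2 h3 x
  refine tens_induction (P := fun x => x ∈ P) P.zero_mem (fun m l => ?_)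
    (fun x y hx hy => P.add_mem hx hy) x
  have key : ∀ l, tmul I.one l ∈ P := by
    refine hT (P.comap (tmul I.one)) (fun a ha m hm => ?_) (fun a m hm => ?_) (fun t ht => ?_)
    · rw [Submodule.mem_comap, ← tmul_balanced, ← I.central a ha, ← tens_left]
      exact h1 a _ hm
    · rw [Submodule.mem_comap, ← tens_right]
      exact h2 a _ hm
    · exact h3 ⟨t, ht, rfl⟩
  refine I.gen (⨅ l, P.comap (tmulRight l)) (fun a m hm => ?_) (fun a m hm => ?_) ?_ m |>
    fun h => (Submodule.mem_iInf _).1 h l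
  · rw [Submodule.mem_iInf] at hm ⊢
    intro l
    rw [Submodule.mem_comap, tmulRight_apply, ← tens_left]
    exact h1 a _ (hm l)
  · rw [Submodule.mem_iInf] at hm ⊢
    intro l
    rw [Submodule.mem_comap, tmulRight_apply, tmul_balanced]
    exact hm _
  · rintro _ rfl
    rw [SetLike.mem_coe, Submodule.mem_iInf]
    exact key

/-- Over a quadratic extension `S ⊂ R` with basis `1, v`, the bimodule `R ⊗_S R` is generated by
`1` and `v` under the right action alone. -/
theorem ext_quad {v : Poly k n} (B : QuadBasis S v) {f g : SHom S' M Q}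
    (h0 : f I.one = g I.one) (h1 : f (M.left v I.one) = g (M.left v I.one)) (x : M.carrier) :
    f x = g x := by
  have key : ∀ x, x ∈ ⨅ r, LinearMap.eqLocus (f.lin.comp (M.left r)) (g.lin.comp (M.left r)) := by
    refine I.gen _ (fun a m hm => ?_) (fun a m hm => ?_) ?_
    · rw [Submodule.mem_iInf] at hm ⊢
      intro r
      have := hm (r * a)
      rwa [map_mul] at this
    · rw [Submodule.mem_iInf] at hm ⊢
      intro r
      have := hm r
      rw [LinearMap.mem_eqLocus, LinearMap.comp_apply, LinearMap.comp_apply] at this ⊢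
      rw [M.left_right, f.map_right, g.map_right, this]
    · rintro _ rfl
      rw [SetLike.mem_coe, Submodule.mem_iInf]
      intro r
      rw [LinearMap.mem_eqLocus, LinearMap.comp_apply, LinearMap.comp_apply]
      have h2 : M.left r I.one = M.right (B.c0 r) I.one + M.right (B.c1 r) (M.left v I.one) := by
        conv_lhs => rw [B.eq r]
        rw [map_add, map_mul, LinearMap.add_apply, Module.End.mul_apply,
          I.central _ (B.c0_mem r), I.central _ (B.c1_mem r), M.left_right]
      rw [h2, map_add, map_add, f.map_right, f.map_right, g.map_right, g.map_right, h0, h1]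
  simpa using (Submodule.mem_iInf _).1 (key x) 1

end Ind

/-- The unit `R`, possibly placed in another homological degree, as an induced bimodule. -/
def Ind.ofPoly (e : Poly k n ≃ₗ[k] M.carrier) (h1 : ∀ a f, M.left a (e f) = e (a * f))
    (h2 : ∀ a f, M.right a (e f) = e (a * f)) : Ind (⊤ : Subalgebra k (Poly k n)) M where
  one := e 1
  central s _ := by rw [h1, h2]
  gen P h _ h3 x := by
    have : x = M.left (e.symm x) (e 1) := by rw [h1, mul_one, e.apply_symm_apply]
    rw [this]
    exact h _ _ (h3 rfl)
  tlift {N Q} α := SHom.tensorLift (LinearMap.mk₂ k (fun x l => Q.left (e.symm x) (α l))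
      (fun _ _ _ => by simp) (fun _ _ _ => by simp) (fun _ _ _ => by simp) (fun _ _ _ => by simp))
    (fun a x l => by
      obtain ⟨f, rfl⟩ := e.surjective x
      simp [h2, mul_comm a])
    (fun a _ x l => by
      obtain ⟨f, rfl⟩ := e.surjective x
      simp [h1])
    (fun a x l => by simp [Q.left_right])
  tlift_one α l := (SHom.tensorLift_tmul _ _ _ _ _ _).trans (by simp)

/-- The linear map out of `R ⊗_S R` given by a balanced bilinear map. -/
def balLift {V : Type*} [AddCommGroup V] [Module k V] (F : Poly k n →ₗ[k] Poly k n →ₗ[k] V)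
    (hF : ∀ s ∈ S, ∀ f g, F (s * f) g = F f (s * g)) : (Poly k n ⊗[S] Poly k n) →ₗ[k] V :=
  let φ : (Poly k n ⊗[S] Poly k n) →+ V := TensorProduct.liftAddHom
    (AddMonoidHom.mk' (fun f => (F f).toAddMonoidHom) fun f g => by ext; simp)
    fun s f g => hF s s.2 f g
  { φ with
    map_smul' := fun c x => by
      change φ (c • x) = c • φ x
      refine TensorProduct.induction_on x (by simp) (fun f g => ?_) (fun x y hx hy => ?_)
      · rw [TensorProduct.smul_tmul']
        change F (c • f) g = c • F f g
        simp
      · rw [smul_add, map_add, map_add, hx, hy, smul_add] }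

@[simp] theorem balLift_tmul {V : Type*} [AddCommGroup V] [Module k V]
    (F : Poly k n →ₗ[k] Poly k n →ₗ[k] V) (hF : ∀ s ∈ S, ∀ f g, F (s * f) g = F f (s * g))
    (f g : Poly k n) : balLift F hF (f ⊗ₜ g) = F f g := rfl

/-- An identification of the underlying bimodule of `M` with `R ⊗_S R`. -/
structure TensorModel (S : Subalgebra k (Poly k n)) (M : DgBimod k p n) where
  e : (Poly k n ⊗[S] Poly k n) ≃ₗ[k] M.carrier
  left_e : ∀ a f g, M.left a (e (f ⊗ₜ g)) = e ((a * f) ⊗ₜ g)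
  right_e : ∀ a f g, M.right a (e (f ⊗ₜ g)) = e (f ⊗ₜ (a * g))

namespace TensorModel

variable (E : TensorModel S M)

theorem induction {P : M.carrier → Prop} (zero : P 0) (pure : ∀ f g, P (E.e (f ⊗ₜ g)))
    (add : ∀ x y, P x → P y → P (x + y)) (x : M.carrier) : P x := by
  obtain ⟨x, rfl⟩ := E.e.surjective x
  refine TensorProduct.induction_on x (by rwa [map_zero]) pure (fun x y hx hy => ?_)
  rw [map_add]
  exact add _ _ hx hy

/-- The bilinear map `(x, l) ↦ f α (g l)` for `x = f ⊗ g`. -/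
def act (α : SHom S N Q) : M.carrier →ₗ[k] N.carrier →ₗ[k] Q.carrier :=
  (balLift (LinearMap.mk₂ k (fun f g => (Q.left f).comp (α.lin.comp (N.left g)))
      (fun _ _ _ => by ext; simp) (fun _ _ _ => by ext; simp) (fun _ _ _ => by ext; simp)
      (fun _ _ _ => by ext; simp))
    (fun s hs f g => LinearMap.ext fun l => by
      simp only [LinearMap.mk₂_apply, LinearMap.comp_apply]
      rw [mul_comm, map_mul, map_mul, Module.End.mul_apply, Module.End.mul_apply,
        α.map_left hs])).comp
    E.e.symm.toLinearMap

@[simp] theorem act_tmul (α : SHom S N Q) (f g : Poly k n) (l : N.carrier) :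
    E.act α (E.e (f ⊗ₜ g)) l = Q.left f (α (N.left g l)) := by
  simp [act]

/-- The universal property of `R ⊗_S R`. -/
def ind : Ind S M where
  one := E.e (1 ⊗ₜ 1)
  central s hs := by
    rw [E.left_e, E.right_e]
    have := TensorProduct.smul_tmul (R := S) (⟨s, hs⟩ : S) (1 : Poly k n) (1 : Poly k n)
    exact congrArg E.e this
  gen P h1 h2 h3 x := by
    refine E.induction (P := fun x => x ∈ P) P.zero_mem (fun f g => ?_)
      (fun x y hx hy => P.add_mem hx hy) x
    have : E.e (f ⊗ₜ g) = M.left f (M.right g (E.e (1 ⊗ₜ 1))) := by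
      rw [E.right_e, E.left_e, mul_one, mul_one]
    rw [this]
    exact h1 _ _ (h2 _ _ (h3 rfl))
  tlift {N Q} α := SHom.tensorLift (E.act α)
    (fun a x l => by
      refine E.induction (P := fun x => E.act α (M.right a x) l = E.act α x (N.left a l)) (by simp)
        (fun f g => ?_) (fun x y hx hy => by simp only [map_add, LinearMap.add_apply, hx, hy]) x
      rw [E.right_e, E.act_tmul, E.act_tmul, mul_comm, map_mul]; rfl)
    (fun a _ x l => by
      refine E.induction (P := fun x => E.act α (M.left a x) l = Q.left a (E.act α x l)) (by simp)
        (fun f g => ?_) (fun x y hx hy => by simp only [map_add, LinearMap.add_apply, hx, hy]) x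
      rw [E.left_e, E.act_tmul, E.act_tmul, map_mul]; rfl)
    (fun a x l => by
      refine E.induction (P := fun x => E.act α x (N.right a l) = Q.right a (E.act α x l)) (by simp)
        (fun f g => ?_) (fun x y hx hy => by simp only [map_add, LinearMap.add_apply, hx, hy]) x
      rw [E.act_tmul, E.act_tmul, ← Q.left_right, N.left_right, α.map_right])
  tlift_one α l := (SHom.tensorLift_tmul _ _ _ _ _ _).trans (by simp)

/-- The map `f ⊗ g ↦ φ f g` to polynomials. -/
def coef (φ : Poly k n →ₗ[S] Poly k n) : M.carrier →ₗ[k] Poly k n :=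
  (balLift (LinearMap.mk₂ k (fun f g => φ f * g) (fun _ _ _ => by simp [add_mul])
      (fun c f g => by
        have : φ (c • f) = c • φ f := by
          have := φ.map_smul (algebraMap k S c) f
          simpa only [algebraMap_smul] using this
        rw [this, smul_mul_assoc])
      (fun _ _ _ => by rw [mul_add]) (fun c f g => by rw [mul_smul_comm]))
    (fun s hs f g => by
      have : φ (s * f) = s * φ f := φ.map_smul (⟨s, hs⟩ : S) f
      simp only [LinearMap.mk₂_apply, this]
      ring)).comp E.e.symm.toLinearMap

@[simp] theorem coef_e (φ : Poly k n →ₗ[S] Poly k n) (f g : Poly k n) :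
    E.coef φ (E.e (f ⊗ₜ g)) = φ f * g := by
  simp [coef]

theorem coef_left (φ : Poly k n →ₗ[S] Poly k n) {s : Poly k n} (hs : s ∈ S) (x : M.carrier) :
    E.coef φ (M.left s x) = s * E.coef φ x := by
  refine E.induction (P := fun x => E.coef φ (M.left s x) = s * E.coef φ x) (by simp)
    (fun f g => ?_) (fun x y hx hy => by simp only [map_add, mul_add, hx, hy]) x
  have : φ (s * f) = s * φ f := φ.map_smul (⟨s, hs⟩ : S) f
  rw [E.left_e, E.coef_e, E.coef_e, this, mul_assoc]

theorem coef_right (φ : Poly k n →ₗ[S] Poly k n) (a : Poly k n) (x : M.carrier) :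
    E.coef φ (M.right a x) = a * E.coef φ x := by
  refine E.induction (P := fun x => E.coef φ (M.right a x) = a * E.coef φ x) (by simp)
    (fun f g => ?_) (fun x y hx hy => by simp only [map_add, mul_add, hx, hy]) x
  rw [E.right_e, E.coef_e, E.coef_e, mul_left_comm]

theorem coef_one (φ : Poly k n →ₗ[S] Poly k n) : E.coef φ E.ind.one = φ 1 :=
  (E.coef_e φ 1 1).trans (mul_one _)

theorem coef_left_one (φ : Poly k n →ₗ[S] Poly k n) (a : Poly k n) :
    E.coef φ (M.left a E.ind.one) = φ a := by
  change E.coef φ (M.left a (E.e (1 ⊗ₜ 1))) = φ a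
  rw [E.left_e, E.coef_e, mul_one, mul_one]

variable {v : Poly k n} (B : QuadBasis S v)

/-- The `S`-linear map that sends `1 ⊗ 1` to `z0` and `v ⊗ 1` to `z1`. -/
def quadLift (z0 z1 : Q.carrier) (h0 : ∀ s ∈ S', Q.left s z0 = Q.right s z0)
    (h1 : ∀ s ∈ S', Q.left s z1 = Q.right s z1) (hS : S' ≤ S) : SHom S' M Q :=
  SHom.mk
    { toFun := fun x => Q.right (E.coef B.c0 x) z0 + Q.right (E.coef B.c1 x) z1
      map_add' := fun x y => by simp only [map_add, LinearMap.add_apply]; abel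
      map_smul' := fun c x => by simp }
    (fun s hs x => by
      change Q.right _ z0 + Q.right _ z1 = Q.left s (Q.right _ z0 + Q.right _ z1)
      rw [map_add, Q.left_right, Q.left_right, h0 s hs, h1 s hs, E.coef_left _ (hS hs),
        E.coef_left _ (hS hs), mul_comm, mul_comm s, map_mul, map_mul]; rfl)
    (fun a x => by
      change Q.right _ z0 + Q.right _ z1 = Q.right a (Q.right _ z0 + Q.right _ z1)
      rw [map_add, E.coef_right, E.coef_right, map_mul, map_mul]; rfl)

theorem quadLift_apply (z0 z1 : Q.carrier) (h0 h1 hS) (x : M.carrier) :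
    (E.quadLift (S' := S') B z0 z1 h0 h1 hS) x =
      Q.right (E.coef B.c0 x) z0 + Q.right (E.coef B.c1 x) z1 := rfl

@[simp] theorem quadLift_one (z0 z1 : Q.carrier) (h0 h1 hS) :
    (E.quadLift (S' := S') B z0 z1 h0 h1 hS) E.ind.one = z0 := by
  rw [quadLift_apply, coef_one, coef_one, B.c0_of_mem S.one_mem, B.c1_of_mem S.one_mem]
  simp

@[simp] theorem quadLift_left_one (z0 z1 : Q.carrier) (h0 h1 hS) :
    (E.quadLift (S' := S') B z0 z1 h0 h1 hS) (M.left v E.ind.one) = z1 := by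
  rw [quadLift_apply, coef_left_one, coef_left_one, B.c0_self, B.c1_self]
  simp

end TensorModel

end Induced

/-! ### The elementary complexes as mapping cones -/

section Elementary

variable {k : Type u} [Field k] {p n : ℕ}

section TwoTermCone

variable {X Y : EqBimod k p n (2 : ℤ)}

theorem mem_deg_of_conc {t₀ : ℤ} {x : X.carrier} {jt : ℤ × ℤ} (h : jt.2 = t₀)
    (hx : (show (conc X t₀).carrier from x) ∈ (conc X t₀).deg jt) : x ∈ X.deg jt.1 := by
  have h' : x ∈ if jt.2 = t₀ then X.deg jt.1 else ⊥ := hx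
  rwa [if_pos h] at h'

theorem eq_zero_of_conc {t₀ : ℤ} {x : X.carrier} {jt : ℤ × ℤ} (h : jt.2 ≠ t₀)
    (hx : (show (conc X t₀).carrier from x) ∈ (conc X t₀).deg jt) : x = 0 := by
  have h' : x ∈ if jt.2 = t₀ then X.deg jt.1 else ⊥ := hx
  rwa [if_neg h, Submodule.mem_bot] at h'

/-- A morphism of modules, seen as a bimodule map of complexes concentrated in degree `t₀`. -/
def concBHom (f : X ⟶ Y) (t₀ : ℤ) : BHom (conc X t₀) (conc Y t₀) := by
  exact ⟨f.1, fun a _ => f.2.1.1 a, f.2.1.2.1⟩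

/-- A morphism of modules, seen as a morphism of complexes concentrated in degree `t₀`. -/
def concMap (f : X ⟶ Y) (t₀ : ℤ) : DgHom (conc X t₀) (conc Y t₀) where
  hom := concBHom f t₀
  map_D := f.2.2
  map_d _ := map_zero f.1
  map_deg jt x hx := by
    obtain ⟨j, t⟩ := jt
    by_cases h : t = t₀
    · subst h
      exact conc_mem t (f.2.1.2.2 _ _ (mem_deg_of_conc rfl hx))
    · have h1 : x = 0 := eq_zero_of_conc h hx
      rw [h1, map_zero]
      exact zero_mem _

/-- The identification of the underlying spaces of a two-term complex and of a mapping cone. -/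
def twoTermId (f : X ⟶ Y) (t₀ : ℤ) : BHom (cone (concMap f t₀)) (twoTerm f t₀) := by
  exact ⟨LinearMap.id, fun _ _ _ => rfl, fun _ _ => rfl⟩

/-- The inverse of `twoTermId`. -/
def twoTermIdInv (f : X ⟶ Y) (t₀ : ℤ) : BHom (twoTerm f t₀) (cone (concMap f t₀)) := by
  exact ⟨LinearMap.id, fun _ _ _ => rfl, fun _ _ => rfl⟩

/-- A two-term complex is a mapping cone. -/
def twoTermHom (f : X ⟶ Y) (t₀ : ℤ) : DgHom (cone (concMap f t₀)) (twoTerm f t₀) where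
  hom := twoTermId f t₀
  map_D _ := rfl
  map_d z := by
    have h : ((-(0 : X.carrier), f.1 z.1 + 0) : X.carrier × Y.carrier) = (0, f.1 z.1) := by
      rw [neg_zero, add_zero]
    exact h
  map_deg jt z hz := by
    obtain ⟨j, t⟩ := jt
    obtain ⟨h1, h2⟩ := hz
    refine ⟨?_, h2⟩
    change (z.1 : X.carrier) ∈ if t = t₀ + 1 then X.deg j else ⊥
    by_cases h : t = t₀ + 1
    · rw [if_pos h]
      have h3 := mem_deg_of_conc (by rw [h]; simp) h1
      rwa [show ((j, t) - (0, 1) : ℤ × ℤ).1 = j from sub_zero j] at h3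
    · rw [if_neg h]
      exact eq_zero_of_conc (fun h' => h (by rw [← h']; simp)) h1

/-- A two-term complex is isomorphic to a mapping cone. -/
def twoTermRetract (f : X ⟶ Y) (t₀ : ℤ) : DefRetract (cone (concMap f t₀)) (twoTerm f t₀) :=
  .ofIso (twoTermHom f t₀) (twoTermIdInv f t₀) (fun z => Eq.refl (α := X.carrier × Y.carrier) z)
    (fun z => Eq.refl (α := X.carrier × Y.carrier) z)

end TwoTermCone

variable [Fact p.Prime] [CharP k p]

open DgBimod

variable (k p n) in
/-- The bimodule `R` in homological degree `t`. -/
def uC (t : ℤ) : DgBimod k p n := conc (unitBimod k p n (2 : ℤ)) t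

variable (k p n) in
/-- The bimodule `R` is induced from the whole of `R`. -/
def uInd (t : ℤ) : Ind (⊤ : Subalgebra k (Poly k n)) (uC k p n t) :=
  Ind.ofPoly (by exact LinearEquiv.refl k (Poly k n)) (fun _ _ => rfl) (fun _ _ => rfl)

variable (k p n) in
/-- The generator of `R`. -/
def uOne (t : ℤ) : (uC k p n t).carrier := (uInd k p n t).one

variable (k p) in
/-- The bimodule `B_i` in homological degree zero. -/
def bC (i : Fin (n - 1)) : DgBimod k p n := conc (bBimod k p i) 0

variable (k p) in
/-- The underlying bimodule of `B_i`. -/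
def bModel (i : Fin (n - 1)) : TensorModel (symSubalgebra k i) (bC k p i) where
  e := by exact LinearEquiv.refl k _
  left_e a f g := (Algebra.TensorProduct.tmul_mul_tmul a f 1 g).trans
    (congrArg (fun g => (a * f) ⊗ₜ g) (one_mul g))
  right_e a f g := (Algebra.TensorProduct.tmul_mul_tmul 1 f a g).trans
    (congrArg (fun f => f ⊗ₜ (a * g)) (one_mul f))

variable (k p) in
/-- The generator of `B_i`. -/
def bOne (i : Fin (n - 1)) : (bC k p i).carrier := (bModel k p i).ind.one

variable (k) in
/-- The bimodule `q ^ {-2} B_i ^ {-(x_i + x_{i + 1})}` in homological degree `-1`. -/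
def bnC (hp : 2 < p) (i : Fin (n - 1)) : DgBimod k p n := conc (bNegBimod k hp i) (-1)

variable (k) in
/-- The underlying bimodule of the twist of `B_i`. -/
def bnModel (hp : 2 < p) (i : Fin (n - 1)) : TensorModel (symSubalgebra k i) (bnC k hp i) where
  e := by exact LinearEquiv.refl k _
  left_e a f g := (Algebra.TensorProduct.tmul_mul_tmul a f 1 g).trans
    (congrArg (fun g => (a * f) ⊗ₜ g) (one_mul g))
  right_e a f g := (Algebra.TensorProduct.tmul_mul_tmul 1 f a g).trans
    (congrArg (fun f => f ⊗ₜ (a * g)) (one_mul f))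

variable (k) in
/-- The generator of the twist of `B_i`. -/
def bnOne (hp : 2 < p) (i : Fin (n - 1)) : (bnC k hp i).carrier := (bnModel k hp i).ind.one

@[simp] theorem uC_d (t : ℤ) (x : (uC k p n t).carrier) : (uC k p n t).d x = 0 := rfl

@[simp] theorem bC_d (i : Fin (n - 1)) (x : (bC k p i).carrier) : (bC k p i).d x = 0 := rfl

@[simp] theorem bnC_d (hp : 2 < p) (i : Fin (n - 1)) (x : (bnC k hp i).carrier) :
    (bnC k hp i).d x = 0 := rfl

@[simp] theorem uC_D (t : ℤ) : (uC k p n t).D (uOne k p n t) = 0 := by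
  have h : dq k n (1 : Poly k n) = 0 := Derivation.map_one_eq_zero _
  exact h

theorem bTwistD_one (i : Fin (n - 1)) (f : Poly k n) :
    bTwistD i f ((1 : Poly k n) ⊗ₜ (1 : Poly k n)) = (1 : Poly k n) ⊗ₜ f := by
  have h : dq k n (1 : Poly k n) = 0 := Derivation.map_one_eq_zero _
  rw [bTwistD_tmul, dqTwist_apply, h, TensorProduct.zero_tmul, zero_add, zero_add, mul_one]

@[simp] theorem bC_D (i : Fin (n - 1)) : (bC k p i).D (bOne k p i) = 0 := by
  have h := bTwistD_one (k := k) i 0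
  rw [TensorProduct.tmul_zero] at h
  exact h

@[simp] theorem bnC_D (hp : 2 < p) (i : Fin (n - 1)) : (bnC k hp i).D (bnOne k hp i) =
    -(bnC k hp i).right (xa k i + xb k i) (bnOne k hp i) := by
  have h := bTwistD_one (k := k) i (negForm k i)
  have h2 := (bnModel k hp i).right_e (xa k i + xb k i) 1 1
  rw [mul_one] at h2
  change bTwistD i (negForm k i) ((1 : Poly k n) ⊗ₜ (1 : Poly k n)) = _
  rw [h, negForm, TensorProduct.tmul_neg]
  exact congrArg Neg.neg h2.symm

theorem uOne_mem (t : ℤ) : uOne k p n t ∈ (uC k p n t).deg (0, t) :=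
  conc_mem t (MvPolynomial.isWeightedHomogeneous_one k (fun _ : Fin n => (2 : ℤ)))

theorem one_mem_bDeg (i : Fin (n - 1)) :
    ((1 : Poly k n) ⊗ₜ (1 : Poly k n) : BCarrier (k := k) i) ∈ bDeg i 0 := by
  have h : ∀ {a b : Poly k n} {e e' : ℤ},
      a ∈ MvPolynomial.weightedHomogeneousSubmodule k (fun _ : Fin n => (2 : ℤ)) e →
      b ∈ MvPolynomial.weightedHomogeneousSubmodule k (fun _ : Fin n => (2 : ℤ)) e' →
      (a ⊗ₜ b : BCarrier (k := k) i) ∈ bDeg i (e + e') := tmul_mem_tensorDeg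
  have h1 := MvPolynomial.isWeightedHomogeneous_one k (fun _ : Fin n => (2 : ℤ))
  have h2 := h h1 h1
  rwa [add_zero] at h2

theorem bOne_mem (i : Fin (n - 1)) : bOne k p i ∈ (bC k p i).deg (0, 0) :=
  conc_mem 0 (one_mem_bDeg i)

theorem bnOne_mem (hp : 2 < p) (i : Fin (n - 1)) : bnOne k hp i ∈ (bnC k hp i).deg (-2, -1) :=
  conc_mem (X := bNegBimod k hp i) (-1) (by
    change _ ∈ bDeg i (-2 - -2)
    exact one_mem_bDeg i)

theorem tmul_mem' {M N : DgBimod k p n} {a b c : ℤ × ℤ} {m : M.carrier} {l : N.carrier}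
    (hm : m ∈ M.deg a) (hl : l ∈ N.deg b) (h : a + b = c) : tmul m l ∈ (M ⊠ N).deg c :=
  h ▸ tmul_mem hm hl

theorem left_X_mem {M : DgBimod k p n} (l : Fin n) {m : M.carrier} {j t : ℤ}
    (hm : m ∈ M.deg (j, t)) : M.left (MvPolynomial.X l) m ∈ M.deg (2 + j, t) := by
  rw [show ((2 + j, t) : ℤ × ℤ) = (2, 0) + (j, t) by simp]
  exact M.left_mem (MvPolynomial.isWeightedHomogeneous_X _ _ l) hm

theorem right_X_mem {M : DgBimod k p n} (l : Fin n) {m : M.carrier} {j t : ℤ}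
    (hm : m ∈ M.deg (j, t)) : M.right (MvPolynomial.X l) m ∈ M.deg (2 + j, t) := by
  rw [show ((2 + j, t) : ℤ × ℤ) = (2, 0) + (j, t) by simp]
  exact M.right_mem (MvPolynomial.isWeightedHomogeneous_X _ _ l) hm

variable (k p) in
/-- The multiplication map `B_i → R`. -/
def brHom (i : Fin (n - 1)) : DgHom (bC k p i) (uC k p n 0) := concMap (br k p i) 0

@[simp] theorem brHom_one (i : Fin (n - 1)) : (brHom k p i).hom (bOne k p i) = uOne k p n 0 :=
  (brLin_tmul i 1 1).trans (one_mul (1 : Poly k n))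

variable (k) in
/-- The map from `R` to the twist of `B_i`. -/
def rbHom (hp : 2 < p) (i : Fin (n - 1)) : DgHom (uC k p n (-1)) (bnC k hp i) :=
  concMap (rb k hp i) (-1)

@[simp] theorem rbHom_one (hp : 2 < p) (i : Fin (n - 1)) :
    (rbHom k hp i).hom (uOne k p n (-1)) = (bnC k hp i).left (xb k i) (bnOne k hp i) -
      (bnC k hp i).right (xa k i) (bnOne k hp i) := by
  have h1 := (bnModel k hp i).left_e (xb k i) 1 1
  have h2 := (bnModel k hp i).right_e (xa k i) 1 1
  rw [mul_one] at h1 h2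
  refine ((rbLin_apply (k := k) i 1).trans (one_mul _)).trans ?_
  exact (congrArg₂ (fun x y : (bnC k hp i).carrier => x - y) h1 h2).symm

variable (k p) in
/-- The complex `T_i` as a mapping cone. -/
def posC (i : Fin (n - 1)) : DgBimod k p n := cone (brHom k p i)

variable (k) in
/-- The complex `T_i'` as a mapping cone. -/
def negC (hp : 2 < p) (i : Fin (n - 1)) : DgBimod k p n := cone (rbHom k hp i)

variable (k p) in
/-- The complex `T_i` is isomorphic to its model as a mapping cone. -/
def posRetract (i : Fin (n - 1)) : DefRetract (posC k p i) (rouquierPos k p i) :=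
  twoTermRetract (br k p i) 0

variable (k) in
/-- The complex `T_i'` is isomorphic to its model as a mapping cone. -/
def negRetract (hp : 2 < p) (i : Fin (n - 1)) : DefRetract (negC k hp i) (rouquierNeg k hp i) :=
  twoTermRetract (rb k hp i) (-1)

namespace cone

variable {X Y Q N : DgBimod k p n} (f : DgHom X Y)

/-- The projection of a cone to the source of `f`. -/
def fst : BHom (cone f) X := desc (SHom.id X) 0

/-- The projection of a cone to the target of `f`. -/
def snd : BHom (cone f) Y := desc 0 (SHom.id Y)

@[simp] theorem fst_inl (x : X.carrier) : fst f (inl f x) = x := by simp [fst]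
@[simp] theorem fst_inr (y : Y.carrier) : fst f (inr f y) = 0 := by simp [fst]
@[simp] theorem snd_inl (x : X.carrier) : snd f (inl f x) = 0 := by simp [snd]
@[simp] theorem snd_inr (y : Y.carrier) : snd f (inr f y) = y := by simp [snd]

variable {f}
variable {S S' : Subalgebra k (Poly k n)} (I : Ind S X) (J : Ind S' Y)

/-- The map out of `cone f ⊗ N` given by its values on both generators of the cone. -/
def tlift (α : SHom S N Q) (γ : SHom S' N Q) : BHom (cone f ⊠ N) Q :=
  (I.tlift α).comp (SHom.tmap (fst f) (SHom.id N)) +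
    (J.tlift γ).comp (SHom.tmap (snd f) (SHom.id N))

@[simp] theorem tlift_inl (α : SHom S N Q) (γ : SHom S' N Q) (l : N.carrier) :
    (tlift (f := f) I J α γ) (tmul (inl f I.one) l) = α l := by
  simp [tlift]

@[simp] theorem tlift_inr (α : SHom S N Q) (γ : SHom S' N Q) (l : N.carrier) :
    (tlift (f := f) I J α γ) (tmul (inr f J.one) l) = γ l := by
  simp [tlift]

theorem gen_tens {T T' : Set N.carrier} (hT : GenOver S N T) (hT' : GenOver S' N T') :
    Gen (cone f ⊠ N) ((fun t => tmul (inl f I.one) t) '' T ∪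
      (fun t => tmul (inr f J.one) t) '' T') := by
  intro P h1 h2 h3 z
  have hX : ∀ x, (SHom.tmap (inl f) (SHom.id N)) x ∈ P := by
    refine I.gen_tens hT (P.comap (SHom.tmap (inl f) (SHom.id N)).lin) (fun a m hm => ?_)
      (fun a m hm => ?_) ?_
    · rw [Submodule.mem_comap, BHom.map_left]; exact h1 a _ hm
    · rw [Submodule.mem_comap, SHom.map_right]; exact h2 a _ hm
    · rintro _ ⟨t, ht, rfl⟩
      rw [SetLike.mem_coe, Submodule.mem_comap, SHom.tmap_tmul]
      exact h3 (Or.inl ⟨t, ht, rfl⟩)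
  have hY : ∀ y, (SHom.tmap (inr f) (SHom.id N)) y ∈ P := by
    refine J.gen_tens hT' (P.comap (SHom.tmap (inr f) (SHom.id N)).lin) (fun a m hm => ?_)
      (fun a m hm => ?_) ?_
    · rw [Submodule.mem_comap, BHom.map_left]; exact h1 a _ hm
    · rw [Submodule.mem_comap, SHom.map_right]; exact h2 a _ hm
    · rintro _ ⟨t, ht, rfl⟩
      rw [SetLike.mem_coe, Submodule.mem_comap, SHom.tmap_tmul]
      exact h3 (Or.inr ⟨t, ht, rfl⟩)
  refine tens_induction (P := fun z => z ∈ P) P.zero_mem (fun c l => ?_)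
    (fun x y hx hy => P.add_mem hx hy) z
  obtain ⟨x, y, rfl⟩ := eq_inl_add_inr f c
  rw [map_add, LinearMap.add_apply]
  refine P.add_mem ?_ ?_
  · have := hX (tmul x l)
    rwa [SHom.tmap_tmul] at this
  · have := hY (tmul y l)
    rwa [SHom.tmap_tmul] at this

end cone

variable (k p) in
/-- The generator `1 ⊗ 1` of `B_i` in `T_i`. -/
def posB (i : Fin (n - 1)) : (posC k p i).carrier := cone.inl (brHom k p i) (bOne k p i)

variable (k p) in
/-- The generator of `R` in `T_i`. -/
def posR (i : Fin (n - 1)) : (posC k p i).carrier := cone.inr (brHom k p i) (uOne k p n 0)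

variable (k) in
/-- The generator of `R` in `T_i'`. -/
def negR (hp : 2 < p) (i : Fin (n - 1)) : (negC k hp i).carrier :=
  cone.inl (rbHom k hp i) (uOne k p n (-1))

variable (k) in
/-- The generator `1 ⊗ 1` of the twist of `B_i` in `T_i'`. -/
def negB (hp : 2 < p) (i : Fin (n - 1)) : (negC k hp i).carrier :=
  cone.inr (rbHom k hp i) (bnOne k hp i)

theorem cone.inl_mem' {X Y : DgBimod k p n} {f : DgHom X Y} {j t s : ℤ} {x : X.carrier}
    (hx : x ∈ X.deg (j, t)) (hs : 1 + t = s) : cone.inl f x ∈ (cone f).deg (j, s) := by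
  have h := cone.inl_mem (f := f) hx
  rwa [Prod.mk_add_mk, zero_add, hs] at h

theorem posB_mem (i : Fin (n - 1)) : posB k p i ∈ (posC k p i).deg (0, 1) :=
  cone.inl_mem' (bOne_mem i) (add_zero 1)

theorem posR_mem (i : Fin (n - 1)) : posR k p i ∈ (posC k p i).deg (0, 0) :=
  cone.inr_mem (uOne_mem 0)

theorem negR_mem (hp : 2 < p) (i : Fin (n - 1)) : negR k hp i ∈ (negC k hp i).deg (0, 0) :=
  cone.inl_mem' (uOne_mem (-1)) (by norm_num)

theorem negB_mem (hp : 2 < p) (i : Fin (n - 1)) : negB k hp i ∈ (negC k hp i).deg (-2, -1) :=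
  cone.inr_mem (bnOne_mem hp i)

theorem signOp_even {M : DgBimod k p n} {j : ℤ} {m : M.carrier} (hm : m ∈ M.deg (j, 0)) :
    M.signOp m = m := by
  rw [signOp_of_mem hm]; simp

theorem signOp_odd {M : DgBimod k p n} {j : ℤ} {m : M.carrier} (hm : m ∈ M.deg (j, 1)) :
    M.signOp m = -m := by
  rw [signOp_of_mem hm]; simp

theorem signOp_odd' {M : DgBimod k p n} {j : ℤ} {m : M.carrier} (hm : m ∈ M.deg (j, -1)) :
    M.signOp m = -m := by
  rw [signOp_of_mem hm]; simp

@[simp] theorem signOp_posB (i : Fin (n - 1)) : (posC k p i).signOp (posB k p i) = -posB k p i :=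
  signOp_odd (posB_mem i)

@[simp] theorem signOp_posR (i : Fin (n - 1)) : (posC k p i).signOp (posR k p i) = posR k p i :=
  signOp_even (posR_mem i)

@[simp] theorem signOp_negR (hp : 2 < p) (i : Fin (n - 1)) :
    (negC k hp i).signOp (negR k hp i) = negR k hp i :=
  signOp_even (negR_mem hp i)

@[simp] theorem signOp_negB (hp : 2 < p) (i : Fin (n - 1)) :
    (negC k hp i).signOp (negB k hp i) = -negB k hp i :=
  signOp_odd' (negB_mem hp i)

@[simp] theorem signOp_bOne (i : Fin (n - 1)) : (bC k p i).signOp (bOne k p i) = bOne k p i :=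
  signOp_even (bOne_mem i)

@[simp] theorem posC_D_posB (i : Fin (n - 1)) : (posC k p i).D (posB k p i) = 0 :=
  (cone.D_inl _ _).trans (by rw [bC_D, map_zero]; rfl)

@[simp] theorem posC_D_posR (i : Fin (n - 1)) : (posC k p i).D (posR k p i) = 0 :=
  (cone.D_inr _ _).trans (by rw [uC_D, map_zero]; rfl)

@[simp] theorem posC_d_posB (i : Fin (n - 1)) : (posC k p i).d (posB k p i) = posR k p i :=
  (cone.d_inl _ _).trans (by rw [bC_d, map_zero, sub_zero, brHom_one]; rfl)

@[simp] theorem posC_d_posR (i : Fin (n - 1)) : (posC k p i).d (posR k p i) = 0 :=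
  (cone.d_inr _ _).trans (by rw [uC_d, map_zero]; rfl)

@[simp] theorem negC_D_negR (hp : 2 < p) (i : Fin (n - 1)) :
    (negC k hp i).D (negR k hp i) = 0 :=
  (cone.D_inl _ _).trans (by rw [uC_D, map_zero]; rfl)

@[simp] theorem negC_D_negB (hp : 2 < p) (i : Fin (n - 1)) :
    (negC k hp i).D (negB k hp i) = -(negC k hp i).right (xa k i + xb k i) (negB k hp i) :=
  (cone.D_inr _ _).trans (by rw [bnC_D, map_neg, SHom.map_right]; rfl)

@[simp] theorem negC_d_negR (hp : 2 < p) (i : Fin (n - 1)) :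
    (negC k hp i).d (negR k hp i) = (negC k hp i).left (xb k i) (negB k hp i) -
      (negC k hp i).right (xa k i) (negB k hp i) :=
  (cone.d_inl _ _).trans (by
    rw [uC_d, map_zero, sub_zero, rbHom_one, map_sub, SHom.map_right, BHom.map_left]; rfl)

@[simp] theorem negC_d_negB (hp : 2 < p) (i : Fin (n - 1)) :
    (negC k hp i).d (negB k hp i) = 0 :=
  (cone.d_inr _ _).trans (by rw [bnC_d, map_zero]; rfl)

theorem bOne_central {i : Fin (n - 1)} {s : Poly k n} (hs : s ∈ symSubalgebra k i) :
    (bC k p i).left s (bOne k p i) = (bC k p i).right s (bOne k p i) :=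
  (bModel k p i).ind.central s hs

theorem posB_central {i : Fin (n - 1)} {s : Poly k n} (hs : s ∈ symSubalgebra k i) :
    (posC k p i).left s (posB k p i) = (posC k p i).right s (posB k p i) :=
  ((cone.inl (brHom k p i)).map_left s _).symm.trans
    ((congrArg _ (bOne_central hs)).trans (SHom.map_right _ _ _))

theorem posR_central {i : Fin (n - 1)} (s : Poly k n) :
    (posC k p i).left s (posR k p i) = (posC k p i).right s (posR k p i) :=
  ((cone.inr (brHom k p i)).map_left s _).symm.trans
    ((congrArg _ ((uInd k p n 0).central s Algebra.mem_top)).trans (SHom.map_right _ _ _))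

theorem negR_central {hp : 2 < p} {i : Fin (n - 1)} (s : Poly k n) :
    (negC k hp i).left s (negR k hp i) = (negC k hp i).right s (negR k hp i) :=
  ((cone.inl (rbHom k hp i)).map_left s _).symm.trans
    ((congrArg _ ((uInd k p n (-1)).central s Algebra.mem_top)).trans (SHom.map_right _ _ _))

theorem negB_central {hp : 2 < p} {i : Fin (n - 1)} {s : Poly k n}
    (hs : s ∈ symSubalgebra k i) :
    (negC k hp i).left s (negB k hp i) = (negC k hp i).right s (negB k hp i) :=
  ((cone.inr (rbHom k hp i)).map_left s _).symm.trans
    ((congrArg _ ((bnModel k hp i).ind.central s hs)).trans (SHom.map_right _ _ _))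

theorem posC_gen (i : Fin (n - 1)) : Gen (posC k p i) {posB k p i, posR k p i} := by
  have h := cone.gen (f := brHom k p i) (bModel k p i).ind.gen (uInd k p n 0).gen
  rw [Set.image_singleton, Set.image_singleton, Set.singleton_union] at h
  exact h

theorem negC_gen (hp : 2 < p) (i : Fin (n - 1)) :
    Gen (negC k hp i) {negR k hp i, negB k hp i} := by
  have h := cone.gen (f := rbHom k hp i) (uInd k p n (-1)).gen (bnModel k hp i).ind.gen
  rw [Set.image_singleton, Set.image_singleton, Set.singleton_union] at h
  exact h

/-- An element that commutes with the polynomials symmetric in `x` and `y` gives rise to one that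
commutes with all polynomials. -/
theorem IsPair.central {i : Fin (n - 1)} {x y : Fin n} (h : IsPair i x y) {M : DgBimod k p n}
    {z : M.carrier} (hz : ∀ s ∈ symSubalgebra k i, M.left s z = M.right s z) (a : Poly k n) :
    M.left a (M.left (MvPolynomial.X x) z - M.right (MvPolynomial.X y) z) =
      M.right a (M.left (MvPolynomial.X x) z - M.right (MvPolynomial.X y) z) := by
  have hl : ∀ (a b : Poly k n) m, M.left a (M.left b m) = M.left (a * b) m := fun a b m => by
    rw [map_mul]; rfl
  have hr : ∀ (a b : Poly k n) m, M.right a (M.right b m) = M.right (a * b) m := fun a b m => by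
    rw [map_mul]; rfl
  have hs := hz _ h.sum_mem
  have hq := hz _ h.prod_mem
  have key : M.left (MvPolynomial.X x)
      (M.left (MvPolynomial.X x) z - M.right (MvPolynomial.X y) z) =
      M.right (MvPolynomial.X x) (M.left (MvPolynomial.X x) z - M.right (MvPolynomial.X y) z) := by
    have e1 : M.left (MvPolynomial.X x) (M.left (MvPolynomial.X x) z) =
        M.right (MvPolynomial.X x + MvPolynomial.X y) (M.left (MvPolynomial.X x) z) -
          M.right (MvPolynomial.X x * MvPolynomial.X y) z := by
      rw [hl, ← M.left_right, ← hs, ← hq, hl, ← LinearMap.sub_apply, ← map_sub]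
      congr 2; ring
    rw [map_sub, map_sub, e1, M.left_right, map_add, LinearMap.add_apply, hr]
    abel
  obtain ⟨b, hb, c, hc, rfl⟩ : ∃ b ∈ symSubalgebra k i, ∃ c ∈ symSubalgebra k i,
      a = b + MvPolynomial.X x * c :=
    ⟨_, (h.quadBasis k).c0_mem a, _, (h.quadBasis k).c1_mem a, (h.quadBasis k).eq a⟩
  have hsym : ∀ s ∈ symSubalgebra k i,
      M.left s (M.left (MvPolynomial.X x) z - M.right (MvPolynomial.X y) z) =
        M.right s (M.left (MvPolynomial.X x) z - M.right (MvPolynomial.X y) z) := by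
    intro s hs
    rw [map_sub, map_sub, hl, mul_comm, ← hl, hz s hs, M.left_right, M.left_right, hz s hs, hr, hr,
      mul_comm]
  rw [map_add, map_add, LinearMap.add_apply, LinearMap.add_apply, hsym b hb, mul_comm, ← hl, key,
    M.left_right, hsym c hc, hr, mul_comm]

end Elementary

/-! ### Maps out of tensor products with elementary complexes -/

section ElementaryMaps

variable {k : Type u} [Field k] {p n : ℕ}

theorem Gen.genOver_top {M : DgBimod k p n} {T : Set M.carrier} (hT : Gen M T) :
    GenOver (⊤ : Subalgebra k (Poly k n)) M T :=
  fun P h1 h2 h3 => hT P (fun a => h1 a Algebra.mem_top) h2 h3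

theorem left_comm (M : DgBimod k p n) (a b : Poly k n) (m : M.carrier) :
    M.left a (M.left b m) = M.left b (M.left a m) := by
  rw [← Module.End.mul_apply, ← map_mul, mul_comm, map_mul, Module.End.mul_apply]

theorem right_comm (M : DgBimod k p n) (a b : Poly k n) (m : M.carrier) :
    M.right a (M.right b m) = M.right b (M.right a m) := by
  rw [← Module.End.mul_apply, ← map_mul, mul_comm, map_mul, Module.End.mul_apply]

variable [Fact p.Prime] [CharP k p]

open DgBimod

variable {S : Subalgebra k (Poly k n)} {M N Q : DgBimod k p n}

theorem tmul_left_central {s : Poly k n} {m : M.carrier} (hm : M.left s m = M.right s m)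
    (l : N.carrier) : tmul m (N.left s l) = (M ⊠ N).left s (tmul m l) := by
  rw [← tmul_balanced, ← hm, tens_left]

theorem tmul_left_right {s : Poly k n} (m : M.carrier) {l : N.carrier}
    (hl : N.left s l = N.right s l) : tmul m (N.left s l) = (M ⊠ N).right s (tmul m l) := by
  rw [hl, tens_right]

theorem tmul_central {s : Poly k n} {m : M.carrier} {l : N.carrier}
    (hm : M.left s m = M.right s m) (hl : N.left s l = N.right s l) :
    (M ⊠ N).left s (tmul m l) = (M ⊠ N).right s (tmul m l) := by
  rw [← tmul_left_central hm, tmul_left_right m hl]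

/-- The map `R → Q`, with `R` in homological degree `t`, that sends `1` to an element on which both
actions of `S` agree. -/
def uLift (S : Subalgebra k (Poly k n)) (t : ℤ) (z : Q.carrier)
    (hz : ∀ s ∈ S, Q.left s z = Q.right s z) : SHom S (uC k p n t) Q :=
  (unitLift S z hz).comp
    (BHom.restr S ((uInd k p n t).lift (unitOne k p n) fun _ _ => unit_left_one _))

@[simp] theorem uLift_one (t : ℤ) (z : Q.carrier) (hz) :
    (uLift (p := p) S t z hz) (uOne k p n t) = z := by
  simp only [uLift, SHom.comp_apply, BHom.restr_apply, uOne, Ind.lift_one, unitLift_one]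

/-- The bimodule map `B_i → Q` that sends `1 ⊗ 1` to `z`. -/
def bLift (i : Fin (n - 1)) (z : Q.carrier)
    (hz : ∀ s ∈ symSubalgebra k i, Q.left s z = Q.right s z) : BHom (bC k p i) Q :=
  (bModel k p i).ind.lift z hz

@[simp] theorem bLift_one (i : Fin (n - 1)) (z : Q.carrier) (hz) :
    (bLift i z hz) (bOne k p i) = z := Ind.lift_one _ _ _

variable {i : Fin (n - 1)} {x y : Fin n}

/-- The map out of `B_i` that sends `1 ⊗ 1` to `z0` and `x ⊗ 1` to `z1`. -/
def bQuad (h : IsPair i x y) (hS : S ≤ symSubalgebra k i) (z0 z1 : Q.carrier)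
    (h0 : ∀ s ∈ S, Q.left s z0 = Q.right s z0) (h1 : ∀ s ∈ S, Q.left s z1 = Q.right s z1) :
    SHom S (bC k p i) Q :=
  (bModel k p i).quadLift (h.quadBasis k) z0 z1 h0 h1 hS

@[simp] theorem bQuad_one (h : IsPair i x y) (hS : S ≤ symSubalgebra k i) (z0 z1 : Q.carrier)
    (h0 h1) : (bQuad h hS z0 z1 h0 h1) (bOne k p i) = z0 :=
  TensorModel.quadLift_one _ _ _ _ _ _ _

@[simp] theorem bQuad_left_one (h : IsPair i x y) (hS : S ≤ symSubalgebra k i) (z0 z1 : Q.carrier)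
    (h0 h1) :
    (bQuad h hS z0 z1 h0 h1) ((bC k p i).left (MvPolynomial.X x) (bOne k p i)) = z1 :=
  TensorModel.quadLift_left_one _ _ _ _ _ _ _

/-- The map out of the twist of `B_i` that sends `1 ⊗ 1` to `z0` and `x ⊗ 1` to `z1`. -/
def bnQuad (hp : 2 < p) (h : IsPair i x y) (z0 z1 : Q.carrier)
    (h0 : ∀ s ∈ symSubalgebra k i, Q.left s z0 = Q.right s z0)
    (h1 : ∀ s ∈ symSubalgebra k i, Q.left s z1 = Q.right s z1) :
    SHom (symSubalgebra k i) (bnC k hp i) Q :=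
  (bnModel k hp i).quadLift (h.quadBasis k) z0 z1 h0 h1 le_rfl

@[simp] theorem bnQuad_one (hp : 2 < p) (h : IsPair i x y) (z0 z1 : Q.carrier) (h0 h1) :
    (bnQuad hp h z0 z1 h0 h1) (bnOne k hp i) = z0 :=
  TensorModel.quadLift_one _ _ _ _ _ _ _

@[simp] theorem bnQuad_left_one (hp : 2 < p) (h : IsPair i x y) (z0 z1 : Q.carrier) (h0 h1) :
    (bnQuad hp h z0 z1 h0 h1) ((bnC k hp i).left (MvPolynomial.X x) (bnOne k hp i)) = z1 :=
  TensorModel.quadLift_left_one _ _ _ _ _ _ _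

/-- The bimodule map out of the twist of `B_i` that sends `1 ⊗ 1` to `z`. -/
def bnLift (hp : 2 < p) (i : Fin (n - 1)) (z : Q.carrier)
    (hz : ∀ s ∈ symSubalgebra k i, Q.left s z = Q.right s z) : BHom (bnC k hp i) Q :=
  (bnModel k hp i).ind.lift z hz

@[simp] theorem bnLift_one (hp : 2 < p) (i : Fin (n - 1)) (z : Q.carrier) (hz) :
    (bnLift hp i z hz) (bnOne k hp i) = z := Ind.lift_one _ _ _

variable (k p) in
/-- The projection `T_i → B_i`. -/
def posFst (i : Fin (n - 1)) : BHom (posC k p i) (bC k p i) := cone.fst (brHom k p i)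

variable (k p) in
/-- The projection `T_i → R`. -/
def posSnd (i : Fin (n - 1)) : BHom (posC k p i) (uC k p n 0) := cone.snd (brHom k p i)

@[simp] theorem posFst_posB (i : Fin (n - 1)) : posFst k p i (posB k p i) = bOne k p i :=
  cone.fst_inl _ _

@[simp] theorem posFst_posR (i : Fin (n - 1)) : posFst k p i (posR k p i) = 0 := cone.fst_inr _ _

@[simp] theorem posSnd_posB (i : Fin (n - 1)) : posSnd k p i (posB k p i) = 0 := cone.snd_inl _ _

@[simp] theorem posSnd_posR (i : Fin (n - 1)) : posSnd k p i (posR k p i) = uOne k p n 0 :=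
  cone.snd_inr _ _

variable (k) in
/-- The projection of `T_i'` to `R`. -/
def negFst (hp : 2 < p) (i : Fin (n - 1)) : BHom (negC k hp i) (uC k p n (-1)) :=
  cone.fst (rbHom k hp i)

variable (k) in
/-- The projection of `T_i'` to the twist of `B_i`. -/
def negSnd (hp : 2 < p) (i : Fin (n - 1)) : BHom (negC k hp i) (bnC k hp i) :=
  cone.snd (rbHom k hp i)

@[simp] theorem negFst_negR (hp : 2 < p) (i : Fin (n - 1)) :
    negFst k hp i (negR k hp i) = uOne k p n (-1) := cone.fst_inl _ _

@[simp] theorem negFst_negB (hp : 2 < p) (i : Fin (n - 1)) :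
    negFst k hp i (negB k hp i) = 0 := cone.fst_inr _ _

@[simp] theorem negSnd_negR (hp : 2 < p) (i : Fin (n - 1)) :
    negSnd k hp i (negR k hp i) = 0 := cone.snd_inl _ _

@[simp] theorem negSnd_negB (hp : 2 < p) (i : Fin (n - 1)) :
    negSnd k hp i (negB k hp i) = bnOne k hp i := cone.snd_inr _ _

/-- The map out of `T_i ⊗ N` given by its values on both generators of `T_i`. -/
def posTlift (i : Fin (n - 1)) (α : SHom (symSubalgebra k i) N Q) (γ : BHom N Q) :
    BHom (posC k p i ⊠ N) Q :=
  cone.tlift (f := brHom k p i) (bModel k p i).ind (uInd k p n 0) α γ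

@[simp] theorem posTlift_posB (i : Fin (n - 1)) (α : SHom (symSubalgebra k i) N Q) (γ : BHom N Q)
    (l : N.carrier) : (posTlift i α γ) (tmul (posB k p i) l) = α l :=
  cone.tlift_inl _ _ _ _ _

@[simp] theorem posTlift_posR (i : Fin (n - 1)) (α : SHom (symSubalgebra k i) N Q) (γ : BHom N Q)
    (l : N.carrier) : (posTlift i α γ) (tmul (posR k p i) l) = γ l :=
  cone.tlift_inr _ _ _ _ _

/-- The map out of `T_i' ⊗ N` given by its values on both generators of `T_i'`. -/
def negTlift (hp : 2 < p) (i : Fin (n - 1)) (γ : BHom N Q) (α : SHom (symSubalgebra k i) N Q) :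
    BHom (negC k hp i ⊠ N) Q :=
  cone.tlift (f := rbHom k hp i) (uInd k p n (-1)) (bnModel k hp i).ind γ α

@[simp] theorem negTlift_negR (hp : 2 < p) (i : Fin (n - 1)) (γ : BHom N Q)
    (α : SHom (symSubalgebra k i) N Q) (l : N.carrier) :
    (negTlift hp i γ α) (tmul (negR k hp i) l) = γ l :=
  cone.tlift_inl _ _ _ _ _

@[simp] theorem negTlift_negB (hp : 2 < p) (i : Fin (n - 1)) (γ : BHom N Q)
    (α : SHom (symSubalgebra k i) N Q) (l : N.carrier) :
    (negTlift hp i γ α) (tmul (negB k hp i) l) = α l :=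
  cone.tlift_inr _ _ _ _ _

/-- Generators of `T_i ⊗ N`: the generator of `B_i` has to be tensored with generators of `N` and
with their multiples by one of the two variables. -/
theorem posC_gen_tens (h : IsPair i x y) {T : Set N.carrier} (hT : Gen N T) :
    Gen (posC k p i ⊠ N) ((fun t => tmul (posB k p i) t) '' T ∪
      (fun t => tmul (posB k p i) (N.left (MvPolynomial.X x) t)) '' T ∪
      (fun t => tmul (posR k p i) t) '' T) := by
  have := cone.gen_tens (f := brHom k p i) (bModel k p i).ind (uInd k p n 0)
    (hT.genOver_quad (h.quadBasis k)) hT.genOver_top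
  rwa [Set.image_union, Set.image_image] at this

/-- Generators of `T_i' ⊗ N`. -/
theorem negC_gen_tens (hp : 2 < p) (h : IsPair i x y) {T : Set N.carrier} (hT : Gen N T) :
    Gen (negC k hp i ⊠ N) ((fun t => tmul (negR k hp i) t) '' T ∪
      ((fun t => tmul (negB k hp i) t) '' T ∪
      (fun t => tmul (negB k hp i) (N.left (MvPolynomial.X x) t)) '' T)) := by
  have := cone.gen_tens (f := rbHom k hp i) (uInd k p n (-1)) (bnModel k hp i).ind
    hT.genOver_top (hT.genOver_quad (h.quadBasis k))
  rwa [Set.image_union, Set.image_image] at this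

/-- Generators of `B_i ⊗ N`. -/
theorem bC_gen_tens (h : IsPair i x y) {T : Set N.carrier} (hT : Gen N T) :
    Gen (bC k p i ⊠ N) ((fun t => tmul (bOne k p i) t) '' T ∪
      (fun t => tmul (bOne k p i) (N.left (MvPolynomial.X x) t)) '' T) := by
  have := (bModel k p i).ind.gen_tens (hT.genOver_quad (h.quadBasis k))
  rwa [Set.image_union, Set.image_image] at this

end ElementaryMaps

/-! ### The complexes `T_i` and `T_i'` are inverse to each other -/

section Inverse

variable {k : Type u} [Field k] {p n : ℕ} [Fact p.Prime] [CharP k p]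

open DgBimod

namespace PosNeg

variable (k) (hp : 2 < p) (i : Fin (n - 1))

/-- A generator of `T_i ⊗ T_i'`. In the names of the generators the first letter tells whether the
first factor is the generator of the `B`-term or of the `R`-term of `T_i`, the last letter tells the
same for `T_i'`, and an `x` between them stands for the variable `x_i` inserted in the middle. -/
def bR : (posC k p i ⊠ negC k hp i).carrier := tmul (posB k p i) (negR k hp i)

/-- The generator `b ⊗ b` of `T_i ⊗ T_i'`. -/
def bB : (posC k p i ⊠ negC k hp i).carrier := tmul (posB k p i) (negB k hp i)

/-- The generator `b ⊗ x_i b` of `T_i ⊗ T_i'`. -/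
def bxB : (posC k p i ⊠ negC k hp i).carrier :=
  tmul (posB k p i) ((negC k hp i).left (xa k i) (negB k hp i))

/-- The generator `r ⊗ r` of `T_i ⊗ T_i'`. -/
def rR : (posC k p i ⊠ negC k hp i).carrier := tmul (posR k p i) (negR k hp i)

/-- The generator `r ⊗ b` of `T_i ⊗ T_i'`. -/
def rB : (posC k p i ⊠ negC k hp i).carrier := tmul (posR k p i) (negB k hp i)

/-- The bimodule `T_i ⊗ T_i'`. -/
abbrev T : DgBimod k p n := posC k p i ⊠ negC k hp i

theorem gen : Gen (T k hp i) {bR k hp i, bB k hp i, bxB k hp i, rR k hp i, rB k hp i} := by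
  refine (posC_gen_tens (isPair i) (negC_gen hp i)).of_gen fun P h1 h2 h3 => ?_
  simp only [Set.insert_subset_iff, Set.singleton_subset_iff, SetLike.mem_coe] at h3
  obtain ⟨m1, m2, m3, m4, m5⟩ := h3
  rintro _ ((⟨t, rfl | rfl, rfl⟩ | ⟨t, rfl | rfl, rfl⟩) | ⟨t, rfl | rfl, rfl⟩)
  · exact m1
  · exact m2
  · have := h2 (xa k i) _ m1
    rwa [bR, ← tmul_left_right _ (negR_central _)] at this
  · exact m3
  · exact m4
  · exact m5

theorem bR_mem : bR k hp i ∈ (T k hp i).deg (0, 1) :=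
  tmul_mem' (posB_mem i) (negR_mem hp i) (by simp)

theorem bB_mem : bB k hp i ∈ (T k hp i).deg (-2, 0) :=
  tmul_mem' (posB_mem i) (negB_mem hp i) (by simp)

theorem bxB_mem : bxB k hp i ∈ (T k hp i).deg (0, 0) :=
  tmul_mem' (posB_mem i) (left_X_mem (pos i) (negB_mem hp i)) (by simp)

theorem rR_mem : rR k hp i ∈ (T k hp i).deg (0, 0) :=
  tmul_mem' (posR_mem i) (negR_mem hp i) (by simp)

theorem rB_mem : rB k hp i ∈ (T k hp i).deg (-2, -1) :=
  tmul_mem' (posR_mem i) (negB_mem hp i) (by simp)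

variable {k hp i}

theorem bR_central {s : Poly k n} (hs : s ∈ symSubalgebra k i) :
    (T k hp i).left s (bR k hp i) = (T k hp i).right s (bR k hp i) :=
  tmul_central (posB_central hs) (negR_central s)

theorem bB_central {s : Poly k n} (hs : s ∈ symSubalgebra k i) :
    (T k hp i).left s (bB k hp i) = (T k hp i).right s (bB k hp i) :=
  tmul_central (posB_central hs) (negB_central hs)

theorem rR_central (s : Poly k n) :
    (T k hp i).left s (rR k hp i) = (T k hp i).right s (rR k hp i) :=
  tmul_central (posR_central s) (negR_central s)

theorem left_xb_negB : (negC k hp i).left (xb k i) (negB k hp i) =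
    (negC k hp i).right (xa k i + xb k i) (negB k hp i) -
      (negC k hp i).left (xa k i) (negB k hp i) := by
  rw [← negB_central (isPair i).sum_mem, map_add, LinearMap.add_apply, add_sub_cancel_left]

theorem d_bR : (T k hp i).d (bR k hp i) =
    rR k hp i + bxB k hp i - (T k hp i).right (xb k i) (bB k hp i) := by
  simp only [bR, tens_d, posC_d_posB, signOp_posB, negC_d_negR, left_xb_negB, map_sub, map_neg,
    LinearMap.neg_apply, rR, bxB, bB, map_add, LinearMap.add_apply, tens_right]
  abel

theorem d_bB : (T k hp i).d (bB k hp i) = rB k hp i := by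
  simp [bB, rB]

theorem d_bxB : (T k hp i).d (bxB k hp i) = (T k hp i).left (xa k i) (rB k hp i) := by
  rw [bxB, rB, tens_d, posC_d_posB, ← tmul_left_central (posR_central _), DgBimod.d_left,
    negC_d_negB, map_zero, map_zero, add_zero]

theorem d_rR : (T k hp i).d (rR k hp i) = (T k hp i).left (xb k i) (rB k hp i) -
    (T k hp i).right (xa k i) (rB k hp i) := by
  rw [rR, rB, tens_d, posC_d_posR, signOp_posR, negC_d_negR, map_zero, LinearMap.zero_apply,
    zero_add, map_sub, tmul_left_central (posR_central _), tens_right]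

theorem d_rB : (T k hp i).d (rB k hp i) = 0 := by
  simp [rB]

variable (k hp i)

/-- The element of `T_i ⊗ T_i'` that spans a copy of `R`. -/
def one : (T k hp i).carrier :=
  rR k hp i - ((T k hp i).left (xb k i) (bB k hp i) - (T k hp i).right (xa k i) (bB k hp i))

theorem one_mem : one k hp i ∈ (T k hp i).deg (0, 0) :=
  sub_mem (rR_mem k hp i) (sub_mem (left_X_mem _ (bB_mem k hp i)) (right_X_mem _ (bB_mem k hp i)))

/-- The element `one` is central: `rR` is, and the remainder is obtained from `bB`, on which the
actions of the symmetric polynomials agree, by `IsPair.central`. -/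
theorem one_central (a : Poly k n) :
    (T k hp i).left a (one k hp i) = (T k hp i).right a (one k hp i) := by
  rw [one, map_sub, rR_central, (isPair i).symm.central fun s hs => bB_central hs, ← map_sub]

/-- Here the twist enters: `∂_q` takes `bB` to `-(x_i + x_{i + 1}) bB`, which cancels the terms
`∂_q x = x ^ 2` that come from the coefficients. -/
theorem D_one : (T k hp i).D (one k hp i) = 0 := by
  have hR : (T k hp i).D (rR k hp i) = 0 := by simp [rR]
  have hB : (T k hp i).D (bB k hp i) = -(T k hp i).right (xa k i + xb k i) (bB k hp i) := by
    rw [bB, tens_D, posC_D_posB, map_zero, LinearMap.zero_apply, zero_add, negC_D_negB, map_neg,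
      tens_right]
  have h1 : (T k hp i).left (xb k i ^ 2) (bB k hp i) = (T k hp i).left (xb k i)
      ((T k hp i).right (xa k i + xb k i) (bB k hp i)) -
        (T k hp i).right (xa k i * xb k i) (bB k hp i) := by
    rw [← bB_central (isPair i).sum_mem, ← bB_central (isPair i).prod_mem,
      ← Module.End.mul_apply, ← map_mul, ← LinearMap.sub_apply, ← map_sub]
    congr 2; ring
  have h2 : (T k hp i).right (xa k i ^ 2) (bB k hp i) = (T k hp i).right (xa k i)
      ((T k hp i).right (xa k i + xb k i) (bB k hp i)) -
        (T k hp i).right (xa k i * xb k i) (bB k hp i) := by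
    rw [← Module.End.mul_apply, ← map_mul, ← LinearMap.sub_apply, ← map_sub]
    congr 2; ring
  rw [one, map_sub, map_sub, hR, (T k hp i).D_left, (T k hp i).D_right, dq_X, dq_X, h1, h2, hB,
    map_neg, map_neg]
  abel

theorem d_one : (T k hp i).d (one k hp i) = 0 := by
  rw [one, map_sub, map_sub, d_rR, DgBimod.d_left, DgBimod.d_right, d_bB, sub_self]

/-- The inclusion `R → T_i ⊗ T_i'`. -/
def incl : DgHom (unitC k p n) (T k hp i) :=
  DgHom.ofGen unit_gen (ofCentral (one k hp i) (one_central k hp i))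
    (by rintro _ rfl; rw [ofCentral_one, unit_D_one, map_zero, D_one])
    (by rintro _ rfl; rw [ofCentral_one, unit_d, map_zero, d_one])
    (by rintro _ rfl; rw [ofCentral_one]; exact ⟨0, unitOne_mem, one_mem k hp i⟩)

@[simp] theorem incl_one : (incl k hp i).hom (unitOne k p n) = one k hp i := by
  rw [incl, DgHom.ofGen_hom, ofCentral_one]

/-- The retraction of `T_i ⊗ T_i'` onto `R`. -/
def retr : BHom (T k hp i) (unitC k p n) :=
  posTlift i
    ((bnQuad hp (isPair i) 0 (-unitOne k p n) (by simp) (by simp)).comp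
      (BHom.restr _ (negSnd k hp i)))
    ((uLift ⊤ (-1) (unitOne k p n) fun s _ => unit_left_one s).comp (negFst k hp i))

@[simp] theorem retr_bR : (retr k hp i) (bR k hp i) = 0 :=
  (posTlift_posB _ _ _ _).trans (by simp)

@[simp] theorem retr_bB : (retr k hp i) (bB k hp i) = 0 :=
  (posTlift_posB _ _ _ _).trans (by simp)

@[simp] theorem retr_bxB : (retr k hp i) (bxB k hp i) = -unitOne k p n :=
  (posTlift_posB _ _ _ _).trans (by simp)

@[simp] theorem retr_rR : (retr k hp i) (rR k hp i) = unitOne k p n :=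
  (posTlift_posR _ _ _ _).trans (by simp)

@[simp] theorem retr_rB : (retr k hp i) (rB k hp i) = 0 :=
  (posTlift_posR _ _ _ _).trans (by simp)

/-- The contracting homotopy on the complement of `R` in `T_i ⊗ T_i'`. -/
def htpy : BHom (T k hp i) (T k hp i) :=
  posTlift i
    ((bnQuad hp (isPair i) 0 (-bR k hp i) (by simp)
      (fun s hs => by rw [map_neg, map_neg, bR_central hs])).comp (BHom.restr _ (negSnd k hp i)))
    ((bnLift hp i (-bB k hp i) (fun s hs => by rw [map_neg, map_neg, bB_central hs])).comp
      (negSnd k hp i))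

@[simp] theorem htpy_bR : (htpy k hp i) (bR k hp i) = 0 :=
  (posTlift_posB _ _ _ _).trans (by simp)

@[simp] theorem htpy_bB : (htpy k hp i) (bB k hp i) = 0 :=
  (posTlift_posB _ _ _ _).trans (by simp)

@[simp] theorem htpy_bxB : (htpy k hp i) (bxB k hp i) = -bR k hp i :=
  (posTlift_posB _ _ _ _).trans (by simp)

@[simp] theorem htpy_rR : (htpy k hp i) (rR k hp i) = 0 :=
  (posTlift_posR _ _ _ _).trans (by simp)

@[simp] theorem htpy_rB : (htpy k hp i) (rB k hp i) = -bB k hp i :=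
  (posTlift_posR _ _ _ _).trans (by simp)

theorem right_sum_bB : (T k hp i).right (xb k i) (bB k hp i) =
    (T k hp i).left (xa k i) (bB k hp i) +
    (T k hp i).left (xb k i) (bB k hp i) - (T k hp i).right (xa k i) (bB k hp i) := by
  have h := bB_central (hp := hp) ((isPair i).sum_mem (k := k))
  rw [map_add, map_add, LinearMap.add_apply, LinearMap.add_apply] at h
  rw [h, add_sub_cancel_left]

/-- The complex `T_i ⊗ T_i'` retracts onto `R`. -/
def retract : DefRetract (unitC k p n) (T k hp i) :=
  .ofGen unit_gen (gen k hp i) (incl k hp i) (retr k hp i) (htpy k hp i)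
    (by
      rintro _ (rfl | rfl | rfl | rfl | rfl)
      · exact ⟨_, bR_mem k hp i, by rw [htpy_bR]; exact zero_mem _⟩
      · exact ⟨_, bB_mem k hp i, by rw [htpy_bB]; exact zero_mem _⟩
      · exact ⟨_, bxB_mem k hp i, by rw [htpy_bxB]; exact neg_mem (bR_mem k hp i)⟩
      · exact ⟨_, rR_mem k hp i, by rw [htpy_rR]; exact zero_mem _⟩
      · exact ⟨_, rB_mem k hp i, by rw [htpy_rB]; exact neg_mem (bB_mem k hp i)⟩)
    (by
      rintro _ rfl
      simp only [incl_one, one, map_sub, BHom.map_left, SHom.map_right, retr_rR, retr_bB, map_zero,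
        sub_zero])
    (by
      rintro _ rfl
      simp only [incl_one, one, map_sub, BHom.map_left, SHom.map_right, htpy_rR, htpy_bB, map_zero,
        sub_zero])
    (by
      rintro _ (rfl | rfl | rfl | rfl | rfl)
      · rw [htpy_bR, d_bR, retr_bR, map_sub, map_add, SHom.map_right, htpy_rR, htpy_bxB, htpy_bB]
        simp
      · rw [htpy_bB, d_bB, retr_bB, htpy_rB]
        simp
      · rw [htpy_bxB, map_neg, d_bR, d_bxB, retr_bxB, map_neg, incl_one, BHom.map_left, htpy_rB,
          right_sum_bB, one, map_neg]
        abel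
      · rw [htpy_rR, d_rR, retr_rR, incl_one, map_sub, BHom.map_left, SHom.map_right, htpy_rB, one,
          map_neg, map_neg]
        simp only [map_zero]
        abel
      · rw [htpy_rB, d_rB, retr_rB, map_neg, d_bB]
        simp)

end PosNeg

namespace NegPos

variable (k : Type u) [Field k] {p n : ℕ} [Fact p.Prime] [CharP k p] (hp : 2 < p) (i : Fin (n - 1))

/-- The bimodule `T_i' ⊗ T_i`. -/
abbrev T : DgBimod k p n := negC k hp i ⊠ posC k p i

/-- A generator of `T_i' ⊗ T_i`, named in the same way as those of `T_i ⊗ T_i'`. -/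
def rB : (T k hp i).carrier := tmul (negR k hp i) (posB k p i)

/-- The generator `b ⊗ b` of `T_i' ⊗ T_i`. -/
def bB : (T k hp i).carrier := tmul (negB k hp i) (posB k p i)

/-- The generator `b ⊗ x_i b` of `T_i' ⊗ T_i`. -/
def bxB : (T k hp i).carrier := tmul (negB k hp i) ((posC k p i).left (xa k i) (posB k p i))

/-- The generator `r ⊗ r` of `T_i' ⊗ T_i`. -/
def rR : (T k hp i).carrier := tmul (negR k hp i) (posR k p i)

/-- The generator `b ⊗ r` of `T_i' ⊗ T_i`. -/
def bR : (T k hp i).carrier := tmul (negB k hp i) (posR k p i)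

theorem gen : Gen (T k hp i) {rB k hp i, bB k hp i, bxB k hp i, rR k hp i, bR k hp i} := by
  refine (negC_gen_tens hp (isPair i) (posC_gen i)).of_gen fun P h1 h2 h3 => ?_
  simp only [Set.insert_subset_iff, Set.singleton_subset_iff, SetLike.mem_coe] at h3
  obtain ⟨m1, m2, m3, m4, m5⟩ := h3
  rintro _ (⟨t, rfl | rfl, rfl⟩ | ⟨t, rfl | rfl, rfl⟩ | ⟨t, rfl | rfl, rfl⟩)
  · exact m1
  · exact m4
  · exact m2
  · exact m5
  · exact m3
  · have := h2 (xa k i) _ m5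
    rwa [bR, ← tmul_left_right _ (posR_central _)] at this

theorem rB_mem : rB k hp i ∈ (T k hp i).deg (0, 1) :=
  tmul_mem' (negR_mem hp i) (posB_mem i) (by simp)

theorem bB_mem : bB k hp i ∈ (T k hp i).deg (-2, 0) :=
  tmul_mem' (negB_mem hp i) (posB_mem i) (by simp)

theorem bxB_mem : bxB k hp i ∈ (T k hp i).deg (0, 0) :=
  tmul_mem' (negB_mem hp i) (left_X_mem (pos i) (posB_mem i)) (by simp)

theorem rR_mem : rR k hp i ∈ (T k hp i).deg (0, 0) :=
  tmul_mem' (negR_mem hp i) (posR_mem i) (by simp)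

theorem bR_mem : bR k hp i ∈ (T k hp i).deg (-2, -1) :=
  tmul_mem' (negB_mem hp i) (posR_mem i) (by simp)

variable {k hp i}

theorem rB_central {s : Poly k n} (hs : s ∈ symSubalgebra k i) :
    (T k hp i).left s (rB k hp i) = (T k hp i).right s (rB k hp i) :=
  tmul_central (negR_central s) (posB_central hs)

theorem bB_central {s : Poly k n} (hs : s ∈ symSubalgebra k i) :
    (T k hp i).left s (bB k hp i) = (T k hp i).right s (bB k hp i) :=
  tmul_central (negB_central hs) (posB_central hs)

theorem rR_central (s : Poly k n) :
    (T k hp i).left s (rR k hp i) = (T k hp i).right s (rR k hp i) :=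
  tmul_central (negR_central s) (posR_central s)

theorem d_rB : (T k hp i).d (rB k hp i) =
    (T k hp i).left (xb k i) (bB k hp i) - bxB k hp i + rR k hp i := by
  rw [rB, bB, bxB, rR, tens_d, negC_d_negR, signOp_negR, posC_d_posB, map_sub, LinearMap.sub_apply,
    tmul_balanced, tens_left]

theorem d_bB : (T k hp i).d (bB k hp i) = -bR k hp i := by
  simp [bB, bR]

theorem d_bxB : (T k hp i).d (bxB k hp i) = -(T k hp i).right (xa k i) (bR k hp i) := by
  rw [bxB, bR, tens_d, negC_d_negB, signOp_negB, DgBimod.d_left, posC_d_posB, map_neg,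
    LinearMap.neg_apply, tmul_left_right _ (posR_central _), map_zero, LinearMap.zero_apply,
    zero_add]

theorem d_rR : (T k hp i).d (rR k hp i) = (T k hp i).left (xb k i) (bR k hp i) -
    (T k hp i).right (xa k i) (bR k hp i) := by
  rw [rR, bR, tens_d, negC_d_negR, posC_d_posR, map_zero, add_zero, map_sub, LinearMap.sub_apply,
    tmul_balanced, tmul_left_right _ (posR_central _), tens_left]

theorem d_bR : (T k hp i).d (bR k hp i) = 0 := by
  simp [bR]

variable (k hp i)

/-- The element of `T_i' ⊗ T_i` that spans a copy of `R`. -/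
def one : (T k hp i).carrier :=
  rR k hp i + ((T k hp i).left (xb k i) (bB k hp i) - (T k hp i).right (xa k i) (bB k hp i))

theorem one_mem : one k hp i ∈ (T k hp i).deg (0, 0) :=
  add_mem (rR_mem k hp i) (sub_mem (left_X_mem _ (bB_mem k hp i)) (right_X_mem _ (bB_mem k hp i)))

theorem one_central (a : Poly k n) :
    (T k hp i).left a (one k hp i) = (T k hp i).right a (one k hp i) := by
  rw [one, map_add, rR_central, (isPair i).symm.central fun s hs => bB_central hs, ← map_add]

theorem D_one : (T k hp i).D (one k hp i) = 0 := by
  have hR : (T k hp i).D (rR k hp i) = 0 := by simp [rR]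
  have hB : (T k hp i).D (bB k hp i) = -(T k hp i).right (xa k i + xb k i) (bB k hp i) := by
    rw [bB, tens_D, posC_D_posB, map_zero, add_zero, negC_D_negB, map_neg, LinearMap.neg_apply,
      tmul_balanced, tmul_left_right _ (posB_central (isPair i).sum_mem)]
  have h1 : (T k hp i).left (xb k i ^ 2) (bB k hp i) = (T k hp i).left (xb k i)
      ((T k hp i).right (xa k i + xb k i) (bB k hp i)) -
        (T k hp i).right (xa k i * xb k i) (bB k hp i) := by
    rw [← bB_central (isPair i).sum_mem, ← bB_central (isPair i).prod_mem,
      ← Module.End.mul_apply, ← map_mul, ← LinearMap.sub_apply, ← map_sub]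
    congr 2; ring
  have h2 : (T k hp i).right (xa k i ^ 2) (bB k hp i) = (T k hp i).right (xa k i)
      ((T k hp i).right (xa k i + xb k i) (bB k hp i)) -
        (T k hp i).right (xa k i * xb k i) (bB k hp i) := by
    rw [← Module.End.mul_apply, ← map_mul, ← LinearMap.sub_apply, ← map_sub]
    congr 2; ring
  rw [one, map_add, map_sub, hR, (T k hp i).D_left, (T k hp i).D_right, dq_X, dq_X, h1, h2, hB,
    map_neg, map_neg]
  abel

theorem d_one : (T k hp i).d (one k hp i) = 0 := by
  rw [one, map_add, map_sub, d_rR, DgBimod.d_left, DgBimod.d_right, d_bB, map_neg, map_neg]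
  abel

/-- The inclusion `R → T_i' ⊗ T_i`. -/
def incl : DgHom (unitC k p n) (T k hp i) :=
  DgHom.ofGen unit_gen (ofCentral (one k hp i) (one_central k hp i))
    (by rintro _ rfl; rw [ofCentral_one, unit_D_one, map_zero, D_one])
    (by rintro _ rfl; rw [ofCentral_one, unit_d, map_zero, d_one])
    (by rintro _ rfl; rw [ofCentral_one]; exact ⟨0, unitOne_mem, one_mem k hp i⟩)

@[simp] theorem incl_one : (incl k hp i).hom (unitOne k p n) = one k hp i := by
  rw [incl, DgHom.ofGen_hom, ofCentral_one]

/-- The retraction of `T_i' ⊗ T_i` onto `R`. -/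
def retr : BHom (T k hp i) (unitC k p n) :=
  negTlift hp i ((uLift ⊤ 0 (unitOne k p n) fun s _ => unit_left_one s).comp (posSnd k p i))
    ((bQuad (isPair i) le_rfl 0 (unitOne k p n) (by simp)
      fun s _ => unit_left_one s).comp
      (BHom.restr _ (posFst k p i)))

@[simp] theorem retr_rB : (retr k hp i) (rB k hp i) = 0 :=
  (negTlift_negR _ _ _ _ _).trans (by simp)

@[simp] theorem retr_bB : (retr k hp i) (bB k hp i) = 0 :=
  (negTlift_negB _ _ _ _ _).trans (by simp)

@[simp] theorem retr_bxB : (retr k hp i) (bxB k hp i) = unitOne k p n :=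
  (negTlift_negB _ _ _ _ _).trans (by simp)

@[simp] theorem retr_rR : (retr k hp i) (rR k hp i) = unitOne k p n :=
  (negTlift_negR _ _ _ _ _).trans (by simp)

@[simp] theorem retr_bR : (retr k hp i) (bR k hp i) = 0 :=
  (negTlift_negB _ _ _ _ _).trans (by simp)

/-- The contracting homotopy on the complement of `R` in `T_i' ⊗ T_i`. -/
def htpy : BHom (T k hp i) (T k hp i) :=
  negTlift hp i 0
    ((bQuad (isPair i) le_rfl 0 (rB k hp i) (by simp) (fun s hs => rB_central hs)).comp
      (BHom.restr _ (posFst k p i)) +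
      (uLift _ 0 (bB k hp i) (fun s hs => bB_central hs)).comp (BHom.restr _ (posSnd k p i)))

@[simp] theorem htpy_rB : (htpy k hp i) (rB k hp i) = 0 :=
  (negTlift_negR _ _ _ _ _).trans (by simp)

@[simp] theorem htpy_bB : (htpy k hp i) (bB k hp i) = 0 :=
  (negTlift_negB _ _ _ _ _).trans (by simp)

@[simp] theorem htpy_bxB : (htpy k hp i) (bxB k hp i) = rB k hp i :=
  (negTlift_negB _ _ _ _ _).trans (by simp)

@[simp] theorem htpy_rR : (htpy k hp i) (rR k hp i) = 0 :=
  (negTlift_negR _ _ _ _ _).trans (by simp)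

@[simp] theorem htpy_bR : (htpy k hp i) (bR k hp i) = bB k hp i :=
  (negTlift_negB _ _ _ _ _).trans (by simp)

/-- The complex `T_i' ⊗ T_i` retracts onto `R`. -/
def retract : DefRetract (unitC k p n) (T k hp i) :=
  .ofGen unit_gen (gen k hp i) (incl k hp i) (retr k hp i) (htpy k hp i)
    (by
      rintro _ (rfl | rfl | rfl | rfl | rfl)
      · exact ⟨_, rB_mem k hp i, by rw [htpy_rB]; exact zero_mem _⟩
      · exact ⟨_, bB_mem k hp i, by rw [htpy_bB]; exact zero_mem _⟩
      · exact ⟨_, bxB_mem k hp i, by rw [htpy_bxB]; exact rB_mem k hp i⟩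
      · exact ⟨_, rR_mem k hp i, by rw [htpy_rR]; exact zero_mem _⟩
      · exact ⟨_, bR_mem k hp i, by rw [htpy_bR]; exact bB_mem k hp i⟩)
    (by
      rintro _ rfl
      simp only [incl_one, one, map_sub, map_add, BHom.map_left, SHom.map_right, retr_rR, retr_bB,
        map_zero, sub_zero, add_zero])
    (by
      rintro _ rfl
      simp only [incl_one, one, map_sub, map_add, BHom.map_left, SHom.map_right, htpy_rR, htpy_bB,
        map_zero, sub_zero, add_zero])
    (by
      rintro _ (rfl | rfl | rfl | rfl | rfl)
      · rw [htpy_rB, d_rB, retr_rB, map_add, map_sub, BHom.map_left, htpy_rR, htpy_bxB, htpy_bB]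
        simp
      · rw [htpy_bB, d_bB, retr_bB, map_neg, htpy_bR]
        simp
      · rw [htpy_bxB, d_rB, d_bxB, retr_bxB, incl_one, map_neg, SHom.map_right, htpy_bR, one]
        abel
      · rw [htpy_rR, d_rR, retr_rR, incl_one, map_sub, BHom.map_left, SHom.map_right, htpy_bR, one]
        simp only [map_zero]
        abel
      · rw [htpy_bR, d_bR, retr_bR, d_bB]
        simp)

end NegPos

end Inverse

/-! ### Far commutation -/

section FarCommutation

variable {k : Type u} [Field k] {p n : ℕ}

/-- The variable `x` satisfies its quadratic equation over the symmetric polynomials, with the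
coefficients moved to the right action. -/
theorem left_left_quad {M : DgBimod k p n} {z : M.carrier} {x y : Fin n}
    (hs : M.left (MvPolynomial.X x + MvPolynomial.X y) z =
      M.right (MvPolynomial.X x + MvPolynomial.X y) z)
    (hq : M.left (MvPolynomial.X x * MvPolynomial.X y) z =
      M.right (MvPolynomial.X x * MvPolynomial.X y) z) :
    M.left (MvPolynomial.X x) (M.left (MvPolynomial.X x) z) =
      M.right (MvPolynomial.X x + MvPolynomial.X y) (M.left (MvPolynomial.X x) z) -
        M.right (MvPolynomial.X x * MvPolynomial.X y) z := by
  rw [← M.left_right, ← hs, ← hq, ← Module.End.mul_apply, ← Module.End.mul_apply, ← map_mul,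
    ← map_mul, ← LinearMap.sub_apply, ← map_sub]
  congr 2; ring

/-- The generators `i` and `j` act on disjoint pairs of strands. -/
def Far (i j : Fin (n - 1)) : Prop := (i : ℕ) + 1 < j ∨ (j : ℕ) + 1 < i

namespace Far

variable {i j : Fin (n - 1)}

theorem symm (h : Far i j) : Far j i := Or.symm h

theorem X_pos_mem (h : Far i j) : MvPolynomial.X (pos j) ∈ symSubalgebra k i := by
  refine X_mem_sym (fun h' => ?_) (fun h' => ?_) <;>
  · have := congrArg Fin.val h'
    simp only [pos, posSucc] at this
    obtain h | h := h <;> omega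

theorem X_posSucc_mem (h : Far i j) : MvPolynomial.X (posSucc j) ∈ symSubalgebra k i := by
  refine X_mem_sym (fun h' => ?_) (fun h' => ?_) <;>
  · have := congrArg Fin.val h'
    simp only [pos, posSucc] at this
    obtain h | h := h <;> omega

/-- The polynomials symmetric for `i` are generated by those symmetric for both `i` and `j` and the
single variable on the first strand of `j`. -/
theorem le_adjoin (h : Far i j) : symSubalgebra k i ≤ Algebra.adjoin k
    (insert (MvPolynomial.X (pos j))
      ((symSubalgebra k i ⊓ symSubalgebra k j : Subalgebra k (Poly k n)) : Set (Poly k n))) := by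
  have h1 : ∀ a ∈ symSubalgebra k i ⊓ symSubalgebra k j, a ∈ Algebra.adjoin k
      (insert (MvPolynomial.X (pos j))
        ((symSubalgebra k i ⊓ symSubalgebra k j : Subalgebra k (Poly k n)) : Set (Poly k n))) :=
    fun a ha => Algebra.subset_adjoin (Set.mem_insert_of_mem _ ha)
  have h2 : (MvPolynomial.X (pos j) : Poly k n) ∈ Algebra.adjoin k
      (insert (MvPolynomial.X (pos j))
        ((symSubalgebra k i ⊓ symSubalgebra k j : Subalgebra k (Poly k n)) : Set (Poly k n))) :=
    Algebra.subset_adjoin (Set.mem_insert _ _)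
  refine (isPair i).le_of_mem _ (h1 _ ⟨(isPair i).sum_mem, ?_⟩) (h1 _ ⟨(isPair i).prod_mem, ?_⟩)
    fun l hl hl' => ?_
  · exact add_mem h.symm.X_pos_mem h.symm.X_posSucc_mem
  · exact mul_mem h.symm.X_pos_mem h.symm.X_posSucc_mem
  · by_cases hx : l = pos j
    · exact hx ▸ h2
    by_cases hy : l = posSucc j
    · have h3 := sub_mem (h1 _ ⟨add_mem h.X_pos_mem h.X_posSucc_mem, (isPair j).sum_mem⟩) h2
      rwa [add_sub_cancel_left, ← hy] at h3
    · exact h1 _ ⟨X_mem_sym hl hl', X_mem_sym hx hy⟩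

variable [Fact p.Prime] [CharP k p] {Q : DgBimod k p n}

open DgBimod

variable (p) in
/-- The map out of `B_j` that sends `1 ⊗ 1` to `z` and `x ⊗ 1` to `x z`, linear over the polynomials
symmetric for both `i` and `j`. -/
def bSlideAux (i j : Fin (n - 1)) (z : Q.carrier)
    (hz : ∀ s ∈ symSubalgebra k i ⊓ symSubalgebra k j, Q.left s z = Q.right s z) :
    SHom (symSubalgebra k i ⊓ symSubalgebra k j) (bC k p j) Q :=
  bQuad (isPair j) inf_le_right z (Q.left (MvPolynomial.X (pos j)) z) hz (fun s hs => by
    rw [left_comm, hz s hs, Q.left_right])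

theorem bSlideAux_left (h : Far i j) (z : Q.carrier) (hz) (m : (bC k p j).carrier) :
    (bSlideAux p i j z hz) ((bC k p j).left (MvPolynomial.X (pos j)) m) =
      Q.left (MvPolynomial.X (pos j)) ((bSlideAux p i j z hz) m) := by
  have hs := hz _ ⟨add_mem h.X_pos_mem h.X_posSucc_mem, (isPair j).sum_mem⟩
  have hq := hz _ ⟨mul_mem h.X_pos_mem h.X_posSucc_mem, (isPair j).prod_mem⟩
  have h0 : (bSlideAux p i j z hz) (bOne k p j) = z := bQuad_one _ _ _ _ _ _
  have h1 : (bSlideAux p i j z hz) ((bC k p j).left (MvPolynomial.X (pos j)) (bOne k p j)) =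
      Q.left (MvPolynomial.X (pos j)) z := bQuad_left_one _ _ _ _ _ _
  have e1 := left_left_quad (bOne_central (p := p) ((isPair j).sum_mem (k := k)))
    (bOne_central (isPair j).prod_mem)
  refine (bModel k p j).ind.ext_quad ((isPair j).quadBasis k)
    (f := (bSlideAux p i j z hz).comp (SHom.lmul _ _ (MvPolynomial.X (pos j))))
    (g := (SHom.lmul _ _ (MvPolynomial.X (pos j))).comp (bSlideAux p i j z hz)) ?_ ?_ m
  · exact h1.trans (congrArg _ h0.symm)
  · change (bSlideAux p i j z hz) ((bC k p j).left (MvPolynomial.X (pos j))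
      ((bC k p j).left (MvPolynomial.X (pos j)) (bOne k p j))) =
        Q.left (MvPolynomial.X (pos j)) ((bSlideAux p i j z hz)
          ((bC k p j).left (MvPolynomial.X (pos j)) (bOne k p j)))
    rw [e1, map_sub, SHom.map_right, SHom.map_right, h1, h0]
    exact (left_left_quad hs hq).symm

variable (p) in
/-- If `i` and `j` are far apart, a map out of `B_j` that is only linear over the polynomials
symmetric for both `i` and `j` extends to one that is linear over those symmetric for `i`. -/
def bSlide (h : Far i j) (z : Q.carrier)
    (hz : ∀ s ∈ symSubalgebra k i ⊓ symSubalgebra k j, Q.left s z = Q.right s z) :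
    SHom (symSubalgebra k i) (bC k p j) Q :=
  SHom.upgrade (MvPolynomial.X (pos j)) h.le_adjoin (bSlideAux p i j z hz) (h.bSlideAux_left z hz)

@[simp] theorem bSlide_one (h : Far i j) (z : Q.carrier) (hz) :
    (h.bSlide p z hz) (bOne k p j) = z :=
  (SHom.upgrade_apply _ _ _ _ _).trans (bQuad_one _ _ _ _ _ _)

variable (k p) in
/-- Generators of `T_i ⊗ T_j` for `i` and `j` far apart. -/
theorem gen (h : Far i j) : Gen (posC k p i ⊠ posC k p j)
    {tmul (posB k p i) (posB k p j), tmul (posB k p i) (posR k p j),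
      tmul (posR k p i) (posB k p j), tmul (posR k p i) (posR k p j)} := by
  refine (posC_gen_tens (isPair i) (posC_gen j)).of_gen fun P h1 h2 h3 => ?_
  simp only [Set.insert_subset_iff, Set.singleton_subset_iff, SetLike.mem_coe] at h3
  obtain ⟨m1, m2, m3, m4⟩ := h3
  rintro _ ((⟨t, rfl | rfl, rfl⟩ | ⟨t, rfl | rfl, rfl⟩) | ⟨t, rfl | rfl, rfl⟩)
  · exact m1
  · exact m2
  · have := h2 (xa k i) _ m1
    rwa [← tmul_left_right _ (posB_central h.symm.X_pos_mem)] at this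
  · have := h2 (xa k i) _ m2
    rwa [← tmul_left_right _ (posR_central _)] at this
  · exact m3
  · exact m4

variable (k p) in
/-- The bimodule map `T_i ⊗ T_j → T_j ⊗ T_i` that exchanges the generators, with the Koszul sign. -/
def swapMap (h : Far i j) : BHom (posC k p i ⊠ posC k p j) (posC k p j ⊠ posC k p i) :=
  posTlift i
    ((h.bSlide p (-tmul (posB k p j) (posB k p i)) (fun s hs => by
        rw [map_neg, map_neg, tmul_central (posB_central hs.2) (posB_central hs.1)])).comp
        (BHom.restr _ (posFst k p j)) +
      (uLift _ 0 (tmul (posR k p j) (posB k p i)) (fun s hs =>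
        tmul_central (posR_central s) (posB_central hs))).comp (BHom.restr _ (posSnd k p j)))
    ((bLift j (tmul (posB k p j) (posR k p i)) (fun s hs =>
        tmul_central (posB_central hs) (posR_central s))).comp (posFst k p j) +
      (uLift ⊤ 0 (tmul (posR k p j) (posR k p i)) (fun s _ =>
        tmul_central (posR_central s) (posR_central s))).comp (posSnd k p j))

variable (h : Far i j)

@[simp] theorem swapMap_BB : (h.swapMap k p) (tmul (posB k p i) (posB k p j)) =
    -tmul (posB k p j) (posB k p i) := (posTlift_posB _ _ _ _).trans (by simp)

@[simp] theorem swapMap_BR : (h.swapMap k p) (tmul (posB k p i) (posR k p j)) =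
    tmul (posR k p j) (posB k p i) := (posTlift_posB _ _ _ _).trans (by simp)

@[simp] theorem swapMap_RB : (h.swapMap k p) (tmul (posR k p i) (posB k p j)) =
    tmul (posB k p j) (posR k p i) := (posTlift_posR _ _ _ _).trans (by simp)

@[simp] theorem swapMap_RR : (h.swapMap k p) (tmul (posR k p i) (posR k p j)) =
    tmul (posR k p j) (posR k p i) := (posTlift_posR _ _ _ _).trans (by simp)

variable (k p) in
/-- The swap as a morphism of complexes. -/
def swapHom : DgHom (posC k p i ⊠ posC k p j) (posC k p j ⊠ posC k p i) :=
  DgHom.ofGen (h.gen k p) (h.swapMap k p)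
    (by rintro _ (rfl | rfl | rfl | rfl) <;> simp)
    (by
      rintro _ (rfl | rfl | rfl | rfl)
      · simp only [tens_d, posC_d_posB, signOp_posB, map_add, map_neg, LinearMap.neg_apply,
          swapMap_RB, swapMap_BR, swapMap_BB]
        abel
      · simp
      · simp
      · simp)
    (by
      rintro _ (rfl | rfl | rfl | rfl)
      · exact ⟨(0, 2), tmul_mem' (posB_mem i) (posB_mem j) (by simp), by
          rw [swapMap_BB]; exact neg_mem (tmul_mem' (posB_mem j) (posB_mem i) (by simp))⟩
      · exact ⟨(0, 1), tmul_mem' (posB_mem i) (posR_mem j) (by simp), by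
          rw [swapMap_BR]; exact tmul_mem' (posR_mem j) (posB_mem i) (by simp)⟩
      · exact ⟨(0, 1), tmul_mem' (posR_mem i) (posB_mem j) (by simp), by
          rw [swapMap_RB]; exact tmul_mem' (posB_mem j) (posR_mem i) (by simp)⟩
      · exact ⟨(0, 0), tmul_mem' (posR_mem i) (posR_mem j) (by simp), by
          rw [swapMap_RR]; exact tmul_mem' (posR_mem j) (posR_mem i) (by simp)⟩)

theorem swapMap_swapMap : (h.symm.swapMap k p).comp (h.swapMap k p) = SHom.id _ := by
  refine (h.gen k p).ext ?_
  rintro _ (rfl | rfl | rfl | rfl) <;> simp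

variable (k p) in
/-- The complexes `T_i ⊗ T_j` and `T_j ⊗ T_i` are isomorphic if `i` and `j` are far apart. -/
def retract : DefRetract (posC k p i ⊠ posC k p j) (posC k p j ⊠ posC k p i) :=
  .ofIso (h.swapHom k p) (h.symm.swapMap k p)
    (fun m => congrArg (fun f => f.lin m) h.swapMap_swapMap)
    (fun m => congrArg (fun f => f.lin m) h.symm.swapMap_swapMap)

end Far

end FarCommutation

/-! ### Polynomials symmetric in three variables and the six-valent vertex -/

section Triple

variable {k : Type u} [Field k] {p n : ℕ}

section InducedBimod

/-- The subalgebra `S` is graded and stable under `∂_q`. -/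
structure Stable (S : Subalgebra k (Poly k n)) : Prop where
  dq_mem : ∀ s ∈ S, dq k n s ∈ S
  component_mem : ∀ s ∈ S, ∀ r, MvPolynomial.homogeneousComponent r s ∈ S

variable {S : Subalgebra k (Poly k n)}

/-- The restriction of `∂_q` to a stable subalgebra. -/
def Stable.dqSub (hS : Stable S) (s : S) : S := ⟨dq k n s, hS.dq_mem s s.2⟩

theorem Stable.dq_smul (hS : Stable S) (s : S) (a : Poly k n) :
    (dq k n : Poly k n →ₗ[k] Poly k n) (s • a) = hS.dqSub s • a + s • dq k n a := by
  change dq k n ((s : Poly k n) * a) = dq k n s * a + s * dq k n a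
  rw [Derivation.leibniz, smul_eq_mul, smul_eq_mul]; ring

variable (S) in
/-- The grading of `R ⊗ R` over a subalgebra. -/
abbrev eDeg : ℤ → Submodule k (Poly k n ⊗[S] Poly k n) :=
  tensorDeg S
    (MvPolynomial.weightedHomogeneousSubmodule k fun _ : Fin n => (2 : ℤ))
    (MvPolynomial.weightedHomogeneousSubmodule k fun _ : Fin n => (2 : ℤ))

theorem eDeg_isInternal (hS : Stable S) : DirectSum.IsInternal (eDeg S) := by
  refine tensor_isInternal (polyDeg_isInternal 2) (polyDeg_isInternal 2) fun s => ?_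
  have h : s = ∑ r ∈ Finset.range ((s : Poly k n).totalDegree + 1),
      (⟨MvPolynomial.homogeneousComponent r (s : Poly k n), hS.component_mem s s.2 r⟩ : S) := by
    apply Subtype.ext
    rw [AddSubmonoidClass.coe_finsetSum, MvPolynomial.sum_homogeneousComponent]
  rw [h]
  refine AddSubmonoid.sum_mem _ fun r _ => AddSubmonoid.subset_closure ?_
  have h := isWeightedHomogeneous_of_isHomogeneous (2 : ℤ)
    (MvPolynomial.homogeneousComponent_isHomogeneous r (s : Poly k n))
  exact ⟨r • 2, fun _ _ hm => h.mul hm, fun _ _ hm => h.mul hm⟩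

/-- The operator `∂_q` on `R ⊗ R` over a stable subalgebra. -/
def eD (hS : Stable S) : (Poly k n ⊗[S] Poly k n) →ₗ[k] (Poly k n ⊗[S] Poly k n) :=
  leibniz hS.dqSub (dq k n : Poly k n →ₗ[k] Poly k n) (dq k n : Poly k n →ₗ[k] Poly k n)
    hS.dq_smul hS.dq_smul

theorem eD_tmul (hS : Stable S) (a b : Poly k n) :
    eD hS (a ⊗ₜ b) = dq k n a ⊗ₜ b + a ⊗ₜ dq k n b := rfl

theorem eD_mul (hS : Stable S) (a b : Poly k n) (x : Poly k n ⊗[S] Poly k n) :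
    eD hS ((a ⊗ₜ b) * x) = eD hS (a ⊗ₜ b) * x + (a ⊗ₜ b) * eD hS x := by
  induction x using TensorProduct.induction_on with
  | zero => simp
  | tmul c d =>
    simp only [Algebra.TensorProduct.tmul_mul_tmul, eD_tmul, mul_add, add_mul,
      Derivation.leibniz, smul_eq_mul, TensorProduct.add_tmul, TensorProduct.tmul_add]
    rw [mul_comm c, mul_comm d]; abel
  | add x y hx hy => simp only [mul_add, map_add, hx, hy]; abel

theorem mul_mem_eDeg {a b : Poly k n} {e e' l : ℤ} {x : Poly k n ⊗[S] Poly k n}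
    (ha : MvPolynomial.IsWeightedHomogeneous (fun _ => (2 : ℤ)) a e)
    (hb : MvPolynomial.IsWeightedHomogeneous (fun _ => (2 : ℤ)) b e')
    (hx : x ∈ eDeg S l) : (a ⊗ₜ b) * x ∈ eDeg S (e + e' + l) := by
  have : eDeg S l ≤ (eDeg S (e + e' + l)).comap (LinearMap.mulLeft k (a ⊗ₜ b)) :=
    Submodule.span_le.2 (by
      rintro x ⟨c, d, rfl, m, hm, l, hl, rfl⟩
      rw [SetLike.mem_coe, Submodule.mem_comap, LinearMap.mulLeft_apply,
        Algebra.TensorProduct.tmul_mul_tmul, show e + e' + (c + d) = (e + c) + (e' + d) by ring]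
      exact tmul_mem_tensorDeg (ha.mul hm) (hb.mul hl))
  exact this hx

variable [Fact p.Prime] [CharP k p]

variable (p) in
/-- The graded `(R, R) # H_q`-module `R ⊗ R` over a stable subalgebra. -/
@[reducible]
def eBimod (hS : Stable S) : EqBimod k p n (2 : ℤ) where
  carrier := Poly k n ⊗[S] Poly k n
  left := (Algebra.lmul k (Poly k n ⊗[S] Poly k n)).comp Algebra.TensorProduct.includeLeft
  right := (Algebra.lmul k (Poly k n ⊗[S] Poly k n)).comp
    (Algebra.TensorProduct.includeRight.restrictScalars k)
  left_right a b m := mul_left_comm _ _ _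
  deg := eDeg S
  isInternal := eDeg_isInternal hS
  left_mem ha hx := by
    have := mul_mem_eDeg ha (MvPolynomial.isWeightedHomogeneous_one k _) hx
    rwa [add_zero] at this
  right_mem ha hx := by
    have := mul_mem_eDeg (MvPolynomial.isWeightedHomogeneous_one k _) ha hx
    rwa [zero_add] at this
  D := eD hS
  D_pow := by
    have h : (dq k n : Poly k n →ₗ[k] Poly k n) = dqTwist 0 :=
      LinearMap.ext fun a => (dqTwist_zero a).symm
    have h' : (dq k n : Poly k n →ₗ[k] Poly k n) ^ p = 0 := by rw [h, dqTwist_zero_pow]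
    exact leibniz_pow_eq_zero p _ _ _ _ _ h' h'
  D_left a x := by
    have h : dq k n (1 : Poly k n) = 0 := Derivation.map_one_eq_zero _
    refine (eD_mul hS a 1 x).trans ?_
    rw [eD_tmul, h, TensorProduct.tmul_zero, add_zero]
    rfl
  D_right a x := by
    have h : dq k n (1 : Poly k n) = 0 := Derivation.map_one_eq_zero _
    refine (eD_mul hS 1 a x).trans ?_
    rw [eD_tmul, h, TensorProduct.zero_tmul, zero_add]
    rfl
  D_mem := leibniz_mem 2 _ _ _ _ _ (fun _ _ hm => dq_mem 2 hm) fun _ _ hm => dq_mem 2 hm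

variable (p) in
/-- The bimodule `R ⊗ R` over a stable subalgebra, in homological degree one. -/
def eC (hS : Stable S) : DgBimod k p n := conc (eBimod p hS) 1

variable (p) in
/-- The underlying bimodule of `eC`. -/
def eModel (hS : Stable S) : TensorModel S (eC p hS) where
  e := by exact LinearEquiv.refl k _
  left_e a f g := (Algebra.TensorProduct.tmul_mul_tmul a f 1 g).trans
    (congrArg (fun g => (a * f) ⊗ₜ g) (one_mul g))
  right_e a f g := (Algebra.TensorProduct.tmul_mul_tmul 1 f a g).trans
    (congrArg (fun f => f ⊗ₜ (a * g)) (one_mul f))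

variable (p) in
/-- The generator of `eC`. -/
def eOne (hS : Stable S) : (eC p hS).carrier := (eModel p hS).ind.one

@[simp] theorem eC_d (hS : Stable S) (x : (eC p hS).carrier) : (eC p hS).d x = 0 := rfl

@[simp] theorem eC_D (hS : Stable S) : (eC p hS).D (eOne p hS) = 0 := by
  have h : dq k n (1 : Poly k n) = 0 := Derivation.map_one_eq_zero _
  change eD hS ((1 : Poly k n) ⊗ₜ (1 : Poly k n)) = 0
  rw [eD_tmul, h, TensorProduct.tmul_zero, TensorProduct.zero_tmul, add_zero]

theorem eOne_mem (hS : Stable S) : eOne p hS ∈ (eC p hS).deg (0, 1) :=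
  conc_mem (X := eBimod p hS) 1 (by
    have h : ∀ {a b : Poly k n} {e e' : ℤ},
        a ∈ MvPolynomial.weightedHomogeneousSubmodule k (fun _ : Fin n => (2 : ℤ)) e →
        b ∈ MvPolynomial.weightedHomogeneousSubmodule k (fun _ : Fin n => (2 : ℤ)) e' →
        (a ⊗ₜ b : Poly k n ⊗[S] Poly k n) ∈ eDeg S (e + e') := tmul_mem_tensorDeg
    have h1 := MvPolynomial.isWeightedHomogeneous_one k (fun _ : Fin n => (2 : ℤ))
    have h2 := h h1 h1
    rwa [add_zero] at h2)

theorem eOne_central (hS : Stable S) {s : Poly k n} (hs : s ∈ S) :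
    (eC p hS).left s (eOne p hS) = (eC p hS).right s (eOne p hS) :=
  (eModel p hS).ind.central s hs

end InducedBimod

variable (k) in
/-- The polynomials symmetric for both `i` and `j`. -/
def symInf (i j : Fin (n - 1)) : Subalgebra k (Poly k n) := symSubalgebra k i ⊓ symSubalgebra k j

theorem symInf_le_left {i j : Fin (n - 1)} : symInf k i j ≤ symSubalgebra k i := inf_le_left

theorem symInf_le_right {i j : Fin (n - 1)} : symInf k i j ≤ symSubalgebra k j := inf_le_right

theorem mem_symInf {i j : Fin (n - 1)} {s : Poly k n} (h1 : s ∈ symSubalgebra k i)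
    (h2 : s ∈ symSubalgebra k j) : s ∈ symInf k i j := ⟨h1, h2⟩

theorem component_mem_symSubalgebra {i : Fin (n - 1)} {s : Poly k n} (hs : s ∈ symSubalgebra k i)
    (r : ℕ) : MvPolynomial.homogeneousComponent r s ∈ symSubalgebra k i := by
  rw [mem_symSubalgebra, MvPolynomial.rename_homogeneousComponent, mem_symSubalgebra.1 hs]

theorem symInf_stable (i j : Fin (n - 1)) : Stable (symInf k i j) where
  dq_mem _ hs := mem_symInf (dqSym i ⟨_, symInf_le_left hs⟩).2 (dqSym j ⟨_, symInf_le_right hs⟩).2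
  component_mem _ hs r := mem_symInf (component_mem_symSubalgebra (symInf_le_left hs) r)
    (component_mem_symSubalgebra (symInf_le_right hs) r)

section TripleBimod

variable (i : Fin (n - 1)) [Fact p.Prime] [CharP k p]

variable (k p) in
/-- The bimodule `B_i` in homological degree one. -/
def bC1 : DgBimod k p n := conc (bBimod k p i) 1

variable (k p) in
/-- The underlying bimodule of `bC1`. -/
def b1Model : TensorModel (symSubalgebra k i) (bC1 k p i) where
  e := by exact LinearEquiv.refl k _
  left_e := (bModel k p i).left_e
  right_e := (bModel k p i).right_e

variable (k p) in
/-- The generator of `bC1`. -/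
def b1One : (bC1 k p i).carrier := (b1Model k p i).ind.one

@[simp] theorem bC1_d (x : (bC1 k p i).carrier) : (bC1 k p i).d x = 0 := rfl

@[simp] theorem bC1_D : (bC1 k p i).D (b1One k p i) = 0 := bC_D i

theorem b1One_mem : b1One k p i ∈ (bC1 k p i).deg (0, 1) := conc_mem 1 (one_mem_bDeg i)

variable {i} in
theorem b1One_central {s : Poly k n} (hs : s ∈ symSubalgebra k i) :
    (bC1 k p i).left s (b1One k p i) = (bC1 k p i).right s (b1One k p i) :=
  (b1Model k p i).ind.central s hs

end TripleBimod

/-- The generators `i` and `j` have exactly one strand `b` in common; `a` is the other strand on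
which `i` acts, and `c` is the other strand on which `j` acts. -/
structure Adj (i j : Fin (n - 1)) (a b c : Fin n) : Prop where
  left : IsPair i a b
  right : IsPair j c b
  ne : a ≠ c

namespace Adj

variable {i j : Fin (n - 1)} {a b c : Fin n}

theorem symm (h : Adj i j a b c) : Adj j i c b a := ⟨h.right, h.left, h.ne.symm⟩

theorem X_mem (h : Adj i j a b c) : MvPolynomial.X c ∈ symSubalgebra k i :=
  h.left.X_mem h.ne.symm h.right.ne

theorem X_mem' (h : Adj i j a b c) : MvPolynomial.X a ∈ symSubalgebra k j := h.symm.X_mem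

theorem e1_mem (h : Adj i j a b c) :
    (MvPolynomial.X a + MvPolynomial.X b + MvPolynomial.X c : Poly k n) ∈ symInf k i j := by
  refine mem_symInf (add_mem h.left.sum_mem h.X_mem) ?_
  rw [add_assoc, add_comm (MvPolynomial.X b)]
  exact add_mem h.X_mem' h.right.sum_mem

theorem e2_mem (h : Adj i j a b c) :
    (MvPolynomial.X a * MvPolynomial.X b + MvPolynomial.X c *
      (MvPolynomial.X a + MvPolynomial.X b) : Poly k n) ∈ symInf k i j := by
  refine mem_symInf (add_mem h.left.prod_mem (mul_mem h.X_mem h.left.sum_mem)) ?_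
  have := add_mem (h.right.prod_mem (k := k)) (mul_mem h.X_mem' (h.right.sum_mem (k := k)))
  rwa [show (MvPolynomial.X c * MvPolynomial.X b + MvPolynomial.X a *
    (MvPolynomial.X c + MvPolynomial.X b) : Poly k n) = MvPolynomial.X a * MvPolynomial.X b +
      MvPolynomial.X c * (MvPolynomial.X a + MvPolynomial.X b) by ring] at this

theorem e3_mem (h : Adj i j a b c) :
    (MvPolynomial.X a * MvPolynomial.X b * MvPolynomial.X c : Poly k n) ∈ symInf k i j := by
  refine mem_symInf (mul_mem h.left.prod_mem h.X_mem) ?_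
  have := mul_mem h.X_mem' (h.right.prod_mem (k := k))
  rwa [show (MvPolynomial.X a * (MvPolynomial.X c * MvPolynomial.X b) : Poly k n) =
    MvPolynomial.X a * MvPolynomial.X b * MvPolynomial.X c by ring] at this

/-- The polynomials symmetric for `i` are generated by those symmetric for both `i` and `j` and the
single variable `c`. -/
theorem le_adjoin (h : Adj i j a b c) : symSubalgebra k i ≤ Algebra.adjoin k
    (insert (MvPolynomial.X c) (symInf k i j : Set (Poly k n))) := by
  have h1 : ∀ s ∈ symInf k i j, s ∈ Algebra.adjoin k
      (insert (MvPolynomial.X c) (symInf k i j : Set (Poly k n))) :=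
    fun a ha => Algebra.subset_adjoin (Set.mem_insert_of_mem _ ha)
  have h2 : (MvPolynomial.X c : Poly k n) ∈ Algebra.adjoin k
      (insert (MvPolynomial.X c) (symInf k i j : Set (Poly k n))) :=
    Algebra.subset_adjoin (Set.mem_insert _ _)
  have h3 := sub_mem (h1 _ h.e1_mem) h2
  rw [add_sub_cancel_right] at h3
  have h4 := sub_mem (h1 _ h.e2_mem) (mul_mem h2 h3)
  rw [add_sub_cancel_right] at h4
  refine h.left.le_of_mem _ h3 h4 fun l hl hl' => ?_
  by_cases hc : l = c
  · exact hc ▸ h2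
  · exact h1 _ (mem_symInf (h.left.X_mem hl hl') (h.right.X_mem hc hl'))

/-- The variable `c` is a root of a cubic polynomial with coefficients in the symmetric
polynomials. -/
theorem left_cubic (h : Adj i j a b c) {M : DgBimod k p n} {z : M.carrier}
    (hz : ∀ s ∈ symInf k i j, M.left s z = M.right s z) :
    M.left (MvPolynomial.X c) (M.left (MvPolynomial.X c) (M.left (MvPolynomial.X c) z)) =
      M.right (MvPolynomial.X a + MvPolynomial.X b + MvPolynomial.X c)
        (M.left (MvPolynomial.X c) (M.left (MvPolynomial.X c) z)) -
      M.right (MvPolynomial.X a * MvPolynomial.X b + MvPolynomial.X c *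
        (MvPolynomial.X a + MvPolynomial.X b)) (M.left (MvPolynomial.X c) z) +
      M.right (MvPolynomial.X a * MvPolynomial.X b * MvPolynomial.X c) z := by
  rw [← M.left_right, ← M.left_right, ← M.left_right, ← hz _ h.e1_mem, ← hz _ h.e2_mem,
    ← hz _ h.e3_mem]
  simp only [← Module.End.mul_apply, ← map_mul]
  rw [← LinearMap.sub_apply, ← map_sub, ← LinearMap.add_apply, ← map_add]
  congr 2; ring

variable [Fact p.Prime] [CharP k p] {Q : DgBimod k p n}

open DgBimod

variable (h : Adj i j a b c) (z : Q.carrier)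
  (hz : ∀ s ∈ symInf k i j, Q.left s z = Q.right s z)

/-- The map out of `B_i` that sends `1 ⊗ 1` to `z` and `b ⊗ 1` to `c z`. -/
def kappa : SHom (symInf k i j) (bC k p i) Q :=
  bQuad h.left.symm symInf_le_left z (Q.left (MvPolynomial.X c) z) hz (fun s hs => by
    rw [left_comm, hz s hs, Q.left_right])

@[simp] theorem kappa_one : (h.kappa z hz) (bOne k p i) = z := bQuad_one _ _ _ _ _ _

@[simp] theorem kappa_left_one :
    (h.kappa z hz) ((bC k p i).left (MvPolynomial.X b) (bOne k p i)) =
      Q.left (MvPolynomial.X c) z := bQuad_left_one _ _ _ _ _ _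

/-- Although `kappa` is not linear over `c`, it satisfies the quadratic equation of `c` over the
polynomials symmetric for `j`. -/
theorem kappa_quad (y : (bC k p i).carrier) :
    Q.left (MvPolynomial.X c) ((h.kappa z hz)
        ((bC k p i).left (MvPolynomial.X c + MvPolynomial.X b) y)) -
      (h.kappa z hz) ((bC k p i).left (MvPolynomial.X c * MvPolynomial.X b) y) =
      Q.left (MvPolynomial.X c) (Q.left (MvPolynomial.X c) ((h.kappa z hz) y)) := by
  have hc : (bC k p i).left (MvPolynomial.X c) (bOne k p i) =
      (bC k p i).right (MvPolynomial.X c) (bOne k p i) := bOne_central h.X_mem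
  have e1 := left_left_quad (bOne_central (p := p) (h.left.symm.sum_mem (k := k)))
    (bOne_central h.left.symm.prod_mem)
  have key := (bModel k p i).ind.ext_quad (h.left.symm.quadBasis k)
    (f := (SHom.lmul _ _ (MvPolynomial.X c)).comp ((h.kappa z hz).comp
      (SHom.lmul _ _ (MvPolynomial.X c + MvPolynomial.X b))) -
        (h.kappa z hz).comp (SHom.lmul _ _ (MvPolynomial.X c * MvPolynomial.X b)))
    (g := (SHom.lmul _ _ (MvPolynomial.X c)).comp
      ((SHom.lmul _ _ (MvPolynomial.X c)).comp (h.kappa z hz)))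
  simp only [SHom.sub_apply, SHom.comp_apply, SHom.lmul_apply] at key
  refine key ?_ ?_ y
  · change Q.left (MvPolynomial.X c) ((h.kappa z hz)
        ((bC k p i).left (MvPolynomial.X c + MvPolynomial.X b) (bOne k p i))) -
      (h.kappa z hz) ((bC k p i).left (MvPolynomial.X c * MvPolynomial.X b) (bOne k p i)) =
      Q.left (MvPolynomial.X c) (Q.left (MvPolynomial.X c) ((h.kappa z hz) (bOne k p i)))
    rw [mul_comm (MvPolynomial.X c) (MvPolynomial.X b), map_mul, Module.End.mul_apply, hc,
      map_add, LinearMap.add_apply, hc, (bC k p i).left_right]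
    simp only [map_add, SHom.map_right, kappa_one, kappa_left_one]
    rw [Q.left_right]
    abel
  · change Q.left (MvPolynomial.X c) ((h.kappa z hz)
        ((bC k p i).left (MvPolynomial.X c + MvPolynomial.X b)
          ((bC k p i).left (MvPolynomial.X b) (bOne k p i)))) -
      (h.kappa z hz) ((bC k p i).left (MvPolynomial.X c * MvPolynomial.X b)
          ((bC k p i).left (MvPolynomial.X b) (bOne k p i))) =
      Q.left (MvPolynomial.X c) (Q.left (MvPolynomial.X c) ((h.kappa z hz)
          ((bC k p i).left (MvPolynomial.X b) (bOne k p i))))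
    rw [map_mul, Module.End.mul_apply, map_add, LinearMap.add_apply, e1,
      left_comm _ (MvPolynomial.X c), hc, (bC k p i).left_right, map_sub, (bC k p i).left_right,
      (bC k p i).left_right, left_comm _ (MvPolynomial.X c), hc, (bC k p i).left_right]
    simp only [map_add, map_sub, SHom.map_right, kappa_one, kappa_left_one]
    rw [h.left_cubic hz]
    simp only [map_add, map_mul, LinearMap.add_apply, Module.End.mul_apply, Q.left_right,
      SHom.map_right, kappa_left_one]
    simp only [right_comm Q (MvPolynomial.X b) (MvPolynomial.X a),
      right_comm Q (MvPolynomial.X c) (MvPolynomial.X a),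
      right_comm Q (MvPolynomial.X c) (MvPolynomial.X b)]
    abel

/-- The coordinates of elements of `B_j` with respect to the basis `1 ⊗ 1`, `c ⊗ 1` over the right
action. -/
theorem coef_eq (x : (bC k p j).carrier) :
    x = (bC k p j).right ((bModel k p j).coef (h.right.quadBasis k).c0 x) (bOne k p j) +
      (bC k p j).right ((bModel k p j).coef (h.right.quadBasis k).c1 x)
        ((bC k p j).left (MvPolynomial.X c) (bOne k p j)) := by
  have e := (bModel k p j).ind.ext_quad (h.right.quadBasis k) (S' := ⊥)
    (f := SHom.id (bC k p j)) (g := bQuad h.right bot_le (bOne k p j)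
      ((bC k p j).left (MvPolynomial.X c) (bOne k p j))
      (fun s hs => bOne_central (bot_le (a := symSubalgebra k j) hs)) (fun s hs => by
        rw [left_comm, bOne_central (bot_le (a := symSubalgebra k j) hs), (bC k p j).left_right]))
    (by exact (bQuad_one _ _ _ _ _ _).symm) (by exact (bQuad_left_one _ _ _ _ _ _).symm) x
  exact e

/-- The bilinear map underlying `sixAux`. -/
def sixBilin : (bC k p j).carrier →ₗ[k] (bC k p i).carrier →ₗ[k] Q.carrier :=
  LinearMap.mk₂ k (fun x y => (h.kappa z hz) ((bC k p i).left
      ((bModel k p j).coef (h.right.quadBasis k).c0 x) y) +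
    Q.left (MvPolynomial.X c) ((h.kappa z hz) ((bC k p i).left
      ((bModel k p j).coef (h.right.quadBasis k).c1 x) y)))
    (fun x x' y => by simp only [map_add, LinearMap.add_apply]; abel)
    (fun r x y => by simp only [map_smul, LinearMap.smul_apply, smul_add])
    (fun x y y' => by simp only [map_add]; abel)
    (fun r x y => by simp only [map_smul, smul_add])

theorem sixBilin_apply (x : (bC k p j).carrier) (y : (bC k p i).carrier) :
    h.sixBilin z hz x y = (h.kappa z hz) ((bC k p i).left
      ((bModel k p j).coef (h.right.quadBasis k).c0 x) y) +
    Q.left (MvPolynomial.X c) ((h.kappa z hz) ((bC k p i).left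
      ((bModel k p j).coef (h.right.quadBasis k).c1 x) y)) := rfl

/-- The map out of `B_j ⊗ B_i` that sends the generator to `z` and is linear over the polynomials
symmetric for both `i` and `j`, given by `kappa` on `1 ⊗ B_i` and by `c` times `kappa` on
`c ⊗ B_i`. -/
def sixAux : SHom (symInf k i j) (bC k p j ⊠ bC k p i) Q :=
  SHom.tensorLift (h.sixBilin z hz)
    (fun r x y => by
      simp only [sixBilin_apply, TensorModel.coef_right]
      rw [mul_comm r, mul_comm r, map_mul, map_mul, Module.End.mul_apply, Module.End.mul_apply])
    (fun s hs x y => by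
      simp only [sixBilin_apply, TensorModel.coef_left _ _ (symInf_le_right hs)]
      rw [map_mul, map_mul, Module.End.mul_apply, Module.End.mul_apply, SHom.map_left _ hs,
        SHom.map_left _ hs, left_comm Q, map_add])
    (fun r x y => by
      simp only [sixBilin_apply]
      rw [(bC k p i).left_right, (bC k p i).left_right, SHom.map_right, SHom.map_right,
        Q.left_right, map_add])

theorem sixAux_one (y : (bC k p i).carrier) :
    (h.sixAux z hz) (tmul (bOne k p j) y) = (h.kappa z hz) y := by
  refine (SHom.tensorLift_tmul _ _ _ _ _ _).trans ?_
  have h0 : (bModel k p j).coef (h.right.quadBasis k).c0 (bOne k p j) = 1 :=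
    ((bModel k p j).coef_one _).trans ((h.right.quadBasis k).c0_of_mem (one_mem _))
  have h1 : (bModel k p j).coef (h.right.quadBasis k).c1 (bOne k p j) = 0 :=
    ((bModel k p j).coef_one _).trans ((h.right.quadBasis k).c1_of_mem (one_mem _))
  rw [sixBilin_apply, h0, h1]
  simp

theorem sixAux_left_one (y : (bC k p i).carrier) :
    (h.sixAux z hz) (tmul ((bC k p j).left (MvPolynomial.X c) (bOne k p j)) y) =
      Q.left (MvPolynomial.X c) ((h.kappa z hz) y) := by
  refine (SHom.tensorLift_tmul _ _ _ _ _ _).trans ?_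
  have h0 : (bModel k p j).coef (h.right.quadBasis k).c0
      ((bC k p j).left (MvPolynomial.X c) (bOne k p j)) = 0 :=
    ((bModel k p j).coef_left_one _ _).trans (h.right.quadBasis k).c0_self
  have h1 : (bModel k p j).coef (h.right.quadBasis k).c1
      ((bC k p j).left (MvPolynomial.X c) (bOne k p j)) = 1 :=
    ((bModel k p j).coef_left_one _ _).trans (h.right.quadBasis k).c1_self
  rw [sixBilin_apply, h0, h1]
  simp

/-- Linearity over `c`: on `c ⊗ 1` the element `c ^ 2` is rewritten by the quadratic equation over
the polynomials symmetric for `j`, and `kappa_quad` says that both sides agree. -/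
theorem sixAux_left (x : (bC k p j ⊠ bC k p i).carrier) :
    (h.sixAux z hz) ((bC k p j ⊠ bC k p i).left (MvPolynomial.X c) x) =
      Q.left (MvPolynomial.X c) ((h.sixAux z hz) x) := by
  refine tens_induction (P := fun x => (h.sixAux z hz)
    ((bC k p j ⊠ bC k p i).left (MvPolynomial.X c) x) =
      Q.left (MvPolynomial.X c) ((h.sixAux z hz) x)) (by simp) (fun x y => ?_)
      (fun x y hx hy => by simp only [map_add, hx, hy]) x
  have e1 := left_left_quad (bOne_central (p := p) (h.right.sum_mem (k := k)))
    (bOne_central h.right.prod_mem)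
  rw [h.coef_eq x]
  simp only [map_add, LinearMap.add_apply, tmul_balanced]
  congr 1
  · rw [tens_left, sixAux_left_one, sixAux_one]
  · rw [tens_left, e1, map_sub, LinearMap.sub_apply, tmul_balanced, tmul_balanced, map_sub,
      sixAux_left_one, sixAux_one, sixAux_left_one, h.kappa_quad]

/-- The map out of `B_j ⊗ B_i` that sends the generator to `z` and is linear over the polynomials
symmetric for `i`. For `z = 1 ⊗ 1` in `R ⊗ R` over the polynomials symmetric for both `i` and `j`,
this extends to the map `B_i ⊗ B_j ⊗ B_i → R ⊗ R` that underlies the six-valent vertex. -/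
def six : SHom (symSubalgebra k i) (bC k p j ⊠ bC k p i) Q :=
  SHom.upgrade (MvPolynomial.X c) h.le_adjoin (h.sixAux z hz) (h.sixAux_left z hz)

@[simp] theorem six_one : (h.six z hz) (tmul (bOne k p j) (bOne k p i)) = z :=
  (SHom.upgrade_apply _ _ _ _ _).trans ((h.sixAux_one z hz _).trans (h.kappa_one z hz))

@[simp] theorem six_left_one :
    (h.six z hz) (tmul ((bC k p j).left (MvPolynomial.X b) (bOne k p j)) (bOne k p i)) =
      Q.right (MvPolynomial.X c) z := by
  have e : (bC k p j).left (MvPolynomial.X b) (bOne k p j) =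
      (bC k p j).right (MvPolynomial.X c + MvPolynomial.X b) (bOne k p j) -
        (bC k p j).left (MvPolynomial.X c) (bOne k p j) := by
    rw [← bOne_central h.right.sum_mem, ← LinearMap.sub_apply, ← map_sub, add_sub_cancel_left]
  refine (SHom.upgrade_apply _ _ _ _ _).trans ?_
  rw [e, map_sub, LinearMap.sub_apply, tmul_balanced, map_sub, sixAux_one, sixAux_left_one,
    map_add, LinearMap.add_apply, bOne_central h.X_mem, map_add, SHom.map_right, kappa_one,
    kappa_left_one]
  abel

end Adj

end Triple

/-! ### The braid relation: the complexes `X` and `T_i ⊗ T_j ⊗ B_i` -/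

section BraidRelation

variable {k : Type u} [Field k] {p n : ℕ} [Fact p.Prime] [CharP k p]

open DgBimod

section Insertion

variable {S : Subalgebra k (Poly k n)} {M N Q : DgBimod k p n}

/-- The map `l ↦ m ⊗ l`, for an element `m` on which both actions of `S` agree. -/
def tmulC (S : Subalgebra k (Poly k n)) (N : DgBimod k p n) (m : M.carrier)
    (hm : ∀ s ∈ S, M.left s m = M.right s m) : SHom S N (M ⊠ N) :=
  SHom.mk (tmul m) (fun s hs l => tmul_left_central (hm s hs) l)
    (fun s l => (tens_right s m l).symm)

@[simp] theorem tmulC_apply (m : M.carrier) (hm) (l : N.carrier) :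
    (tmulC S N m hm) l = tmul m l := rfl

variable (k p) in
/-- The projection `T_j ⊗ N → B_j ⊗ N`. -/
def tensFst (j : Fin (n - 1)) (N : DgBimod k p n) : BHom (posC k p j ⊠ N) (bC k p j ⊠ N) :=
  SHom.tmap (posFst k p j) (SHom.id N)

variable (k p) in
/-- The projection `T_j ⊗ N → N`. -/
def tensSnd (j : Fin (n - 1)) (N : DgBimod k p n) : BHom (posC k p j ⊠ N) N :=
  posTlift j 0 (SHom.id N)

variable {j : Fin (n - 1)}

@[simp] theorem tensFst_posB (l : N.carrier) :
    (tensFst k p j N) (tmul (posB k p j) l) = tmul (bOne k p j) l := by simp [tensFst]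

@[simp] theorem tensFst_left_posB (a : Poly k n) (l : N.carrier) :
    (tensFst k p j N) (tmul ((posC k p j).left a (posB k p j)) l) =
      tmul ((bC k p j).left a (bOne k p j)) l := by simp [tensFst]

@[simp] theorem tensFst_posR (l : N.carrier) :
    (tensFst k p j N) (tmul (posR k p j) l) = 0 := by simp [tensFst]

@[simp] theorem tensFst_left_posR (a : Poly k n) (l : N.carrier) :
    (tensFst k p j N) (tmul ((posC k p j).left a (posR k p j)) l) = 0 := by
  rw [← tens_left, BHom.map_left, tensFst_posR, map_zero]

@[simp] theorem tensSnd_posB (l : N.carrier) :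
    (tensSnd k p j N) (tmul (posB k p j) l) = 0 := (posTlift_posB _ _ _ _).trans rfl

@[simp] theorem tensSnd_posR (l : N.carrier) :
    (tensSnd k p j N) (tmul (posR k p j) l) = l := (posTlift_posR _ _ _ _).trans rfl

@[simp] theorem tensSnd_left_posB (a : Poly k n) (l : N.carrier) :
    (tensSnd k p j N) (tmul ((posC k p j).left a (posB k p j)) l) = 0 := by
  rw [← tens_left, BHom.map_left, tensSnd_posB, map_zero]

@[simp] theorem tensSnd_left_posR (a : Poly k n) (l : N.carrier) :
    (tensSnd k p j N) (tmul ((posC k p j).left a (posR k p j)) l) = N.left a l := by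
  rw [← tens_left, BHom.map_left, tensSnd_posR]

end Insertion

namespace Six

variable (k p) (i j : Fin (n - 1))

/-- The bimodule `R ⊗ R` over the polynomials symmetric for both `i` and `j`, in degree one. -/
abbrev E : DgBimod k p n := eC p (symInf_stable (k := k) i j)

/-- The bimodule `B_j ⊗ B_i` in degree one. -/
abbrev W : DgBimod k p n := bC1 k p j ⊠ bC k p i

/-- The generator of `E`. -/
def eGen : (E k p i j).carrier := eOne p (symInf_stable (k := k) i j)

/-- The generator of `W`. -/
def wGen : (W k p i j).carrier := tmul (b1One k p j) (bOne k p i)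

variable {k p i j}

theorem eGen_central {s : Poly k n} (hs : s ∈ symInf k i j) :
    (E k p i j).left s (eGen k p i j) = (E k p i j).right s (eGen k p i j) :=
  eOne_central _ hs

theorem wGen_central {s : Poly k n} (hs : s ∈ symInf k i j) :
    (W k p i j).left s (wGen k p i j) = (W k p i j).right s (wGen k p i j) :=
  tmul_central (b1One_central (symInf_le_right hs)) (bOne_central (symInf_le_left hs))

theorem eGen_mem : eGen k p i j ∈ (E k p i j).deg (0, 1) := eOne_mem _

theorem wGen_mem : wGen k p i j ∈ (W k p i j).deg (0, 1) :=
  tmul_mem' (b1One_mem j) (bOne_mem i) (by simp)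

@[simp] theorem eGen_D : (E k p i j).D (eGen k p i j) = 0 := eC_D _

@[simp] theorem wGen_D : (W k p i j).D (wGen k p i j) = 0 := by simp [wGen]

@[simp] theorem wGen_d : (W k p i j).d (wGen k p i j) = 0 := by simp [wGen]

theorem e_gen : Gen (E k p i j) {eGen k p i j} := (eModel p (symInf_stable i j)).ind.gen

variable {a b c : Fin n}

theorem w_gen (h : Adj i j a b c) : Gen (W k p i j) {wGen k p i j} := by
  refine ((b1Model k p j).ind.gen_tens
    ((bModel k p i).ind.gen.genOver_quad (h.right.quadBasis k))).of_gen fun P h1 h2 h3 => ?_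
  rw [Set.singleton_subset_iff] at h3
  rintro _ ⟨_, rfl | ⟨_, rfl, rfl⟩, rfl⟩
  · exact h3
  · have := h2 (MvPolynomial.X c) _ h3
    rw [wGen, ← tmul_left_right _ (bOne_central h.X_mem)] at this
    exact this

variable (k p i j) in
/-- The map `E → W` that sends the generator to the generator. -/
def phi : DgHom (E k p i j) (W k p i j) :=
  DgHom.ofGen e_gen ((eModel p (symInf_stable i j)).ind.lift (wGen k p i j)
      fun _ hs => wGen_central hs)
    (by
      rintro _ rfl
      rw [eGen_D, map_zero]
      exact ((congrArg (W k p i j).D (Ind.lift_one _ _ _)).trans wGen_D).symm)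
    (by
      rintro _ rfl
      rw [eC_d, map_zero]
      exact ((congrArg (W k p i j).d (Ind.lift_one _ _ _)).trans wGen_d).symm)
    (by
      rintro _ rfl
      refine ⟨_, eGen_mem, ?_⟩
      have := wGen_mem (k := k) (p := p) (i := i) (j := j)
      rwa [← Ind.lift_one (eModel p (symInf_stable i j)).ind (wGen k p i j)
        fun _ hs => wGen_central hs] at this)

@[simp] theorem phi_eGen : (phi k p i j).hom (eGen k p i j) = wGen k p i j :=
  Ind.lift_one _ _ _

variable (k p i j) in
/-- The mapping cone of `phi : E → W`, the complex to which both `T_i ⊗ T_j ⊗ B_i` and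
`B_j ⊗ T_i ⊗ T_j` retract. -/
def X : DgBimod k p n := cone (phi k p i j)

variable (k p i j) in
/-- The generator of `X` in degree two. -/
def e : (X k p i j).carrier := cone.inl (phi k p i j) (eGen k p i j)

variable (k p i j) in
/-- The generator of `X` in degree one. -/
def w : (X k p i j).carrier := cone.inr (phi k p i j) (wGen k p i j)

theorem e_mem : e k p i j ∈ (X k p i j).deg (0, 2) := cone.inl_mem' eGen_mem (by norm_num)

theorem w_mem : w k p i j ∈ (X k p i j).deg (0, 1) := cone.inr_mem wGen_mem

@[simp] theorem e_D : (X k p i j).D (e k p i j) = 0 :=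
  (cone.D_inl _ _).trans (by rw [eGen_D, map_zero]; rfl)

@[simp] theorem w_D : (X k p i j).D (w k p i j) = 0 :=
  (cone.D_inr _ _).trans (by rw [wGen_D, map_zero]; rfl)

@[simp] theorem e_d : (X k p i j).d (e k p i j) = w k p i j :=
  (cone.d_inl _ _).trans (by rw [eC_d, map_zero, sub_zero, phi_eGen]; rfl)

@[simp] theorem w_d : (X k p i j).d (w k p i j) = 0 :=
  (cone.d_inr _ _).trans (by rw [wGen_d, map_zero]; rfl)

theorem e_central {s : Poly k n} (hs : s ∈ symInf k i j) :
    (X k p i j).left s (e k p i j) = (X k p i j).right s (e k p i j) :=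
  ((cone.inl (phi k p i j)).map_left s _).symm.trans
    ((congrArg _ (eGen_central hs)).trans (SHom.map_right _ _ _))

theorem gen (h : Adj i j a b c) : Gen (X k p i j) {e k p i j, w k p i j} := by
  have h := cone.gen (f := phi k p i j) e_gen (w_gen h)
  rw [Set.image_singleton, Set.image_singleton, Set.singleton_union] at h
  exact h

variable {Q : DgBimod k p n}

/-- The map out of `X` given by its values on both generators; a map out of `B_j ⊗ B_i` is given by
a map out of `B_i` that is linear over the polynomials symmetric for `j`. -/
def lift (z : Q.carrier) (hz : ∀ s ∈ symInf k i j, Q.left s z = Q.right s z)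
    (α : SHom (symSubalgebra k j) (bC k p i) Q) : BHom (X k p i j) Q :=
  cone.desc ((eModel p (symInf_stable i j)).ind.lift z hz) ((b1Model k p j).ind.tlift α)

@[simp] theorem lift_e (z : Q.carrier) (hz) (α : SHom (symSubalgebra k j) (bC k p i) Q) :
    (lift z hz α) (e k p i j) = z :=
  (cone.desc_inl _ _ _).trans (Ind.lift_one _ _ _)

@[simp] theorem lift_w (z : Q.carrier) (hz) (α : SHom (symSubalgebra k j) (bC k p i) Q) :
    (lift z hz α) (w k p i j) = α (bOne k p i) :=
  (cone.desc_inr _ _ _).trans (Ind.tlift_one _ _ _)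

variable (k p i j) in
/-- The inclusion `B_j ⊗ B_i → X`. -/
def inW : BHom (W k p i j) (X k p i j) := cone.inr (phi k p i j)

@[simp] theorem inW_wGen : inW k p i j (tmul (b1One k p j) (bOne k p i)) = w k p i j := rfl

end Six

variable (k p) in
/-- The identity of `B_j`, with a shift of the homological degree. -/
def bShift (j : Fin (n - 1)) : BHom (bC k p j) (bC1 k p j) :=
  bLift j (b1One k p j) fun _ hs => b1One_central hs

@[simp] theorem bShift_one (j : Fin (n - 1)) : bShift k p j (bOne k p j) = b1One k p j :=
  bLift_one _ _ _

namespace LeftTriple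

variable {i j : Fin (n - 1)} {a b c : Fin n}

variable (k p i j) in
/-- The complex `T_i ⊗ T_j ⊗ B_i`. -/
abbrev T : DgBimod k p n := posC k p i ⊠ (posC k p j ⊠ bC k p i)

variable (k p i j) in
/-- The generator `b ⊗ b ⊗ 1` of `T_i ⊗ T_j ⊗ B_i`. In the names of the generators the letters
tell, for `T_i` and `T_j` in turn, whether the generator of the `B`-term or of the `R`-term is
taken. -/
def bB : (T k p i j).carrier := tmul (posB k p i) (tmul (posB k p j) (bOne k p i))

variable (k p i j) in
/-- The generator `b ⊗ r ⊗ 1` of `T_i ⊗ T_j ⊗ B_i`. -/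
def bR : (T k p i j).carrier := tmul (posB k p i) (tmul (posR k p j) (bOne k p i))

variable (k p i j) in
/-- The generator `r ⊗ b ⊗ 1` of `T_i ⊗ T_j ⊗ B_i`. -/
def rB : (T k p i j).carrier := tmul (posR k p i) (tmul (posB k p j) (bOne k p i))

variable (k p i j) in
/-- The generator `r ⊗ r ⊗ 1` of `T_i ⊗ T_j ⊗ B_i`. -/
def rR : (T k p i j).carrier := tmul (posR k p i) (tmul (posR k p j) (bOne k p i))

variable (k p i j) in
/-- The generator `bB` with the variable `x` inserted after the first factor. -/
def bxB (x : Fin n) : (T k p i j).carrier := tmul (posB k p i)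
  ((posC k p j ⊠ bC k p i).left (MvPolynomial.X x) (tmul (posB k p j) (bOne k p i)))

variable (k p i j) in
/-- The generator `bR` with the variable `x` inserted after the first factor. -/
def bxR (x : Fin n) : (T k p i j).carrier := tmul (posB k p i)
  ((posC k p j ⊠ bC k p i).left (MvPolynomial.X x) (tmul (posR k p j) (bOne k p i)))

theorem gen_right (h : Adj i j a b c) : Gen (posC k p j ⊠ bC k p i)
    {tmul (posB k p j) (bOne k p i), tmul (posR k p j) (bOne k p i)} := by
  refine (posC_gen_tens h.right (bModel k p i).ind.gen).of_gen fun P h1 h2 h3 => ?_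
  simp only [Set.insert_subset_iff, Set.singleton_subset_iff, SetLike.mem_coe] at h3
  obtain ⟨m1, m2⟩ := h3
  rintro _ ((⟨t, rfl, rfl⟩ | ⟨t, rfl, rfl⟩) | ⟨t, rfl, rfl⟩)
  · exact m1
  · have := h2 (MvPolynomial.X c) _ m1
    rwa [← tmul_left_right _ (bOne_central h.X_mem)] at this
  · exact m2

theorem gen (h : Adj i j a b c) : Gen (T k p i j) {bB k p i j, bxB k p i j b, bR k p i j,
    bxR k p i j b, rB k p i j, rR k p i j} := by
  refine (posC_gen_tens h.left.symm (gen_right h)).of_gen fun P h1 h2 h3 => ?_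
  simp only [Set.insert_subset_iff, Set.singleton_subset_iff, SetLike.mem_coe] at h3
  obtain ⟨m1, m2, m3, m4, m5, m6⟩ := h3
  rintro _ ((⟨t, rfl | rfl, rfl⟩ | ⟨t, rfl | rfl, rfl⟩) | ⟨t, rfl | rfl, rfl⟩)
  · exact m1
  · exact m3
  · exact m2
  · exact m4
  · exact m5
  · exact m6

theorem bB_central {s : Poly k n} (hs : s ∈ symInf k i j) :
    (T k p i j).left s (bB k p i j) = (T k p i j).right s (bB k p i j) :=
  tmul_central (posB_central (symInf_le_left hs))
    (tmul_central (posB_central (symInf_le_right hs)) (bOne_central (symInf_le_left hs)))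

theorem bR_central {s : Poly k n} (hs : s ∈ symSubalgebra k i) :
    (T k p i j).left s (bR k p i j) = (T k p i j).right s (bR k p i j) :=
  tmul_central (posB_central hs) (tmul_central (posR_central s) (bOne_central hs))

theorem bB_mem : bB k p i j ∈ (T k p i j).deg (0, 2) :=
  tmul_mem' (posB_mem i) (tmul_mem' (posB_mem j) (bOne_mem i) rfl) (by simp)

theorem bR_mem : bR k p i j ∈ (T k p i j).deg (0, 1) :=
  tmul_mem' (posB_mem i) (tmul_mem' (posR_mem j) (bOne_mem i) rfl) (by simp)

theorem rB_mem : rB k p i j ∈ (T k p i j).deg (0, 1) :=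
  tmul_mem' (posR_mem i) (tmul_mem' (posB_mem j) (bOne_mem i) rfl) (by simp)

theorem rR_mem : rR k p i j ∈ (T k p i j).deg (0, 0) :=
  tmul_mem' (posR_mem i) (tmul_mem' (posR_mem j) (bOne_mem i) rfl) (by simp)

theorem bxB_mem (x : Fin n) : bxB k p i j x ∈ (T k p i j).deg (2, 2) :=
  tmul_mem' (posB_mem i) (left_X_mem x (tmul_mem' (posB_mem j) (bOne_mem i) rfl)) (by simp)

theorem bxR_mem (x : Fin n) : bxR k p i j x ∈ (T k p i j).deg (2, 1) :=
  tmul_mem' (posB_mem i) (left_X_mem x (tmul_mem' (posR_mem j) (bOne_mem i) rfl)) (by simp)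

@[simp] theorem bB_D : (T k p i j).D (bB k p i j) = 0 := by simp [bB]

@[simp] theorem bR_D : (T k p i j).D (bR k p i j) = 0 := by simp [bR]

@[simp] theorem rB_D : (T k p i j).D (rB k p i j) = 0 := by simp [rB]

@[simp] theorem bB_d : (T k p i j).d (bB k p i j) = rB k p i j - bR k p i j := by
  simp [bB, rB, bR, sub_eq_add_neg]

@[simp] theorem bR_d : (T k p i j).d (bR k p i j) = rR k p i j := by
  simp [bR, rR]

@[simp] theorem rB_d : (T k p i j).d (rB k p i j) = rR k p i j := by
  simp [rB, rR]

@[simp] theorem rR_d : (T k p i j).d (rR k p i j) = 0 := by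
  simp [rR]

@[simp] theorem bxB_d (x : Fin n) : (T k p i j).d (bxB k p i j x) =
    (T k p i j).left (MvPolynomial.X x) (rB k p i j) - bxR k p i j x := by
  rw [bxB, rB, bxR, tens_d, posC_d_posB, ← tmul_left_central (posR_central _), DgBimod.d_left,
    tens_d, posC_d_posB, bC_d, map_zero, add_zero, signOp_posB, map_neg, LinearMap.neg_apply,
    sub_eq_add_neg]

@[simp] theorem bxR_d (x : Fin n) : (T k p i j).d (bxR k p i j x) =
    (T k p i j).left (MvPolynomial.X x) (rR k p i j) := by
  rw [bxR, rR, tens_d, posC_d_posB, ← tmul_left_central (m := posR k p i) (posR_central _),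
    DgBimod.d_left, tens_d, posC_d_posR, bC_d, map_zero, map_zero, LinearMap.zero_apply, add_zero,
    map_zero, map_zero, add_zero]

/-- The map `X → T_i ⊗ T_j ⊗ B_i` as a map of bimodules. -/
def inclMap : BHom (Six.X k p i j) (T k p i j) :=
  Six.lift (bB k p i j) (fun _ hs => bB_central hs)
    ((BHom.restr _ (tmulC ⊤ _ (posR k p i) (fun s _ => posR_central s))).comp
      (tmulC _ _ (posB k p j) (fun _ hs => posB_central hs)) -
      BHom.restr _ (bLift i (bR k p i j) (fun _ hs => bR_central hs)))

@[simp] theorem inclMap_e : (inclMap (k := k) (p := p)) (Six.e k p i j) = bB k p i j :=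
  Six.lift_e _ _ _

@[simp] theorem inclMap_w : (inclMap (k := k) (p := p)) (Six.w k p i j) =
    rB k p i j - bR k p i j := (Six.lift_w _ _ _).trans (by simp [rB])

/-- The map `X → T_i ⊗ T_j ⊗ B_i`. -/
def incl (h : Adj i j a b c) : DgHom (Six.X k p i j) (T k p i j) :=
  DgHom.ofGen (Six.gen h) inclMap
    (by rintro _ (rfl | rfl) <;> simp)
    (by rintro _ (rfl | rfl) <;> simp)
    (by
      rintro _ (rfl | rfl)
      · exact ⟨_, Six.e_mem, by rw [inclMap_e]; exact bB_mem⟩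
      · exact ⟨_, Six.w_mem, by rw [inclMap_w]; exact sub_mem rB_mem bR_mem⟩)

@[simp] theorem incl_hom (h : Adj i j a b c) : (incl (k := k) (p := p) h).hom = inclMap := rfl

/-- On this element, the value of `retr` at `bxR`, the actions of the polynomials symmetric for `i`
agree: it is the image of a central element of `B_j` tensored with the generator of `B_i`. -/
theorem w_sub_central (h : Adj i j a b c) {s : Poly k n} (hs : s ∈ symSubalgebra k i) :
    (Six.X k p i j).left s ((Six.X k p i j).left (MvPolynomial.X b) (Six.w k p i j) -
      (Six.X k p i j).right (MvPolynomial.X c) (Six.w k p i j)) =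
    (Six.X k p i j).right s ((Six.X k p i j).left (MvPolynomial.X b) (Six.w k p i j) -
      (Six.X k p i j).right (MvPolynomial.X c) (Six.w k p i j)) := by
  have e : (Six.X k p i j).left (MvPolynomial.X b) (Six.w k p i j) -
      (Six.X k p i j).right (MvPolynomial.X c) (Six.w k p i j) =
      Six.inW k p i j (tmul ((bC1 k p j).left (MvPolynomial.X b) (b1One k p j) -
        (bC1 k p j).right (MvPolynomial.X c) (b1One k p j)) (bOne k p i)) := by
    rw [map_sub, LinearMap.sub_apply, map_sub, ← tens_left, tmul_balanced,
      tmul_left_right _ (bOne_central h.X_mem), BHom.map_left, SHom.map_right, Six.inW_wGen]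
  rw [e, ← BHom.map_left, ← SHom.map_right, tmul_central
    (h.right.symm.central (fun s hs => b1One_central hs) s) (bOne_central hs)]

/-- The same for the value of `htpy` at `bxR`. -/
theorem bxB_sub_central (h : Adj i j a b c) {s : Poly k n} (hs : s ∈ symSubalgebra k i) :
    (T k p i j).left s (bxB k p i j b - (T k p i j).right (MvPolynomial.X c) (bB k p i j)) =
      (T k p i j).right s (bxB k p i j b -
        (T k p i j).right (MvPolynomial.X c) (bB k p i j)) := by
  have e : bxB k p i j b - (T k p i j).right (MvPolynomial.X c) (bB k p i j) =
      tmul (posB k p i) (tmul ((posC k p j).left (MvPolynomial.X b) (posB k p j) -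
        (posC k p j).right (MvPolynomial.X c) (posB k p j)) (bOne k p i)) := by
    rw [map_sub, LinearMap.sub_apply, map_sub, ← tens_left, tmul_balanced,
      tmul_left_right _ (bOne_central h.X_mem), bxB, bB,
      tens_right (N := posC k p j ⊠ bC k p i)]
  rw [e]
  exact tmul_central (posB_central hs) (tmul_central
    (h.right.symm.central (fun s hs => posB_central hs) s) (bOne_central hs))

/-- The retraction of `T_i ⊗ T_j ⊗ B_i` onto `X`. -/
def retr (h : Adj i j a b c) : BHom (T k p i j) (Six.X k p i j) :=
  posTlift i
    ((h.six (Six.e k p i j) (fun _ hs => Six.e_central hs)).comp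
        (BHom.restr _ (tensFst k p j _)) +
      (bQuad h.left.symm le_rfl 0 _ (by simp) (fun _ hs => w_sub_central h hs)).comp
        (BHom.restr _ (tensSnd k p j _)))
    ((Six.inW k p i j).comp ((SHom.tmap (bShift k p j) (SHom.id _)).comp (tensFst k p j _)))

variable (h : Adj i j a b c)

@[simp] theorem retr_bB : (retr (k := k) (p := p) h) (bB k p i j) = Six.e k p i j :=
  (posTlift_posB _ _ _ _).trans (by simp)

@[simp] theorem retr_bxB : (retr (k := k) (p := p) h) (bxB k p i j b) =
    (Six.X k p i j).right (MvPolynomial.X c) (Six.e k p i j) :=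
  (posTlift_posB _ _ _ _).trans (by simp)

@[simp] theorem retr_bR : (retr (k := k) (p := p) h) (bR k p i j) = 0 :=
  (posTlift_posB _ _ _ _).trans (by simp)

@[simp] theorem retr_bxR : (retr (k := k) (p := p) h) (bxR k p i j b) =
    (Six.X k p i j).left (MvPolynomial.X b) (Six.w k p i j) -
      (Six.X k p i j).right (MvPolynomial.X c) (Six.w k p i j) :=
  (posTlift_posB _ _ _ _).trans (by simp)

@[simp] theorem retr_rB : (retr (k := k) (p := p) h) (rB k p i j) = Six.w k p i j :=
  (posTlift_posR _ _ _ _).trans (by simp)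

@[simp] theorem retr_rR : (retr (k := k) (p := p) h) (rR k p i j) = 0 :=
  (posTlift_posR _ _ _ _).trans (by simp)

/-- The contracting homotopy on the complement of `X` in `T_i ⊗ T_j ⊗ B_i`. -/
def htpy : BHom (T k p i j) (T k p i j) :=
  posTlift i
    ((bQuad h.left.symm le_rfl 0 _ (by simp) (fun _ hs => bxB_sub_central h hs)).comp
        (BHom.restr _ (tensSnd k p j _)))
    (-(bLift i (bR k p i j) (fun _ hs => bR_central hs)).comp (tensSnd k p j _))

@[simp] theorem htpy_bB : (htpy (k := k) (p := p) h) (bB k p i j) = 0 :=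
  (posTlift_posB _ _ _ _).trans (by simp)

@[simp] theorem htpy_bxB : (htpy (k := k) (p := p) h) (bxB k p i j b) = 0 :=
  (posTlift_posB _ _ _ _).trans (by simp)

@[simp] theorem htpy_bR : (htpy (k := k) (p := p) h) (bR k p i j) = 0 :=
  (posTlift_posB _ _ _ _).trans (by simp)

@[simp] theorem htpy_bxR : (htpy (k := k) (p := p) h) (bxR k p i j b) =
    bxB k p i j b - (T k p i j).right (MvPolynomial.X c) (bB k p i j) :=
  (posTlift_posB _ _ _ _).trans (by simp)

@[simp] theorem htpy_rB : (htpy (k := k) (p := p) h) (rB k p i j) = 0 :=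
  (posTlift_posR _ _ _ _).trans (by simp)

@[simp] theorem htpy_rR : (htpy (k := k) (p := p) h) (rR k p i j) = -bR k p i j :=
  (posTlift_posR _ _ _ _).trans (by simp)

/-- The complex `T_i ⊗ T_j ⊗ B_i` retracts onto `X`. -/
def retract : DefRetract (Six.X k p i j) (T k p i j) :=
  .ofGen (Six.gen h) (gen h) (incl h) (retr h) (htpy h)
    (by
      rintro _ (rfl | rfl | rfl | rfl | rfl | rfl)
      · exact ⟨_, bB_mem, by rw [htpy_bB]; exact zero_mem _⟩
      · exact ⟨_, bxB_mem b, by rw [htpy_bxB]; exact zero_mem _⟩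
      · exact ⟨_, bR_mem, by rw [htpy_bR]; exact zero_mem _⟩
      · exact ⟨_, bxR_mem b, by
          rw [htpy_bxR]; exact sub_mem (bxB_mem b) (right_X_mem c bB_mem)⟩
      · exact ⟨_, rB_mem, by rw [htpy_rB]; exact zero_mem _⟩
      · exact ⟨_, rR_mem, by rw [htpy_rR]; exact neg_mem bR_mem⟩)
    (by rintro _ (rfl | rfl) <;> simp)
    (by rintro _ (rfl | rfl) <;> simp)
    (by
      rintro _ (rfl | rfl | rfl | rfl | rfl | rfl)
      · simp
      · simp
      · simp
      · simp only [htpy_bxR, bxR_d, retr_bxR, incl_hom, map_sub, DgBimod.d_right, BHom.map_left,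
          SHom.map_right, bxB_d, bB_d, inclMap_w, htpy_rR, map_neg]
        abel
      · simp
      · simp)

end LeftTriple

end BraidRelation

/-! ### The braid relation: the complex `B_j ⊗ T_i ⊗ T_j` -/

section BraidRelationRight

variable {k : Type u} [Field k] {p n : ℕ} [Fact p.Prime] [CharP k p]

open DgBimod

namespace RightTriple

variable {i j : Fin (n - 1)} {a b c : Fin n}

variable (k p i j) in
/-- The complex `B_j ⊗ T_i ⊗ T_j`. -/
abbrev T : DgBimod k p n := bC k p j ⊠ (posC k p i ⊠ posC k p j)

variable (k p i j) in
/-- The generator `1 ⊗ b ⊗ b` of `B_j ⊗ T_i ⊗ T_j`. In the names of the generators the letters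
tell, for `T_i` and `T_j` in turn, whether the generator of the `B`-term or of the `R`-term is
taken. -/
def bB : (T k p i j).carrier := tmul (bOne k p j) (tmul (posB k p i) (posB k p j))

variable (k p i j) in
/-- The generator `1 ⊗ b ⊗ r` of `B_j ⊗ T_i ⊗ T_j`. -/
def bR : (T k p i j).carrier := tmul (bOne k p j) (tmul (posB k p i) (posR k p j))

variable (k p i j) in
/-- The generator `1 ⊗ r ⊗ b` of `B_j ⊗ T_i ⊗ T_j`. -/
def rB : (T k p i j).carrier := tmul (bOne k p j) (tmul (posR k p i) (posB k p j))

variable (k p i j) in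
/-- The generator `1 ⊗ r ⊗ r` of `B_j ⊗ T_i ⊗ T_j`. -/
def rR : (T k p i j).carrier := tmul (bOne k p j) (tmul (posR k p i) (posR k p j))

variable (k p i j) in
/-- The generator `bB` with the variable `x` inserted after the first factor. -/
def xbB (x : Fin n) : (T k p i j).carrier := tmul (bOne k p j)
  ((posC k p i ⊠ posC k p j).left (MvPolynomial.X x) (tmul (posB k p i) (posB k p j)))

variable (k p i j) in
/-- The generator `rB` with the variable `x` inserted after the first factor. -/
def xrB (x : Fin n) : (T k p i j).carrier := tmul (bOne k p j)
  ((posC k p i ⊠ posC k p j).left (MvPolynomial.X x) (tmul (posR k p i) (posB k p j)))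

variable (k p i j) in
/-- The generator `bR` with the variable `x` inserted after the first factor. -/
def xbR (x : Fin n) : (T k p i j).carrier := tmul (bOne k p j)
  ((posC k p i ⊠ posC k p j).left (MvPolynomial.X x) (tmul (posB k p i) (posR k p j)))

/-- This multiple of `bR` is no new generator: `a + b` passes to the right through `T_i` and the
term `R` of `T_j`, while `a` passes to the left through `B_j`. -/
theorem xbR_eq (h : Adj i j a b c) : xbR k p i j b =
    (T k p i j).right (MvPolynomial.X a + MvPolynomial.X b) (bR k p i j) -
      (T k p i j).left (MvPolynomial.X a) (bR k p i j) := by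
  have e : (posC k p i).left (MvPolynomial.X b) (posB k p i) =
      (posC k p i).right (MvPolynomial.X a + MvPolynomial.X b) (posB k p i) -
        (posC k p i).left (MvPolynomial.X a) (posB k p i) := by
    rw [← posB_central h.left.sum_mem, ← LinearMap.sub_apply, ← map_sub, add_sub_cancel_left]
  rw [xbR, bR, tens_left, e, map_sub, LinearMap.sub_apply, map_sub, tmul_balanced,
    tmul_left_right _ (posR_central _), ← tmul_left_central (m := bOne k p j)
      (bOne_central h.X_mem'), tens_left, tens_right (N := posC k p i ⊠ posC k p j)]

theorem gen_right (h : Adj i j a b c) : Gen (posC k p i ⊠ posC k p j)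
    {tmul (posB k p i) (posB k p j), tmul (posB k p i) (posR k p j),
      tmul (posR k p i) (posB k p j), tmul (posR k p i) (posR k p j)} := by
  refine (posC_gen_tens h.left (posC_gen j)).of_gen fun P h1 h2 h3 => ?_
  simp only [Set.insert_subset_iff, Set.singleton_subset_iff, SetLike.mem_coe] at h3
  obtain ⟨m1, m2, m3, m4⟩ := h3
  rintro _ ((⟨t, rfl | rfl, rfl⟩ | ⟨t, rfl | rfl, rfl⟩) | ⟨t, rfl | rfl, rfl⟩)
  · exact m1
  · exact m2
  · have := h2 (MvPolynomial.X a) _ m1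
    rwa [← tmul_left_right _ (posB_central h.X_mem')] at this
  · have := h2 (MvPolynomial.X a) _ m2
    rwa [← tmul_left_right _ (posR_central _)] at this
  · exact m3
  · exact m4

theorem gen (h : Adj i j a b c) : Gen (T k p i j) {bB k p i j, xbB k p i j b, bR k p i j,
    rB k p i j, xrB k p i j b, rR k p i j} := by
  refine (bC_gen_tens h.right.symm (gen_right h)).of_gen fun P h1 h2 h3 => ?_
  simp only [Set.insert_subset_iff, Set.singleton_subset_iff, SetLike.mem_coe] at h3
  obtain ⟨m1, m2, m3, m4, m5, m6⟩ := h3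
  rintro _ (⟨t, rfl | rfl | rfl | rfl, rfl⟩ | ⟨t, rfl | rfl | rfl | rfl, rfl⟩)
  · exact m1
  · exact m3
  · exact m4
  · exact m6
  · exact m2
  · change xbR k p i j b ∈ P
    rw [xbR_eq h]
    exact sub_mem (h2 _ _ m3) (h1 _ _ m3)
  · exact m5
  · have := h2 (MvPolynomial.X b) _ m6
    rwa [rR, ← tmul_left_right _ (tmul_central (posR_central _) (posR_central _))] at this

theorem bB_central {s : Poly k n} (hs : s ∈ symInf k i j) :
    (T k p i j).left s (bB k p i j) = (T k p i j).right s (bB k p i j) :=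
  tmul_central (bOne_central (symInf_le_right hs))
    (tmul_central (posB_central (symInf_le_left hs)) (posB_central (symInf_le_right hs)))

theorem rB_central {s : Poly k n} (hs : s ∈ symSubalgebra k j) :
    (T k p i j).left s (rB k p i j) = (T k p i j).right s (rB k p i j) :=
  tmul_central (bOne_central hs) (tmul_central (posR_central s) (posB_central hs))

theorem bB_mem : bB k p i j ∈ (T k p i j).deg (0, 2) :=
  tmul_mem' (bOne_mem j) (tmul_mem' (posB_mem i) (posB_mem j) rfl) (by simp)

theorem bR_mem : bR k p i j ∈ (T k p i j).deg (0, 1) :=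
  tmul_mem' (bOne_mem j) (tmul_mem' (posB_mem i) (posR_mem j) rfl) (by simp)

theorem rB_mem : rB k p i j ∈ (T k p i j).deg (0, 1) :=
  tmul_mem' (bOne_mem j) (tmul_mem' (posR_mem i) (posB_mem j) rfl) (by simp)

theorem rR_mem : rR k p i j ∈ (T k p i j).deg (0, 0) :=
  tmul_mem' (bOne_mem j) (tmul_mem' (posR_mem i) (posR_mem j) rfl) (by simp)

theorem xbB_mem (x : Fin n) : xbB k p i j x ∈ (T k p i j).deg (2, 2) :=
  tmul_mem' (bOne_mem j) (left_X_mem x (tmul_mem' (posB_mem i) (posB_mem j) rfl)) (by simp)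

theorem xrB_mem (x : Fin n) : xrB k p i j x ∈ (T k p i j).deg (2, 1) :=
  tmul_mem' (bOne_mem j) (left_X_mem x (tmul_mem' (posR_mem i) (posB_mem j) rfl)) (by simp)

@[simp] theorem bB_D : (T k p i j).D (bB k p i j) = 0 := by simp [bB]

@[simp] theorem bR_D : (T k p i j).D (bR k p i j) = 0 := by simp [bR]

@[simp] theorem rB_D : (T k p i j).D (rB k p i j) = 0 := by simp [rB]

@[simp] theorem bB_d : (T k p i j).d (bB k p i j) = rB k p i j - bR k p i j := by
  simp [bB, rB, bR, sub_eq_add_neg]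

@[simp] theorem bR_d : (T k p i j).d (bR k p i j) = rR k p i j := by
  simp [bR, rR]

@[simp] theorem rB_d : (T k p i j).d (rB k p i j) = rR k p i j := by
  simp [rB, rR]

@[simp] theorem rR_d : (T k p i j).d (rR k p i j) = 0 := by
  simp [rR]

@[simp] theorem xbB_d (x : Fin n) :
    (T k p i j).d (xbB k p i j x) = xrB k p i j x - xbR k p i j x := by
  rw [xbB, xrB, xbR, tens_d, bC_d, map_zero, LinearMap.zero_apply, zero_add, signOp_bOne,
    DgBimod.d_left, tens_d, posC_d_posB, posC_d_posB, signOp_posB, map_neg, LinearMap.neg_apply,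
    ← sub_eq_add_neg, map_sub, map_sub]

@[simp] theorem xrB_d (x : Fin n) : (T k p i j).d (xrB k p i j x) =
    (T k p i j).right (MvPolynomial.X x) (rR k p i j) := by
  rw [xrB, rR, tens_d, bC_d, map_zero, LinearMap.zero_apply, zero_add, signOp_bOne,
    DgBimod.d_left, tens_d, posC_d_posR, posC_d_posB, signOp_posR, map_zero, LinearMap.zero_apply,
    zero_add, tmul_left_right _ (tmul_central (posR_central _) (posR_central _))]

/-- The map `X → B_j ⊗ T_i ⊗ T_j` as a map of bimodules. -/
def inclMap : BHom (Six.X k p i j) (T k p i j) :=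
  Six.lift (bB k p i j) (fun _ hs => bB_central hs)
    ((uLift _ 0 (rB k p i j) fun _ hs => rB_central hs).comp (BHom.restr _ (brHom k p i).hom) -
      (tmulC _ _ (bOne k p j) (fun _ hs => bOne_central hs)).comp (BHom.restr _
        (bLift i (tmul (posB k p i) (posR k p j))
          (fun s hs => tmul_central (posB_central hs) (posR_central s)))))

@[simp] theorem inclMap_e : (inclMap (k := k) (p := p)) (Six.e k p i j) = bB k p i j :=
  Six.lift_e _ _ _

@[simp] theorem inclMap_w : (inclMap (k := k) (p := p)) (Six.w k p i j) =
    rB k p i j - bR k p i j := (Six.lift_w _ _ _).trans (by simp [bR])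

/-- The map `X → B_j ⊗ T_i ⊗ T_j`. -/
def incl (h : Adj i j a b c) : DgHom (Six.X k p i j) (T k p i j) :=
  DgHom.ofGen (Six.gen h) inclMap
    (by rintro _ (rfl | rfl) <;> simp)
    (by rintro _ (rfl | rfl) <;> simp)
    (by
      rintro _ (rfl | rfl)
      · exact ⟨_, Six.e_mem, by rw [inclMap_e]; exact bB_mem⟩
      · exact ⟨_, Six.w_mem, by rw [inclMap_w]; exact sub_mem rB_mem bR_mem⟩)

@[simp] theorem incl_hom (h : Adj i j a b c) : (incl (k := k) (p := p) h).hom = inclMap := rfl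

/-- On this element, the value of `retr` at `xrB`, the actions of the polynomials symmetric for `j`
agree: it is the image of the generator of `B_j` tensored with a central element of `B_i`. -/
theorem w_sub_central (h : Adj i j a b c) {s : Poly k n} (hs : s ∈ symSubalgebra k j) :
    (Six.X k p i j).left s ((Six.X k p i j).left (MvPolynomial.X a) (Six.w k p i j) -
      (Six.X k p i j).right (MvPolynomial.X b) (Six.w k p i j)) =
    (Six.X k p i j).right s ((Six.X k p i j).left (MvPolynomial.X a) (Six.w k p i j) -
      (Six.X k p i j).right (MvPolynomial.X b) (Six.w k p i j)) := by
  have e : (Six.X k p i j).left (MvPolynomial.X a) (Six.w k p i j) -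
      (Six.X k p i j).right (MvPolynomial.X b) (Six.w k p i j) =
      Six.inW k p i j (tmul (b1One k p j) ((bC k p i).left (MvPolynomial.X a) (bOne k p i) -
        (bC k p i).right (MvPolynomial.X b) (bOne k p i))) := by
    rw [map_sub, map_sub, tmul_left_central (b1One_central h.X_mem'), ← tens_right,
      BHom.map_left, SHom.map_right, Six.inW_wGen]
  rw [e, ← BHom.map_left, ← SHom.map_right, tmul_central (b1One_central hs)
    (h.left.central (fun s hs => bOne_central hs) s)]

/-- The same for the value of `htpy` at `xrB`. -/
theorem xbB_sub_central (h : Adj i j a b c) {s : Poly k n} (hs : s ∈ symSubalgebra k j) :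
    (T k p i j).left s ((T k p i j).right (MvPolynomial.X a) (bB k p i j) - xbB k p i j b) =
      (T k p i j).right s ((T k p i j).right (MvPolynomial.X a) (bB k p i j) -
        xbB k p i j b) := by
  have e : (T k p i j).right (MvPolynomial.X a) (bB k p i j) - xbB k p i j b =
      -tmul (bOne k p j) (tmul ((posC k p i).left (MvPolynomial.X b) (posB k p i) -
        (posC k p i).right (MvPolynomial.X a) (posB k p i)) (posB k p j)) := by
    rw [map_sub, LinearMap.sub_apply, map_sub, ← tens_left, tmul_balanced,
      tmul_left_right _ (posB_central h.X_mem'), xbB, bB,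
      tens_right (N := posC k p i ⊠ posC k p j), neg_sub]
  rw [e, map_neg, map_neg]
  exact congrArg Neg.neg (tmul_central (bOne_central hs) (tmul_central
    (h.left.symm.central (fun s hs => posB_central hs) s) (posB_central hs)))

variable (k p i j) in
/-- The projection `T_i ⊗ T_j → B_i ⊗ B_j`. -/
def projBB : BHom (posC k p i ⊠ posC k p j) (bC k p i ⊠ bC k p j) :=
  SHom.tmap (posFst k p i) (posFst k p j)

variable (k p i j) in
/-- The projection `T_i ⊗ T_j → B_i`. -/
def projBR : BHom (posC k p i ⊠ posC k p j) (bC k p i) :=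
  posTlift i ((uLift _ 0 (bOne k p i) fun _ hs => bOne_central hs).comp
    (BHom.restr _ (posSnd k p j))) 0

variable (k p i j) in
/-- The projection `T_i ⊗ T_j → B_j`. -/
def projRB : BHom (posC k p i ⊠ posC k p j) (bC k p j) := posTlift i 0 (posFst k p j)

variable (k p i j) in
/-- The projection `T_i ⊗ T_j → R`. -/
def projRR : BHom (posC k p i ⊠ posC k p j) (uC k p n 0) := posTlift i 0 (posSnd k p j)

@[simp] theorem projBB_BB : projBB k p i j (tmul (posB k p i) (posB k p j)) =
    tmul (bOne k p i) (bOne k p j) := by simp [projBB]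

@[simp] theorem projBB_BR : projBB k p i j (tmul (posB k p i) (posR k p j)) = 0 := by
  simp [projBB]

@[simp] theorem projBB_RB : projBB k p i j (tmul (posR k p i) (posB k p j)) = 0 := by
  simp [projBB]

@[simp] theorem projBB_RR : projBB k p i j (tmul (posR k p i) (posR k p j)) = 0 := by
  simp [projBB]

@[simp] theorem projBR_BB : projBR k p i j (tmul (posB k p i) (posB k p j)) = 0 :=
  (posTlift_posB _ _ _ _).trans (by simp)

@[simp] theorem projBR_BR : projBR k p i j (tmul (posB k p i) (posR k p j)) = bOne k p i :=
  (posTlift_posB _ _ _ _).trans (by simp)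

@[simp] theorem projBR_R (l : (posC k p j).carrier) :
    projBR k p i j (tmul (posR k p i) l) = 0 :=
  (posTlift_posR _ _ _ _).trans rfl

@[simp] theorem projRB_B (l : (posC k p j).carrier) :
    projRB k p i j (tmul (posB k p i) l) = 0 :=
  (posTlift_posB _ _ _ _).trans rfl

@[simp] theorem projRB_RB : projRB k p i j (tmul (posR k p i) (posB k p j)) = bOne k p j :=
  (posTlift_posR _ _ _ _).trans (by simp)

@[simp] theorem projRB_RR : projRB k p i j (tmul (posR k p i) (posR k p j)) = 0 :=
  (posTlift_posR _ _ _ _).trans (by simp)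

@[simp] theorem projRR_B (l : (posC k p j).carrier) :
    projRR k p i j (tmul (posB k p i) l) = 0 :=
  (posTlift_posB _ _ _ _).trans rfl

@[simp] theorem projRR_RB : projRR k p i j (tmul (posR k p i) (posB k p j)) = 0 :=
  (posTlift_posR _ _ _ _).trans (by simp)

@[simp] theorem projRR_RR : projRR k p i j (tmul (posR k p i) (posR k p j)) = uOne k p n 0 :=
  (posTlift_posR _ _ _ _).trans (by simp)

/-- The retraction of `B_j ⊗ T_i ⊗ T_j` onto `X`. -/
def retr (h : Adj i j a b c) : BHom (T k p i j) (Six.X k p i j) :=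
  (bModel k p j).ind.tlift
    ((h.symm.six (Six.e k p i j) (fun _ hs =>
        Six.e_central (mem_symInf (symInf_le_right hs) (symInf_le_left hs)))).comp
        (BHom.restr _ (projBB k p i j)) +
      (bQuad h.right.symm le_rfl 0 _ (by simp) (fun _ hs => w_sub_central h hs)).comp
        (BHom.restr _ (projRB k p i j)) -
      (BHom.restr _ (Six.inW k p i j)).comp
        ((tmulC _ _ (b1One k p j) (fun _ hs => b1One_central hs)).comp
          (BHom.restr _ (projBR k p i j))))

variable (h : Adj i j a b c)

@[simp] theorem retr_bB : (retr (k := k) (p := p) h) (bB k p i j) = Six.e k p i j :=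
  (Ind.tlift_one _ _ _).trans (by simp)

@[simp] theorem retr_xbB : (retr (k := k) (p := p) h) (xbB k p i j b) =
    (Six.X k p i j).right (MvPolynomial.X a) (Six.e k p i j) :=
  (Ind.tlift_one _ _ _).trans (by
    simp only [SHom.sub_apply, SHom.add_apply, SHom.comp_apply, BHom.restr_apply, BHom.map_left,
      projBB_BB, projRB_B, projBR_BB, map_zero, add_zero, sub_zero]
    rw [tens_left, Adj.six_left_one])

@[simp] theorem retr_bR : (retr (k := k) (p := p) h) (bR k p i j) = -Six.w k p i j :=
  (Ind.tlift_one _ _ _).trans (by simp)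

@[simp] theorem retr_rB : (retr (k := k) (p := p) h) (rB k p i j) = 0 :=
  (Ind.tlift_one _ _ _).trans (by simp)

@[simp] theorem retr_xrB : (retr (k := k) (p := p) h) (xrB k p i j b) =
    (Six.X k p i j).left (MvPolynomial.X a) (Six.w k p i j) -
      (Six.X k p i j).right (MvPolynomial.X b) (Six.w k p i j) :=
  (Ind.tlift_one _ _ _).trans (by
    simp only [SHom.sub_apply, SHom.add_apply, SHom.comp_apply, BHom.restr_apply, BHom.map_left,
      projBB_RB, projRB_RB, projBR_R, map_zero, zero_add, sub_zero, bQuad_left_one])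

@[simp] theorem retr_rR : (retr (k := k) (p := p) h) (rR k p i j) = 0 :=
  (Ind.tlift_one _ _ _).trans (by simp)

/-- The contracting homotopy on the complement of `X` in `B_j ⊗ T_i ⊗ T_j`. -/
def htpy : BHom (T k p i j) (T k p i j) :=
  (bModel k p j).ind.tlift
    ((bQuad h.right.symm le_rfl 0 _ (by simp) (fun _ hs => xbB_sub_central h hs)).comp
        (BHom.restr _ (projRB k p i j)) -
      (uLift _ 0 (rB k p i j) fun _ hs => rB_central hs).comp (BHom.restr _ (projRR k p i j)))

@[simp] theorem htpy_bB : (htpy (k := k) (p := p) h) (bB k p i j) = 0 :=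
  (Ind.tlift_one _ _ _).trans (by simp)

@[simp] theorem htpy_xbB : (htpy (k := k) (p := p) h) (xbB k p i j b) = 0 :=
  (Ind.tlift_one _ _ _).trans (by
    simp only [SHom.sub_apply, SHom.comp_apply, BHom.restr_apply, BHom.map_left, projRB_B,
      projRR_B, map_zero, sub_zero])

@[simp] theorem htpy_bR : (htpy (k := k) (p := p) h) (bR k p i j) = 0 :=
  (Ind.tlift_one _ _ _).trans (by simp)

@[simp] theorem htpy_rB : (htpy (k := k) (p := p) h) (rB k p i j) = 0 :=
  (Ind.tlift_one _ _ _).trans (by simp)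

@[simp] theorem htpy_xrB : (htpy (k := k) (p := p) h) (xrB k p i j b) =
    (T k p i j).right (MvPolynomial.X a) (bB k p i j) - xbB k p i j b :=
  (Ind.tlift_one _ _ _).trans (by
    simp only [SHom.sub_apply, SHom.comp_apply, BHom.restr_apply, BHom.map_left, projRB_RB,
      projRR_RB, map_zero, sub_zero, bQuad_left_one])

@[simp] theorem htpy_rR : (htpy (k := k) (p := p) h) (rR k p i j) = -rB k p i j :=
  (Ind.tlift_one _ _ _).trans (by simp)

/-- The complex `B_j ⊗ T_i ⊗ T_j` retracts onto `X`. -/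
def retract : DefRetract (Six.X k p i j) (T k p i j) :=
  .ofGen (Six.gen h) (gen h) (incl h) (retr h) (htpy h)
    (by
      rintro _ (rfl | rfl | rfl | rfl | rfl | rfl)
      · exact ⟨_, bB_mem, by rw [htpy_bB]; exact zero_mem _⟩
      · exact ⟨_, xbB_mem b, by rw [htpy_xbB]; exact zero_mem _⟩
      · exact ⟨_, bR_mem, by rw [htpy_bR]; exact zero_mem _⟩
      · exact ⟨_, rB_mem, by rw [htpy_rB]; exact zero_mem _⟩
      · exact ⟨_, xrB_mem b, by
          rw [htpy_xrB]; exact sub_mem (right_X_mem a bB_mem) (xbB_mem b)⟩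
      · exact ⟨_, rR_mem, by rw [htpy_rR]; exact neg_mem rB_mem⟩)
    (by rintro _ (rfl | rfl) <;> simp)
    (by rintro _ (rfl | rfl) <;> simp)
    (by
      rintro _ (rfl | rfl | rfl | rfl | rfl | rfl)
      · simp
      · simp [xbR_eq h]
      · simp
      · simp
      · have hr : (T k p i j).left (MvPolynomial.X a) (rB k p i j) =
            (T k p i j).right (MvPolynomial.X a) (rB k p i j) := rB_central h.X_mem'
        simp only [htpy_xrB, xrB_d, retr_xrB, incl_hom, map_sub, DgBimod.d_right, BHom.map_left,
          SHom.map_right, xbB_d, bB_d, inclMap_w, htpy_rR, map_neg, xbR_eq h, hr, map_add,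
          LinearMap.add_apply]
        abel
      · simp)

end RightTriple

end BraidRelationRight

/-! ### The braid relation: both sides as mapping cones -/

section Gluing

variable {k : Type u} [Field k] {p n : ℕ} [Fact p.Prime] [CharP k p]

open DgBimod

variable {M N : DgBimod k p n}

/-- Generators of `M ⊗ N` from generators of `N`. The elements of `M` are taken to be homogeneous,
so that degrees and signs can be computed on the generators. -/
theorem Gen.tens_right {T : Set N.carrier} (hT : Gen N T) (M : DgBimod k p n) :
    Gen (M ⊠ N) {x | ∃ jt, ∃ m ∈ M.deg jt, ∃ t ∈ T, x = tmul m t} := by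
  intro P h1 h2 h3 x
  have key : ∀ l, l ∈ ⨅ m, P.comap (tmul m) := by
    refine hT _ (fun a l hl => ?_) (fun a l hl => ?_) fun t ht => ?_
    · rw [Submodule.mem_iInf] at hl ⊢
      intro m
      rw [Submodule.mem_comap, ← tmul_balanced]
      exact hl _
    · rw [Submodule.mem_iInf] at hl ⊢
      intro m
      rw [Submodule.mem_comap, ← DgBimod.tens_right]
      exact h2 a _ (hl m)
    · rw [SetLike.mem_coe, Submodule.mem_iInf]
      intro m
      refine graded_induction M.isInternal (P := fun m => t ∈ P.comap (tmul m))
        (fun jt m hm => h3 ⟨jt, m, hm, t, ht, rfl⟩) (by simp) (fun x y hx hy => ?_) m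
      rw [Submodule.mem_comap, map_add]
      exact P.add_mem hx hy
  refine tens_induction (P := fun x => x ∈ P) P.zero_mem (fun m l => ?_)
    (fun x y hx hy => P.add_mem hx hy) x
  exact (Submodule.mem_iInf _).1 (key l) m

/-- Generators of `M ⊗ N` from generators of `M`, tensored with homogeneous elements of `N`. -/
theorem Gen.tens_left {T : Set M.carrier} (hT : Gen M T) (N : DgBimod k p n) :
    Gen (M ⊠ N) {x | ∃ jt, ∃ l ∈ N.deg jt, ∃ t ∈ T, x = tmul t l} := by
  intro P h1 h2 h3 x
  have key : ∀ m, m ∈ ⨅ l, P.comap (tmulRight (M := M) (N := N) l) := by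
    refine hT _ (fun a m hm => ?_) (fun a m hm => ?_) fun t ht => ?_
    · rw [Submodule.mem_iInf] at hm ⊢
      intro l
      rw [Submodule.mem_comap, tmulRight_apply, ← DgBimod.tens_left]
      exact h1 a _ (hm l)
    · rw [Submodule.mem_iInf] at hm ⊢
      intro l
      rw [Submodule.mem_comap, tmulRight_apply, tmul_balanced]
      exact hm _
    · rw [SetLike.mem_coe, Submodule.mem_iInf]
      intro l
      refine graded_induction N.isInternal (P := fun l => t ∈ P.comap (tmulRight (M := M) l))
        (fun jt l hl => h3 ⟨jt, l, hl, t, ht, rfl⟩) (by simp) (fun x y hx hy => ?_) l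
      rw [Submodule.mem_comap, tmulRight_apply, map_add]
      exact P.add_mem hx hy
  refine tens_induction (P := fun x => x ∈ P) P.zero_mem (fun m l => ?_)
    (fun x y hx hy => P.add_mem hx hy) x
  exact (Submodule.mem_iInf _).1 (key m) l

variable (k p n) in
/-- The identification of the two models of the complex `R`. -/
def uHom : DgHom (uC k p n 0) (unitC k p n) :=
  DgHom.ofGen (uInd k p n 0).gen ((uInd k p n 0).lift (unitOne k p n) fun _ _ => unit_left_one _)
    (by
      rintro _ rfl
      change ((uInd k p n 0).lift (unitOne k p n) fun _ _ => unit_left_one _)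
        ((uC k p n 0).D (uOne k p n 0)) = _
      rw [uC_D, Ind.lift_one, unit_D_one, map_zero])
    (by rintro _ rfl; simp)
    (by
      rintro _ rfl
      exact ⟨_, uOne_mem 0, by rw [Ind.lift_one]; exact unitOne_mem⟩)

@[simp] theorem uHom_one : (uHom k p n).hom (uOne k p n 0) = unitOne k p n := Ind.lift_one _ _ _

variable (k p) in
/-- The multiplication `B_i → R`. -/
def epsHom (i : Fin (n - 1)) : DgHom (bC k p i) (unitC k p n) := (uHom k p n).comp (brHom k p i)

@[simp] theorem epsHom_one (i : Fin (n - 1)) : (epsHom k p i).hom (bOne k p i) = unitOne k p n := by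
  simp [epsHom]

/-- Tensoring a morphism of complexes on the left. -/
def DgHom.tensLeft {X Y : DgBimod k p n} (M : DgBimod k p n) (f : DgHom X Y) :
    DgHom (M ⊠ X) (M ⊠ Y) :=
  DgHom.ofTens (SHom.tmap (SHom.id M) f.hom) (fun m l => by simp [f.map_D])
    (fun m l => by simp [f.map_d])
    (fun a b m hm l hl => by simpa using tmul_mem hm (f.map_deg _ _ hl))

/-- Tensoring a morphism of complexes on the right. -/
def DgHom.tensRight {X Y : DgBimod k p n} (f : DgHom X Y) (M : DgBimod k p n) :
    DgHom (X ⊠ M) (Y ⊠ M) :=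
  DgHom.ofTens (SHom.tmap f.hom (SHom.id M)) (fun m l => by simp [f.map_D])
    (fun m l => by simp [f.map_d, signOp_hom])
    (fun a b m hm l hl => by simpa using tmul_mem (f.map_deg _ _ hm) hl)

variable (M)

/-- The isomorphism `M ⊗ R → M`. -/
def rightUnitHom : DgHom (M ⊠ unitC k p n) M where
  hom := rightUnitMap M
  map_D x := by obtain ⟨m, rfl⟩ := rightUnit_exists M x; simp
  map_d x := by obtain ⟨m, rfl⟩ := rightUnit_exists M x; simp
  map_deg jt x hx := (rightUnitRetract M).retr_deg jt x hx

/-- The isomorphism `R ⊗ M → M`. -/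
def leftUnitHom : DgHom (unitC k p n ⊠ M) M where
  hom := leftUnitMap M
  map_D x := by obtain ⟨m, rfl⟩ := leftUnit_exists M x; simp
  map_d x := by obtain ⟨m, rfl⟩ := leftUnit_exists M x; simp
  map_deg jt x hx := (leftUnitRetract M).retr_deg jt x hx

/-- The map `M ⊗ B_i → M`. -/
def mulRight (i : Fin (n - 1)) : DgHom (M ⊠ bC k p i) M :=
  (rightUnitHom M).comp (DgHom.tensLeft M (epsHom k p i))

/-- The map `B_i ⊗ M → M`. -/
def mulLeft (i : Fin (n - 1)) : DgHom (bC k p i ⊠ M) M :=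
  (leftUnitHom M).comp (DgHom.tensRight (epsHom k p i) M)

@[simp] theorem mulRight_tmul (i : Fin (n - 1)) (m : M.carrier) :
    (mulRight M i).hom (tmul m (bOne k p i)) = m := by
  refine (congrArg (rightUnitMap M).lin (SHom.tmap_tmul _ _ _ _)).trans ?_
  rw [epsHom_one, rightUnitMap_tmul]; rfl

@[simp] theorem mulLeft_tmul (i : Fin (n - 1)) (m : M.carrier) :
    (mulLeft M i).hom (tmul (bOne k p i) m) = m := by
  refine (congrArg (leftUnitMap M).lin (SHom.tmap_tmul _ _ _ _)).trans ?_
  rw [epsHom_one, leftUnitMap_tmul]; rfl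

variable (k p) in
/-- The inclusion `R → T_i`. -/
def posRMap (i : Fin (n - 1)) : BHom (unitC k p n) (posC k p i) :=
  ofCentral (posR k p i) posR_central

@[simp] theorem posRMap_one (i : Fin (n - 1)) : posRMap k p i (unitOne k p n) = posR k p i :=
  ofCentral_one _ _

variable (k p) in
/-- The inclusion `B_i → T_i`. -/
def posBMap (i : Fin (n - 1)) : BHom (bC k p i) (posC k p i) := cone.inl (brHom k p i)

@[simp] theorem posBMap_one (i : Fin (n - 1)) : posBMap k p i (bOne k p i) = posB k p i := rfl

namespace TensCone

variable (i : Fin (n - 1))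

/-- The map from `M ⊗ T_i` to the cone of `M ⊗ B_i → M`. -/
def rightMap : BHom (M ⊠ posC k p i) (cone (mulRight M i)) :=
  (cone.inl (mulRight M i)).comp (SHom.tmap M.sgn (posFst k p i)) +
    (cone.inr (mulRight M i)).comp ((rightUnitMap M).comp
      (SHom.tmap (SHom.id M) ((uHom k p n).hom.comp (posSnd k p i))))

@[simp] theorem rightMap_posB (m : M.carrier) : (rightMap M i) (tmul m (posB k p i)) =
    cone.inl (mulRight M i) (tmul (M.signOp m) (bOne k p i)) := by
  simp [rightMap]

@[simp] theorem rightMap_posR (m : M.carrier) : (rightMap M i) (tmul m (posR k p i)) =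
    cone.inr (mulRight M i) m := by
  simp [rightMap]

/-- The map to `M ⊗ T_i` from the cone of `M ⊗ B_i → M`. -/
def rightInv : BHom (cone (mulRight M i)) (M ⊠ posC k p i) :=
  cone.desc (SHom.tmap M.sgn (posBMap k p i))
    ((SHom.tmap (SHom.id M) (posRMap k p i)).comp (tmulOne M))

@[simp] theorem rightInv_inl (m : M.carrier) :
    (rightInv M i) (cone.inl (mulRight M i) (tmul m (bOne k p i))) =
      tmul (M.signOp m) (posB k p i) := by simp [rightInv]

@[simp] theorem rightInv_inr (m : M.carrier) :
    (rightInv M i) (cone.inr (mulRight M i) m) = tmul m (posR k p i) := by simp [rightInv]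

theorem right_gen : Gen (cone (mulRight M i))
    ((fun x => cone.inl (mulRight M i) x) ''
        {x | ∃ jt, ∃ m ∈ M.deg jt, ∃ t ∈ ({bOne k p i} : Set _), x = tmul m t} ∪
      (fun m => cone.inr (mulRight M i) m) '' Set.univ) :=
  cone.gen ((bModel k p i).ind.gen.tens_right M) fun _ _ _ h m => h (Set.mem_univ m)

/-- The map from `M ⊗ T_i` to the cone of `M ⊗ B_i → M` as a morphism of complexes. -/
def rightHom : DgHom (M ⊠ posC k p i) (cone (mulRight M i)) :=
  DgHom.ofGen ((posC_gen i).tens_right M) (rightMap M i)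
    (by
      rintro _ ⟨jt, m, hm, t, rfl | rfl, rfl⟩
      · simp [signOp_D]
      · simp)
    (by
      rintro _ ⟨jt, m, hm, t, rfl | rfl, rfl⟩
      · simp [signOp_d, sub_eq_add_neg, add_comm]
      · simp)
    (by
      rintro _ ⟨jt, m, hm, t, rfl | rfl, rfl⟩
      · refine ⟨_, tmul_mem hm (posB_mem i), ?_⟩
        rw [rightMap_posB, add_comm]
        refine cone.inl_mem ?_
        exact tmul_mem' (signOp_mem _ hm) (bOne_mem i) (add_zero _)
      · refine ⟨_, tmul_mem' hm (posR_mem i) (add_zero _), ?_⟩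
        rw [rightMap_posR]
        exact cone.inr_mem hm)

/-- The complex `M ⊗ T_i` is the cone of `M ⊗ B_i → M`. -/
def rightRetract : DefRetract (M ⊠ posC k p i) (cone (mulRight M i)) :=
  .ofIso (rightHom M i) (rightInv M i)
    (fun x => congrArg (fun f => f.lin x) (((posC_gen i).tens_right M).ext
      (f := (rightInv M i).comp (rightMap M i)) (g := SHom.id _) (by
        rintro _ ⟨jt, m, hm, t, rfl | rfl, rfl⟩
        · simp [signOp_signOp]
        · simp)))
    (fun x => congrArg (fun f => f.lin x) ((right_gen M i).ext
      (f := (rightMap M i).comp (rightInv M i)) (g := SHom.id _) (by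
        rintro _ (⟨_, ⟨jt, m, hm, t, rfl, rfl⟩, rfl⟩ | ⟨m, -, rfl⟩)
        · simp [signOp_signOp]
        · simp)))

/-- The map from `T_i ⊗ M` to the cone of `B_i ⊗ M → M`. -/
def leftMap : BHom (posC k p i ⊠ M) (cone (mulLeft M i)) :=
  (cone.inl (mulLeft M i)).comp (SHom.tmap (posFst k p i) (SHom.id M)) +
    (cone.inr (mulLeft M i)).comp ((leftUnitMap M).comp
      (SHom.tmap ((uHom k p n).hom.comp (posSnd k p i)) (SHom.id M)))

@[simp] theorem leftMap_posB (m : M.carrier) : (leftMap M i) (tmul (posB k p i) m) =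
    cone.inl (mulLeft M i) (tmul (bOne k p i) m) := by
  simp [leftMap]

@[simp] theorem leftMap_posR (m : M.carrier) : (leftMap M i) (tmul (posR k p i) m) =
    cone.inr (mulLeft M i) m := by
  simp [leftMap]

/-- The map to `T_i ⊗ M` from the cone of `B_i ⊗ M → M`. -/
def leftInv : BHom (cone (mulLeft M i)) (posC k p i ⊠ M) :=
  cone.desc (SHom.tmap (posBMap k p i) (SHom.id M))
    ((SHom.tmap (posRMap k p i) (SHom.id M)).comp (leftUnitRetract M).incl.hom)

@[simp] theorem leftInv_inl (m : M.carrier) :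
    (leftInv M i) (cone.inl (mulLeft M i) (tmul (bOne k p i) m)) =
      tmul (posB k p i) m := by simp [leftInv]

@[simp] theorem leftInv_inr (m : M.carrier) :
    (leftInv M i) (cone.inr (mulLeft M i) m) = tmul (posR k p i) m := by
  have h : (leftUnitRetract M).incl.hom m = tmul (unitOne k p n) m := rfl
  simp [leftInv, h]

theorem left_gen : Gen (cone (mulLeft M i))
    ((fun x => cone.inl (mulLeft M i) x) ''
        {x | ∃ jt, ∃ m ∈ M.deg jt, ∃ t ∈ ({bOne k p i} : Set _), x = tmul t m} ∪
      (fun m => cone.inr (mulLeft M i) m) '' Set.univ) :=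
  cone.gen ((bModel k p i).ind.gen.tens_left M) fun _ _ _ h m => h (Set.mem_univ m)

/-- The map from `T_i ⊗ M` to the cone of `B_i ⊗ M → M` as a morphism of complexes. -/
def leftHom : DgHom (posC k p i ⊠ M) (cone (mulLeft M i)) :=
  DgHom.ofGen ((posC_gen i).tens_left M) (leftMap M i)
    (by
      rintro _ ⟨jt, m, hm, t, rfl | rfl, rfl⟩
      · simp
      · simp)
    (by
      rintro _ ⟨jt, m, hm, t, rfl | rfl, rfl⟩
      · simp [sub_eq_add_neg]
      · simp)
    (by
      rintro _ ⟨jt, m, hm, t, rfl | rfl, rfl⟩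
      · refine ⟨_, tmul_mem (posB_mem i) hm, ?_⟩
        rw [leftMap_posB]
        refine cone.inl_mem ?_
        exact tmul_mem' (bOne_mem i) hm (zero_add _)
      · refine ⟨_, tmul_mem' (posR_mem i) hm (zero_add _), ?_⟩
        rw [leftMap_posR]
        exact cone.inr_mem hm)

/-- The complex `T_i ⊗ M` is the cone of `B_i ⊗ M → M`. -/
def leftRetract : DefRetract (posC k p i ⊠ M) (cone (mulLeft M i)) :=
  .ofIso (leftHom M i) (leftInv M i)
    (fun x => congrArg (fun f => f.lin x) (((posC_gen i).tens_left M).ext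
      (f := (leftInv M i).comp (leftMap M i)) (g := SHom.id _) (by
        rintro _ ⟨jt, m, hm, t, rfl | rfl, rfl⟩
        · simp
        · simp)))
    (fun x => congrArg (fun f => f.lin x) ((left_gen M i).ext
      (f := (leftMap M i).comp (leftInv M i)) (g := SHom.id _) (by
        rintro _ (⟨_, ⟨jt, m, hm, t, rfl, rfl⟩, rfl⟩ | ⟨m, -, rfl⟩)
        · simp
        · simp)))

end TensCone

/-- The cones that model `T_i ⊗ T_j ⊗ T_i` and `T_j ⊗ T_i ⊗ T_j` retract onto the same mapping cone,
because the two composites `X → T_i ⊗ T_j` agree on the generators of `X`. -/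
theorem Adj.exists_retract {i j : Fin (n - 1)} {a b c : Fin n} (h : Adj i j a b c) :
    ∃ Y : DgBimod k p n,
      Nonempty (DefRetract Y (cone (mulRight (posC k p i ⊠ posC k p j) i))) ∧
      Nonempty (DefRetract Y (cone (mulLeft (posC k p i ⊠ posC k p j) j))) := by
  refine ⟨cone ((mulRight (posC k p i ⊠ posC k p j) i).comp
    ((LeftTriple.retract h).trans (assocInvRetract _ _ _)).incl),
    ⟨cone.retract ((LeftTriple.retract h).trans (assocInvRetract _ _ _)) _ _ fun _ => rfl⟩,
    ⟨cone.retract (RightTriple.retract h) _ _ fun x => ?_⟩⟩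
  refine congrArg (fun f => f.lin x) ((Six.gen h).ext
    (f := (mulRight (posC k p i ⊠ posC k p j) i).hom.comp
      ((assocInv _ _ _).comp LeftTriple.inclMap))
    (g := (mulLeft (posC k p i ⊠ posC k p j) j).hom.comp RightTriple.inclMap) ?_)
  rintro _ (rfl | rfl)
  · simp [LeftTriple.bB, RightTriple.bB]
  · simp [LeftTriple.bR, RightTriple.bR, LeftTriple.rB, RightTriple.rB]

end Gluing

/-! ### Deformation retractions and the relative homotopy category -/

section Localization

variable {k : Type u} [Field k] {p n : ℕ} {M N : DgBimod k p n}

theorem HasDeg.map_partSubmodule {f : M.carrier →ₗ[k] N.carrier} {e : ℤ} (hf : HasDeg (0, e) f)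
    {t t' : ℤ} (h : t' = e + t) : ∀ m ∈ M.partSubmodule t, f m ∈ N.partSubmodule t' := by
  have : M.partSubmodule t ≤ (N.partSubmodule t').comap f := iSup_le fun j m hm => by
    have h1 := hf _ m hm
    rw [Prod.mk_add_mk, zero_add, ← h] at h1
    exact N.le_partSubmodule _ _ h1
  exact this

namespace BHom

/-- The component in homological degree `t` of a bimodule map of bidegree `(0, e)`. -/
def partHom (f : BHom M N) {e : ℤ} (hf : HasDeg (0, e) f.lin) {t t' : ℤ} (h : t' = e + t) :
    (M.part t).toGrBimod ⟶ (N.part t').toGrBimod :=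
  ⟨f.lin.restrict (hf.map_partSubmodule h),
    fun a m => Subtype.ext (f.map_left a m), fun a m => Subtype.ext (f.map_right a m),
    fun j m hm => by
      have h1 := hf _ _ hm
      rw [Prod.mk_add_mk, zero_add, ← h] at h1
      exact h1⟩

end BHom

namespace DgBimod

theorem part_hom_ext {t t' : ℤ} {f g : (M.part t).toGrBimod ⟶ (N.part t').toGrBimod}
    (h : ∀ m : M.partSubmodule t, (f.1 m : N.partSubmodule t').1 = (g.1 m : N.partSubmodule t').1) :
    f = g :=
  Subtype.ext (LinearMap.ext fun m => Subtype.ext (h m))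

theorem toComplex_d (M : DgBimod k p n) (t : ℤ) : M.toComplex.d (t + 1) t = M.partD t :=
  ChainComplex.of_d _ _ _

variable (M) in
/-- The chain complex of graded bimodules that underlies `M`. -/
def bimodComplex : ChainComplex (GrBimod k n (2 : ℤ)) ℤ :=
  ((forgetHq k p n 2).mapHomologicalComplex _).obj M.toComplex

theorem bimodComplex_d (t : ℤ) :
    M.bimodComplex.d (t + 1) t = (forgetHq k p n 2).map (M.partD t) :=
  congrArg (forgetHq k p n 2).map (toComplex_d M t)

end DgBimod

open DgBimod

/-- The map of chain complexes given by a morphism. -/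
def DgHom.toComplexHom (f : DgHom M N) : M.toComplex ⟶ N.toComplex :=
  ChainComplex.ofHom (X := M.toComplex) (Y := N.toComplex)
    (fun t => ⟨f.hom.lin.restrict (HasDeg.map_partSubmodule (e := 0)
        (fun jt m hm => by rw [Prod.mk_zero_zero, zero_add]; exact f.map_deg jt m hm)
        (zero_add t).symm),
      ⟨fun a (m : M.partSubmodule t) => Subtype.ext (f.hom.map_left a m.1),
        fun a (m : M.partSubmodule t) => Subtype.ext (f.hom.map_right a m.1),
        fun j (m : M.partSubmodule t) hm => f.map_deg _ m.1 hm⟩,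
      fun (m : M.partSubmodule t) => Subtype.ext (f.map_D m.1)⟩)
    (fun t => by
      rw [toComplex_d, toComplex_d]
      exact Subtype.ext (LinearMap.ext fun m : M.partSubmodule (t + 1) =>
        Subtype.ext (f.map_d m.1).symm))

namespace DefRetract

variable (R : DefRetract M N)

theorem retr_hasDeg : HasDeg (0, 0) R.retr.lin := fun jt m hm => by
  rw [Prod.mk_zero_zero, zero_add]; exact R.retr_deg jt m hm

/-- The retraction as a map of chain complexes of graded bimodules. -/
def retrComplexHom : N.bimodComplex ⟶ M.bimodComplex :=
  ChainComplex.ofHom (X := N.bimodComplex) (Y := M.bimodComplex)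
    (fun t => R.retr.partHom R.retr_hasDeg (zero_add t).symm)
    (fun t => by
      rw [bimodComplex_d, bimodComplex_d]
      exact part_hom_ext fun m => (R.retr_d m.1).symm)

/-- The inclusion as a map of chain complexes of graded bimodules. -/
def inclComplexHom : M.bimodComplex ⟶ N.bimodComplex :=
  ((forgetHq k p n 2).mapHomologicalComplex _).map R.incl.toComplexHom

/-- The components of the homotopy. -/
def htpyPart (t t' : ℤ) : N.bimodComplex.X t ⟶ N.bimodComplex.X t' :=
  if h : t' = 1 + t then R.htpy.partHom R.htpy_deg h else 0

theorem htpyPart_succ (t : ℤ) :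
    R.htpyPart t (t + 1) = R.htpy.partHom R.htpy_deg (add_comm t 1) := dif_pos _

/-- After `∂_q` is forgotten, the inclusion of a deformation retract is a homotopy equivalence. -/
def homotopyEquiv : HomotopyEquiv M.bimodComplex N.bimodComplex where
  hom := R.inclComplexHom
  inv := R.retrComplexHom
  homotopyHomInvId := Homotopy.ofEq (HomologicalComplex.Hom.ext (funext fun t =>
    part_hom_ext (M := M) (N := M) fun m => R.retr_incl m.1))
  homotopyInvHomId :=
    { hom := R.htpyPart
      zero := fun t t' h => dif_neg fun e => h (by rw [ComplexShape.down_Rel, e, add_comm])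
      comm := fun t => by
        obtain ⟨t, rfl⟩ : ∃ s, t = s + 1 := ⟨t - 1, by ring⟩
        rw [dNext_eq _ (show (ComplexShape.down ℤ).Rel (t + 1) t from rfl),
          prevD_eq _ (show (ComplexShape.down ℤ).Rel (t + 1 + 1) (t + 1) from rfl),
          htpyPart_succ, htpyPart_succ, bimodComplex_d, bimodComplex_d]
        refine part_hom_ext (M := N) (N := N) fun m => ?_
        change R.incl.hom (R.retr m.1) = R.htpy (N.d m.1) + N.d (R.htpy m.1) + m.1
        rw [add_comm (R.htpy _), R.htpy_d, sub_add_cancel] }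

/-- A deformation retract of a complex is isomorphic to it in the relative homotopy category. -/
theorem nonempty_toRel_iso (R : DefRetract M N) :
    Nonempty (toRel k p n M.toComplex ≅ toRel k p n N.toComplex) := by
  refine ⟨Localization.isoOfHom (relIso k p n).Q (relIso k p n)
    ((HomotopyCategory.quotient _ _).map R.incl.toComplexHom) ?_⟩
  exact (HomotopyCategory.isoOfHomotopyEquiv R.homotopyEquiv).isIso_hom

end DefRetract

end Localization

/-! ### The homomorphism from the braid group -/

section BraidAction

variable (k : Type u) [Field k] (p n : ℕ)

/-- The equivalence relation generated by deformation retractions. -/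
def retractSetoid : Setoid (DgBimod k p n) :=
  Relation.EqvGen.setoid fun M N => Nonempty (DefRetract M N)

/-- The classes of complexes of graded `(R, R) # H_q`-modules up to deformation retractions. -/
def RetractClass : Type (u + 1) := Quotient (retractSetoid k p n)

variable {k p n}

theorem nonempty_toRel_iso_of_retractSetoid {M N : DgBimod k p n} (h : retractSetoid k p n M N) :
    Nonempty (toRel k p n M.toComplex ≅ toRel k p n N.toComplex) := by
  induction h with
  | rel M N h => exact h.elim DefRetract.nonempty_toRel_iso
  | refl M => exact ⟨Iso.refl _⟩
  | symm M N _ ih => exact ih.map Iso.symm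
  | trans M N L _ _ ih ih' => exact ih.elim fun e => ih'.map fun e' => e.trans e'

/-- The class of a complex. -/
def retractClass (M : DgBimod k p n) : RetractClass k p n := Quotient.mk _ M

theorem DefRetract.class_eq {M N : DgBimod k p n} (R : DefRetract M N) :
    retractClass M = retractClass N :=
  Quotient.sound (Relation.EqvGen.rel _ _ ⟨R⟩)

variable [Fact p.Prime] [CharP k p]

theorem retractSetoid_tens_right {M N : DgBimod k p n} (L : DgBimod k p n)
    (h : retractSetoid k p n M N) : retractSetoid k p n (M ⊠ L) (N ⊠ L) := by
  induction h with
  | rel M N h => exact .rel _ _ (h.map fun R => R.tensRight L)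
  | refl M => exact .refl _
  | symm M N _ ih => exact .symm _ _ ih
  | trans M N Q _ _ ih ih' => exact .trans _ _ _ ih ih'

theorem retractSetoid_tens_left {M N : DgBimod k p n} (L : DgBimod k p n)
    (h : retractSetoid k p n M N) : retractSetoid k p n (L ⊠ M) (L ⊠ N) := by
  induction h with
  | rel M N h => exact .rel _ _ (h.map fun R => DefRetract.tensLeft L R)
  | refl M => exact .refl _
  | symm M N _ ih => exact .symm _ _ ih
  | trans M N Q _ _ ih ih' => exact .trans _ _ _ ih ih'

/-- The tensor product over `R` as a multiplication of classes. -/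
instance : Monoid (RetractClass k p n) where
  mul := Quotient.map₂ (· ⊠ ·) fun _ _ h _ _ h' =>
    (retractSetoid k p n).trans (retractSetoid_tens_right _ h) (retractSetoid_tens_left _ h')
  one := retractClass (unitC k p n)
  mul_assoc := by
    rintro ⟨M⟩ ⟨N⟩ ⟨L⟩
    exact (assocRetract M N L).class_eq
  one_mul := by
    rintro ⟨M⟩
    exact (leftUnitRetract M).class_eq.symm
  mul_one := by
    rintro ⟨M⟩
    exact (rightUnitRetract M).class_eq.symm

theorem retractClass_tens (M N : DgBimod k p n) :
    retractClass (M ⊠ N) = retractClass M * retractClass N := rfl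

variable (k) in
/-- The class of `T_i`, whose inverse is the class of `T_i'`. -/
def posUnit (hp : 2 < p) (i : Fin (n - 1)) : (RetractClass k p n)ˣ where
  val := retractClass (posC k p i)
  inv := retractClass (negC k hp i)
  val_inv := (PosNeg.retract k hp i).class_eq.symm
  inv_val := (NegPos.retract k hp i).class_eq.symm

theorem Adj.of_succ {i j : Fin (n - 1)} (h : (i : ℕ) + 1 = j) :
    Adj i j (pos i) (posSucc i) (posSucc j) where
  left := isPair i
  right := Or.inr ⟨rfl, Fin.ext h⟩
  ne e := by
    have := congrArg Fin.val e
    simp only [pos, posSucc] at this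
    omega

/-- Both triple products have the class of the cone of the common map `X → T_i ⊗ T_j`. -/
theorem Adj.braid_relation {i j : Fin (n - 1)} {a b c : Fin n} (h : Adj i j a b c) :
    retractClass (posC k p i) * retractClass (posC k p j) * retractClass (posC k p i) =
      retractClass (posC k p j) * retractClass (posC k p i) * retractClass (posC k p j) := by
  obtain ⟨Y, ⟨R⟩, ⟨L⟩⟩ := h.exists_retract (k := k) (p := p)
  rw [mul_assoc (retractClass (posC k p j)), ← retractClass_tens, ← retractClass_tens,
    ← retractClass_tens]
  exact (TensCone.rightRetract _ _).class_eq.trans (R.class_eq.symm.trans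
    (L.class_eq.trans (TensCone.leftRetract _ _).class_eq.symm))

theorem posUnit_relation (hp : 2 < p) :
    ∀ r ∈ braidRels n, FreeGroup.lift (posUnit k hp (n := n)) r = 1 := by
  rintro _ (⟨i, j, h, rfl⟩ | ⟨i, j, h, rfl⟩)
  · simp only [map_mul, map_inv, FreeGroup.lift_apply_of]
    rw [mul_inv_eq_one]
    exact Units.ext (Far.retract k p (Or.inl h)).class_eq
  · simp only [map_mul, map_inv, FreeGroup.lift_apply_of]
    rw [mul_inv_eq_one]
    exact Units.ext (Adj.of_succ h).braid_relation

variable (k) in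
/-- The homomorphism that sends `σ_i` to the class of `T_i`. -/
def braidHom (hp : 2 < p) : BraidGroup n →* (RetractClass k p n)ˣ :=
  PresentedGroup.toGroup (posUnit_relation hp)

theorem braidHom_letterBraid (hp : 2 < p) (s : Fin (n - 1) × Bool) :
    (braidHom k hp (letterBraid s) : RetractClass k p n) = retractClass (letterComplex k hp s) := by
  obtain ⟨i, _ | _⟩ := s
  · simp only [letterBraid, letterComplex, braidHom, Bool.false_eq_true, if_false, map_inv,
      PresentedGroup.toGroup.of]
    exact (negRetract k hp i).class_eq
  · simp only [letterBraid, letterComplex, braidHom, if_true, PresentedGroup.toGroup.of]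
    exact (posRetract k p i).class_eq

/-- The class of the complex of a word depends only on the braid that the word represents. -/
theorem braidHom_wordBraid (hp : 2 < p) (w : BraidWord n) :
    (braidHom k hp (wordBraid w) : RetractClass k p n) = retractClass (wordComplex k hp w) := by
  induction w with
  | nil => rw [wordBraid, List.map_nil, List.prod_nil, map_one]; rfl
  | cons s w ih =>
    rw [wordBraid, List.map_cons, List.prod_cons, map_mul, Units.val_mul, braidHom_letterBraid]
    exact congrArg _ ih

theorem exists_wordBraid_eq (β : BraidGroup n) : ∃ w : BraidWord n, wordBraid w = β := by
  induction β using PresentedGroup.induction_on with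
  | _ x =>
    induction x using FreeGroup.induction_on with
    | C1 => exact ⟨[], rfl⟩
    | of i => exact ⟨[(i, true)], by simp [wordBraid, letterBraid]; rfl⟩
    | inv_of i _ => exact ⟨[(i, false)], by simp [wordBraid, letterBraid]; rfl⟩
    | mul x y hx hy =>
      obtain ⟨w, hw⟩ := hx
      obtain ⟨w', hw'⟩ := hy
      refine ⟨w ++ w', ?_⟩
      rw [map_mul, ← hw, ← hw', wordBraid, List.map_append, List.prod_append]
      rfl

end BraidAction

end

end SoergelBraid

theorem mainTheorem7 {k : Type u} [Field k] {p : ℕ} [Fact p.Prime] [CharP k p] (hp : 2 < p)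
    (n : ℕ) (β : SoergelBraid.BraidGroup n) :
    (∃ w : SoergelBraid.BraidWord n, SoergelBraid.wordBraid w = β) ∧
    ∀ w w' : SoergelBraid.BraidWord n,
      SoergelBraid.wordBraid w = β → SoergelBraid.wordBraid w' = β →
      Nonempty (SoergelBraid.braidObject k hp w ≅ SoergelBraid.braidObject k hp w') := by
  refine ⟨SoergelBraid.exists_wordBraid_eq β, fun w w' hw hw' =>
    SoergelBraid.nonempty_toRel_iso_of_retractSetoid (Quotient.exact ?_)⟩
  change SoergelBraid.retractClass _ = SoergelBraid.retractClass _
  rw [← SoergelBraid.braidHom_wordBraid, ← SoergelBraid.braidHom_wordBraid, hw, hw']
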